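/- **Setting.** For $k\ge 0$ let $L^1_k$ be the space of measurable $f:(0,\infty)\to\mathbb R$ (modulo null sets) with $\|f\|_{L^1_k}=\int_0^\infty |f(x)|(1+x)^k\,dx<\infty$. For a kernel $K$ put $$\mathcal C_K(g,h)(x)=\tfrac12\int_0^x K(x-y,y)g(x-y)h(y)\,dy-\tfrac12 g(x)\int_0^\infty K(x,y)h(y)\,dy-\tfrac12 h(x)\int_0^\infty K(x,y)g(y)\,dy .$$ A *self-similar profile* for $K$ is an almost everywhere nonnegative $G\in L^1_1$ which is a stationary mild solution of $\partial_t f=\mathcal C_K(f,f)+2f+x\partial_x f$, that is, $G=S_tG+\int_0^t S_{t-s}\,\mathcal C_K(G,G)\,ds$ for all $t\ge0$, where $(S_tf)(x)=e^{2t}f(e^tx)$. It has mass $1$ if $\int_0^\infty xG(x)\,dx=1$. An *admissible perturbation* is a continuous symmetric $W:(0,\infty)^2\to[0,1]$ with $W(\lambda x,\lambda y)=W(x,y)$ for all $\lambda,x,y>0$; put $K_\varepsilon=2+\varepsilon W$, $K_0=2$ and $G_0(x)=e^{-x}$. For a profile $G$ of $K_\varepsilon$ let $\mathcal L_\varepsilon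 h=2h+xh'+2\mathcal C_{K_\varepsilon}(G,h)$, and let $\mathcal L_0h=2h+xh'+2\mathcal C_{K_0}(G_0,h)$; these are understood as closures in $L^1_k$ of their restrictions to $C_c^\infty(0,\infty)$. Their difference is the operator $h\mapsto 2\mathcal C_{K_\varepsilon}(G,h)-2\mathcal C_{K_0}(G_0,h)$ on $L^1_k$. **Theorem 7.7.** Let $k>2$. 1. There is a constant $C>0$, depending only on $k$, such that $\mathcal L_0$ generates a strongly continuous semigroup on $L^1_k$ and $$\|e^{t\mathcal L_0}h\|_{L^1_k}\le C e^{-t/2}\|h\|_{L^1_k}\qquad\text{for all } t\ge 0 \text{ and all } h\in L^1_k \text{ with } \int_0^\infty xh(x)\,dx=0. \tag{a}$$ 2. There is a constant $M_2>0$, depending only on $k$, such that $$\|\mathcal L_\varepsilon h-\mathcal L_0h\|_{L^1_k}\le \varepsilon M_2\|h\|_{L^1_k}\qquad\text{for all } h\in L^1_k, \tag{b}$$ for every $0<\varepsilon<1$, every admissible $W$, and the operator $\mathcal L_\varepsilon$ around any mass-$1$ profile of $K_\varepsilon$. 3. For any constants $C>0$ and $M_2>0$ with the properties (a) and (b), put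 $\varepsilon_0=\frac1{2CM_2}$. Then for every admissible $W$ and every $0<\varepsilon<\varepsilon_0$ there is, up to equality almost everywhere, at most one self-similar profile $G_\varepsilon$ with mass $1$ for the kernel $K_\varepsilon$ satisfying $$\|G_\varepsilon-G_0\|_{L^1_k}\le\frac{1-\varepsilon/\varepsilon_0}{12\,C\,(1+\varepsilon)} .$$ -/

import Mathlib

open MeasureTheory Set Filter Topology
open scoped ENNReal ContDiff

noncomputable section

/-- The measure `(1 + x) ^ k dx` on the half-line `(0, ∞)`. The space `L¹_k` is
`L¹` of this measure: its norm is `∫₀^∞ |f x| (1 + x) ^ k dx`. -/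
def weightedMeasure (k : ℝ) : Measure ℝ :=
  (volume.restrict (Ioi 0)).withDensity (fun x => ENNReal.ofReal ((1 + x) ^ k))

/-- Membership of a function in `L¹_k`. -/
def MemL1k (k : ℝ) (f : ℝ → ℝ) : Prop := MemLp f 1 (weightedMeasure k)

/-- The norm `‖f‖_{L¹_k} = ∫₀^∞ |f x| (1 + x) ^ k dx`, with value `∞` when the integral
diverges. -/
def normL1k (k : ℝ) (f : ℝ → ℝ) : ℝ≥0∞ := eLpNorm f 1 (weightedMeasure k)

/-- The Banach space `L¹_k` (classes of functions modulo equality almost everywhere). -/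
abbrev L1k (k : ℝ) : Type := Lp ℝ 1 (weightedMeasure k)

/-- The symmetric bilinear coagulation operator `C_K(g, h)`; on the diagonal it is
`C_K(f, f)(x) = 1/2 ∫₀ˣ K(x-y, y) f(x-y) f(y) dy - f(x) ∫₀^∞ K(x, y) f(y) dy`. -/
def coag (K : ℝ → ℝ → ℝ) (g h : ℝ → ℝ) (x : ℝ) : ℝ :=
  (1 / 2) * (∫ y in (0 : ℝ)..x, K (x - y) y * g (x - y) * h y)
    - (1 / 2) * g x * (∫ y in Ioi (0 : ℝ), K x y * h y)
    - (1 / 2) * h x * (∫ y in Ioi (0 : ℝ), K x y * g y)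

/-- Admissible perturbations `W` of the constant kernel: continuous, symmetric, with values
in `[0, 1]`, and homogeneous of degree zero, on `(0, ∞) × (0, ∞)`. -/
structure IsPerturbation (W : ℝ → ℝ → ℝ) : Prop where
  continuousOn : ContinuousOn (fun p : ℝ × ℝ => W p.1 p.2) (Ioi 0 ×ˢ Ioi 0)
  symm : ∀ x y : ℝ, 0 < x → 0 < y → W x y = W y x
  nonneg : ∀ x y : ℝ, 0 < x → 0 < y → 0 ≤ W x y
  le_one : ∀ x y : ℝ, 0 < x → 0 < y → W x y ≤ 1
  homogeneous : ∀ l x y : ℝ, 0 < l → 0 < x → 0 < y → W (l * x) (l * y) = W x y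

/-- The kernel `K_ε = 2 + ε W`. -/
def kernel (ε : ℝ) (W : ℝ → ℝ → ℝ) (x y : ℝ) : ℝ := 2 + ε * W x y

/-- The constant kernel `K₀ = 2`. -/
def kernelZero (_ _ : ℝ) : ℝ := 2

/-- The unit-mass profile `G₀(x) = e^{-x}` of the constant kernel. -/
def profileZero (x : ℝ) : ℝ := Real.exp (-x)

/-- The semigroup `(S_t f)(x) = e^{2t} f(e^t x)` generated by `f ↦ 2 f + x f'`. -/
def scalingSemigroup (t : ℝ) (f : ℝ → ℝ) (x : ℝ) : ℝ := Real.exp (2 * t) * f (Real.exp t * x)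

/-- `G` is a self-similar profile for the kernel `K`: a nonnegative function in `L¹_1` which is
a stationary mild solution of `∂_t f = C_K(f, f) + 2 f + x ∂_x f`, that is
`G = S_t G + ∫₀ᵗ S_{t-s} C_K(G, G) ds` for all `t ≥ 0`. -/
structure IsProfile (K : ℝ → ℝ → ℝ) (G : ℝ → ℝ) : Prop where
  memL1k : MemL1k 1 G
  nonneg : ∀ᵐ x ∂(volume.restrict (Ioi (0 : ℝ))), 0 ≤ G x
  stationary : ∀ t : ℝ, 0 ≤ t → ∀ᵐ x ∂(volume.restrict (Ioi (0 : ℝ))),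
    G x = scalingSemigroup t G x
      + ∫ s in (0 : ℝ)..t, scalingSemigroup (t - s) (coag K G G) x

/-- A self-similar profile with mass one, `∫₀^∞ x G(x) dx = 1`. -/
structure IsUnitProfile (K : ℝ → ℝ → ℝ) (G : ℝ → ℝ) : Prop extends IsProfile K G where
  mass : ∫ x in Ioi (0 : ℝ), x * G x = 1

/-- The linearisation `h ↦ 2 h + x h' + 2 C_K(G, h)` of the self-similar Smoluchowski operator
with kernel `K` around `G` (used on smooth functions). -/
def linearised (K : ℝ → ℝ → ℝ) (G h : ℝ → ℝ) (x : ℝ) : ℝ :=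
  2 * h x + x * deriv h x + 2 * coag K G h x

/-- The space `C_c^∞(0, ∞)`. -/
structure IsTestFunction (φ : ℝ → ℝ) : Prop where
  smooth : ContDiff ℝ ∞ φ
  compact : HasCompactSupport φ
  support : tsupport φ ⊆ Ioi 0

/-- A strongly continuous semigroup `(S t)_{t ≥ 0}` of bounded operators (values at negative
times are irrelevant). -/
structure IsC0Semigroup {X : Type*} [NormedAddCommGroup X] [NormedSpace ℝ X]
    (S : ℝ → X →L[ℝ] X) : Prop where
  zero : S 0 = ContinuousLinearMap.id ℝ X
  add : ∀ s t : ℝ, 0 ≤ s → 0 ≤ t → S (s + t) = (S s).comp (S t)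
  tendsto : ∀ u : X, Tendsto (fun t => S t u) (𝓝[>] 0) (𝓝 u)

/-- `u` is in the domain of the generator of `S`, and the generator maps it to `v`. -/
def IsGeneratorValue {X : Type*} [NormedAddCommGroup X] [NormedSpace ℝ X]
    (S : ℝ → X →L[ℝ] X) (u v : X) : Prop :=
  Tendsto (fun t : ℝ => t⁻¹ • (S t u - u)) (𝓝[>] 0) (𝓝 v)

/-- `S` is the semigroup on `L¹_k` generated by the linearised operator `L` with kernel `K`
around `G`: its generator is defined on `C_c^∞(0, ∞)` and equal to `L` there, and
`C_c^∞(0, ∞)` is a core, i.e. dense in the domain for the graph norm. These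
requirements determine `S t` for `t ≥ 0`. -/
structure IsLinearisedSemigroup (k : ℝ) (K : ℝ → ℝ → ℝ) (G : ℝ → ℝ)
    (S : ℝ → L1k k →L[ℝ] L1k k) : Prop where
  semigroup : IsC0Semigroup S
  generator_eq : ∀ φ : ℝ → ℝ, IsTestFunction φ → ∃ u v : L1k k,
    u =ᵐ[weightedMeasure k] φ ∧ v =ᵐ[weightedMeasure k] linearised K G φ ∧
      IsGeneratorValue S u v
  core : ∀ u v : L1k k, IsGeneratorValue S u v → ∀ δ : ℝ, 0 < δ →
    ∃ φ : ℝ → ℝ, IsTestFunction φ ∧ ∃ u' v' : L1k k,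
      u' =ᵐ[weightedMeasure k] φ ∧ v' =ᵐ[weightedMeasure k] linearised K G φ ∧
        ‖u - u'‖ + ‖v - v'‖ < δ

/-- `C` is a constant in the spectral gap estimate for `L₀`, the linearisation around `G₀` for
the kernel `2`: the semigroup `e^{t L₀}` on `L¹_k` exists and
`‖e^{t L₀} h‖ ≤ C e^{-t/2} ‖h‖` for all `t ≥ 0` and all `h` with `∫ x h = 0`. -/
def IsGapConstant (k C : ℝ) : Prop :=
  0 < C ∧ ∃ S : ℝ → L1k k →L[ℝ] L1k k,
    IsLinearisedSemigroup k kernelZero profileZero S ∧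
      ∀ h : L1k k, ∫ x in Ioi (0 : ℝ), x * h x = 0 →
        ∀ t : ℝ, 0 ≤ t → ‖S t h‖ ≤ C * Real.exp (-(1 / 2) * t) * ‖h‖

/-- The unbounded parts `2 h + x h'` of two linearised operators cancel in their difference. -/
theorem linearised_sub_linearised (K K' : ℝ → ℝ → ℝ) (G G' h : ℝ → ℝ) (x : ℝ) :
    linearised K G h x - linearised K' G' h x = 2 * coag K G h x - 2 * coag K' G' h x := by
  unfold linearised
  ring

/-- `M` is a constant in the estimate `‖L_ε - L₀‖ ≤ ε M` of operators on `L¹_k`, for all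
`0 < ε < 1`, all admissible `W`, and all linearisations `L_ε` around a unit-mass profile `G` of
the kernel `K_ε`. The difference `L_ε - L₀` is the operator
`h ↦ 2 C_{K_ε}(G, h) - 2 C_{K₀}(G₀, h)`, which acts on all of `L¹_k`. -/
def IsPerturbationConstant (k M : ℝ) : Prop :=
  0 < M ∧ ∀ W : ℝ → ℝ → ℝ, IsPerturbation W → ∀ ε : ℝ, 0 < ε → ε < 1 →
    ∀ G : ℝ → ℝ, IsUnitProfile (kernel ε W) G → ∀ h : ℝ → ℝ, MemL1k k h →
      normL1k k (fun x => 2 * coag (kernel ε W) G h x - 2 * coag kernelZero profileZero h x)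
        ≤ ENNReal.ofReal (ε * M) * normL1k k h

/-- The threshold `ε₀ = 1 / (2 C M₂)`. -/
def epsilonZero (C M : ℝ) : ℝ := 1 / (2 * C * M)

end

/-! Write `P h = E * h - (∫ h) E` with `E(x) = e^{-x}`, and let `D_t h = h(e^t ·)` be the dilations.

Spectral gap. Because `∫ G₀ = 1`, the operator `L₀` equals `x h' + 2 P h`, the generator of `D_t`
plus a bounded operator. In Laplace variables `P` multiplies `ĥ(s) - ĥ(0)` by `1 / (1 + s)`, which
leads to the closed form `e^{t L₀} = (1 + (e^t - 1) P)² D_t` (`gapSemigroup`). The semigroup law is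
a partial fraction identity (`expOp_expOp`) combined with scaling (`dilate_expOp`). Test functions
are a core for the dilations (`dilation_core`), hence also after the bounded perturbation. For
decay, `D_t` has norm at most `e^{-t}`. The kernel of `P` is `O(y)` for small `y`. That of `P²` is
`O(y²)` up to a term linear in `y`, which `∫ x h = 0` removes. After dilation these powers of `y`
become powers of `e^{-t}` that outweigh the growing coefficients (`exists_gap_bound`), so the decay
rate is even `e^{-t}`.

Inverse estimate. Integrating the decay `C e^{-t/2}` in time gives `‖h‖ ≤ 2 C ‖L₀ h‖` for `h` of
zero mass (`IsC0Semigroup.norm_le_of_decay`, `IsGapConstant.nrm_le`). The mild equation of a profile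
is first turned into `x² G(x) = ∫_x^∞ y C_K(G, G)(y) dy` (`isStationaryPair_of_mild`). This form
identifies `x G'` through the generator of the dilations, so the inverse estimate applies to
differences of profiles.

Perturbation bound. By bilinearity it suffices that `‖G - G₀‖ ≤ D ε` and `‖G‖ ≤ B` in `L¹_k`,
uniformly over all profiles. The moments of `G` are bounded by testing the equation with piecewise
linear and with truncated power functions (`tail_le_one`, `truncated_moment_le`). For closeness, `g
= G - G₀` solves a linear equation with kernel `2`, coefficient `Γ = G + G₀` and forcing `A = ε
C_W(G, G)`. Its second tail `∫ (y - x)₊ g(y) dy` obeys an `L¹` inequality with contraction factor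
`2/3`, because `∫ Γ ≤ 2` (`IsForcedPair.nrm_secondTail_le`). From the second tail one climbs back to
the tail, to `x g` and to `g`, then interpolates with a higher moment to reach `L¹_k`. This gives
smallness without a rate; the inverse estimate then absorbs the quadratic term and yields the linear
rate (`exists_nrm_sub_profileZero_le_mul`).

Uniqueness. For two profiles and `h = G₁ - G₂`, the equation reads `L₀ h = C_K(h, h) - (L_ε - L₀)
h`. Hence `‖h‖ ≤ 2 C (ε M₂ ‖h‖ + (3/2)(2 + ε) ‖h‖²)`, which forces `h = 0` when `‖h‖` is at most
twice the given radius. Property (b) is available only for `ε < 1`, so `ε₀ ≤ 1` is needed. It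
follows from `C ≥ 1` and `M₂ ≥ 1/2`; the second is obtained by testing (b) on an explicit
exponential profile. -/

noncomputable section

/-! ### Weights, null sets and norms of `L¹_k`. -/

/-- Lebesgue measure on the half-line `(0, ∞)`. -/
abbrev posMeasure : Measure ℝ := volume.restrict (Ioi 0)

/-- The weight `(1 + x) ^ k` with values in `[0, ∞]`. -/
def weight (k x : ℝ) : ℝ≥0∞ := ENNReal.ofReal ((1 + x) ^ k)

theorem measurable_weight (k : ℝ) : Measurable (weight k) := by
  unfold weight; fun_prop

theorem weight_ne_top (k x : ℝ) : weight k x ≠ ⊤ := ENNReal.ofReal_ne_top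

theorem weight_pos (k : ℝ) {x : ℝ} (hx : 0 < x) : 0 < weight k x :=
  ENNReal.ofReal_pos.2 (Real.rpow_pos_of_pos (by linarith) _)

theorem one_le_weight {k : ℝ} (hk : 0 ≤ k) {x : ℝ} (hx : 0 < x) : 1 ≤ weight k x := by
  unfold weight
  rw [← ENNReal.ofReal_one]
  exact ENNReal.ofReal_le_ofReal (Real.one_le_rpow (by linarith) hk)

theorem weight_mono {j k : ℝ} (hjk : j ≤ k) {x : ℝ} (hx : 0 < x) : weight j x ≤ weight k x :=
  ENNReal.ofReal_le_ofReal (Real.rpow_le_rpow_of_exponent_le (by linarith) hjk)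

theorem weight_le_of_le {k : ℝ} (hk : 0 ≤ k) {x y : ℝ} (hx : 0 < x) (hxy : x ≤ y) :
    weight k x ≤ weight k y :=
  ENNReal.ofReal_le_ofReal (Real.rpow_le_rpow (by linarith) (by linarith) hk)

/-- Since `1 + x + y ≤ (1 + x)(1 + y)`, the weight is submultiplicative; this is what makes
convolutions bounded on `L¹_k`. -/
theorem weight_add_le {k : ℝ} (hk : 0 ≤ k) {x y : ℝ} (hx : 0 ≤ x) (hy : 0 ≤ y) :
    weight k (x + y) ≤ weight k x * weight k y := by
  unfold weight
  rw [← ENNReal.ofReal_mul (by positivity), ← Real.mul_rpow (by positivity) (by positivity)]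
  exact ENNReal.ofReal_le_ofReal (Real.rpow_le_rpow (by positivity) (by nlinarith) hk)

theorem weightedMeasure_eq (k : ℝ) :
    weightedMeasure k = posMeasure.withDensity (weight k) := rfl

theorem weightedMeasure_ac (k : ℝ) : weightedMeasure k ≪ posMeasure :=
  withDensity_absolutelyContinuous _ _

/-- The weight is positive on the half-line, so both measures have the same null sets and almost
everywhere statements can be made for `posMeasure` throughout. -/
theorem ac_weightedMeasure (k : ℝ) : posMeasure ≪ weightedMeasure k := by
  refine withDensity_absolutelyContinuous' (measurable_weight k).aemeasurable ?_
  filter_upwards [ae_restrict_mem measurableSet_Ioi] with x hx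
  exact (weight_pos k hx).ne'

theorem ae_weighted_iff {k : ℝ} {p : ℝ → Prop} :
    (∀ᵐ x ∂weightedMeasure k, p x) ↔ ∀ᵐ x ∂posMeasure, p x :=
  ⟨fun h => (ac_weightedMeasure k).ae_le h, fun h => (weightedMeasure_ac k).ae_le h⟩

theorem aeEq_weighted_iff {k : ℝ} {f g : ℝ → ℝ} :
    f =ᵐ[weightedMeasure k] g ↔ f =ᵐ[posMeasure] g := ae_weighted_iff

theorem ae_pos : ∀ᵐ x ∂posMeasure, 0 < x := ae_restrict_mem measurableSet_Ioi

theorem normL1k_eq (k : ℝ) (f : ℝ → ℝ) :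
    normL1k k f = ∫⁻ x in Ioi 0, ‖f x‖ₑ * weight k x := by
  unfold normL1k
  rw [eLpNorm_one_eq_lintegral_enorm, weightedMeasure_eq,
    lintegral_withDensity_eq_lintegral_mul_non_measurable _ (measurable_weight k)
      (ae_of_all _ fun x => (weight_ne_top k x).lt_top)]
  simp only [Pi.mul_apply, mul_comm]

theorem memL1k_iff {k : ℝ} {f : ℝ → ℝ} :
    MemL1k k f ↔ AEStronglyMeasurable f posMeasure ∧ normL1k k f < ⊤ := by
  unfold MemL1k MemLp normL1k
  refine and_congr_left fun _ => ⟨fun h => h.mono_ac (ac_weightedMeasure k),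
    fun h => h.mono_ac (weightedMeasure_ac k)⟩

theorem MemL1k.aesm {k : ℝ} {f : ℝ → ℝ} (h : MemL1k k f) : AEStronglyMeasurable f posMeasure :=
  (memL1k_iff.1 h).1

theorem MemL1k.lt_top {k : ℝ} {f : ℝ → ℝ} (h : MemL1k k f) : normL1k k f < ⊤ := (memL1k_iff.1 h).2

theorem normL1k_congr {k : ℝ} {f g : ℝ → ℝ} (h : f =ᵐ[posMeasure] g) :
    normL1k k f = normL1k k g := eLpNorm_congr_ae (aeEq_weighted_iff.2 h)

theorem memL1k_congr {k : ℝ} {f g : ℝ → ℝ} (h : f =ᵐ[posMeasure] g) :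
    MemL1k k f ↔ MemL1k k g := memLp_congr_ae (aeEq_weighted_iff.2 h)

theorem normL1k_mono {j k : ℝ} (hjk : j ≤ k) (f : ℝ → ℝ) : normL1k j f ≤ normL1k k f := by
  rw [normL1k_eq, normL1k_eq]
  refine lintegral_mono_ae ?_
  filter_upwards [ae_pos] with x hx
  gcongr
  exact weight_mono hjk hx

theorem MemL1k.mono {j k : ℝ} (hjk : j ≤ k) {f : ℝ → ℝ} (h : MemL1k k f) : MemL1k j f :=
  memL1k_iff.2 ⟨h.aesm, (normL1k_mono hjk f).trans_lt h.lt_top⟩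

theorem lintegral_le_normL1k {k : ℝ} (hk : 0 ≤ k) (f : ℝ → ℝ) :
    ∫⁻ x in Ioi 0, ‖f x‖ₑ ≤ normL1k k f := by
  rw [normL1k_eq]
  refine lintegral_mono_ae ?_
  filter_upwards [ae_pos] with x hx
  exact le_mul_of_one_le_right zero_le (one_le_weight hk hx)

theorem MemL1k.integrable {k : ℝ} (hk : 0 ≤ k) {f : ℝ → ℝ} (h : MemL1k k f) :
    Integrable f posMeasure :=
  ⟨h.aesm, (lintegral_le_normL1k hk f).trans_lt h.lt_top⟩

/-- Functions growing at most like `(1 + x) ^ k`. -/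
theorem MemL1k.lintegral_mul_le {k c : ℝ} (hc : 0 ≤ c) (f ψ : ℝ → ℝ)
    (hb : ∀ x, 0 < x → |ψ x| ≤ c * (1 + x) ^ k) :
    ∫⁻ x in Ioi 0, ‖ψ x * f x‖ₑ ≤ ENNReal.ofReal c * normL1k k f := by
  rw [normL1k_eq, ← lintegral_const_mul' _ _ ENNReal.ofReal_ne_top]
  refine lintegral_mono_ae ?_
  filter_upwards [ae_pos] with x hx
  rw [enorm_mul, mul_comm ‖f x‖ₑ, ← mul_assoc]
  gcongr
  unfold weight
  rw [← ENNReal.ofReal_mul hc, Real.enorm_eq_ofReal_abs]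
  exact ENNReal.ofReal_le_ofReal (hb x hx)

theorem MemL1k.integrable_mul {k c : ℝ} (hc : 0 ≤ c) {f ψ : ℝ → ℝ} (h : MemL1k k f)
    (hψ : Measurable ψ) (hb : ∀ x, 0 < x → |ψ x| ≤ c * (1 + x) ^ k) :
    Integrable (fun x => ψ x * f x) posMeasure :=
  ⟨hψ.aestronglyMeasurable.mul h.aesm,
    (MemL1k.lintegral_mul_le hc f ψ hb).trans_lt (ENNReal.mul_lt_top ENNReal.ofReal_lt_top h.lt_top)⟩

theorem MemL1k.integrable_id_mul {k : ℝ} (hk : 1 ≤ k) {f : ℝ → ℝ} (h : MemL1k k f) :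
    Integrable (fun x => x * f x) posMeasure := by
  refine (h.mono hk).integrable_mul zero_le_one measurable_id fun x hx => ?_
  rw [abs_of_pos hx, Real.rpow_one]; linarith

theorem MemL1k.add {k : ℝ} {f g : ℝ → ℝ} (hf : MemL1k k f) (hg : MemL1k k g) :
    MemL1k k (fun x => f x + g x) := MemLp.add hf hg

theorem MemL1k.sub {k : ℝ} {f g : ℝ → ℝ} (hf : MemL1k k f) (hg : MemL1k k g) :
    MemL1k k (fun x => f x - g x) := MemLp.sub hf hg

theorem MemL1k.const_mul {k : ℝ} {f : ℝ → ℝ} (hf : MemL1k k f) (c : ℝ) :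
    MemL1k k (fun x => c * f x) := MemLp.const_mul hf c

theorem normL1k_add_le {k : ℝ} {f g : ℝ → ℝ} (hf : MemL1k k f) (hg : MemL1k k g) :
    normL1k k (fun x => f x + g x) ≤ normL1k k f + normL1k k g :=
  eLpNorm_add_le hf.1 hg.1 le_rfl

theorem normL1k_sub_le {k : ℝ} {f g : ℝ → ℝ} (hf : MemL1k k f) (hg : MemL1k k g) :
    normL1k k (fun x => f x - g x) ≤ normL1k k f + normL1k k g :=
  eLpNorm_sub_le hf.1 hg.1 le_rfl

theorem normL1k_const_mul (k c : ℝ) (f : ℝ → ℝ) :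
    normL1k k (fun x => c * f x) = ENNReal.ofReal |c| * normL1k k f := by
  have := eLpNorm_const_smul c f 1 (weightedMeasure k)
  rw [Real.enorm_eq_ofReal_abs] at this
  exact this

theorem normL1k_le_of_le {k : ℝ} {f g : ℝ → ℝ} (h : ∀ᵐ x ∂posMeasure, |f x| ≤ |g x|) :
    normL1k k f ≤ normL1k k g :=
  eLpNorm_mono_ae (ae_weighted_iff.2 h)

/-! ### Integral operators -/

/-- Minkowski's inequality by Tonelli: an integral operator on an `L¹` space is controlled by the
norms of the columns of its kernel. -/
theorem normL1k_kernel_le {k : ℝ} {p : ℝ → ℝ → ℝ} (hp : Measurable (Function.uncurry p))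
    {h : ℝ → ℝ} (hh : AEStronglyMeasurable h posMeasure) :
    normL1k k (fun x => ∫ y in Ioi 0, p x y * h y)
      ≤ ∫⁻ y in Ioi 0, normL1k k (fun x => p x y) * ‖h y‖ₑ := by
  have h1 : AEMeasurable (Function.uncurry fun x y => ‖p x y * h y‖ₑ * weight k x)
      (posMeasure.prod posMeasure) := by
    have := (hp.aestronglyMeasurable (μ := posMeasure.prod posMeasure)).mul
      (hh.comp_snd (μ := posMeasure))
    exact this.enorm.mul ((measurable_weight k).comp measurable_fst).aemeasurable
  calc normL1k k (fun x => ∫ y in Ioi 0, p x y * h y)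
      = ∫⁻ x in Ioi 0, ‖∫ y in Ioi 0, p x y * h y‖ₑ * weight k x := normL1k_eq _ _
    _ ≤ ∫⁻ x in Ioi 0, ∫⁻ y in Ioi 0, ‖p x y * h y‖ₑ * weight k x := by
        refine lintegral_mono fun x => ?_
        rw [lintegral_mul_const' _ _ (weight_ne_top k x)]
        gcongr
        exact enorm_integral_le_lintegral_enorm _
    _ = ∫⁻ y in Ioi 0, ∫⁻ x in Ioi 0, ‖p x y * h y‖ₑ * weight k x := lintegral_lintegral_swap h1
    _ = ∫⁻ y in Ioi 0, normL1k k (fun x => p x y) * ‖h y‖ₑ := by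
        refine lintegral_congr fun y => ?_
        rw [normL1k_eq, ← lintegral_mul_const' _ _ enorm_ne_top]
        refine lintegral_congr fun x => ?_
        rw [enorm_mul]; ring

theorem aesm_kernel {p : ℝ → ℝ → ℝ} (hp : Measurable (Function.uncurry p))
    {h : ℝ → ℝ} (hh : AEStronglyMeasurable h posMeasure) :
    AEStronglyMeasurable (fun x => ∫ y in Ioi 0, p x y * h y) posMeasure := by
  have := (hp.aestronglyMeasurable (μ := posMeasure.prod posMeasure)).mul
      (hh.comp_snd (μ := posMeasure))
  exact this.integral_prod_right'

theorem lintegral_kernel_le {k c : ℝ} {N : ℝ → ℝ≥0∞} {h : ℝ → ℝ}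
    (hN : ∀ y, 0 < y → N y ≤ ENNReal.ofReal c * weight k y) :
    ∫⁻ y in Ioi 0, N y * ‖h y‖ₑ ≤ ENNReal.ofReal c * normL1k k h := by
  rw [normL1k_eq, ← lintegral_const_mul' _ _ ENNReal.ofReal_ne_top]
  refine lintegral_mono_ae ?_
  filter_upwards [ae_pos] with y hy
  rw [mul_comm ‖h y‖ₑ, ← mul_assoc]
  gcongr
  exact hN y hy

theorem memL1k_kernel {k c : ℝ} {p : ℝ → ℝ → ℝ} (hp : Measurable (Function.uncurry p))
    {h : ℝ → ℝ} (hN : ∀ y, 0 < y → normL1k k (fun x => p x y) ≤ ENNReal.ofReal c * weight k y)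
    (hh : MemL1k k h) :
    MemL1k k (fun x => ∫ y in Ioi 0, p x y * h y) ∧
      normL1k k (fun x => ∫ y in Ioi 0, p x y * h y) ≤ ENNReal.ofReal c * normL1k k h := by
  have h1 := (normL1k_kernel_le (k := k) hp hh.aesm).trans (lintegral_kernel_le hN)
  exact ⟨memL1k_iff.2 ⟨aesm_kernel hp hh.aesm,
    h1.trans_lt (ENNReal.mul_lt_top ENNReal.ofReal_lt_top hh.lt_top)⟩, h1⟩

theorem integrable_prod_kernel {k c d : ℝ} (hd : 0 ≤ d) {p : ℝ → ℝ → ℝ}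
    (hp : Measurable (Function.uncurry p)) {h ψ : ℝ → ℝ}
    (hN : ∀ y, 0 < y → normL1k k (fun x => p x y) ≤ ENNReal.ofReal c * weight k y)
    (hh : MemL1k k h) (hψ : Measurable ψ) (hb : ∀ x, 0 < x → |ψ x| ≤ d * (1 + x) ^ k) :
    Integrable (Function.uncurry fun x y => ψ x * (p x y * h y)) (posMeasure.prod posMeasure) := by
  have hm : AEStronglyMeasurable (Function.uncurry fun x y => ψ x * (p x y * h y))
      (posMeasure.prod posMeasure) :=
    (hψ.comp measurable_fst).aestronglyMeasurable.mul
      ((hp.aestronglyMeasurable (μ := posMeasure.prod posMeasure)).mul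
      (hh.aesm.comp_snd (μ := posMeasure)))
  refine ⟨hm, ?_⟩
  unfold HasFiniteIntegral
  rw [lintegral_prod_symm _ hm.enorm]
  calc ∫⁻ y in Ioi 0, ∫⁻ x in Ioi 0, ‖ψ x * (p x y * h y)‖ₑ
      ≤ ∫⁻ y in Ioi 0, (ENNReal.ofReal d * normL1k k (fun x => p x y)) * ‖h y‖ₑ := by
        refine lintegral_mono fun y => ?_
        calc ∫⁻ x in Ioi 0, ‖ψ x * (p x y * h y)‖ₑ
            = ∫⁻ x in Ioi 0, ‖ψ x * p x y‖ₑ * ‖h y‖ₑ := by simp only [enorm_mul, mul_assoc]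
          _ = (∫⁻ x in Ioi 0, ‖ψ x * p x y‖ₑ) * ‖h y‖ₑ := lintegral_mul_const' _ _ enorm_ne_top
          _ ≤ _ := by
            gcongr
            exact MemL1k.lintegral_mul_le hd (fun x => p x y) ψ hb
    _ = ENNReal.ofReal d * ∫⁻ y in Ioi 0, normL1k k (fun x => p x y) * ‖h y‖ₑ := by
        rw [← lintegral_const_mul' _ _ ENNReal.ofReal_ne_top]
        simp only [mul_assoc]
    _ ≤ ENNReal.ofReal d * (ENNReal.ofReal c * normL1k k h) := by
        gcongr
        exact lintegral_kernel_le hN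
    _ < ⊤ := ENNReal.mul_lt_top ENNReal.ofReal_lt_top
        (ENNReal.mul_lt_top ENNReal.ofReal_lt_top hh.lt_top)

theorem integral_kernel_swap {k c d : ℝ} (hd : 0 ≤ d) {p : ℝ → ℝ → ℝ}
    (hp : Measurable (Function.uncurry p)) {h ψ : ℝ → ℝ}
    (hN : ∀ y, 0 < y → normL1k k (fun x => p x y) ≤ ENNReal.ofReal c * weight k y)
    (hh : MemL1k k h) (hψ : Measurable ψ) (hb : ∀ x, 0 < x → |ψ x| ≤ d * (1 + x) ^ k) :
    ∫ x in Ioi 0, ψ x * ∫ y in Ioi 0, p x y * h y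
      = ∫ y in Ioi 0, (∫ x in Ioi 0, ψ x * p x y) * h y := by
  have := integral_integral_swap (integrable_prod_kernel hd hp hN hh hψ hb)
  simp only [integral_const_mul] at this
  rw [this]
  refine integral_congr_ae (ae_of_all _ fun y => ?_)
  simp only [← mul_assoc, integral_mul_const]

/-! ### Bounded operators on `L¹_k` given on functions -/

/-- A map on functions which induces a bounded linear operator on `L¹_k` of norm at most `c`. -/
structure IsL1kOperator (k c : ℝ) (F : (ℝ → ℝ) → ℝ → ℝ) : Prop where
  nonneg : 0 ≤ c
  congr : ∀ f g : ℝ → ℝ, f =ᵐ[posMeasure] g → F f =ᵐ[posMeasure] F g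
  add : ∀ f g : ℝ → ℝ, MemL1k k f → MemL1k k g →
    F (fun x => f x + g x) =ᵐ[posMeasure] fun x => F f x + F g x
  smul : ∀ (a : ℝ) (f : ℝ → ℝ), F (fun x => a * f x) =ᵐ[posMeasure] fun x => a * F f x
  mem : ∀ f : ℝ → ℝ, MemL1k k f → MemL1k k (F f)
  bound : ∀ f : ℝ → ℝ, MemL1k k f → normL1k k (F f) ≤ ENNReal.ofReal c * normL1k k f

theorem L1k.memL1k {k : ℝ} (u : L1k k) : MemL1k k u := Lp.memLp u

theorem L1k.norm_eq {k : ℝ} (u : L1k k) : ‖u‖ = (normL1k k u).toReal := Lp.norm_def u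

theorem L1k.ext_pos {k : ℝ} {u v : L1k k} (h : u =ᵐ[posMeasure] v) : u = v :=
  Lp.ext (aeEq_weighted_iff.2 h)

/-- The class in `L¹_k` of a function. -/
def MemL1k.toL1k {k : ℝ} {f : ℝ → ℝ} (h : MemL1k k f) : L1k k := MemLp.toLp f h

theorem MemL1k.coeFn_toL1k {k : ℝ} {f : ℝ → ℝ} (h : MemL1k k f) : h.toL1k =ᵐ[posMeasure] f :=
  aeEq_weighted_iff.1 (MemLp.coeFn_toLp h)

theorem MemL1k.norm_toL1k {k : ℝ} {f : ℝ → ℝ} (h : MemL1k k f) :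
    ‖h.toL1k‖ = (normL1k k f).toReal := Lp.norm_toLp f h

theorem L1k.coeFn_add' {k : ℝ} (u v : L1k k) :
    (u + v : L1k k) =ᵐ[posMeasure] fun x => u x + v x :=
  aeEq_weighted_iff.1 (Lp.coeFn_add u v)

theorem L1k.coeFn_sub' {k : ℝ} (u v : L1k k) :
    (u - v : L1k k) =ᵐ[posMeasure] fun x => u x - v x :=
  aeEq_weighted_iff.1 (Lp.coeFn_sub u v)

theorem L1k.coeFn_smul' {k : ℝ} (a : ℝ) (u : L1k k) :
    (a • u : L1k k) =ᵐ[posMeasure] fun x => a * u x :=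
  aeEq_weighted_iff.1 (Lp.coeFn_smul a u)

theorem L1k.norm_le_of_normL1k_le {k c : ℝ} (hc : 0 ≤ c) {u : L1k k}
    (h : normL1k k u ≤ ENNReal.ofReal c) : ‖u‖ ≤ c := by
  rw [L1k.norm_eq]
  exact ENNReal.toReal_le_of_le_ofReal hc h

theorem L1k.normL1k_eq_ofReal {k : ℝ} (u : L1k k) : normL1k k u = ENNReal.ofReal ‖u‖ := by
  rw [L1k.norm_eq, ENNReal.ofReal_toReal u.memL1k.lt_top.ne]

namespace IsL1kOperator

variable {k c : ℝ} {F : (ℝ → ℝ) → ℝ → ℝ}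

/-- The bounded operator on `L¹_k` induced by `F`. -/
def toCLM (hF : IsL1kOperator k c F) : L1k k →L[ℝ] L1k k :=
  LinearMap.mkContinuous
    { toFun := fun u => (hF.mem u u.memL1k).toL1k
      map_add' := fun u v => by
        apply L1k.ext_pos
        filter_upwards [(hF.mem _ (u + v).memL1k).coeFn_toL1k,
          L1k.coeFn_add' (hF.mem u u.memL1k).toL1k (hF.mem v v.memL1k).toL1k,
          (hF.mem u u.memL1k).coeFn_toL1k, (hF.mem v v.memL1k).coeFn_toL1k,
          hF.congr _ _ (L1k.coeFn_add' u v), hF.add u v u.memL1k v.memL1k] with x h1 h2 h3 h4 h5 h6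
        rw [h1, h2, h3, h4, h5, h6]
      map_smul' := fun a u => by
        apply L1k.ext_pos
        filter_upwards [(hF.mem _ (a • u).memL1k).coeFn_toL1k,
          L1k.coeFn_smul' a (hF.mem u u.memL1k).toL1k,
          (hF.mem u u.memL1k).coeFn_toL1k,
          hF.congr _ _ (L1k.coeFn_smul' a u), hF.smul a u] with x h1 h2 h3 h5 h6
        rw [h1, RingHom.id_apply, h2, h3, h5, h6] }
    c (fun u => by
      refine L1k.norm_le_of_normL1k_le (mul_nonneg hF.nonneg (norm_nonneg _)) ?_
      change normL1k k ((hF.mem u u.memL1k).toL1k) ≤ _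
      rw [normL1k_congr (hF.mem u u.memL1k).coeFn_toL1k, ENNReal.ofReal_mul hF.nonneg,
        ← L1k.normL1k_eq_ofReal]
      exact hF.bound u u.memL1k)

theorem coeFn_toCLM (hF : IsL1kOperator k c F) (u : L1k k) : hF.toCLM u =ᵐ[posMeasure] F u :=
  (hF.mem u u.memL1k).coeFn_toL1k

theorem coeFn_toCLM_of_ae (hF : IsL1kOperator k c F) {u : L1k k} {f : ℝ → ℝ}
    (h : u =ᵐ[posMeasure] f) : hF.toCLM u =ᵐ[posMeasure] F f :=
  (hF.coeFn_toCLM u).trans (hF.congr _ _ h)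

theorem norm_toCLM_le (hF : IsL1kOperator k c F) : ‖hF.toCLM‖ ≤ c :=
  LinearMap.mkContinuous_norm_le _ hF.nonneg _

end IsL1kOperator

/-- The integral operator with kernel `p` on the half-line. -/
def kernelOp (p : ℝ → ℝ → ℝ) (h : ℝ → ℝ) (x : ℝ) : ℝ := ∫ y in Ioi 0, p x y * h y

theorem ae_integrable_kernel {k c : ℝ} (hk : 0 ≤ k) {p : ℝ → ℝ → ℝ}
    (hp : Measurable (Function.uncurry p)) {h : ℝ → ℝ}
    (hN : ∀ y, 0 < y → normL1k k (fun x => p x y) ≤ ENNReal.ofReal c * weight k y)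
    (hh : MemL1k k h) : ∀ᵐ x ∂posMeasure, Integrable (fun y => p x y * h y) posMeasure := by
  have := integrable_prod_kernel zero_le_one hp hN hh (ψ := fun _ => 1) measurable_const
    (fun x hx => by
      rw [abs_one, one_mul]
      exact Real.one_le_rpow (by linarith) hk)
  simpa using this.prod_right_ae

theorem isL1kOperator_kernelOp {k c : ℝ} (hk : 0 ≤ k) (hc : 0 ≤ c) {p : ℝ → ℝ → ℝ}
    (hp : Measurable (Function.uncurry p))
    (hN : ∀ y, 0 < y → normL1k k (fun x => p x y) ≤ ENNReal.ofReal c * weight k y) :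
    IsL1kOperator k c (kernelOp p) where
  nonneg := hc
  congr f g h := by
    refine ae_of_all _ fun x => integral_congr_ae ?_
    filter_upwards [h] with y hy
    rw [hy]
  add f g hf hg := by
    filter_upwards [ae_integrable_kernel hk hp hN hf, ae_integrable_kernel hk hp hN hg] with x h1 h2
    simp only [kernelOp, mul_add]
    exact integral_add h1 h2
  smul a f := by
    refine ae_of_all _ fun x => ?_
    simp only [kernelOp]
    rw [← integral_const_mul]
    exact integral_congr_ae (ae_of_all _ fun y => by ring)
  mem f hf := (memL1k_kernel hp hN hf).1
  bound f hf := (memL1k_kernel hp hN hf).2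

/-! ### Translations and dilations -/

/-- The translate of `φ` by `y`, extended by zero. -/
def shift (φ : ℝ → ℝ) (x y : ℝ) : ℝ := if y < x then φ (x - y) else 0

theorem measurable_shift {φ : ℝ → ℝ} (hφ : Measurable φ) :
    Measurable (Function.uncurry (shift φ)) :=
  Measurable.ite (measurableSet_lt measurable_snd measurable_fst)
    (hφ.comp (measurable_fst.sub measurable_snd)) measurable_const

theorem lintegral_shift {y : ℝ} (hy : 0 ≤ y) (g : ℝ → ℝ≥0∞) :
    ∫⁻ x in Ioi 0, (if y < x then g x else 0) = ∫⁻ u in Ioi 0, g (u + y) := by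
  rw [← lintegral_indicator measurableSet_Ioi, ← lintegral_indicator measurableSet_Ioi,
    ← lintegral_add_right_eq_self _ y]
  refine lintegral_congr fun u => ?_
  simp only [indicator, mem_Ioi]
  by_cases hu : 0 < u
  · rw [if_pos (by linarith), if_pos (by linarith), if_pos hu]
  · rw [if_neg hu]
    split_ifs <;> first | rfl | linarith

theorem integral_shift {y : ℝ} (hy : 0 ≤ y) (g : ℝ → ℝ) :
    ∫ x in Ioi 0, (if y < x then g x else 0) = ∫ u in Ioi 0, g (u + y) := by
  rw [← integral_indicator measurableSet_Ioi, ← integral_indicator measurableSet_Ioi,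
    ← integral_add_right_eq_self _ y]
  refine integral_congr_ae (ae_of_all _ fun u => ?_)
  simp only [indicator, mem_Ioi]
  by_cases hu : 0 < u
  · rw [if_pos (by linarith), if_pos (by linarith), if_pos hu]
  · rw [if_neg hu]
    split_ifs <;> first | rfl | linarith

theorem normL1k_shift_le {k : ℝ} (hk : 0 ≤ k) (φ : ℝ → ℝ) {y : ℝ} (hy : 0 < y) :
    normL1k k (fun x => shift φ x y) ≤ normL1k k φ * weight k y := by
  rw [normL1k_eq, normL1k_eq, ← lintegral_mul_const' _ _ (weight_ne_top k y)]
  have : ∀ x, ‖shift φ x y‖ₑ * weight k x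
      = if y < x then ‖φ (x - y)‖ₑ * weight k x else 0 := fun x => by
    unfold shift; split_ifs <;> simp
  simp_rw [this]
  rw [lintegral_shift hy.le]
  refine lintegral_mono_ae ?_
  filter_upwards [ae_pos] with u hu
  rw [add_sub_cancel_right, mul_assoc]
  gcongr
  exact weight_add_le hk hu.le hy.le

theorem integral_mul_shift {y : ℝ} (hy : 0 ≤ y) (ψ φ : ℝ → ℝ) :
    ∫ x in Ioi 0, ψ x * shift φ x y = ∫ u in Ioi 0, ψ (u + y) * φ u := by
  have : ∀ x, ψ x * shift φ x y = if y < x then ψ x * φ (x - y) else 0 := fun x => by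
    unfold shift; split_ifs <;> simp
  simp_rw [this]
  rw [integral_shift hy]
  simp

theorem map_mul_posMeasure {c : ℝ} (hc : 0 < c) :
    Measure.map (fun x => c * x) posMeasure = ENNReal.ofReal c⁻¹ • posMeasure := by
  have he : MeasurableEmbedding (fun x : ℝ => c * x) :=
    (Homeomorph.mulLeft₀ c hc.ne').measurableEmbedding
  have : (fun x : ℝ => c * x) ⁻¹' Ioi 0 = Ioi 0 := by
    ext x; simp [hc]
  rw [posMeasure, ← Measure.restrict_smul]
  conv_lhs => rw [← this]
  rw [← he.restrict_map, Real.map_volume_mul_left hc.ne', abs_of_pos (inv_pos.2 hc)]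

theorem lintegral_comp_mul_pos {c : ℝ} (hc : 0 < c) (g : ℝ → ℝ≥0∞) :
    ∫⁻ x in Ioi 0, g (c * x) = ENNReal.ofReal c⁻¹ * ∫⁻ x in Ioi 0, g x := by
  have he : MeasurableEmbedding (fun x : ℝ => c * x) :=
    (Homeomorph.mulLeft₀ c hc.ne').measurableEmbedding
  rw [← he.lintegral_map, map_mul_posMeasure hc, lintegral_smul_measure, smul_eq_mul]

theorem quasiMeasurePreserving_mul {c : ℝ} (hc : 0 < c) :
    Measure.QuasiMeasurePreserving (fun x => c * x) posMeasure posMeasure := by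
  refine ⟨measurable_const_mul c, ?_⟩
  rw [map_mul_posMeasure hc]
  exact Measure.smul_absolutelyContinuous

/-- The dilation `h ↦ h (c ·)`. -/
def dilate (c : ℝ) (h : ℝ → ℝ) (x : ℝ) : ℝ := h (c * x)

theorem normL1k_dilate_le {k : ℝ} (hk : 0 ≤ k) {c : ℝ} (hc : 1 ≤ c) (h : ℝ → ℝ) :
    normL1k k (dilate c h) ≤ ENNReal.ofReal c⁻¹ * normL1k k h := by
  have hc0 : 0 < c := by linarith
  rw [normL1k_eq, normL1k_eq, ← lintegral_comp_mul_pos hc0]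
  refine lintegral_mono_ae ?_
  filter_upwards [ae_pos] with x hx
  unfold dilate
  gcongr
  exact weight_le_of_le hk hx (by nlinarith)

theorem isL1kOperator_dilate {k : ℝ} (hk : 0 ≤ k) {c : ℝ} (hc : 1 ≤ c) :
    IsL1kOperator k c⁻¹ (dilate c) where
  nonneg := by positivity
  congr f g h := (quasiMeasurePreserving_mul (by linarith)).ae_eq_comp h
  add f g _ _ := ae_of_all _ fun _ => rfl
  smul a f := ae_of_all _ fun _ => rfl
  mem f hf := memL1k_iff.2 ⟨hf.aesm.comp_quasiMeasurePreserving
    (quasiMeasurePreserving_mul (by linarith)), (normL1k_dilate_le hk hc f).trans_lt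
      (ENNReal.mul_lt_top ENNReal.ofReal_lt_top hf.lt_top)⟩
  bound f _ := normL1k_dilate_le hk hc f

/-! ### Exponentials -/

theorem memL1k_pow_mul_exp (k : ℝ) (n : ℕ) {b : ℝ} (hb : 0 < b) :
    MemL1k k (fun x => x ^ n * Real.exp (-(b * x))) := by
  refine memL1k_iff.2 ⟨by fun_prop, ?_⟩
  have h1 : IntegrableOn (fun x : ℝ => x ^ n * Real.exp (-(b * x)) * (1 + x) ^ k) (Ioi 0) := by
    -- One third of the exponent absorbs `x ^ n`, one third absorbs `(1 + x) ^ k`, and one third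
    -- remains as decay.
    refine integrable_of_isBigO_exp_neg (b := b / 3) (by linarith) ?_ ?_
    · intro x hx
      refine ContinuousWithinAt.mul (by fun_prop) ?_
      exact ContinuousWithinAt.rpow_const (by fun_prop) (Or.inl (by
        have := mem_Ici.1 hx; linarith))
    · have ha : (fun x : ℝ => (1 + x) ^ k) =O[atTop] fun x => Real.exp (b / 3 * x) := by
        have h2 := (isLittleO_rpow_exp_pos_mul_atTop k (b := b / 3) (by linarith)).isBigO.comp_tendsto
          (tendsto_atTop_add_const_left atTop (1 : ℝ) tendsto_id)
        refine h2.trans (Asymptotics.IsBigO.of_bound (Real.exp (b / 3)) (Eventually.of_forall fun x => ?_))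
        simp only [Function.comp, id, Real.norm_eq_abs, Real.abs_exp]
        rw [← Real.exp_add]
        exact (congrArg _ (by ring)).le
      have hb' : (fun x : ℝ => x ^ n) =O[atTop] fun x => Real.exp (b / 3 * x) := by
        have := (isLittleO_rpow_exp_pos_mul_atTop n (b := b / 3) (by linarith)).isBigO
        simpa using this
      have := (hb'.mul (Asymptotics.isBigO_refl (fun x : ℝ => Real.exp (-(b * x))) atTop)).mul ha
      refine this.trans (Asymptotics.IsBigO.of_bound 1 (Eventually.of_forall fun x => ?_))
      simp only [Real.norm_eq_abs, abs_mul, Real.abs_exp, one_mul]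
      rw [← Real.exp_add, ← Real.exp_add]
      exact (congrArg _ (by ring)).le
  rw [normL1k_eq]
  refine lt_of_eq_of_lt (lintegral_congr_ae ?_) h1.2
  filter_upwards [ae_pos] with x hx
  rw [enorm_mul _ ((1 + x) ^ k), Real.enorm_eq_ofReal_abs ((1 + x) ^ k),
    abs_of_nonneg (Real.rpow_nonneg (by linarith) _)]
  rfl

/-! ### Test functions -/

theorem isFiniteMeasureOnCompacts_weightedMeasure {k : ℝ} (hk : 0 ≤ k) :
    IsFiniteMeasureOnCompacts (weightedMeasure k) := by
  refine ⟨fun K hK => ?_⟩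
  obtain ⟨B, hB⟩ := hK.isBounded.subset_closedBall 0
  have hKB : ∀ x ∈ K, x ≤ B := fun x hx => by
    have := hB hx
    rw [mem_closedBall_zero_iff, Real.norm_eq_abs] at this
    exact (le_abs_self x).trans this
  rw [weightedMeasure_eq, withDensity_apply' _ K]
  calc ∫⁻ x in K, weight k x ∂posMeasure ≤ ∫⁻ x in K, weight k B ∂posMeasure := by
        refine lintegral_mono_ae ?_
        filter_upwards [ae_restrict_mem hK.measurableSet, ae_restrict_of_ae ae_pos] with x hx h0
        exact weight_le_of_le hk h0 (hKB x hx)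
    _ < ⊤ := by
        rw [setLIntegral_const]
        refine ENNReal.mul_lt_top (weight_ne_top k B).lt_top ?_
        exact (Measure.restrict_apply_le _ _).trans_lt hK.measure_lt_top

theorem IsTestFunction.continuous {φ : ℝ → ℝ} (h : IsTestFunction φ) : Continuous φ :=
  h.smooth.continuous

theorem IsTestFunction.memL1k {φ : ℝ → ℝ} (h : IsTestFunction φ) {k : ℝ} (hk : 0 ≤ k) :
    MemL1k k φ := by
  have := isFiniteMeasureOnCompacts_weightedMeasure hk
  exact h.continuous.memLp_of_hasCompactSupport h.compact

/-- Approximation on the whole line gives a smooth `g` whose support may reach `0` or beyond. The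
cutoffs `χ n` vanish for `x ≤ 1 / n` and tend to `1` on the half-line, so dominated convergence
allows the part near `0` to be cut off. -/
theorem exists_testFunction_approx {k : ℝ} (hk : 0 ≤ k) {f : ℝ → ℝ} (hf : MemL1k k f) {δ : ℝ}
    (hδ : 0 < δ) :
    ∃ φ : ℝ → ℝ, IsTestFunction φ ∧ normL1k k (fun x => f x - φ x) ≤ ENNReal.ofReal δ := by
  have := isFiniteMeasureOnCompacts_weightedMeasure hk
  obtain ⟨g, hgc, hgs, hg⟩ := MemLp.exist_eLpNorm_sub_le ENNReal.one_ne_top le_rfl hf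
    (half_pos hδ)
  have hgm : MemL1k k g := hgs.continuous.memLp_of_hasCompactSupport hgc
  set χ : ℕ → ℝ → ℝ := fun n x => Real.smoothTransition ((n : ℝ) * x - 1) with hχ
  have hlim : Tendsto (fun n => normL1k k (fun x => g x - χ n x * g x)) atTop (𝓝 0) := by
    simp only [normL1k_eq]
    have : (0 : ℝ≥0∞) = ∫⁻ x in Ioi (0 : ℝ), 0 := by simp
    rw [this]
    refine tendsto_lintegral_of_dominated_convergence' (fun x => ‖g x‖ₑ * weight k x) ?_ ?_ ?_ ?_
    · intro n
      have h1 : Continuous (χ n) := Real.smoothTransition.continuous.comp (by fun_prop)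
      have h2 : Continuous fun x => g x - χ n x * g x :=
        hgs.continuous.sub (h1.mul hgs.continuous)
      exact (h2.measurable.enorm.mul (measurable_weight k)).aemeasurable
    · intro n
      refine ae_of_all _ fun x => mul_le_mul' ?_ le_rfl
      rw [Real.enorm_eq_ofReal_abs, Real.enorm_eq_ofReal_abs]
      refine ENNReal.ofReal_le_ofReal ?_
      rw [show g x - χ n x * g x = (1 - χ n x) * g x by ring, abs_mul]
      refine mul_le_of_le_one_left (abs_nonneg _) ?_
      have h1 := Real.smoothTransition.nonneg ((n : ℝ) * x - 1)
      have h2 := Real.smoothTransition.le_one ((n : ℝ) * x - 1)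
      rw [abs_le]; constructor <;> simp only [hχ] <;> linarith
    · rw [← normL1k_eq]; exact hgm.lt_top.ne
    · filter_upwards [ae_pos] with x hx
      refine tendsto_const_nhds.congr' ?_
      obtain ⟨N, hN⟩ := exists_nat_gt (2 / x)
      filter_upwards [eventually_ge_atTop N] with n hn
      have : 1 ≤ (n : ℝ) * x - 1 := by
        have h1 : 2 / x < n := hN.trans_le (by exact_mod_cast hn)
        rw [div_lt_iff₀ hx] at h1
        linarith
      simp only [hχ]
      rw [Real.smoothTransition.one_of_one_le this]
      simp
  obtain ⟨n, hn⟩ := ((hlim.eventually_le_const (ENNReal.ofReal_pos.2 (half_pos hδ))).and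
    (eventually_gt_atTop 0)).exists
  have hn0 : (0 : ℝ) < n := by exact_mod_cast hn.2
  have hχs : ContDiff ℝ ∞ (χ n) := Real.smoothTransition.contDiff.comp (by fun_prop)
  have hφm : MemL1k k (fun x => χ n x * g x) :=
    (hχs.continuous.mul hgs.continuous).memLp_of_hasCompactSupport hgc.mul_left
  refine ⟨fun x => χ n x * g x, ⟨hχs.mul hgs, hgc.mul_left, ?_⟩, ?_⟩
  · have : tsupport (fun x => χ n x * g x) ⊆ Ici (1 / (n : ℝ)) := by
      refine closure_minimal (fun x hx => ?_) isClosed_Ici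
      by_contra hlt
      rw [mem_Ici, not_le, lt_div_iff₀ hn0] at hlt
      refine hx ?_
      simp only [hχ]
      rw [Real.smoothTransition.zero_of_nonpos (by nlinarith), zero_mul]
    exact this.trans fun x hx => lt_of_lt_of_le (by positivity) (mem_Ici.1 hx)
  · have h1 := normL1k_add_le (hf.sub hgm) (hgm.sub hφm)
    have h2 : (fun x => (f x - g x) + (g x - χ n x * g x)) = fun x => f x - χ n x * g x := by
      ext x; ring
    rw [h2] at h1
    refine h1.trans ?_
    calc _ ≤ ENNReal.ofReal (δ / 2) + ENNReal.ofReal (δ / 2) := add_le_add hg hn.1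
      _ = ENNReal.ofReal δ := by rw [← ENNReal.ofReal_add (by positivity) (by positivity),
          add_halves]

theorem L1k.norm_sub_toL1k {k : ℝ} (u : L1k k) {f : ℝ → ℝ} (hf : MemL1k k f) :
    ‖u - hf.toL1k‖ = (normL1k k (fun x => u x - f x)).toReal := by
  rw [L1k.norm_eq]
  congr 1
  refine normL1k_congr ?_
  filter_upwards [L1k.coeFn_sub' u hf.toL1k, hf.coeFn_toL1k] with x h1 h2
  rw [h1, h2]

theorem L1k.exists_testFunction_near {k : ℝ} (hk : 0 ≤ k) (u : L1k k) {δ : ℝ} (hδ : 0 < δ) :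
    ∃ (φ : ℝ → ℝ) (hφ : IsTestFunction φ), ‖u - (hφ.memL1k hk).toL1k‖ ≤ δ := by
  obtain ⟨φ, hφ, h⟩ := exists_testFunction_approx hk u.memL1k hδ
  refine ⟨φ, hφ, ?_⟩
  rw [L1k.norm_sub_toL1k]
  exact ENNReal.toReal_le_of_le_ofReal hδ.le h

/-- By density, identities between bounded operators need only be verified on test functions, where
primitives are classically differentiable. -/
theorem L1k.clm_ext {k : ℝ} (hk : 0 ≤ k) {A B : L1k k →L[ℝ] L1k k}
    (h : ∀ (φ : ℝ → ℝ) (hφ : IsTestFunction φ),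
      A (hφ.memL1k hk).toL1k = B (hφ.memL1k hk).toL1k) : A = B := by
  have hd : Dense {u : L1k k | ∃ (φ : ℝ → ℝ) (hφ : IsTestFunction φ),
      u = (hφ.memL1k hk).toL1k} := by
    rw [Metric.dense_iff]
    intro u r hr
    obtain ⟨φ, hφ, h1⟩ := L1k.exists_testFunction_near hk u (half_pos hr)
    refine ⟨_, ?_, φ, hφ, rfl⟩
    rw [Metric.mem_ball, dist_comm, dist_eq_norm]
    linarith
  refine DFunLike.coe_injective (Continuous.ext_on hd A.continuous B.continuous ?_)
  rintro u ⟨φ, hφ, rfl⟩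
  exact h φ hφ

/-! ### The operators `h ↦ E_b * h - (∫ h) E_b` with `E_b(x) = b e^{-b x}` -/

/-- The exponential density `b e^{-b x}`. -/
def expDensity (b x : ℝ) : ℝ := b * Real.exp (-(b * x))

theorem measurable_expDensity (b : ℝ) : Measurable (expDensity b) := by
  unfold expDensity; fun_prop

theorem memL1k_expDensity (k : ℝ) {b : ℝ} (hb : 0 < b) : MemL1k k (expDensity b) := by
  have := (memL1k_pow_mul_exp k 0 hb).const_mul b
  simpa [expDensity] using! this

/-- The kernel of `h ↦ E_b * h - (∫ h) E_b`. -/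
def expKernel (b x y : ℝ) : ℝ := shift (expDensity b) x y - expDensity b x

theorem measurable_expKernel (b : ℝ) : Measurable (Function.uncurry (expKernel b)) :=
  (measurable_shift (measurable_expDensity b)).sub
    ((measurable_expDensity b).comp measurable_fst)

theorem normL1k_shift_sub_le {k : ℝ} (hk : 0 ≤ k) {φ : ℝ → ℝ} (hφ : Measurable φ)
    (hm : MemL1k k φ) {y : ℝ} (hy : 0 < y) :
    normL1k k (fun x => shift φ x y - φ x)
      ≤ ENNReal.ofReal (2 * (normL1k k φ).toReal) * weight k y := by
  have hs : MemL1k k (fun x => shift φ x y) := memL1k_iff.2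
    ⟨((measurable_shift hφ).comp (measurable_id.prodMk measurable_const)).aestronglyMeasurable,
      (normL1k_shift_le hk φ hy).trans_lt (ENNReal.mul_lt_top hm.lt_top (weight_ne_top k y).lt_top)⟩
  refine (normL1k_sub_le hs hm).trans ?_
  rw [ENNReal.ofReal_mul zero_le_two, ENNReal.ofReal_toReal hm.lt_top.ne]
  calc normL1k k (fun x => shift φ x y) + normL1k k φ
      ≤ normL1k k φ * weight k y + normL1k k φ * weight k y := by
        gcongr
        · exact normL1k_shift_le hk φ hy
        · exact le_mul_of_one_le_right zero_le (one_le_weight hk hy)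
    _ = _ := by rw [← two_mul, ENNReal.ofReal_ofNat, mul_assoc]

/-- The operator `h ↦ E_b * h - (∫ h) E_b`. -/
def expOp (b : ℝ) : (ℝ → ℝ) → ℝ → ℝ := kernelOp (expKernel b)

theorem isL1kOperator_expOp {k : ℝ} (hk : 0 ≤ k) {b : ℝ} (hb : 0 < b) :
    IsL1kOperator k (2 * (normL1k k (expDensity b)).toReal) (expOp b) :=
  isL1kOperator_kernelOp hk (by positivity) (measurable_expKernel b) fun _ hy =>
    normL1k_shift_sub_le hk (measurable_expDensity b) (memL1k_expDensity k hb) hy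

/-- The density `x e^{-x}`. -/
def gammaDensity (x : ℝ) : ℝ := x * Real.exp (-x)

theorem measurable_gammaDensity : Measurable gammaDensity := by
  unfold gammaDensity; fun_prop

theorem memL1k_gammaDensity (k : ℝ) : MemL1k k gammaDensity := by
  have := memL1k_pow_mul_exp k 1 one_pos
  simpa [gammaDensity, Function.comp_def] using! this

/-- The kernel of `h ↦ F * h - (∫ h) F` with `F(x) = x e^{-x}`. -/
def gammaKernel (x y : ℝ) : ℝ := shift gammaDensity x y - gammaDensity x

theorem measurable_gammaKernel : Measurable (Function.uncurry gammaKernel) :=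
  (measurable_shift measurable_gammaDensity).sub (measurable_gammaDensity.comp measurable_fst)

/-- The operator `h ↦ F * h - (∫ h) F` with `F(x) = x e^{-x}`. -/
def gammaOp : (ℝ → ℝ) → ℝ → ℝ := kernelOp gammaKernel

theorem isL1kOperator_gammaOp {k : ℝ} (hk : 0 ≤ k) :
    IsL1kOperator k (2 * (normL1k k gammaDensity).toReal) gammaOp :=
  isL1kOperator_kernelOp hk (by positivity) measurable_gammaKernel fun _ hy =>
    normL1k_shift_sub_le hk measurable_gammaDensity (memL1k_gammaDensity k) hy

/-! ### Explicit formulas and composition rules for the exponential operators. -/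

theorem kernelOp_shift_sub {φ h : ℝ → ℝ} (hh : Integrable h posMeasure) {x : ℝ} (hx : 0 < x)
    (hi : IntegrableOn (fun y => φ (x - y) * h y) (Ioc 0 x)) :
    kernelOp (fun x y => shift φ x y - φ x) h x
      = (∫ y in (0 : ℝ)..x, φ (x - y) * h y) - φ x * ∫ y in Ioi 0, h y := by
  have hi' : IntegrableOn (fun y => φ (x - y) * h y) (Ioo 0 x) := hi.mono_set Ioo_subset_Ioc_self
  have e : ∀ y, 0 < y → shift φ x y * h y = (Ioo 0 x).indicator (fun y => φ (x - y) * h y) y := by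
    intro y hy
    by_cases hyx : y < x <;> simp [shift, indicator, hyx, hy]
  have hi2 : Integrable (fun y => shift φ x y * h y) posMeasure := by
    refine ((hi'.integrable_indicator measurableSet_Ioo).restrict (s := Ioi 0)).congr ?_
    filter_upwards [ae_pos] with y hy
    exact (e y hy).symm
  simp only [kernelOp, sub_mul]
  rw [integral_sub hi2 (hh.const_mul _), integral_const_mul]
  congr 1
  rw [intervalIntegral.integral_of_le hx.le, integral_Ioc_eq_integral_Ioo,
    ← integral_indicator measurableSet_Ioo]
  rw [setIntegral_congr_fun measurableSet_Ioi fun y hy => e y hy]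
  exact setIntegral_eq_integral_of_forall_compl_eq_zero fun y hy => by
    rw [indicator_of_notMem]
    exact fun h => hy h.1

theorem integrableOn_continuous_mul {g h : ℝ → ℝ} (hg : Continuous g)
    (hh : Integrable h posMeasure) (x : ℝ) : IntegrableOn (fun y => g y * h y) (Ioc 0 x) := by
  have h1 : IntegrableOn h (Ioc 0 x) := (show IntegrableOn h (Ioi 0) volume from hh).mono_set
    Ioc_subset_Ioi_self
  exact (h1.continuousOn_mul_of_subset hg.continuousOn isCompact_Icc
    measurableSet_Ioc Ioc_subset_Icc_self)

/-- The factorisation `e^{-b(x-y)} = e^{-bx} e^{by}` reduces the convolution to a primitive, so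
compositions can be evaluated with the fundamental theorem of calculus. -/
theorem expOp_apply (b : ℝ) {h : ℝ → ℝ} (hh : Integrable h posMeasure) {x : ℝ} (hx : 0 < x) :
    expOp b h x = expDensity b x * ((∫ y in (0 : ℝ)..x, Real.exp (b * y) * h y)
      - ∫ y in Ioi 0, h y) := by
  have hc : Continuous (expDensity b) := by unfold expDensity; fun_prop
  rw [expOp, show expKernel b = fun x y => shift (expDensity b) x y - expDensity b x from rfl,
    kernelOp_shift_sub hh hx (integrableOn_continuous_mul
      (hc.comp (continuous_const.sub continuous_id)) hh x), mul_sub,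
    ← intervalIntegral.integral_const_mul]
  congr 1
  refine intervalIntegral.integral_congr fun y _ => ?_
  simp only [expDensity]
  rw [show -(b * (x - y)) = -(b * x) + b * y by ring, Real.exp_add]
  ring

theorem gammaOp_apply {h : ℝ → ℝ} (hh : Integrable h posMeasure) {x : ℝ} (hx : 0 < x) :
    gammaOp h x = Real.exp (-x) * (x * (∫ y in (0 : ℝ)..x, Real.exp y * h y)
      - (∫ y in (0 : ℝ)..x, (y * Real.exp y) * h y) - x * ∫ y in Ioi 0, h y) := by
  have hc : Continuous gammaDensity := by unfold gammaDensity; fun_prop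
  have h1 : IntervalIntegrable (fun y => Real.exp y * h y) volume 0 x :=
    (intervalIntegrable_iff_integrableOn_Ioc_of_le hx.le).2
      (integrableOn_continuous_mul Real.continuous_exp hh x)
  have h2 : IntervalIntegrable (fun y => (y * Real.exp y) * h y) volume 0 x :=
    (intervalIntegrable_iff_integrableOn_Ioc_of_le hx.le).2
      (integrableOn_continuous_mul (by fun_prop) hh x)
  rw [gammaOp, show gammaKernel = fun x y => shift gammaDensity x y - gammaDensity x from rfl,
    kernelOp_shift_sub hh hx (integrableOn_continuous_mul
      (hc.comp (continuous_const.sub continuous_id)) hh x),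
    ← intervalIntegral.integral_const_mul, ← intervalIntegral.integral_sub (h1.const_mul x) h2,
    mul_sub, ← intervalIntegral.integral_const_mul]
  congr 1
  · refine intervalIntegral.integral_congr fun y _ => ?_
    simp only [gammaDensity]
    rw [show -(x - y) = -x + y by ring, Real.exp_add]
    ring
  · simp only [gammaDensity]; ring

theorem integral_shift_sub (φ : ℝ → ℝ) {y : ℝ} (hy : 0 ≤ y) (hφ : Integrable φ posMeasure)
    (hs : Integrable (fun x => shift φ x y) posMeasure) :
    ∫ x in Ioi 0, (shift φ x y - φ x) = 0 := by
  rw [integral_sub hs hφ]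
  have := integral_mul_shift hy (fun _ => 1) φ
  simp only [one_mul] at this
  rw [this, sub_self]

theorem MemL1k.shift {k : ℝ} (hk : 0 ≤ k) {φ : ℝ → ℝ} (hφ : Measurable φ)
    (hm : MemL1k k φ) {y : ℝ} (hy : 0 < y) : MemL1k k (fun x => shift φ x y) := memL1k_iff.2
    ⟨((measurable_shift hφ).comp (measurable_id.prodMk measurable_const)).aestronglyMeasurable,
      (normL1k_shift_le hk φ hy).trans_lt (ENNReal.mul_lt_top hm.lt_top (weight_ne_top k y).lt_top)⟩

/-- Translation preserves the integral of `E_b`, so every column of the kernel integrates to zero.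
-/
theorem integral_expOp {k : ℝ} (hk : 0 ≤ k) {b : ℝ} (hb : 0 < b) {h : ℝ → ℝ} (hh : MemL1k k h) :
    ∫ x in Ioi 0, expOp b h x = 0 := by
  have h0 := integral_kernel_swap zero_le_one (measurable_expKernel b) (ψ := fun _ => 1)
    (fun y hy => normL1k_shift_sub_le hk (measurable_expDensity b) (memL1k_expDensity k hb) hy) hh
    measurable_const (fun x hx => by
      rw [abs_one, one_mul]
      exact Real.one_le_rpow (by linarith) hk)
  simp only [one_mul] at h0
  rw [show (∫ x in Ioi 0, expOp b h x) = ∫ x in Ioi 0, ∫ y in Ioi 0, expKernel b x y * h y from rfl,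
    h0]
  refine integral_eq_zero_of_ae ?_
  filter_upwards [ae_pos] with y hy
  have := integral_shift_sub (expDensity b) hy.le ((memL1k_expDensity k hb).integrable hk)
    (((memL1k_expDensity k hb).shift hk (measurable_expDensity b) hy).integrable hk)
  rw [show (∫ x in Ioi 0, expKernel b x y) = 0 from this]
  simp

theorem hasDerivAt_integral_continuous {g : ℝ → ℝ} (hg : Continuous g) (x : ℝ) :
    HasDerivAt (fun x => ∫ y in (0 : ℝ)..x, g y) (g x) x :=
  intervalIntegral.integral_hasDerivAt_right (hg.intervalIntegrable _ _)
    hg.stronglyMeasurable.stronglyMeasurableAtFilter hg.continuousAt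

/-- In Laplace variables the operator multiplies `ĥ(s) - ĥ(0)` by `b / (b + s)`, and its values have
zero integral. The identity is therefore the partial fraction expansion of `ab / ((a + s)(b + s))`.
-/
theorem expOp_expOp {k : ℝ} (hk : 0 ≤ k) {a b : ℝ} (ha : 0 < a) (hb : 0 < b) (hab : a ≠ b)
    {φ : ℝ → ℝ} (hφ : IsTestFunction φ) {x : ℝ} (hx : 0 < x) :
    expOp a (expOp b φ) x = (a * expOp b φ x - b * expOp a φ x) / (a - b) := by
  have hφi := (hφ.memL1k hk).integrable hk
  have hφb := (isL1kOperator_expOp hk hb).mem φ (hφ.memL1k hk)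
  have hc := hφ.continuous
  have hab' : a - b ≠ 0 := sub_ne_zero.2 hab
  rw [expOp_apply a (hφb.integrable hk) hx, integral_expOp hk hb (hφ.memL1k hk), sub_zero,
    expOp_apply a hφi hx, expOp_apply b hφi hx]
  set m := ∫ y in Ioi 0, φ y
  have e1 : ∫ y in (0 : ℝ)..x, Real.exp (a * y) * expOp b φ y
      = ∫ y in (0 : ℝ)..x, Real.exp (a * y) * (expDensity b y *
        ((∫ z in (0 : ℝ)..y, Real.exp (b * z) * φ z) - m)) := by
    rw [intervalIntegral.integral_of_le hx.le, intervalIntegral.integral_of_le hx.le]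
    refine setIntegral_congr_fun measurableSet_Ioc fun y hy => ?_
    rw [expOp_apply b hφi hy.1]
  have hd : ∀ c x, HasDerivAt (fun x => ∫ z in (0 : ℝ)..x, Real.exp (c * z) * φ z)
      (Real.exp (c * x) * φ x) x := fun c x =>
    hasDerivAt_integral_continuous (by fun_prop) x
  have hcont : ∀ c, Continuous fun x => ∫ z in (0 : ℝ)..x, Real.exp (c * z) * φ z := fun c =>
    continuous_iff_continuousAt.2 fun x => (hd c x).continuousAt
  -- Integration by parts against `e^{(a-b)y}`, phrased as an explicit primitive; this is where `a ≠
  -- b` enters.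
  have e2 : ∫ y in (0 : ℝ)..x, Real.exp (a * y) * (expDensity b y *
        ((∫ z in (0 : ℝ)..y, Real.exp (b * z) * φ z) - m))
      = b / (a - b) * (Real.exp ((a - b) * x) *
        ((∫ z in (0 : ℝ)..x, Real.exp (b * z) * φ z) - m)
          - ((∫ z in (0 : ℝ)..x, Real.exp (a * z) * φ z) - m)) := by
    rw [intervalIntegral.integral_eq_sub_of_hasDerivAt (f := fun x => b / (a - b) *
      (Real.exp ((a - b) * x) * ((∫ z in (0 : ℝ)..x, Real.exp (b * z) * φ z) - m)
          - ((∫ z in (0 : ℝ)..x, Real.exp (a * z) * φ z) - m)))]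
    · simp
    · intro y _
      have h1 : HasDerivAt (fun x => Real.exp ((a - b) * x))
          (Real.exp ((a - b) * y) * (a - b)) y := by
        simpa using ((hasDerivAt_id y).const_mul (a - b)).exp
      have := ((h1.mul ((hd b y).sub_const m)).sub ((hd a y).sub_const m)).const_mul (b / (a - b))
      convert! this using 1
      simp only [expDensity]
      rw [show (a - b) * y = a * y + -(b * y) by ring, Real.exp_add,
        show Real.exp (a * y) * φ y = Real.exp (a * y) * Real.exp (-(b * y)) *
          (Real.exp (b * y) * φ y) by
          rw [show Real.exp (a * y) * Real.exp (-(b * y)) * (Real.exp (b * y) * φ y)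
            = Real.exp (a * y) * (Real.exp (-(b * y)) * Real.exp (b * y)) * φ y by ring,
            ← Real.exp_add, neg_add_cancel, Real.exp_zero, mul_one]]
      field_simp
      ring
    · refine Continuous.intervalIntegrable ?_ _ _
      have := hcont b
      unfold expDensity
      fun_prop
  rw [e1, e2]
  simp only [expDensity]
  rw [show (a - b) * x = a * x + -(b * x) by ring, Real.exp_add]
  have h3 : Real.exp (-(a * x)) * Real.exp (a * x) = 1 := by
    rw [← Real.exp_add, neg_add_cancel, Real.exp_zero]
  generalize Real.exp (-(b * x)) = u at *
  generalize Real.exp (-(a * x)) = v at *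
  generalize Real.exp (a * x) = w at *
  field_simp
  linear_combination ((∫ (y : ℝ) in (0 : ℝ)..x, Real.exp (b * y) * φ y) * u - m * u) * h3

/-- The double pole case: `E * E` is the density `x e^{-x}`, and the inner operator produces zero
integral. -/
theorem expOp_one_expOp_one {k : ℝ} (hk : 0 ≤ k)
    {φ : ℝ → ℝ} (hφ : IsTestFunction φ) {x : ℝ} (hx : 0 < x) :
    expOp 1 (expOp 1 φ) x = gammaOp φ x := by
  have hφi := (hφ.memL1k hk).integrable hk
  have hφb := (isL1kOperator_expOp hk one_pos).mem φ (hφ.memL1k hk)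
  have hc := hφ.continuous
  rw [expOp_apply 1 (hφb.integrable hk) hx, integral_expOp hk one_pos (hφ.memL1k hk), sub_zero,
    gammaOp_apply hφi hx]
  set m := ∫ y in Ioi 0, φ y
  have hd : ∀ x, HasDerivAt (fun x => ∫ z in (0 : ℝ)..x, Real.exp z * φ z)
      (Real.exp x * φ x) x := fun x =>
    hasDerivAt_integral_continuous (by fun_prop) x
  have hd2 : ∀ x, HasDerivAt (fun x => ∫ z in (0 : ℝ)..x, (z * Real.exp z) * φ z)
      ((x * Real.exp x) * φ x) x := fun x =>
    hasDerivAt_integral_continuous (by fun_prop) x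
  have hcont : Continuous fun x => ∫ z in (0 : ℝ)..x, Real.exp z * φ z :=
    continuous_iff_continuousAt.2 fun x => (hd x).continuousAt
  have e1 : ∫ y in (0 : ℝ)..x, Real.exp (1 * y) * expOp 1 φ y
      = ∫ y in (0 : ℝ)..x, ((∫ z in (0 : ℝ)..y, Real.exp z * φ z) - m) := by
    rw [intervalIntegral.integral_of_le hx.le, intervalIntegral.integral_of_le hx.le]
    refine setIntegral_congr_fun measurableSet_Ioc fun y hy => ?_
    rw [expOp_apply 1 hφi hy.1]
    simp only [expDensity, one_mul]
    rw [← mul_assoc, ← Real.exp_add, add_neg_cancel, Real.exp_zero, one_mul]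
  have e2 : ∫ y in (0 : ℝ)..x, ((∫ z in (0 : ℝ)..y, Real.exp z * φ z) - m)
      = x * (∫ y in (0 : ℝ)..x, Real.exp y * φ y)
      - (∫ y in (0 : ℝ)..x, (y * Real.exp y) * φ y) - x * m := by
    rw [intervalIntegral.integral_eq_sub_of_hasDerivAt (f := fun x =>
      x * (∫ y in (0 : ℝ)..x, Real.exp y * φ y)
      - (∫ y in (0 : ℝ)..x, (y * Real.exp y) * φ y) - x * m)]
    · simp
    · intro y _
      have := (((hasDerivAt_id y).mul (hd y)).sub (hd2 y)).sub ((hasDerivAt_id y).mul_const m)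
      convert! this using 1
      simp only [id]
      ring
    · exact (hcont.sub continuous_const).intervalIntegrable _ _
  rw [e1, e2]
  simp [expDensity]

/-! ### The operators on `L¹_k` -/

/-- `h ↦ E_b * h - (∫ h) E_b` on `L¹_k`. -/
def expCLM {k : ℝ} (hk : 0 ≤ k) {b : ℝ} (hb : 0 < b) : L1k k →L[ℝ] L1k k :=
  (isL1kOperator_expOp hk hb).toCLM

/-- `h ↦ F * h - (∫ h) F` on `L¹_k`, with `F(x) = x e^{-x}`. -/
def gammaCLM {k : ℝ} (hk : 0 ≤ k) : L1k k →L[ℝ] L1k k := (isL1kOperator_gammaOp hk).toCLM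

/-- The dilation by `c` on `L¹_k`. -/
def dilateCLM {k : ℝ} (hk : 0 ≤ k) {c : ℝ} (hc : 1 ≤ c) : L1k k →L[ℝ] L1k k :=
  (isL1kOperator_dilate hk hc).toCLM

theorem expCLM_mul {k : ℝ} (hk : 0 ≤ k) {a b : ℝ} (ha : 0 < a) (hb : 0 < b) (hab : a ≠ b) :
    expCLM hk ha * expCLM hk hb = (a - b)⁻¹ • (a • expCLM hk hb - b • expCLM hk ha) := by
  refine L1k.clm_ext hk fun φ hφ => L1k.ext_pos ?_
  set u := (hφ.memL1k hk).toL1k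
  have hu : u =ᵐ[posMeasure] φ := (hφ.memL1k hk).coeFn_toL1k
  have hA : expCLM hk ha u =ᵐ[posMeasure] expOp a φ :=
    (isL1kOperator_expOp hk ha).coeFn_toCLM_of_ae hu
  have hB : expCLM hk hb u =ᵐ[posMeasure] expOp b φ :=
    (isL1kOperator_expOp hk hb).coeFn_toCLM_of_ae hu
  have hAB : expCLM hk ha (expCLM hk hb u) =ᵐ[posMeasure] expOp a (expOp b φ) :=
    (isL1kOperator_expOp hk ha).coeFn_toCLM_of_ae hB
  change (expCLM hk ha (expCLM hk hb u) : L1k k) =ᵐ[posMeasure]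
    ((a - b)⁻¹ • (a • expCLM hk hb u - b • expCLM hk ha u) : L1k k)
  filter_upwards [hA, hB, hAB, L1k.coeFn_smul' (a - b)⁻¹ (a • expCLM hk hb u - b • expCLM hk ha u),
    L1k.coeFn_sub' (a • expCLM hk hb u) (b • expCLM hk ha u), L1k.coeFn_smul' a (expCLM hk hb u),
    L1k.coeFn_smul' b (expCLM hk ha u), ae_pos] with x h1 h2 h3 h4 h5 h6 h7 hx
  rw [h4, h5, h6, h7, h1, h2, h3, expOp_expOp hk ha hb hab hφ hx]
  ring

theorem expCLM_one_mul_self {k : ℝ} (hk : 0 ≤ k) :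
    expCLM hk one_pos * expCLM hk one_pos = gammaCLM hk := by
  refine L1k.clm_ext hk fun φ hφ => L1k.ext_pos ?_
  set u := (hφ.memL1k hk).toL1k
  have hu : u =ᵐ[posMeasure] φ := (hφ.memL1k hk).coeFn_toL1k
  have hA : expCLM hk one_pos u =ᵐ[posMeasure] expOp 1 φ :=
    (isL1kOperator_expOp hk one_pos).coeFn_toCLM_of_ae hu
  have hAB : expCLM hk one_pos (expCLM hk one_pos u) =ᵐ[posMeasure] expOp 1 (expOp 1 φ) :=
    (isL1kOperator_expOp hk one_pos).coeFn_toCLM_of_ae hA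
  have hG : gammaCLM hk u =ᵐ[posMeasure] gammaOp φ :=
    (isL1kOperator_gammaOp hk).coeFn_toCLM_of_ae hu
  change (expCLM hk one_pos (expCLM hk one_pos u) : L1k k) =ᵐ[posMeasure] gammaCLM hk u
  filter_upwards [hAB, hG, ae_pos] with x h1 h2 hx
  rw [h1, h2, expOp_one_expOp_one hk hφ hx]

/-- Substituting `y ↦ c y` in the integrals turns the rate `1` into the rate `c`: dilations
intertwine the operators for different rates. -/
theorem dilate_expOp {h : ℝ → ℝ} (hh : Integrable h posMeasure) {c : ℝ} (hc : 0 < c) {x : ℝ}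
    (hx : 0 < x) : expOp 1 h (c * x) = expOp c (dilate c h) x := by
  have hi : Integrable (dilate c h) posMeasure := (integrableOn_Ioi_comp_mul_left_iff h 0 hc).2
    (by simpa only [mul_zero] using! hh)
  rw [expOp_apply 1 hh (by positivity), expOp_apply c hi hx]
  have h1 : ∫ y in (0 : ℝ)..x, Real.exp (c * y) * dilate c h y
      = c⁻¹ * ∫ y in (0 : ℝ)..c * x, Real.exp (1 * y) * h y := by
    have := intervalIntegral.integral_comp_mul_left (a := 0) (b := x)
      (fun y => Real.exp (1 * y) * h y) hc.ne'
    simpa [dilate] using this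
  have h2 : ∫ y in Ioi 0, dilate c h y = c⁻¹ * ∫ y in Ioi 0, h y := by
    have := integral_comp_mul_left_Ioi h 0 hc
    simpa [dilate] using this
  rw [h1, h2, ← mul_sub]
  simp only [expDensity]
  field_simp

theorem dilateCLM_mul_expCLM {k : ℝ} (hk : 0 ≤ k) {c : ℝ} (hc : 1 ≤ c) (hc0 : 0 < c) :
    dilateCLM hk hc * expCLM hk one_pos = expCLM hk hc0 * dilateCLM hk hc := by
  refine ContinuousLinearMap.ext fun u => L1k.ext_pos ?_
  have hA : dilateCLM hk hc (expCLM hk one_pos u) =ᵐ[posMeasure] dilate c (expOp 1 u) :=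
    (isL1kOperator_dilate hk hc).coeFn_toCLM_of_ae ((isL1kOperator_expOp hk one_pos).coeFn_toCLM u)
  have hB : expCLM hk hc0 (dilateCLM hk hc u) =ᵐ[posMeasure] expOp c (dilate c u) :=
    (isL1kOperator_expOp hk hc0).coeFn_toCLM_of_ae ((isL1kOperator_dilate hk hc).coeFn_toCLM u)
  change (dilateCLM hk hc (expCLM hk one_pos u) : L1k k) =ᵐ[posMeasure]
    expCLM hk hc0 (dilateCLM hk hc u)
  filter_upwards [hA, hB, ae_pos] with x h1 h2 hx
  rw [h1, h2, ← dilate_expOp (u.memL1k.integrable hk) hc0 hx]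
  rfl

theorem dilateCLM_mul {k : ℝ} (hk : 0 ≤ k) {c d e : ℝ} (hc : 1 ≤ c) (hd : 1 ≤ d) (he : 1 ≤ e)
    (hcd : c * d = e) : dilateCLM hk hc * dilateCLM hk hd = dilateCLM hk he := by
  refine ContinuousLinearMap.ext fun u => L1k.ext_pos ?_
  have hA : dilateCLM hk hc (dilateCLM hk hd u) =ᵐ[posMeasure] dilate c (dilate d u) :=
    (isL1kOperator_dilate hk hc).coeFn_toCLM_of_ae ((isL1kOperator_dilate hk hd).coeFn_toCLM u)
  change (dilateCLM hk hc (dilateCLM hk hd u) : L1k k) =ᵐ[posMeasure] dilateCLM hk he u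
  filter_upwards [hA, (isL1kOperator_dilate hk he).coeFn_toCLM u] with x h1 h2
  rw [h1, dilateCLM, h2]
  simp only [dilate]
  rw [← hcd]
  ring_nf

theorem dilateCLM_one {k : ℝ} (hk : 0 ≤ k) {c : ℝ} (hc : 1 ≤ c) (h1 : c = 1) :
    dilateCLM hk hc = 1 := by
  subst h1
  refine ContinuousLinearMap.ext fun u => L1k.ext_pos ?_
  filter_upwards [(isL1kOperator_dilate hk hc).coeFn_toCLM u] with x h1
  rw [dilateCLM, h1]
  simp [dilate]

theorem norm_dilateCLM_le {k : ℝ} (hk : 0 ≤ k) {c : ℝ} (hc : 1 ≤ c) : ‖dilateCLM hk hc‖ ≤ 1 :=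
  (isL1kOperator_dilate hk hc).norm_toCLM_le.trans (inv_le_one_of_one_le₀ hc)

theorem one_le_exp_max (t : ℝ) : 1 ≤ Real.exp (max t 0) := Real.one_le_exp (le_max_right _ _)

/-- The dilation semigroup `h ↦ h (e^t ·)` (the identity for `t ≤ 0`). -/
def dilationSemigroup {k : ℝ} (hk : 0 ≤ k) (t : ℝ) : L1k k →L[ℝ] L1k k :=
  dilateCLM hk (one_le_exp_max t)

/-- The semigroup generated by `L₀`, in closed form. -/
def gapSemigroup {k : ℝ} (hk : 0 ≤ k) (t : ℝ) : L1k k →L[ℝ] L1k k :=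
  (1 + (Real.exp (max t 0) - 1) • expCLM hk one_pos) ^ 2 * dilationSemigroup hk t

theorem gapSemigroup_zero {k : ℝ} (hk : 0 ≤ k) : gapSemigroup hk 0 = 1 := by
  unfold gapSemigroup dilationSemigroup
  rw [dilateCLM_one hk _ (by simp)]
  simp

/-- On the Laplace side the factors are `(c + s) / (1 + s)` and `(cd + s) / (c + s)`, whose product
telescopes to `(cd + s) / (1 + s)`. -/
theorem one_add_mul_one_add_expCLM {k : ℝ} (hk : 0 ≤ k) {c : ℝ} (hc : 0 < c) (h1 : c ≠ 1) (d : ℝ) :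
    (1 + (c - 1) • expCLM hk one_pos) * (1 + (d - 1) • expCLM hk hc)
      = 1 + (c * d - 1) • expCLM hk one_pos ∧
    (1 + (d - 1) • expCLM hk hc) * (1 + (c - 1) • expCLM hk one_pos)
      = 1 + (c * d - 1) • expCLM hk one_pos := by
  have e1 : c - 1 ≠ 0 := sub_ne_zero.2 h1
  have e2 : 1 - c ≠ 0 := sub_ne_zero.2 h1.symm
  constructor
  · rw [mul_add, add_mul, add_mul, smul_mul_smul_comm, expCLM_mul hk one_pos hc h1.symm]
    simp only [one_mul, mul_one]
    rw [smul_smul, show (c - 1) * (d - 1) * (1 - c)⁻¹ = -(d - 1) by field_simp; ring]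
    module
  · rw [mul_add, add_mul, add_mul, smul_mul_smul_comm, expCLM_mul hk hc one_pos h1]
    simp only [one_mul, mul_one]
    rw [smul_smul, show (d - 1) * (c - 1) * (c - 1)⁻¹ = d - 1 by field_simp]
    module

/-- Moving the dilation by `c = e^s` past `1 + (d - 1) P_1`, where `d = e^t`, replaces `P_1` by
`P_c`. The telescoping product then merges each of the two factors. -/
theorem gapSemigroup_add {k : ℝ} (hk : 0 ≤ k) {s t : ℝ} (hs : 0 ≤ s) (ht : 0 ≤ t) :
    gapSemigroup hk (s + t) = gapSemigroup hk s * gapSemigroup hk t := by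
  -- The partial fraction identity needs `e^s ≠ 1`, so `s = 0` is separate.
  rcases hs.eq_or_lt with rfl | hs'
  · rw [gapSemigroup_zero, zero_add, one_mul]
  unfold gapSemigroup dilationSemigroup
  have hc0 : 0 < Real.exp (max s 0) := Real.exp_pos _
  have hc1 : Real.exp (max s 0) ≠ 1 := by
    rw [max_eq_left hs, Ne, Real.exp_eq_one_iff]
    exact hs'.ne'
  have hcd : Real.exp (max s 0) * Real.exp (max t 0) = Real.exp (max (s + t) 0) := by
    rw [max_eq_left hs, max_eq_left ht, max_eq_left (add_nonneg hs ht), Real.exp_add]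
  have hD := dilateCLM_mul hk (one_le_exp_max s) (one_le_exp_max t) (one_le_exp_max (s + t)) hcd
  have hP := dilateCLM_mul_expCLM hk (one_le_exp_max s) hc0
  obtain ⟨h1, h2⟩ := one_add_mul_one_add_expCLM hk hc0 hc1 (Real.exp (max t 0))
  rw [hcd] at h1 h2
  rw [← hD]
  set D := dilateCLM hk (one_le_exp_max s)
  set D' := dilateCLM hk (one_le_exp_max t)
  set A := 1 + (Real.exp (max s 0) - 1) • expCLM hk one_pos
  set B' := 1 + (Real.exp (max t 0) - 1) • expCLM hk one_pos with hB'
  set B := 1 + (Real.exp (max t 0) - 1) • expCLM hk hc0 with hB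
  have hDB : D * B' = B * D := by
    rw [hB', hB, mul_add, add_mul, mul_one, one_mul, mul_smul_comm, smul_mul_assoc, hP]
  rw [← h1, sq, sq, sq]
  calc A * B * (A * B) * (D * D') = A * (B * A) * (B * D) * D' := by simp only [mul_assoc]
    _ = A * (A * B) * (D * B') * D' := by rw [h2, ← h1, hDB]
    _ = A * A * (B * D) * B' * D' := by simp only [mul_assoc]
    _ = A * A * (D * B') * B' * D' := by rw [hDB]
    _ = A * A * D * (B' * B' * D') := by simp only [mul_assoc]

/-! ### The generator of the dilation semigroup -/

theorem IsTestFunction.id_mul_deriv {φ : ℝ → ℝ} (h : IsTestFunction φ) :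
    IsTestFunction fun x => x * deriv φ x where
  smooth := contDiff_id.mul ((contDiff_infty_iff_deriv.1 h.smooth).2)
  compact := h.compact.deriv.mul_left
  support := (closure_mono fun x hx => by
    rw [Function.mem_support] at hx ⊢
    exact right_ne_zero_of_mul hx).trans ((tsupport_deriv_subset).trans h.support)

theorem IsTestFunction.exists_Icc {φ : ℝ → ℝ} (h : IsTestFunction φ) :
    ∃ α β : ℝ, 0 < α ∧ α < β ∧ ∀ x, x < α ∨ β < x → φ x = 0 := by
  obtain ⟨β, hβ⟩ := h.compact.isCompact.isBounded.bddAbove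
  have : ∃ α : ℝ, 0 < α ∧ ∀ x ∈ tsupport φ, α ≤ x := by
    rcases (tsupport φ).eq_empty_or_nonempty with he | hne
    · exact ⟨1, one_pos, by simp [he]⟩
    · obtain ⟨a, ha, hmin⟩ := h.compact.isCompact.exists_isLeast hne
      exact ⟨a, h.support ha, fun x hx => hmin hx⟩
  obtain ⟨α, hα, hα'⟩ := this
  refine ⟨α, max β (α + 1), hα, lt_max_of_lt_right (by linarith), fun x hx => ?_⟩
  refine image_eq_zero_of_notMem_tsupport fun hx' => ?_
  rcases hx with hx | hx
  · exact absurd (hα' x hx') (not_le.2 hx)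
  · exact absurd ((hβ hx').trans (le_max_left β (α + 1))) (not_le.2 hx)

theorem IsTestFunction.exists_bound {φ : ℝ → ℝ} (h : IsTestFunction φ) :
    ∃ B : ℝ, ∀ x, |φ x| ≤ B := by
  obtain ⟨B, hB⟩ := h.compact.exists_bound_of_continuous h.continuous
  exact ⟨B, hB⟩

theorem hasDerivAt_dilate {φ : ℝ → ℝ} (h : IsTestFunction φ) (x t : ℝ) :
    HasDerivAt (fun τ => φ (Real.exp τ * x)) (Real.exp t * x * deriv φ (Real.exp t * x)) t := by
  have h1 : HasDerivAt φ (deriv φ (Real.exp t * x)) (Real.exp t * x) :=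
    (h.smooth.differentiable (by simp)).differentiableAt.hasDerivAt
  have := h1.comp t ((Real.hasDerivAt_exp t).mul_const x)
  convert! this using 1
  ring

/-- Dominated convergence: `τ ↦ φ(e^τ x)` has derivative `(y φ'(y))` at `y = e^τ x`, which is
bounded uniformly in `τ` and `x`. -/
theorem tendsto_normL1k_dilate_slope {k : ℝ} (hk : 0 ≤ k) {φ : ℝ → ℝ} (hφ : IsTestFunction φ) :
    Tendsto (fun t : ℝ => normL1k k fun x =>
      t⁻¹ * (dilate (Real.exp t) φ x - φ x) - x * deriv φ x) (𝓝[>] 0) (𝓝 0) := by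
  obtain ⟨B, hB⟩ := hφ.id_mul_deriv.exists_bound
  obtain ⟨α, β, hα, hαβ, h0⟩ := hφ.exists_Icc
  obtain ⟨α', β', hα', hαβ', h0'⟩ := hφ.id_mul_deriv.exists_Icc
  have hB0 : 0 ≤ B := (abs_nonneg _).trans (hB 0)
  have hφc := hφ.continuous
  have hφc' := hφ.id_mul_deriv.continuous
  simp only [normL1k_eq]
  rw [show (0 : ℝ≥0∞) = ∫⁻ x in Ioi (0 : ℝ), 0 by simp]
  -- Beyond `M` all three terms vanish, since for `t > 0` the dilation moves the support to the
  -- left.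
  set M := max β β'
  refine tendsto_lintegral_filter_of_dominated_convergence
    ((Iic M).indicator fun x => ENNReal.ofReal (2 * B) * weight k M) ?_ ?_ ?_ ?_
  · refine Eventually.of_forall fun t => ?_
    have : Continuous fun x => t⁻¹ * (dilate (Real.exp t) φ x - φ x) - x * deriv φ x := by
      unfold dilate; fun_prop
    exact this.measurable.enorm.mul (measurable_weight k)
  · filter_upwards [self_mem_nhdsWithin] with t ht
    have ht : 0 < t := ht
    filter_upwards [ae_pos] with x hx
    by_cases hxM : x ≤ M
    · rw [indicator_of_mem (show x ∈ Iic M from hxM)]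
      refine mul_le_mul' ?_ (weight_le_of_le hk hx hxM)
      rw [Real.enorm_eq_ofReal_abs]
      refine ENNReal.ofReal_le_ofReal ?_
      have h1 : |dilate (Real.exp t) φ x - φ x| ≤ B * t := by
        have := Convex.norm_image_sub_le_of_norm_hasDerivWithin_le (s := univ) (x := 0) (y := t)
          (C := B) (fun τ _ => (hasDerivAt_dilate hφ x τ).hasDerivWithinAt)
          (fun τ _ => hB _) convex_univ (mem_univ _) (mem_univ _)
        simpa [dilate, abs_of_pos ht] using this
      calc |t⁻¹ * (dilate (Real.exp t) φ x - φ x) - x * deriv φ x|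
          ≤ |t⁻¹ * (dilate (Real.exp t) φ x - φ x)| + |x * deriv φ x| := abs_sub _ _
        _ ≤ t⁻¹ * (B * t) + B := by
            rw [abs_mul, abs_of_pos (inv_pos.2 ht)]
            gcongr
            exact hB x
        _ = 2 * B := by field_simp; ring
    · rw [indicator_of_notMem (show x ∉ Iic M from hxM)]
      rw [not_le] at hxM
      have h1 : φ x = 0 := h0 x (Or.inr ((le_max_left _ _).trans_lt hxM))
      have h2 : x * deriv φ x = 0 := h0' x (Or.inr ((le_max_right _ _).trans_lt hxM))
      have h3 : dilate (Real.exp t) φ x = 0 := by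
        refine h0 _ (Or.inr (((le_max_left _ _).trans_lt hxM).trans_le ?_))
        have := Real.one_le_exp ht.le
        nlinarith
      rw [h1, h2, h3]
      simp
  · have : ∀ x ∈ Ioi (0 : ℝ), (Iic M).indicator (fun x => ENNReal.ofReal (2 * B) * weight k M) x
        = (Ioc 0 M).indicator (fun x => ENNReal.ofReal (2 * B) * weight k M) x := by
      intro x hx
      have hx : 0 < x := hx
      simp [indicator, hx]
    rw [setLIntegral_congr_fun measurableSet_Ioi this]
    refine ((setLIntegral_le_lintegral _ _).trans_lt ?_).ne
    rw [lintegral_indicator measurableSet_Ioc, setLIntegral_const]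
    refine ENNReal.mul_lt_top (ENNReal.mul_lt_top ENNReal.ofReal_lt_top
      (weight_ne_top k M).lt_top) (by simp)
  · filter_upwards [ae_pos] with x hx
    have h1 := (hasDerivAt_dilate hφ x 0).tendsto_slope_zero_right
    simp only [zero_add, Real.exp_zero, one_mul, smul_eq_mul] at h1
    have h2 := (h1.sub_const (x * deriv φ x)).enorm
    rw [sub_self, enorm_zero] at h2
    have := ENNReal.Tendsto.mul_const (b := weight k x) h2 (Or.inr (weight_ne_top k x))
    simpa [dilate] using this

theorem dilationSemigroup_coeFn {k : ℝ} (hk : 0 ≤ k) {t : ℝ} (ht : 0 ≤ t) {u : L1k k} {f : ℝ → ℝ}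
    (h : u =ᵐ[posMeasure] f) : dilationSemigroup hk t u =ᵐ[posMeasure] dilate (Real.exp t) f := by
  have := (isL1kOperator_dilate hk (one_le_exp_max t)).coeFn_toCLM_of_ae h
  have e : dilate (Real.exp (max t 0)) f = dilate (Real.exp t) f := by rw [max_eq_left ht]
  rw [← e]
  exact this

theorem isGeneratorValue_dilation_testFunction {k : ℝ} (hk : 0 ≤ k) {φ : ℝ → ℝ}
    (hφ : IsTestFunction φ) : IsGeneratorValue (dilationSemigroup hk) (hφ.memL1k hk).toL1k
      (hφ.id_mul_deriv.memL1k hk).toL1k := by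
  unfold IsGeneratorValue
  rw [tendsto_iff_norm_sub_tendsto_zero]
  have h := (ENNReal.tendsto_toReal ENNReal.zero_ne_top).comp (tendsto_normL1k_dilate_slope hk hφ)
  refine h.congr' ?_
  filter_upwards [self_mem_nhdsWithin] with t ht
  have ht : 0 < t := ht
  set u := (hφ.memL1k hk).toL1k
  rw [L1k.norm_sub_toL1k]
  simp only [Function.comp]
  congr 1
  refine normL1k_congr ?_
  filter_upwards [L1k.coeFn_smul' t⁻¹ (dilationSemigroup hk t u - u),
    L1k.coeFn_sub' (dilationSemigroup hk t u) u, (hφ.memL1k hk).coeFn_toL1k,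
    dilationSemigroup_coeFn hk ht.le (hφ.memL1k hk).coeFn_toL1k] with x h1 h2 h3 h4
  rw [h1, h2, h4, h3]

theorem tendsto_of_isGeneratorValue {X : Type*} [NormedAddCommGroup X] [NormedSpace ℝ X]
    {S : ℝ → X →L[ℝ] X} {u v : X} (h : IsGeneratorValue S u v) :
    Tendsto (fun t => S t u) (𝓝[>] 0) (𝓝 u) := by
  have h0 : Tendsto (fun t : ℝ => t) (𝓝[>] 0) (𝓝 0) := tendsto_nhdsWithin_of_tendsto_nhds tendsto_id
  have := (h0.smul h).add_const u
  rw [zero_smul, zero_add] at this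
  refine this.congr' ?_
  filter_upwards [self_mem_nhdsWithin] with t ht
  have ht : (0 : ℝ) < t := ht
  rw [smul_inv_smul₀ ht.ne', sub_add_cancel]

theorem norm_dilationSemigroup_le {k : ℝ} (hk : 0 ≤ k) (t : ℝ) : ‖dilationSemigroup hk t‖ ≤ 1 :=
  norm_dilateCLM_le hk _

theorem norm_dilationSemigroup_apply_le {k : ℝ} (hk : 0 ≤ k) (t : ℝ) (u : L1k k) :
    ‖dilationSemigroup hk t u‖ ≤ ‖u‖ := by
  have := (dilationSemigroup hk t).le_opNorm u
  have h1 := norm_dilationSemigroup_le hk t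
  nlinarith [norm_nonneg u]

theorem tendsto_dilationSemigroup {k : ℝ} (hk : 0 ≤ k) (u : L1k k) :
    Tendsto (fun t => dilationSemigroup hk t u) (𝓝[>] 0) (𝓝 u) := by
  rw [Metric.tendsto_nhds]
  intro ε hε
  obtain ⟨φ, hφ, h1⟩ := L1k.exists_testFunction_near hk u (by positivity : 0 < ε / 4)
  set w := (hφ.memL1k hk).toL1k
  have h2 := tendsto_of_isGeneratorValue (isGeneratorValue_dilation_testFunction hk hφ)
  filter_upwards [Metric.tendsto_nhds.1 h2 (ε / 4) (by positivity)] with t ht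
  rw [dist_eq_norm] at ht ⊢
  have e : dilationSemigroup hk t u - u
      = dilationSemigroup hk t (u - w) + (dilationSemigroup hk t w - w) - (u - w) := by
    rw [map_sub]; abel
  rw [e]
  have h3 := norm_dilationSemigroup_apply_le hk t (u - w)
  have h4 := norm_sub_le (dilationSemigroup hk t (u - w) + (dilationSemigroup hk t w - w)) (u - w)
  have h5 := norm_add_le (dilationSemigroup hk t (u - w)) (dilationSemigroup hk t w - w)
  linarith

theorem tendsto_exp_max_sub_one :
    Tendsto (fun t : ℝ => Real.exp (max t 0) - 1) (𝓝[>] 0) (𝓝 0) := by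
  have h : Continuous fun t : ℝ => Real.exp (max t 0) - 1 := by fun_prop
  have := h.tendsto 0
  simp only [max_self, Real.exp_zero, sub_self] at this
  exact tendsto_nhdsWithin_of_tendsto_nhds this

theorem tendsto_inv_mul_exp_max_sub_one :
    Tendsto (fun t : ℝ => t⁻¹ * (Real.exp (max t 0) - 1)) (𝓝[>] 0) (𝓝 1) := by
  have := (Real.hasDerivAt_exp 0).tendsto_slope_zero_right
  simp only [zero_add, Real.exp_zero, smul_eq_mul] at this
  refine this.congr' ?_
  filter_upwards [self_mem_nhdsWithin] with t ht
  have ht : (0 : ℝ) < t := ht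
  rw [max_eq_left ht.le]

theorem gapSemigroup_apply {k : ℝ} (hk : 0 ≤ k) (t : ℝ) (u : L1k k) :
    gapSemigroup hk t u = dilationSemigroup hk t u
      + (2 * (Real.exp (max t 0) - 1)) • expCLM hk one_pos (dilationSemigroup hk t u)
      + (Real.exp (max t 0) - 1) ^ 2 • gammaCLM hk (dilationSemigroup hk t u) := by
  have : (1 + (Real.exp (max t 0) - 1) • expCLM hk one_pos) ^ 2
      = 1 + (2 * (Real.exp (max t 0) - 1)) • expCLM hk one_pos
        + (Real.exp (max t 0) - 1) ^ 2 • gammaCLM hk := by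
    rw [← expCLM_one_mul_self, sq, mul_add, add_mul, add_mul, smul_mul_smul_comm]
    simp only [one_mul, mul_one]
    module
  rw [gapSemigroup, this]
  rfl

theorem isC0Semigroup_gapSemigroup {k : ℝ} (hk : 0 ≤ k) : IsC0Semigroup (gapSemigroup hk) where
  zero := gapSemigroup_zero hk
  add s t hs ht := gapSemigroup_add hk hs ht
  tendsto u := by
    have h1 := tendsto_dilationSemigroup hk u
    have h2 := tendsto_exp_max_sub_one
    have h3 := ((h2.const_mul 2).smul (((expCLM hk one_pos).continuous.tendsto u).comp h1))
    have h4 := ((h2.pow 2).smul (((gammaCLM hk).continuous.tendsto u).comp h1))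
    have := (h1.add h3).add h4
    simp only [mul_zero, zero_smul, add_zero, ne_eq, OfNat.ofNat_ne_zero, not_false_eq_true,
      zero_pow] at this
    refine this.congr fun t => ?_
    rw [gapSemigroup_apply]
    rfl

/-- The two semigroups differ to first order by the bounded operator `2 P`, applied to any `u`, so
their generators have the same domain. -/
theorem tendsto_gap_sub_dilation {k : ℝ} (hk : 0 ≤ k) (u : L1k k) :
    Tendsto (fun t : ℝ => t⁻¹ • (gapSemigroup hk t u - dilationSemigroup hk t u)) (𝓝[>] 0)
      (𝓝 ((2 : ℝ) • expCLM hk one_pos u)) := by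
  have h1 := tendsto_dilationSemigroup hk u
  have h2 := tendsto_exp_max_sub_one
  have h5 := tendsto_inv_mul_exp_max_sub_one
  have h3 := ((h5.const_mul 2).smul (((expCLM hk one_pos).continuous.tendsto u).comp h1))
  have h4 := ((h5.mul h2).smul (((gammaCLM hk).continuous.tendsto u).comp h1))
  have := h3.add h4
  simp only [mul_zero, zero_smul, add_zero, mul_one] at this
  refine this.congr fun t => ?_
  rw [gapSemigroup_apply]
  simp only [Function.comp]
  module

theorem isGeneratorValue_gap {k : ℝ} (hk : 0 ≤ k) {u v : L1k k}
    (h : IsGeneratorValue (dilationSemigroup hk) u v) :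
    IsGeneratorValue (gapSemigroup hk) u (v + (2 : ℝ) • expCLM hk one_pos u) := by
  refine (Tendsto.add h (tendsto_gap_sub_dilation hk u)).congr fun t => ?_
  module

theorem isGeneratorValue_dilation {k : ℝ} (hk : 0 ≤ k) {u v : L1k k}
    (h : IsGeneratorValue (gapSemigroup hk) u v) :
    IsGeneratorValue (dilationSemigroup hk) u (v - (2 : ℝ) • expCLM hk one_pos u) := by
  refine (Tendsto.sub h (tendsto_gap_sub_dilation hk u)).congr fun t => ?_
  module

/-! ### A core for the generator of the dilation semigroup -/

/-- A primitive of `φ(y) / y`. -/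
def divPrimitive (φ : ℝ → ℝ) (x : ℝ) : ℝ := ∫ y in (0 : ℝ)..x, φ y / y

theorem IsTestFunction.contDiff_div {φ : ℝ → ℝ} (h : IsTestFunction φ) :
    ContDiff ℝ ∞ fun y => φ y / y := by
  obtain ⟨α, β, hα, hαβ, h0⟩ := h.exists_Icc
  refine contDiff_iff_contDiffAt.2 fun x => ?_
  rcases lt_or_ge x α with hx | hx
  · have : (fun y => φ y / y) =ᶠ[𝓝 x] fun _ => 0 := by
      filter_upwards [Iio_mem_nhds hx] with y hy
      rw [h0 y (Or.inl hy), zero_div]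
    exact contDiffAt_const.congr_of_eventuallyEq this
  · exact h.smooth.contDiffAt.div contDiffAt_id (hα.trans_le hx).ne'

theorem IsTestFunction.hasDerivAt_divPrimitive {φ : ℝ → ℝ} (h : IsTestFunction φ) (x : ℝ) :
    HasDerivAt (divPrimitive φ) (φ x / x) x :=
  hasDerivAt_integral_continuous h.contDiff_div.continuous x

theorem IsTestFunction.contDiff_divPrimitive {φ : ℝ → ℝ} (h : IsTestFunction φ) :
    ContDiff ℝ ∞ (divPrimitive φ) := by
  refine contDiff_infty_iff_deriv.2 ⟨fun x => (h.hasDerivAt_divPrimitive x).differentiableAt, ?_⟩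
  rw [show deriv (divPrimitive φ) = fun y => φ y / y from
    funext fun x => (h.hasDerivAt_divPrimitive x).deriv]
  exact h.contDiff_div

/-- The mean `t⁻¹ ∫₀ᵗ φ(e^τ x) dτ`. -/
def dilationMean (φ : ℝ → ℝ) (t x : ℝ) : ℝ :=
  t⁻¹ * (divPrimitive φ (Real.exp t * x) - divPrimitive φ x)

theorem IsTestFunction.dilationMean {φ : ℝ → ℝ} (h : IsTestFunction φ) {t : ℝ} (ht : 0 < t) :
    IsTestFunction (dilationMean φ t) := by
  obtain ⟨α, β, hα, hαβ, h0⟩ := h.exists_Icc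
  have hint : ∀ a b : ℝ, IntervalIntegrable (fun y => φ y / y) volume a b := fun a b =>
    h.contDiff_div.continuous.intervalIntegrable _ _
  have h1 : ∀ x, x < α → divPrimitive φ x = 0 := by
    intro x hx
    refine intervalIntegral.integral_zero_ae (ae_of_all _ fun y hy => ?_)
    have : y < α := by
      rcases le_total 0 x with hx0 | hx0
      · rw [uIoc_of_le hx0] at hy; exact hy.2.trans_lt hx
      · rw [uIoc_of_ge hx0] at hy; exact hy.2.trans_lt hα
    rw [h0 y (Or.inl this), zero_div]
  have h2 : ∀ x z, β < x → x ≤ z → divPrimitive φ z - divPrimitive φ x = 0 := by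
    intro x z hx hxz
    unfold divPrimitive
    rw [intervalIntegral.integral_interval_sub_left (hint _ _) (hint _ _)]
    refine intervalIntegral.integral_zero_ae (ae_of_all _ fun y hy => ?_)
    rw [uIoc_of_le hxz] at hy
    rw [h0 y (Or.inr (hx.trans hy.1)), zero_div]
  -- The mean uses dilations with `1 ≤ e^τ ≤ e^t`, so the support stretches towards `0` by at most
  -- the factor `e^{-t}` and stays away from `0`.
  have hsupp : Function.support (_root_.dilationMean φ t) ⊆ Icc (Real.exp (-t) * α) β := by
    intro x hx
    rw [Function.mem_support] at hx
    by_contra hn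
    rw [mem_Icc, not_and_or, not_le, not_le] at hn
    refine hx ?_
    unfold _root_.dilationMean
    rcases hn with hn | hn
    · have h3 : Real.exp t * x < α := by
        have := mul_lt_mul_of_pos_left hn (Real.exp_pos t)
        rwa [← mul_assoc, ← Real.exp_add, add_neg_cancel, Real.exp_zero, one_mul] at this
      have h4 : x < α := by
        refine hn.trans_le ?_
        have : Real.exp (-t) ≤ 1 := Real.exp_le_one_iff.2 (by linarith)
        nlinarith
      rw [h1 _ h3, h1 _ h4, sub_zero, mul_zero]
    · rw [h2 x _ hn, mul_zero]
      have := Real.one_le_exp ht.le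
      nlinarith
  refine ⟨?_, HasCompactSupport.of_support_subset_isCompact isCompact_Icc hsupp, ?_⟩
  · exact contDiff_const.mul ((h.contDiff_divPrimitive.comp (contDiff_const.mul contDiff_id)).sub
      h.contDiff_divPrimitive)
  · refine (closure_minimal hsupp isClosed_Icc).trans fun x hx => ?_
    exact lt_of_lt_of_le (by positivity) hx.1

/-- The purpose of the mean: applying the generator `x d/dx` to it gives exactly a difference
quotient of the dilations. -/
theorem IsTestFunction.id_mul_deriv_dilationMean {φ : ℝ → ℝ} (h : IsTestFunction φ) (t x : ℝ) :
    x * deriv (_root_.dilationMean φ t) x = t⁻¹ * (dilate (Real.exp t) φ x - φ x) := by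
  have h1 : HasDerivAt (fun x => divPrimitive φ (Real.exp t * x))
      (φ (Real.exp t * x) / (Real.exp t * x) * Real.exp t) x := by
    have := (h.hasDerivAt_divPrimitive (Real.exp t * x)).comp x ((hasDerivAt_id x).const_mul _)
    simpa using! this
  have h2 := ((h1.sub (h.hasDerivAt_divPrimitive x)).const_mul t⁻¹).deriv
  have h3 : deriv (_root_.dilationMean φ t) x
      = t⁻¹ * (φ (Real.exp t * x) / (Real.exp t * x) * Real.exp t - φ x / x) := h2
  rw [h3]
  simp only [dilate]
  rcases eq_or_ne x 0 with rfl | hx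
  · simp
  · field_simp

theorem IsTestFunction.dilationMean_eq {φ : ℝ → ℝ} (h : IsTestFunction φ) (t : ℝ) {x : ℝ}
    (hx : 0 < x) : _root_.dilationMean φ t x = t⁻¹ * ∫ τ in (0 : ℝ)..t, dilate (Real.exp τ) φ x := by
  have hc := h.continuous
  have h1 : ∀ τ, HasDerivAt (fun τ => divPrimitive φ (Real.exp τ * x))
      (dilate (Real.exp τ) φ x) τ := by
    intro τ
    have := (h.hasDerivAt_divPrimitive (Real.exp τ * x)).comp τ ((Real.hasDerivAt_exp τ).mul_const x)
    convert! this using 1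
    simp only [dilate]
    have := Real.exp_pos τ
    field_simp
  rw [intervalIntegral.integral_eq_sub_of_hasDerivAt (fun τ _ => h1 τ)]
  · simp [_root_.dilationMean]
  · refine Continuous.intervalIntegrable ?_ _ _
    unfold dilate
    fun_prop

theorem normL1k_dilationMean_sub_le {k : ℝ} {φ : ℝ → ℝ} (h : IsTestFunction φ)
    {t : ℝ} (ht : 0 < t) {c : ℝ≥0∞}
    (hb : ∀ τ, 0 < τ → τ ≤ t → normL1k k (fun x => dilate (Real.exp τ) φ x - φ x) ≤ c) :
    normL1k k (fun x => dilationMean φ t x - φ x) ≤ c := by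
  have hc := h.continuous
  have hcont : Continuous (Function.uncurry fun x τ => dilate (Real.exp τ) φ x - φ x) := by
    unfold dilate Function.uncurry
    fun_prop
  have h1 : ∀ x ∈ Ioi (0 : ℝ), ‖dilationMean φ t x - φ x‖ₑ * weight k x
      ≤ ENNReal.ofReal t⁻¹ * ∫⁻ τ in Ioc 0 t, ‖dilate (Real.exp τ) φ x - φ x‖ₑ * weight k x := by
    intro x hx
    have hcx : Continuous fun τ => dilate (Real.exp τ) φ x := by unfold dilate; fun_prop
    have e : dilationMean φ t x - φ x
        = t⁻¹ * ∫ τ in Ioc 0 t, (dilate (Real.exp τ) φ x - φ x) := by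
      rw [h.dilationMean_eq t hx, ← intervalIntegral.integral_of_le ht.le,
        intervalIntegral.integral_sub (hcx.intervalIntegrable _ _) (by simp),
        intervalIntegral.integral_const]
      simp only [sub_zero, smul_eq_mul]
      field_simp
    rw [e, enorm_mul, lintegral_mul_const' _ _ (weight_ne_top k x), ← mul_assoc,
      Real.enorm_of_nonneg (by positivity)]
    gcongr
    exact enorm_integral_le_lintegral_enorm _
  calc normL1k k (fun x => dilationMean φ t x - φ x)
      = ∫⁻ x in Ioi 0, ‖dilationMean φ t x - φ x‖ₑ * weight k x := normL1k_eq _ _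
    _ ≤ ∫⁻ x in Ioi 0, ENNReal.ofReal t⁻¹ *
        ∫⁻ τ in Ioc 0 t, ‖dilate (Real.exp τ) φ x - φ x‖ₑ * weight k x :=
        setLIntegral_mono' measurableSet_Ioi h1
    _ = ENNReal.ofReal t⁻¹ * ∫⁻ x in Ioi 0,
        ∫⁻ τ in Ioc 0 t, ‖dilate (Real.exp τ) φ x - φ x‖ₑ * weight k x :=
        lintegral_const_mul' _ _ ENNReal.ofReal_ne_top
    _ = ENNReal.ofReal t⁻¹ * ∫⁻ τ in Ioc 0 t,
        ∫⁻ x in Ioi 0, ‖dilate (Real.exp τ) φ x - φ x‖ₑ * weight k x := by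
        rw [lintegral_lintegral_swap]
        exact (hcont.measurable.enorm.mul
          ((measurable_weight k).comp measurable_fst)).aemeasurable
    _ ≤ ENNReal.ofReal t⁻¹ * ∫⁻ _ in Ioc 0 t, c := by
        gcongr ENNReal.ofReal t⁻¹ * ?_
        refine setLIntegral_mono' measurableSet_Ioc fun τ hτ => ?_
        rw [← normL1k_eq]
        exact hb τ hτ.1 hτ.2
    _ = c := by
        rw [setLIntegral_const, Real.volume_Ioc, sub_zero, mul_comm c, ← mul_assoc,
          ← ENNReal.ofReal_mul (by positivity), inv_mul_cancel₀ ht.ne', ENNReal.ofReal_one, one_mul]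

/-- Choose `t` so small that `D_τ u` is close to `u` for `0 < τ ≤ t` and the quotient `t⁻¹ (D_t u -
u)` is close to `v`. Approximate `u` by a test function `φ` and take the dilation mean of `φ`: it is
a test function near `u`, and its generator value is the quotient of `φ`. -/
theorem dilation_core {k : ℝ} (hk : 0 ≤ k) {u v : L1k k}
    (h : IsGeneratorValue (dilationSemigroup hk) u v) {δ : ℝ} (hδ : 0 < δ) :
    ∃ (ψ : ℝ → ℝ) (hψ : IsTestFunction ψ), ‖u - (hψ.memL1k hk).toL1k‖ ≤ δ ∧
      ‖v - (hψ.id_mul_deriv.memL1k hk).toL1k‖ ≤ δ := by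
  have hδ4 : 0 < δ / 4 := by positivity
  have h1 := Metric.tendsto_nhds.1 h (δ / 4) hδ4
  have h2 := Metric.tendsto_nhds.1 (tendsto_dilationSemigroup hk u) (δ / 4) hδ4
  obtain ⟨t₁, ht₁, h1'⟩ := mem_nhdsGT_iff_exists_Ioc_subset.1 h1
  obtain ⟨t₂, ht₂, h2'⟩ := mem_nhdsGT_iff_exists_Ioc_subset.1 h2
  have ht₁ : 0 < t₁ := ht₁
  have ht₂ : 0 < t₂ := ht₂
  set t := min t₁ t₂ with ht_def
  have ht : 0 < t := lt_min ht₁ ht₂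
  -- The accuracy `t * (δ / 4)` compensates the division by `t` in the difference quotient.
  obtain ⟨φ, hφ, h3⟩ := L1k.exists_testFunction_near hk u
    (lt_min hδ4 (mul_pos ht hδ4) : 0 < min (δ / 4) (t * (δ / 4)))
  set w := (hφ.memL1k hk).toL1k with hw
  have h3a : ‖u - w‖ ≤ δ / 4 := h3.trans (min_le_left _ _)
  have h3b : ‖u - w‖ ≤ t * (δ / 4) := h3.trans (min_le_right _ _)
  have hψ := hφ.dilationMean ht
  refine ⟨_, hψ, ?_, ?_⟩
  · have hb : ∀ τ, 0 < τ → τ ≤ t →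
        normL1k k (fun x => dilate (Real.exp τ) φ x - φ x) ≤ ENNReal.ofReal (3 * (δ / 4)) := by
      intro τ hτ hτt
      have e : normL1k k (fun x => dilate (Real.exp τ) φ x - φ x)
          = ENNReal.ofReal ‖dilationSemigroup hk τ w - w‖ := by
        rw [← L1k.normL1k_eq_ofReal]
        refine normL1k_congr ?_
        filter_upwards [L1k.coeFn_sub' (dilationSemigroup hk τ w) w,
          (hφ.memL1k hk).coeFn_toL1k,
          dilationSemigroup_coeFn hk hτ.le (hφ.memL1k hk).coeFn_toL1k] with x g1 g2 g3
        rw [g1, g3, g2]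
      rw [e]
      refine ENNReal.ofReal_le_ofReal ?_
      have h4 : dist (dilationSemigroup hk τ u) u < δ / 4 :=
        h2' ⟨hτ, hτt.trans (min_le_right _ _)⟩
      rw [dist_eq_norm] at h4
      have e : dilationSemigroup hk τ w - w
          = -dilationSemigroup hk τ (u - w) + (dilationSemigroup hk τ u - u) + (u - w) := by
        rw [map_sub]; abel
      rw [e]
      have g1 := norm_dilationSemigroup_apply_le hk τ (u - w)
      refine (norm_add₃_le).trans ?_
      rw [norm_neg]
      linarith
    have h5 := normL1k_dilationMean_sub_le hφ ht hb
    have h6 : ‖w - (hψ.memL1k hk).toL1k‖ ≤ 3 * (δ / 4) := by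
      rw [← norm_neg, neg_sub]
      refine L1k.norm_le_of_normL1k_le (by positivity) ?_
      refine le_trans (le_of_eq (normL1k_congr ?_)) h5
      filter_upwards [L1k.coeFn_sub' (hψ.memL1k hk).toL1k w, (hφ.memL1k hk).coeFn_toL1k,
        (hψ.memL1k hk).coeFn_toL1k] with x g1 g2 g3
      rw [g1, g2, g3]
    calc ‖u - (hψ.memL1k hk).toL1k‖ = ‖(u - w) + (w - (hψ.memL1k hk).toL1k)‖ := by
          rw [sub_add_sub_cancel]
      _ ≤ ‖u - w‖ + ‖w - (hψ.memL1k hk).toL1k‖ := norm_add_le _ _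
      _ ≤ δ := by linarith
  · have e : (hψ.id_mul_deriv.memL1k hk).toL1k = t⁻¹ • (dilationSemigroup hk t w - w) := by
      refine L1k.ext_pos ?_
      filter_upwards [(hψ.id_mul_deriv.memL1k hk).coeFn_toL1k,
        L1k.coeFn_smul' t⁻¹ (dilationSemigroup hk t w - w),
        L1k.coeFn_sub' (dilationSemigroup hk t w) w, (hφ.memL1k hk).coeFn_toL1k,
        dilationSemigroup_coeFn hk ht.le (hφ.memL1k hk).coeFn_toL1k] with x g1 g2 g3 g4 g5
      rw [g1, g2, g3, g5, g4, hφ.id_mul_deriv_dilationMean]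
    rw [e]
    have h4 : dist (t⁻¹ • (dilationSemigroup hk t u - u)) v < δ / 4 :=
      h1' ⟨ht, min_le_left _ _⟩
    rw [dist_comm, dist_eq_norm] at h4
    have e2 : v - t⁻¹ • (dilationSemigroup hk t w - w)
        = (v - t⁻¹ • (dilationSemigroup hk t u - u))
          + t⁻¹ • (dilationSemigroup hk t (u - w) - (u - w)) := by
      rw [map_sub]; module
    rw [e2]
    refine (norm_add_le _ _).trans ?_
    have g1 : ‖t⁻¹ • (dilationSemigroup hk t (u - w) - (u - w))‖ ≤ 2 * (δ / 4) := by
      rw [norm_smul, Real.norm_of_nonneg (by positivity)]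
      have g2 := norm_sub_le (dilationSemigroup hk t (u - w)) (u - w)
      have g3 := norm_dilationSemigroup_apply_le hk t (u - w)
      rw [inv_mul_le_iff₀ ht]
      linarith
    linarith

/-! ### Identification of `L₀` with the generator of the closed-form semigroup. -/

theorem coag_kernelZero {h : ℝ → ℝ} (hh : Integrable h posMeasure) {x : ℝ} (hx : 0 < x) :
    coag kernelZero profileZero h x = expOp 1 h x - h x := by
  have h1 := kernelOp_shift_sub (φ := expDensity 1) hh hx (integrableOn_continuous_mul
    (by unfold expDensity; fun_prop) hh x)
  have h2 : expOp 1 h x = kernelOp (fun x y => shift (expDensity 1) x y - expDensity 1 x) h x := rfl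
  have e1 : ∫ y in (0 : ℝ)..x, kernelZero (x - y) y * profileZero (x - y) * h y
      = 2 * ∫ y in (0 : ℝ)..x, expDensity 1 (x - y) * h y := by
    rw [← intervalIntegral.integral_const_mul]
    refine intervalIntegral.integral_congr fun y _ => ?_
    simp [kernelZero, profileZero, expDensity]
    ring
  have e2 : ∫ y in Ioi (0 : ℝ), kernelZero x y * h y = 2 * ∫ y in Ioi (0 : ℝ), h y := by
    simp only [kernelZero]
    rw [integral_const_mul]
  have e3 : ∫ y in Ioi (0 : ℝ), kernelZero x y * profileZero y = 2 := by
    simp only [kernelZero, profileZero]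
    rw [integral_const_mul, integral_exp_neg_Ioi_zero, mul_one]
  rw [h2, h1, coag, e1, e2, e3]
  simp only [profileZero, expDensity, one_mul]
  ring

/-- The loss term containing `∫ G₀ = 1` contributes `-2 h`, which cancels the `2 h` of the scaling
part. -/
theorem linearised_kernelZero {h : ℝ → ℝ} (hh : Integrable h posMeasure) :
    linearised kernelZero profileZero h =ᵐ[posMeasure] fun x => x * deriv h x + 2 * expOp 1 h x := by
  filter_upwards [ae_pos] with x hx
  rw [linearised, coag_kernelZero hh hx]
  ring

theorem coeFn_add_two_expCLM {k : ℝ} (hk : 0 ≤ k) {φ : ℝ → ℝ} (hφ : IsTestFunction φ) :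
    ((hφ.id_mul_deriv.memL1k hk).toL1k + (2 : ℝ) • expCLM hk one_pos (hφ.memL1k hk).toL1k : L1k k)
      =ᵐ[posMeasure] linearised kernelZero profileZero φ := by
  filter_upwards [L1k.coeFn_add' (hφ.id_mul_deriv.memL1k hk).toL1k
      ((2 : ℝ) • expCLM hk one_pos (hφ.memL1k hk).toL1k),
    L1k.coeFn_smul' 2 (expCLM hk one_pos (hφ.memL1k hk).toL1k),
    (isL1kOperator_expOp hk one_pos).coeFn_toCLM_of_ae (hφ.memL1k hk).coeFn_toL1k,
    (hφ.id_mul_deriv.memL1k hk).coeFn_toL1k,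
    linearised_kernelZero ((hφ.memL1k hk).integrable hk)] with x h1 h2 h3 h4 h5
  rw [h1, h2, h4, h5, expCLM, h3]

/-- A core for the dilation generator stays a core after adding the bounded operator `2 P`, because
the graph norms are equivalent. -/
theorem isLinearisedSemigroup_gapSemigroup {k : ℝ} (hk : 0 ≤ k) :
    IsLinearisedSemigroup k kernelZero profileZero (gapSemigroup hk) where
  semigroup := isC0Semigroup_gapSemigroup hk
  generator_eq φ hφ := ⟨(hφ.memL1k hk).toL1k, _,
    aeEq_weighted_iff.2 (hφ.memL1k hk).coeFn_toL1k,
    aeEq_weighted_iff.2 (coeFn_add_two_expCLM hk hφ),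
    isGeneratorValue_gap hk (isGeneratorValue_dilation_testFunction hk hφ)⟩
  core u v h δ hδ := by
    set c := ‖expCLM hk one_pos‖ with hc
    have hc0 : 0 ≤ c := norm_nonneg _
    -- The two graph norm errors add up to at most `2 + 2 c` times this accuracy; the `3` leaves
    -- room for the strict inequality.
    obtain ⟨ψ, hψ, h1, h2⟩ := dilation_core hk (isGeneratorValue_dilation hk h)
      (by positivity : 0 < δ / (3 + 2 * c))
    refine ⟨ψ, hψ, (hψ.memL1k hk).toL1k, _,
      aeEq_weighted_iff.2 (hψ.memL1k hk).coeFn_toL1k,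
      aeEq_weighted_iff.2 (coeFn_add_two_expCLM hk hψ), ?_⟩
    have e : v - ((hψ.id_mul_deriv.memL1k hk).toL1k
          + (2 : ℝ) • expCLM hk one_pos (hψ.memL1k hk).toL1k)
        = (v - (2 : ℝ) • expCLM hk one_pos u - (hψ.id_mul_deriv.memL1k hk).toL1k)
          + (2 : ℝ) • expCLM hk one_pos (u - (hψ.memL1k hk).toL1k) := by
      rw [map_sub]; module
    have h3 : ‖(2 : ℝ) • expCLM hk one_pos (u - (hψ.memL1k hk).toL1k)‖
        ≤ 2 * c * (δ / (3 + 2 * c)) := by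
      rw [norm_smul, Real.norm_of_nonneg zero_le_two, mul_assoc]
      gcongr
      exact ((expCLM hk one_pos).le_opNorm _).trans (by gcongr)
    rw [e]
    have h4 := norm_add_le (v - (2 : ℝ) • expCLM hk one_pos u
      - (hψ.id_mul_deriv.memL1k hk).toL1k)
      ((2 : ℝ) • expCLM hk one_pos (u - (hψ.memL1k hk).toL1k))
    have h5 : δ / (3 + 2 * c) * (3 + 2 * c) = δ := by field_simp
    have h6 : 0 < δ / (3 + 2 * c) := by positivity
    nlinarith

/-! ### Exponential decay -/

/-- Columns of the kernels have a jump or kink at `x = y`. To the left a supremum bound times the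
length `y` is used, to the right comparison with a translate. -/
theorem normL1k_le_of_shift_bound {k : ℝ} (hk : 0 ≤ k) {p φ : ℝ → ℝ} {a c y : ℝ} (ha : 0 ≤ a)
    (hc : 0 ≤ c) (hy : 0 < y) (h1 : ∀ x, 0 < x → x ≤ y → |p x| ≤ a)
    (h2 : ∀ x, y < x → |p x| ≤ c * |φ (x - y)|) :
    normL1k k p ≤ (ENNReal.ofReal (a * y) + ENNReal.ofReal c * normL1k k φ) * weight k y := by
  have hpt : ∀ x ∈ Ioi (0 : ℝ), ‖p x‖ₑ * weight k x
      ≤ (Ioc 0 y).indicator (fun _ => ENNReal.ofReal a * weight k y) x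
        + ENNReal.ofReal c * (‖shift φ x y‖ₑ * weight k x) := by
    intro x hx
    have hx : 0 < x := hx
    by_cases hxy : x ≤ y
    · rw [indicator_of_mem (show x ∈ Ioc 0 y from ⟨hx, hxy⟩)]
      refine le_add_of_le_left (mul_le_mul' ?_ (weight_le_of_le hk hx hxy))
      rw [Real.enorm_eq_ofReal_abs]
      exact ENNReal.ofReal_le_ofReal (h1 x hx hxy)
    · rw [indicator_of_notMem (fun h : x ∈ Ioc 0 y => hxy h.2), zero_add, ← mul_assoc]
      refine mul_le_mul' ?_ le_rfl
      rw [not_le] at hxy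
      rw [shift, if_pos hxy, Real.enorm_eq_ofReal_abs, Real.enorm_eq_ofReal_abs,
        ← ENNReal.ofReal_mul hc]
      exact ENNReal.ofReal_le_ofReal (h2 x hxy)
  calc normL1k k p = ∫⁻ x in Ioi 0, ‖p x‖ₑ * weight k x := normL1k_eq _ _
    _ ≤ ∫⁻ x in Ioi 0, ((Ioc 0 y).indicator (fun _ => ENNReal.ofReal a * weight k y) x
        + ENNReal.ofReal c * (‖shift φ x y‖ₑ * weight k x)) :=
        setLIntegral_mono' measurableSet_Ioi hpt
    _ = (∫⁻ x in Ioi 0, (Ioc 0 y).indicator (fun _ => ENNReal.ofReal a * weight k y) x)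
        + ENNReal.ofReal c * normL1k k (fun x => shift φ x y) := by
        rw [lintegral_add_left (measurable_const.indicator measurableSet_Ioc),
          lintegral_const_mul' _ _ ENNReal.ofReal_ne_top, normL1k_eq]
    _ ≤ ENNReal.ofReal a * weight k y * ENNReal.ofReal y
        + ENNReal.ofReal c * (normL1k k φ * weight k y) := by
        gcongr
        · refine (setLIntegral_le_lintegral _ _).trans ?_
          rw [lintegral_indicator measurableSet_Ioc, setLIntegral_const, Real.volume_Ioc, sub_zero]
        · exact normL1k_shift_le hk φ hy
    _ = _ := by rw [ENNReal.ofReal_mul ha]; ring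

theorem weight_eq_mul (k : ℝ) {y : ℝ} (hy : 0 < y) :
    weight k y = ENNReal.ofReal (1 + y) * weight (k - 1) y := by
  unfold weight
  rw [← ENNReal.ofReal_mul (by positivity)]
  congr 1
  rw [Real.rpow_sub (by linarith), Real.rpow_one]
  field_simp

/-- First order estimate in `y`. For `y ≤ 1` the column is `-E(x)` on an interval of length `y` and
`(1 - e^{-y}) E(x - y)` beyond it. For `y ≥ 1` the triangle inequality suffices, since `1 + y ≤ 2 y`
trades one power of the weight for a factor `y`. -/
theorem exists_normL1k_expKernel_le {k : ℝ} (hk : 1 ≤ k) :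
    ∃ C : ℝ, 0 ≤ C ∧ ∀ y, 0 < y →
      normL1k k (fun x => expKernel 1 x y) ≤ ENNReal.ofReal (C * y ^ 1) * weight (k - 1) y := by
  have hk0 : 0 ≤ k := by linarith
  set A := (normL1k k (expDensity 1)).toReal with hA
  have hA' : normL1k k (expDensity 1) = ENNReal.ofReal A :=
    (ENNReal.ofReal_toReal (memL1k_expDensity k one_pos).lt_top.ne).symm
  have hA0 : 0 ≤ A := ENNReal.toReal_nonneg
  refine ⟨2 + 4 * A, by positivity, fun y hy => ?_⟩
  rcases le_total y 1 with hy1 | hy1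
  · have h := normL1k_le_of_shift_bound hk0 (p := fun x => expKernel 1 x y)
      (φ := expDensity 1) (a := 1) (c := y) zero_le_one hy.le hy ?_ ?_
    · refine h.trans ?_
      rw [hA', one_mul, ← ENNReal.ofReal_mul hy.le, ← ENNReal.ofReal_add hy.le (by positivity),
        weight_eq_mul k hy, ← mul_assoc, ← ENNReal.ofReal_mul (by positivity)]
      refine mul_le_mul' (ENNReal.ofReal_le_ofReal ?_) le_rfl
      nlinarith [mul_nonneg hy.le hA0, mul_nonneg (mul_nonneg hy.le hA0) (sub_nonneg.2 hy1)]
    · intro x hx hxy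
      rw [expKernel, shift, if_neg (not_lt.2 hxy), zero_sub, abs_neg, expDensity, one_mul, one_mul,
        Real.abs_exp]
      exact Real.exp_le_one_iff.2 (by linarith)
    · intro x hxy
      have e : expKernel 1 x y = Real.exp (-(x - y)) * (1 - Real.exp (-y)) := by
        rw [expKernel, shift, if_pos hxy]
        simp only [expDensity, one_mul]
        rw [mul_sub, mul_one, ← Real.exp_add]
        ring_nf
      have h1 : Real.exp (-y) ≤ 1 := Real.exp_le_one_iff.2 (by linarith)
      have h2 := Real.add_one_le_exp (-y)
      rw [e, expDensity, one_mul, one_mul, Real.abs_exp, abs_mul, Real.abs_exp,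
        abs_of_nonneg (by linarith), mul_comm]
      gcongr
      linarith
  · refine (normL1k_shift_sub_le hk0 (measurable_expDensity 1)
      (memL1k_expDensity k one_pos) hy).trans ?_
    rw [weight_eq_mul k hy, ← mul_assoc, ← ENNReal.ofReal_mul (by positivity)]
    refine mul_le_mul' (ENNReal.ofReal_le_ofReal ?_) le_rfl
    nlinarith [mul_nonneg hA0 (sub_nonneg.2 hy1)]

/-- The derivative of `x e^{-x}`. -/
def gammaDeriv (x : ℝ) : ℝ := (1 - x) * Real.exp (-x)

theorem measurable_gammaDeriv : Measurable gammaDeriv := by unfold gammaDeriv; fun_prop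

theorem memL1k_gammaDeriv (k : ℝ) : MemL1k k gammaDeriv := by
  have := (memL1k_pow_mul_exp k 0 one_pos).sub (memL1k_pow_mul_exp k 1 one_pos)
  refine (memL1k_congr (ae_of_all _ fun x => ?_)).2 this
  simp only [gammaDeriv]
  ring_nf

/-- Second order Taylor estimate: `F(x - y) - F(x) + y F'(x)` for `F(x) = x e^{-x}`. Since `F(0) =
0`, it is `O(y)` on the interval `(0, y]`, which contributes `O(y²)`. For `y ≥ 1` two powers of the
weight are traded for `y²`. -/
theorem exists_normL1k_gammaKernel_le {k : ℝ} (hk : 2 ≤ k) :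
    ∃ C : ℝ, 0 ≤ C ∧ ∀ y, 0 < y →
      normL1k k (fun x => gammaKernel x y + gammaDeriv x * y)
        ≤ ENNReal.ofReal (C * y ^ 2) * weight (k - 2) y := by
  have hk0 : 0 ≤ k := by linarith
  have hφm : MemL1k k (fun x => (1 + x) * Real.exp (-x)) := by
    have := (memL1k_pow_mul_exp k 0 one_pos).add (memL1k_pow_mul_exp k 1 one_pos)
    refine (memL1k_congr (ae_of_all _ fun x => ?_)).2 this
    ring_nf
  set A := (normL1k k (fun x => (1 + x) * Real.exp (-x))).toReal
  have hA' : normL1k k (fun x => (1 + x) * Real.exp (-x)) = ENNReal.ofReal A :=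
    (ENNReal.ofReal_toReal hφm.lt_top.ne).symm
  have hA0 : 0 ≤ A := ENNReal.toReal_nonneg
  set B := (normL1k k gammaDensity).toReal
  have hB0 : 0 ≤ B := ENNReal.toReal_nonneg
  set D := (normL1k k gammaDeriv).toReal
  have hD' : normL1k k gammaDeriv = ENNReal.ofReal D :=
    (ENNReal.ofReal_toReal (memL1k_gammaDeriv k).lt_top.ne).symm
  have hD0 : 0 ≤ D := ENNReal.toReal_nonneg
  refine ⟨8 + 4 * A + 8 * B + 4 * D, by positivity, fun y hy => ?_⟩
  have hw : weight k y = ENNReal.ofReal ((1 + y) ^ 2) * weight (k - 2) y := by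
    rw [weight_eq_mul k hy, weight_eq_mul (k - 1) hy, ← mul_assoc,
      ← ENNReal.ofReal_mul (by positivity), sq, show k - 1 - 1 = k - 2 by ring]
  rcases le_total y 1 with hy1 | hy1
  · have h := normL1k_le_of_shift_bound hk0 (p := fun x => gammaKernel x y + gammaDeriv x * y)
      (φ := fun x => (1 + x) * Real.exp (-x)) (a := 2 * y) (c := y ^ 2) (by positivity)
      (by positivity) hy ?_ ?_
    · refine h.trans ?_
      rw [hA', ← ENNReal.ofReal_mul (by positivity), ← ENNReal.ofReal_add (by positivity)
        (by positivity), hw, ← mul_assoc, ← ENNReal.ofReal_mul (by positivity)]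
      refine mul_le_mul' (ENNReal.ofReal_le_ofReal ?_) le_rfl
      have h4 : (1 + y) ^ 2 ≤ 4 := by nlinarith
      calc (2 * y * y + y ^ 2 * A) * (1 + y) ^ 2 ≤ (2 * y * y + y ^ 2 * A) * 4 := by gcongr
        _ = (8 + 4 * A) * y ^ 2 := by ring
        _ ≤ _ := mul_le_mul_of_nonneg_right (by linarith) (by positivity)
    · intro x hx hxy
      have e1 : Real.exp (-x) ≤ 1 := Real.exp_le_one_iff.2 (by linarith)
      have e0 := Real.exp_pos (-x)
      rw [gammaKernel, shift, if_neg (not_lt.2 hxy), zero_sub, gammaDensity, gammaDeriv]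
      rw [abs_le]
      have h1 : x * Real.exp (-x) ≤ y := by nlinarith
      have h1' : 0 ≤ x * Real.exp (-x) := by positivity
      have h2 : 0 ≤ (1 - x) * Real.exp (-x) := mul_nonneg (by linarith) e0.le
      have h3 : (1 - x) * Real.exp (-x) ≤ 1 := by nlinarith
      constructor <;> nlinarith
    · intro x hxy
      have e : gammaKernel x y + gammaDeriv x * y = Real.exp (-(x - y)) *
          ((x - y) * (1 - (1 + y) * Real.exp (-y)) - y ^ 2 * Real.exp (-y)) := by
        rw [gammaKernel, shift, if_pos hxy]
        simp only [gammaDensity, gammaDeriv]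
        rw [show Real.exp (-x) = Real.exp (-(x - y)) * Real.exp (-y) by
          rw [← Real.exp_add]; ring_nf]
        ring
      have h1 : Real.exp (-y) ≤ 1 := Real.exp_le_one_iff.2 (by linarith)
      have h0 := Real.exp_pos (-y)
      have h2 := Real.add_one_le_exp (-y)
      have h3 : (1 + y) * Real.exp (-y) ≤ 1 := by
        have h4 := Real.add_one_le_exp y
        calc (1 + y) * Real.exp (-y) ≤ Real.exp y * Real.exp (-y) := by gcongr; linarith
          _ = 1 := by rw [← Real.exp_add, add_neg_cancel, Real.exp_zero]
      have h5 : 1 - (1 + y) * Real.exp (-y) ≤ y ^ 2 := by nlinarith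
      have hu : 0 < x - y := by linarith
      rw [e, abs_mul, Real.abs_exp, abs_mul, Real.abs_exp, abs_of_nonneg (by linarith : 0 ≤ 1 + (x - y)),
        mul_comm, ← mul_assoc]
      gcongr
      have h6 : (x - y) * (1 - (1 + y) * Real.exp (-y)) ≤ (x - y) * y ^ 2 := by gcongr
      have h7 : 0 ≤ (x - y) * (1 - (1 + y) * Real.exp (-y)) := mul_nonneg hu.le (by linarith)
      have h8 : y ^ 2 * Real.exp (-y) ≤ y ^ 2 := by nlinarith [sq_nonneg y]
      have h9 : 0 ≤ y ^ 2 * Real.exp (-y) := by positivity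
      rw [abs_le]
      constructor <;> nlinarith [mul_nonneg hu.le (sq_nonneg y)]
  · have h1 := normL1k_shift_sub_le hk0 measurable_gammaDensity (memL1k_gammaDensity k) hy
    have h2 : normL1k k (fun x => gammaDeriv x * y) ≤ ENNReal.ofReal D * weight k y := by
      have : (fun x => gammaDeriv x * y) = fun x => y * gammaDeriv x := by ext x; ring
      rw [this, normL1k_const_mul, abs_of_pos hy, hD', mul_comm]
      gcongr
      rw [weight_eq_mul k hy]
      calc ENNReal.ofReal y ≤ ENNReal.ofReal (1 + y) * 1 := by
            rw [mul_one]; exact ENNReal.ofReal_le_ofReal (by linarith)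
        _ ≤ _ := by gcongr; exact one_le_weight (by linarith) hy
    have hm1 : MemL1k k (fun x => gammaKernel x y) :=
      ((memL1k_gammaDensity k).shift hk0 measurable_gammaDensity hy).sub (memL1k_gammaDensity k)
    have hm2 : MemL1k k (fun x => gammaDeriv x * y) := by
      have := (memL1k_gammaDeriv k).const_mul y
      simpa only [mul_comm] using this
    refine ((normL1k_add_le hm1 hm2).trans (add_le_add h1 h2)).trans ?_
    rw [← add_mul, ← ENNReal.ofReal_add (by positivity) hD0, hw, ← mul_assoc,
      ← ENNReal.ofReal_mul (by positivity)]
    refine mul_le_mul' (ENNReal.ofReal_le_ofReal ?_) le_rfl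
    have h4 : (1 + y) ^ 2 ≤ 4 * y ^ 2 := by nlinarith
    calc (2 * B + D) * (1 + y) ^ 2 ≤ (2 * B + D) * (4 * y ^ 2) := by gcongr
      _ = (8 * B + 4 * D) * y ^ 2 := by ring
      _ ≤ _ := mul_le_mul_of_nonneg_right (by linarith) (by positivity)

/-- In the variable `z = c y` the factor `y ^ j` yields `c⁻¹ ^ j`, and `dy` yields one more `c⁻¹`.
-/
theorem lintegral_dilate_le {k C c : ℝ} (hC : 0 ≤ C) (hc : 1 ≤ c) {j : ℕ} (hj : (j : ℝ) ≤ k)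
    {N : ℝ → ℝ≥0∞} (h : ℝ → ℝ)
    (hN : ∀ y, 0 < y → N y ≤ ENNReal.ofReal (C * y ^ j) * weight (k - j) y) :
    ∫⁻ y in Ioi 0, N y * ‖dilate c h y‖ₑ ≤ ENNReal.ofReal (C * c⁻¹ ^ (j + 1)) * normL1k k h := by
  have hc0 : 0 < c := by linarith
  calc ∫⁻ y in Ioi 0, N y * ‖dilate c h y‖ₑ
      ≤ ∫⁻ y in Ioi 0, (fun z => ENNReal.ofReal (C * c⁻¹ ^ j) * (‖h z‖ₑ * weight k z)) (c * y) := by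
        refine setLIntegral_mono' measurableSet_Ioi fun y hy => ?_
        have hy : 0 < y := hy
        have hcy : 0 < c * y := by positivity
        simp only [dilate]
        rw [mul_comm ‖h (c * y)‖ₑ, ← mul_assoc]
        refine mul_le_mul' ((hN y hy).trans ?_) le_rfl
        unfold weight
        rw [← ENNReal.ofReal_mul (by positivity), ← ENNReal.ofReal_mul (by positivity)]
        refine ENNReal.ofReal_le_ofReal ?_
        have h1 : (1 + c * y) ^ k = (1 + c * y) ^ (k - j) * (1 + c * y) ^ j := by
          rw [← Real.rpow_natCast, ← Real.rpow_add (by positivity)]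
          congr 1; ring
        have h2 : y ^ j = c⁻¹ ^ j * (c * y) ^ j := by
          rw [← mul_pow, inv_mul_cancel_left₀ hc0.ne']
        rw [h1, h2]
        have h3 : (c * y) ^ j ≤ (1 + c * y) ^ j := by gcongr; linarith
        have h4 : (1 + y) ^ (k - j) ≤ (1 + c * y) ^ (k - j) :=
          Real.rpow_le_rpow (by linarith) (by nlinarith) (by linarith)
        calc C * (c⁻¹ ^ j * (c * y) ^ j) * (1 + y) ^ (k - j)
            ≤ C * (c⁻¹ ^ j * (1 + c * y) ^ j) * (1 + c * y) ^ (k - j) := by gcongr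
          _ = _ := by ring
    _ = _ := by
        rw [lintegral_comp_mul_pos hc0
          (fun z => ENNReal.ofReal (C * c⁻¹ ^ j) * (‖h z‖ₑ * weight k z)), lintegral_const_mul' _ _ ENNReal.ofReal_ne_top,
          ← normL1k_eq, ← mul_assoc, ← ENNReal.ofReal_mul (by positivity)]
        congr 2
        ring

/-- With `c = e^t`, the operators `D_t`, `P D_t` and `P² D_t` are of size `c⁻¹`, `c⁻²` and `c⁻³` on
functions of zero mass, which beats their coefficients `1`, `2(c - 1)` and `(c - 1)²` by a factor
`c⁻¹` each. -/
theorem exists_gap_bound {k : ℝ} (hk : 2 ≤ k) (hk0 : 0 ≤ k) :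
    ∃ C : ℝ, 0 < C ∧ ∀ h : L1k k, ∫ x in Ioi (0 : ℝ), x * h x = 0 → ∀ t : ℝ, 0 ≤ t →
      ‖gapSemigroup hk0 t h‖ ≤ C * Real.exp (-t) * ‖h‖ := by
  obtain ⟨C₁, hC₁, h1⟩ := exists_normL1k_expKernel_le (k := k) (by linarith)
  obtain ⟨C₂, hC₂, h2⟩ := exists_normL1k_gammaKernel_le hk
  refine ⟨1 + 2 * C₁ + C₂, by positivity, fun h hm t ht => ?_⟩
  set c := Real.exp t with hc
  have hc1 : 1 ≤ c := Real.one_le_exp ht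
  have hc0 : 0 < c := by linarith
  have hcinv : c⁻¹ = Real.exp (-t) := by rw [Real.exp_neg]
  have hD : dilationSemigroup hk0 t h =ᵐ[posMeasure] dilate c h :=
    dilationSemigroup_coeFn hk0 ht (EventuallyEq.refl _ _)
  have hdm : MemL1k k (dilate c h) := (isL1kOperator_dilate hk0 hc1).mem h h.memL1k
  have hhn : normL1k k h = ENNReal.ofReal ‖h‖ := L1k.normL1k_eq_ofReal h
  have b0 : ‖dilationSemigroup hk0 t h‖ ≤ c⁻¹ * ‖h‖ := by
    refine L1k.norm_le_of_normL1k_le (by positivity) ?_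
    rw [normL1k_congr hD, ENNReal.ofReal_mul (by positivity), ← hhn]
    exact normL1k_dilate_le hk0 hc1 h
  have b1 : ‖expCLM hk0 one_pos (dilationSemigroup hk0 t h)‖ ≤ C₁ * c⁻¹ ^ 2 * ‖h‖ := by
    refine L1k.norm_le_of_normL1k_le (by positivity) ?_
    rw [expCLM, normL1k_congr ((isL1kOperator_expOp hk0 one_pos).coeFn_toCLM_of_ae hD),
      ENNReal.ofReal_mul (by positivity), ← hhn]
    refine (normL1k_kernel_le (measurable_expKernel 1) hdm.aesm).trans ?_
    refine lintegral_dilate_le hC₁ hc1 (j := 1) (by simp; linarith) h fun y hy => ?_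
    simpa using h1 y hy
  have b2 : ‖gammaCLM hk0 (dilationSemigroup hk0 t h)‖ ≤ C₂ * c⁻¹ ^ 3 * ‖h‖ := by
    refine L1k.norm_le_of_normL1k_le (by positivity) ?_
    rw [gammaCLM, normL1k_congr ((isL1kOperator_gammaOp hk0).coeFn_toCLM_of_ae hD),
      ENNReal.ofReal_mul (by positivity), ← hhn]
    -- Zero mass survives the dilation, so `y F'(x)` can be added to the kernel of `P²` without
    -- changing the value.
    have hzero : ∫ y in Ioi (0 : ℝ), y * dilate c h y = 0 := by
      have := integral_comp_mul_left_Ioi (fun y => y * h y) 0 hc0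
      simp only [mul_zero, hm, smul_zero] at this
      have e : ∀ y, y * dilate c h y = c⁻¹ * (c * y * h (c * y)) := fun y => by
        simp only [dilate]; field_simp
      simp_rw [e]
      rw [integral_const_mul, this, mul_zero]
    have heq : gammaOp (dilate c h) =ᵐ[posMeasure]
        kernelOp (fun x y => gammaKernel x y + gammaDeriv x * y) (dilate c h) := by
      filter_upwards [ae_integrable_kernel hk0 measurable_gammaKernel (fun y hy =>
        normL1k_shift_sub_le hk0 measurable_gammaDensity (memL1k_gammaDensity k) hy) hdm] with x hx
      have hi : Integrable (fun y => gammaDeriv x * (y * dilate c h y)) posMeasure :=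
        (hdm.integrable_id_mul (by linarith)).const_mul _
      have : kernelOp (fun x y => gammaKernel x y + gammaDeriv x * y) (dilate c h) x
          = ∫ y in Ioi (0 : ℝ), (gammaKernel x y * dilate c h y
            + gammaDeriv x * (y * dilate c h y)) := by
        refine integral_congr_ae (ae_of_all _ fun y => ?_)
        ring
      rw [this, integral_add hx hi, integral_const_mul, hzero, mul_zero, add_zero]
      rfl
    rw [normL1k_congr heq]
    have hmeas : Measurable (Function.uncurry fun x y => gammaKernel x y + gammaDeriv x * y) :=
      measurable_gammaKernel.add ((measurable_gammaDeriv.comp measurable_fst).mul measurable_snd)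
    refine (normL1k_kernel_le hmeas hdm.aesm).trans ?_
    exact lintegral_dilate_le hC₂ hc1 (j := 2) (by simpa using hk) h fun y hy => by
      simpa using h2 y hy
  rw [gapSemigroup_apply, max_eq_left ht, ← hc, ← hcinv]
  refine norm_add₃_le.trans ?_
  rw [norm_smul, norm_smul, Real.norm_of_nonneg (by nlinarith), Real.norm_of_nonneg (by positivity)]
  have e1 : 2 * (c - 1) * ‖expCLM hk0 one_pos (dilationSemigroup hk0 t h)‖
      ≤ 2 * c * (C₁ * c⁻¹ ^ 2 * ‖h‖) := by
    gcongr
    linarith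
  have e2 : (c - 1) ^ 2 * ‖gammaCLM hk0 (dilationSemigroup hk0 t h)‖
      ≤ c ^ 2 * (C₂ * c⁻¹ ^ 3 * ‖h‖) := by
    gcongr
    linarith
  have e3 : c⁻¹ * ‖h‖ + 2 * c * (C₁ * c⁻¹ ^ 2 * ‖h‖) + c ^ 2 * (C₂ * c⁻¹ ^ 3 * ‖h‖)
      = (1 + 2 * C₁ + C₂) * c⁻¹ * ‖h‖ := by
    field_simp
  linarith

theorem exists_isGapConstant {k : ℝ} (hk : 2 ≤ k) : ∃ C : ℝ, IsGapConstant k C := by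
  have hk0 : 0 ≤ k := by linarith
  obtain ⟨C, hC, h⟩ := exists_gap_bound hk hk0
  refine ⟨C, hC, gapSemigroup hk0, isLinearisedSemigroup_gapSemigroup hk0, fun u hu t ht => ?_⟩
  refine (h u hu t ht).trans ?_
  gcongr
  linarith

/-! ### The real-valued norm -/

/-- The norm of `L¹_k` as a real number. -/
def nrm (k : ℝ) (f : ℝ → ℝ) : ℝ := (normL1k k f).toReal

theorem nrm_nonneg (k : ℝ) (f : ℝ → ℝ) : 0 ≤ nrm k f := ENNReal.toReal_nonneg

theorem MemL1k.ofReal_nrm {k : ℝ} {f : ℝ → ℝ} (h : MemL1k k f) :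
    ENNReal.ofReal (nrm k f) = normL1k k f := ENNReal.ofReal_toReal h.lt_top.ne

theorem nrm_congr {k : ℝ} {f g : ℝ → ℝ} (h : f =ᵐ[posMeasure] g) : nrm k f = nrm k g := by
  rw [nrm, nrm, normL1k_congr h]

theorem nrm_le_of_le {k c : ℝ} (hc : 0 ≤ c) {f : ℝ → ℝ} (h : normL1k k f ≤ ENNReal.ofReal c) :
    nrm k f ≤ c := ENNReal.toReal_le_of_le_ofReal hc h

theorem nrm_add_le {k : ℝ} {f g : ℝ → ℝ} (hf : MemL1k k f) (hg : MemL1k k g) :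
    nrm k (fun x => f x + g x) ≤ nrm k f + nrm k g := by
  rw [nrm, nrm, nrm, ← ENNReal.toReal_add hf.lt_top.ne hg.lt_top.ne]
  exact ENNReal.toReal_mono (ENNReal.add_lt_top.2 ⟨hf.lt_top, hg.lt_top⟩).ne (normL1k_add_le hf hg)

theorem nrm_sub_le {k : ℝ} {f g : ℝ → ℝ} (hf : MemL1k k f) (hg : MemL1k k g) :
    nrm k (fun x => f x - g x) ≤ nrm k f + nrm k g := by
  rw [nrm, nrm, nrm, ← ENNReal.toReal_add hf.lt_top.ne hg.lt_top.ne]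
  exact ENNReal.toReal_mono (ENNReal.add_lt_top.2 ⟨hf.lt_top, hg.lt_top⟩).ne (normL1k_sub_le hf hg)

theorem nrm_const_mul (k c : ℝ) (f : ℝ → ℝ) : nrm k (fun x => c * f x) = |c| * nrm k f := by
  rw [nrm, nrm, normL1k_const_mul, ENNReal.toReal_mul, ENNReal.toReal_ofReal (abs_nonneg c)]

theorem nrm_mono {j k : ℝ} (hjk : j ≤ k) {f : ℝ → ℝ} (hf : MemL1k k f) : nrm j f ≤ nrm k f :=
  ENNReal.toReal_mono hf.lt_top.ne (normL1k_mono hjk f)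

theorem MemL1k.integral_abs_mul_le {k c : ℝ} (hc : 0 ≤ c) {f ψ : ℝ → ℝ} (h : MemL1k k f)
    (hb : ∀ x, 0 < x → |ψ x| ≤ c * (1 + x) ^ k) :
    ∫ x in Ioi 0, |ψ x * f x| ≤ c * nrm k f := by
  have h1 := MemL1k.lintegral_mul_le hc f ψ hb
  rw [← h.ofReal_nrm, ← ENNReal.ofReal_mul hc] at h1
  have h2 := norm_integral_le_lintegral_norm (μ := posMeasure) fun x => |ψ x * f x|
  simp only [norm_abs_eq_norm, Real.norm_eq_abs] at h2
  refine (le_abs_self _).trans (h2.trans ?_)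
  refine ENNReal.toReal_le_of_le_ofReal (mul_nonneg hc (nrm_nonneg k f)) ?_
  refine le_trans (le_of_eq (lintegral_congr fun x => ?_)) h1
  rw [Real.enorm_eq_ofReal_abs]

theorem one_le_one_add_rpow {k x : ℝ} (hk : 0 ≤ k) (hx : 0 < x) : 1 ≤ (1 + x) ^ k :=
  Real.one_le_rpow (by linarith) hk

theorem MemL1k.integral_abs_le {k : ℝ} (hk : 0 ≤ k) {f : ℝ → ℝ} (h : MemL1k k f) :
    ∫ x in Ioi 0, |f x| ≤ nrm k f := by
  have := h.integral_abs_mul_le zero_le_one (ψ := fun _ => 1) fun x hx => by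
    rw [abs_one, one_mul]; exact one_le_one_add_rpow hk hx
  simpa using this

theorem MemL1k.exists_measurable {k : ℝ} {f : ℝ → ℝ} (h : MemL1k k f) :
    ∃ g : ℝ → ℝ, Measurable g ∧ f =ᵐ[posMeasure] g :=
  ⟨h.aesm.mk f, h.aesm.stronglyMeasurable_mk.measurable, h.aesm.ae_eq_mk⟩

/-! ### The coagulation operator -/

/-- Bounded, measurable and symmetric coagulation kernels. -/
structure IsBoundedKernel (κ : ℝ) (K : ℝ → ℝ → ℝ) : Prop where
  measurable : Measurable (Function.uncurry K)
  symm : ∀ x y, K x y = K y x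
  bound : ∀ x y, |K x y| ≤ κ

theorem IsBoundedKernel.nonneg {κ : ℝ} {K : ℝ → ℝ → ℝ} (h : IsBoundedKernel κ K) : 0 ≤ κ :=
  (abs_nonneg _).trans (h.bound 0 0)

theorem isBoundedKernel_kernelZero : IsBoundedKernel 2 kernelZero where
  measurable := measurable_const
  symm _ _ := rfl
  bound _ _ := by simp [kernelZero]

/-- The kernel of the gain term. -/
def gainKernel (K : ℝ → ℝ → ℝ) (g : ℝ → ℝ) (x y : ℝ) : ℝ := shift (fun u => K u y * g u) x y

theorem measurable_gainKernel {K : ℝ → ℝ → ℝ} (hK : Measurable (Function.uncurry K)) {g : ℝ → ℝ}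
    (hg : Measurable g) : Measurable (Function.uncurry (gainKernel K g)) := by
  refine Measurable.ite (measurableSet_lt measurable_snd measurable_fst) ?_ measurable_const
  have h1 : Measurable fun p : ℝ × ℝ => p.1 - p.2 := measurable_fst.sub measurable_snd
  exact (hK.comp (h1.prodMk measurable_snd)).mul (hg.comp h1)

theorem coag_eq (K : ℝ → ℝ → ℝ) (g h : ℝ → ℝ) {x : ℝ} (hx : 0 < x) :
    coag K g h x = 1 / 2 * kernelOp (gainKernel K g) h x - 1 / 2 * g x * kernelOp K h x
      - 1 / 2 * h x * kernelOp K g x := by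
  have e : ∀ y, 0 < y → gainKernel K g x y * h y
      = (Ioo 0 x).indicator (fun y => K (x - y) y * g (x - y) * h y) y := by
    intro y hy
    by_cases hyx : y < x <;> simp [gainKernel, shift, indicator, hyx, hy]
  have e1 : ∫ y in (0 : ℝ)..x, K (x - y) y * g (x - y) * h y = kernelOp (gainKernel K g) h x := by
    rw [intervalIntegral.integral_of_le hx.le, integral_Ioc_eq_integral_Ioo, kernelOp,
      setIntegral_congr_fun measurableSet_Ioi fun y hy => e y hy, ← integral_indicator
        measurableSet_Ioo]
    refine (setIntegral_eq_integral_of_forall_compl_eq_zero fun y hy => ?_).symm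
    rw [indicator_of_notMem]
    exact fun h => hy h.1
  rw [coag, e1]
  rfl

theorem coag_congr (K : ℝ → ℝ → ℝ) {g g' h h' : ℝ → ℝ} (hg : g =ᵐ[posMeasure] g')
    (hh : h =ᵐ[posMeasure] h') : coag K g h =ᵐ[posMeasure] coag K g' h' := by
  filter_upwards [ae_pos, hg, hh] with x hx hgx hhx
  have hg1 : ∀ᵐ u : ℝ, u ∈ Ioi (0 : ℝ) → g u = g' u := (ae_restrict_iff' measurableSet_Ioi).1 hg
  have hh1 : ∀ᵐ u : ℝ, u ∈ Ioi (0 : ℝ) → h u = h' u := (ae_restrict_iff' measurableSet_Ioi).1 hh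
  have hg2 : ∀ᵐ y : ℝ, x - y ∈ Ioi (0 : ℝ) → g (x - y) = g' (x - y) :=
    (quasiMeasurePreserving_sub_left_of_right_invariant volume x).ae hg1
  have e1 : ∫ y in (0 : ℝ)..x, K (x - y) y * g (x - y) * h y
      = ∫ y in (0 : ℝ)..x, K (x - y) y * g' (x - y) * h' y := by
    rw [intervalIntegral.integral_of_le hx.le, intervalIntegral.integral_of_le hx.le,
      integral_Ioc_eq_integral_Ioo, integral_Ioc_eq_integral_Ioo]
    refine setIntegral_congr_ae measurableSet_Ioo ?_
    filter_upwards [hg2, hh1] with y h2 h3 hy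
    rw [h2 (sub_pos.2 hy.2), h3 hy.1]
  have e2 : ∫ y in Ioi (0 : ℝ), K x y * h y = ∫ y in Ioi (0 : ℝ), K x y * h' y := by
    refine integral_congr_ae ?_
    filter_upwards [hh] with y hy
    rw [hy]
  have e3 : ∫ y in Ioi (0 : ℝ), K x y * g y = ∫ y in Ioi (0 : ℝ), K x y * g' y := by
    refine integral_congr_ae ?_
    filter_upwards [hg] with y hy
    rw [hy]
  rw [coag, coag, e1, e2, e3, hgx, hhx]

theorem coag_comm {κ : ℝ} {K : ℝ → ℝ → ℝ} (hK : IsBoundedKernel κ K) (g h : ℝ → ℝ) (x : ℝ) :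
    coag K g h x = coag K h g x := by
  have e1 : ∫ y in (0 : ℝ)..x, K (x - y) y * g (x - y) * h y
      = ∫ y in (0 : ℝ)..x, K (x - y) y * h (x - y) * g y := by
    have := intervalIntegral.integral_comp_sub_left (a := 0) (b := x)
      (fun y => K (x - y) y * g (x - y) * h y) x
    simp only [sub_self, sub_zero] at this
    rw [← this]
    refine intervalIntegral.integral_congr fun y _ => ?_
    simp only [sub_sub_cancel]
    rw [hK.symm y (x - y)]
    ring
  rw [coag, coag, e1]
  ring

theorem coag_smul_right (K : ℝ → ℝ → ℝ) (c : ℝ) (g h : ℝ → ℝ) (x : ℝ) :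
    coag K g (fun y => c * h y) x = c * coag K g h x := by
  have e1 : ∫ y in (0 : ℝ)..x, K (x - y) y * g (x - y) * (c * h y)
      = c * ∫ y in (0 : ℝ)..x, K (x - y) y * g (x - y) * h y := by
    rw [← intervalIntegral.integral_const_mul]
    exact intervalIntegral.integral_congr fun y _ => by ring
  have e2 : ∫ y in Ioi (0 : ℝ), K x y * (c * h y) = c * ∫ y in Ioi (0 : ℝ), K x y * h y := by
    rw [← integral_const_mul]
    exact integral_congr_ae (ae_of_all _ fun y => by ring)
  rw [coag, coag, e1, e2]
  ring

/-! ### Boundedness, bilinearity and weak form of the coagulation operator. -/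

section
variable {k κ : ℝ} {K : ℝ → ℝ → ℝ} {g h : ℝ → ℝ}

theorem IsBoundedKernel.integrable_mul (hK : IsBoundedKernel κ K) (hk : 0 ≤ k) (hh : MemL1k k h)
    (x : ℝ) : Integrable (fun y => K x y * h y) posMeasure :=
  (hh.mono hk).integrable_mul (k := 0) hK.nonneg (hK.measurable.of_uncurry_left (x := x))
    fun y _ => by simpa using hK.bound x y

theorem IsBoundedKernel.abs_kernelOp_le (hK : IsBoundedKernel κ K) (hk : 0 ≤ k) (hh : MemL1k k h)
    (x : ℝ) : |kernelOp K h x| ≤ κ * nrm k h := by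
  refine (abs_integral_le_integral_abs).trans ?_
  refine ((hh.mono hk).integral_abs_mul_le (k := 0) hK.nonneg fun y _ => ?_).trans ?_
  · simpa using hK.bound x y
  · exact mul_le_mul_of_nonneg_left (nrm_mono hk hh) hK.nonneg

theorem IsBoundedKernel.normL1k_mul_le (hK : IsBoundedKernel κ K) (hg : MemL1k k g) (y : ℝ) :
    normL1k k (fun u => K u y * g u) ≤ ENNReal.ofReal (κ * nrm k g) := by
  rw [ENNReal.ofReal_mul hK.nonneg, hg.ofReal_nrm]
  have h1 := normL1k_const_mul k κ g
  rw [abs_of_nonneg hK.nonneg] at h1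
  rw [← h1]
  refine normL1k_le_of_le (ae_of_all _ fun u => ?_)
  rw [abs_mul, abs_mul, abs_of_nonneg hK.nonneg]
  gcongr
  exact hK.bound u y

theorem IsBoundedKernel.normL1k_gainKernel_le (hK : IsBoundedKernel κ K) (hk : 0 ≤ k)
    (hg : MemL1k k g) {y : ℝ} (hy : 0 < y) :
    normL1k k (fun x => gainKernel K g x y) ≤ ENNReal.ofReal (κ * nrm k g) * weight k y := by
  refine (normL1k_shift_le hk (fun u => K u y * g u) hy).trans ?_
  gcongr
  exact hK.normL1k_mul_le hg y

theorem IsBoundedKernel.measurable_left (hK : IsBoundedKernel κ K) (y : ℝ) :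
    Measurable fun u => K u y := hK.measurable.of_uncurry_right

theorem IsBoundedKernel.memL1k_mul (hK : IsBoundedKernel κ K) (hg : MemL1k k g) (y : ℝ) :
    MemL1k k (fun u => K u y * g u) :=
  memL1k_iff.2 ⟨(hK.measurable_left y).aestronglyMeasurable.mul hg.aesm,
    (hK.normL1k_mul_le hg y).trans_lt ENNReal.ofReal_lt_top⟩

theorem memL1k_mul_bounded {c : ℝ} (hh : MemL1k k h) {m : ℝ → ℝ}
    (hm : AEStronglyMeasurable m posMeasure) (hc : 0 ≤ c) (hb : ∀ x, |m x| ≤ c) :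
    MemL1k k (fun x => h x * m x) ∧ nrm k (fun x => h x * m x) ≤ c * nrm k h := by
  have h1 : normL1k k (fun x => h x * m x) ≤ ENNReal.ofReal (c * nrm k h) := by
    rw [ENNReal.ofReal_mul hc, hh.ofReal_nrm]
    have h1 := normL1k_const_mul k c h
    rw [abs_of_nonneg hc] at h1
    rw [← h1]
    refine normL1k_le_of_le (ae_of_all _ fun u => ?_)
    rw [abs_mul, abs_mul, abs_of_nonneg hc, mul_comm]
    gcongr
    exact hb u
  exact ⟨memL1k_iff.2 ⟨hh.aesm.mul hm, h1.trans_lt ENNReal.ofReal_lt_top⟩,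
    nrm_le_of_le (mul_nonneg hc (nrm_nonneg _ _)) h1⟩

/-- Each of the three terms is at most `κ ‖g‖ ‖h‖`, by submultiplicativity of the weight for the
gain and by a supremum bound for the losses; the prefactors `1/2` give `3/2`. Measurability of `g`
is needed for the joint measurability of the gain kernel and is removed afterwards by changing
representatives. -/
theorem IsBoundedKernel.memL1k_coag_aux (hK : IsBoundedKernel κ K) (hk : 0 ≤ k) (hg : MemL1k k g)
    (hgm : Measurable g) (hh : MemL1k k h) :
    MemL1k k (coag K g h) ∧ nrm k (coag K g h) ≤ 3 / 2 * κ * nrm k g * nrm k h := by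
  have hc : 0 ≤ κ * nrm k g := mul_nonneg hK.nonneg (nrm_nonneg _ _)
  have h1 := memL1k_kernel (measurable_gainKernel hK.measurable hgm)
    (fun y hy => hK.normL1k_gainKernel_le hk hg hy) hh
  have h1n : nrm k (kernelOp (gainKernel K g) h) ≤ κ * nrm k g * nrm k h :=
    nrm_le_of_le (mul_nonneg hc (nrm_nonneg _ _)) (by
      rw [ENNReal.ofReal_mul hc, hh.ofReal_nrm]; exact h1.2)
  have h2 := memL1k_mul_bounded hg (aesm_kernel hK.measurable hh.aesm)
    (mul_nonneg hK.nonneg (nrm_nonneg k h)) (hK.abs_kernelOp_le hk hh)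
  have h3 := memL1k_mul_bounded hh (aesm_kernel hK.measurable hg.aesm) hc
    (hK.abs_kernelOp_le hk hg)
  have e : coag K g h =ᵐ[posMeasure] fun x => 1 / 2 * ((kernelOp (gainKernel K g) h x
      - g x * kernelOp K h x) - h x * kernelOp K g x) := by
    filter_upwards [ae_pos] with x hx
    rw [coag_eq K g h hx]
    ring
  have hm : MemL1k k fun x => 1 / 2 * ((kernelOp (gainKernel K g) h x
      - g x * kernelOp K h x) - h x * kernelOp K g x) := ((h1.1.sub h2.1).sub h3.1).const_mul _
  refine ⟨(memL1k_congr e).2 hm, ?_⟩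
  rw [nrm_congr e, nrm_const_mul, abs_of_pos (by norm_num)]
  have b1 := nrm_sub_le (h1.1.sub h2.1) h3.1
  have b2 := nrm_sub_le h1.1 h2.1
  have b3 := h2.2
  have b4 := h3.2
  change nrm k (fun x => kernelOp (gainKernel K g) h x - g x * kernelOp K h x)
    ≤ nrm k (kernelOp (gainKernel K g) h) + nrm k (fun x => g x * kernelOp K h x) at b2
  change nrm k (fun x => g x * kernelOp K h x) ≤ _ at b3
  change nrm k (fun x => h x * kernelOp K g x) ≤ _ at b4
  change nrm k (fun x => (kernelOp (gainKernel K g) h x - g x * kernelOp K h x)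
    - h x * kernelOp K g x) ≤ nrm k (fun x => kernelOp (gainKernel K g) h x - g x * kernelOp K h x)
      + nrm k (fun x => h x * kernelOp K g x) at b1
  nlinarith

theorem IsBoundedKernel.memL1k_coag (hK : IsBoundedKernel κ K) (hk : 0 ≤ k) (hg : MemL1k k g)
    (hh : MemL1k k h) : MemL1k k (coag K g h) := by
  obtain ⟨g', hgm, hgg⟩ := hg.exists_measurable
  exact (memL1k_congr (coag_congr K hgg (EventuallyEq.refl _ h))).2
    (hK.memL1k_coag_aux hk ((memL1k_congr hgg).1 hg) hgm hh).1

theorem IsBoundedKernel.nrm_coag_le (hK : IsBoundedKernel κ K) (hk : 0 ≤ k) (hg : MemL1k k g)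
    (hh : MemL1k k h) : nrm k (coag K g h) ≤ 3 / 2 * κ * nrm k g * nrm k h := by
  obtain ⟨g', hgm, hgg⟩ := hg.exists_measurable
  rw [nrm_congr (coag_congr K hgg (EventuallyEq.refl _ h)), nrm_congr hgg]
  exact (hK.memL1k_coag_aux hk ((memL1k_congr hgg).1 hg) hgm hh).2

theorem IsBoundedKernel.coag_add_right (hK : IsBoundedKernel κ K) (hk : 0 ≤ k) (hg : MemL1k k g)
    (hh : MemL1k k h) {h' : ℝ → ℝ} (hh' : MemL1k k h') :
    coag K g (fun x => h x + h' x) =ᵐ[posMeasure] fun x => coag K g h x + coag K g h' x := by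
  obtain ⟨g', hgm, hgg⟩ := hg.exists_measurable
  have hg' := (memL1k_congr hgg).1 hg
  have hc : 0 ≤ κ * nrm k g' := mul_nonneg hK.nonneg (nrm_nonneg _ _)
  have h1 := (isL1kOperator_kernelOp hk hc (measurable_gainKernel hK.measurable hgm)
    (fun y hy => hK.normL1k_gainKernel_le hk hg' hy)).add h h' hh hh'
  filter_upwards [coag_congr K hgg (EventuallyEq.refl _ fun x => h x + h' x),
    coag_congr K hgg (EventuallyEq.refl _ h), coag_congr K hgg (EventuallyEq.refl _ h'), ae_pos,
    h1] with x e1 e2 e3 hx e4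
  have e5 : kernelOp K (fun x => h x + h' x) x = kernelOp K h x + kernelOp K h' x := by
    simp only [kernelOp, mul_add]
    exact integral_add (hK.integrable_mul hk hh x) (hK.integrable_mul hk hh' x)
  rw [e1, e2, e3, coag_eq K g' _ hx, coag_eq K g' _ hx, coag_eq K g' _ hx, e4, e5]
  ring

theorem IsBoundedKernel.coag_sub_right (hK : IsBoundedKernel κ K) (hk : 0 ≤ k) (hg : MemL1k k g)
    (hh : MemL1k k h) {h' : ℝ → ℝ} (hh' : MemL1k k h') :
    coag K g (fun x => h x - h' x) =ᵐ[posMeasure] fun x => coag K g h x - coag K g h' x := by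
  have e : (fun x => h x - h' x) = fun x => h x + -1 * h' x := by ext x; ring
  rw [e]
  filter_upwards [hK.coag_add_right hk hg hh (hh'.const_mul (-1))] with x hx
  rw [hx, coag_smul_right]
  ring

theorem IsBoundedKernel.coag_sub_left (hK : IsBoundedKernel κ K) (hk : 0 ≤ k) (hg : MemL1k k g)
    (hh : MemL1k k h) {g' : ℝ → ℝ} (hg' : MemL1k k g') :
    coag K (fun x => g x - g' x) h =ᵐ[posMeasure] fun x => coag K g h x - coag K g' h x := by
  filter_upwards [hK.coag_sub_right hk hh hg hg'] with x hx
  rw [coag_comm hK, hx, coag_comm hK, coag_comm hK h]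

theorem IsBoundedKernel.coag_add_left (hK : IsBoundedKernel κ K) (hk : 0 ≤ k) (hg : MemL1k k g)
    (hh : MemL1k k h) {g' : ℝ → ℝ} (hg' : MemL1k k g') :
    coag K (fun x => g x + g' x) h =ᵐ[posMeasure] fun x => coag K g h x + coag K g' h x := by
  filter_upwards [hK.coag_add_right hk hh hg hg'] with x hx
  rw [coag_comm hK, hx, coag_comm hK, coag_comm hK h]

/-- The identity `a² - b² = (a + b)(a - b)` for a symmetric bilinear map. -/
theorem IsBoundedKernel.coag_diff (hK : IsBoundedKernel κ K) (hk : 0 ≤ k) (hg : MemL1k k g)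
    (hh : MemL1k k h) : (fun x => coag K g g x - coag K h h x)
      =ᵐ[posMeasure] coag K (fun x => g x + h x) (fun x => g x - h x) := by
  filter_upwards [hK.coag_add_left hk hg (hg.sub hh) hh, hK.coag_sub_right hk hg hg hh,
    hK.coag_sub_right hk hh hg hh] with x h1 h2 h3
  rw [h1, h2, h3, coag_comm hK h g]
  ring

theorem rpow_add_le_mul {x y : ℝ} (hk : 0 ≤ k) (hx : 0 < x) (hy : 0 < y) :
    (1 + (x + y)) ^ k ≤ (1 + y) ^ k * (1 + x) ^ k := by
  rw [← Real.mul_rpow (by linarith) (by linarith)]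
  exact Real.rpow_le_rpow (by linarith) (by nlinarith) hk

/-- The weak form of coagulation: a merger of sizes `u` and `y` changes `∫ ψ f` by `ψ(u + y) - ψ(u)
- ψ(y)`. It comes from Fubini, the substitution `x = u + y` in the gain term, and the symmetry of
`K`. -/
theorem IsBoundedKernel.integral_mul_coag (hK : IsBoundedKernel κ K) (hk : 0 ≤ k)
    (hg : MemL1k k g) (hh : MemL1k k h) {ψ : ℝ → ℝ} (hψ : Measurable ψ) {d : ℝ} (hd : 0 ≤ d)
    (hb : ∀ x, 0 < x → |ψ x| ≤ d * (1 + x) ^ k) :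
    ∫ x in Ioi 0, ψ x * coag K g h x
      = 1 / 2 * ∫ y in Ioi 0, (∫ u in Ioi 0, (ψ (u + y) - ψ u - ψ y) * (K u y * g u)) * h y := by
  -- The gain kernel evaluates `g` at `x - y`, so a genuinely measurable representative is chosen
  -- first.
  wlog hgm : Measurable g generalizing g
  · obtain ⟨g', hgm, hgg⟩ := hg.exists_measurable
    have h1 := this ((memL1k_congr hgg).1 hg) hgm
    have e1 : ∫ x in Ioi 0, ψ x * coag K g h x = ∫ x in Ioi 0, ψ x * coag K g' h x := by
      refine integral_congr_ae ?_
      filter_upwards [coag_congr K hgg (EventuallyEq.refl _ h)] with x hx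
      rw [hx]
    rw [e1, h1]
    congr 1
    refine integral_congr_ae (ae_of_all _ fun y => ?_)
    simp only
    congr 1
    refine integral_congr_ae ?_
    filter_upwards [hgg] with u hu
    rw [hu]
  have hc : 0 ≤ κ * nrm k g := mul_nonneg hK.nonneg (nrm_nonneg _ _)
  set p : ℝ → ℝ → ℝ := fun x y => gainKernel K g x y - K x y * g x with hp
  have hpm : Measurable (Function.uncurry p) :=
    (measurable_gainKernel hK.measurable hgm).sub (hK.measurable.mul (hgm.comp measurable_fst))
  have hgain : ∀ y, 0 < y → MemL1k k (fun x => gainKernel K g x y) := fun y hy =>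
    (hK.memL1k_mul hg y).shift hk ((hK.measurable_left y).mul hgm) hy
  have hN : ∀ y, 0 < y → normL1k k (fun x => p x y)
      ≤ ENNReal.ofReal (2 * (κ * nrm k g)) * weight k y := by
    intro y hy
    refine (normL1k_sub_le (hgain y hy) (hK.memL1k_mul hg y)).trans ?_
    rw [ENNReal.ofReal_mul zero_le_two, ENNReal.ofReal_ofNat, two_mul, add_mul]
    refine add_le_add (hK.normL1k_gainKernel_le hk hg hy) ((hK.normL1k_mul_le hg y).trans ?_)
    exact le_mul_of_one_le_right zero_le (one_le_weight hk hy)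
  have hswap := integral_kernel_swap hd hpm hN hh hψ hb
  have hint1 : Integrable (fun y => (∫ x in Ioi 0, ψ x * p x y) * h y) posMeasure := by
    refine (integrable_prod_kernel hd hpm hN hh hψ hb).integral_prod_right.congr
      (ae_of_all _ fun y => ?_)
    simp only [Function.uncurry, ← mul_assoc, integral_mul_const]
  have hKg := memL1k_mul_bounded hh (aesm_kernel hK.measurable hg.aesm) hc
    (hK.abs_kernelOp_le hk hg)
  have hint2 : Integrable (fun y => ψ y * (h y * kernelOp K g y)) posMeasure :=
    hKg.1.integrable_mul hd hψ hb
  have hint3 : Integrable (fun x => ψ x * kernelOp p h x) posMeasure :=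
    (memL1k_kernel hpm hN hh).1.integrable_mul hd hψ hb
  have e1 : ∫ x in Ioi 0, ψ x * coag K g h x
      = ∫ x in Ioi 0, 1 / 2 * (ψ x * kernelOp p h x - ψ x * (h x * kernelOp K g x)) := by
    refine integral_congr_ae ?_
    filter_upwards [ae_pos, ae_integrable_kernel hk (measurable_gainKernel hK.measurable hgm)
      (fun y hy => hK.normL1k_gainKernel_le hk hg hy) hh] with x hx hi
    have : kernelOp p h x = kernelOp (gainKernel K g) h x - g x * kernelOp K h x := by
      simp only [kernelOp, hp, sub_mul]
      rw [integral_sub hi, ← integral_const_mul]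
      · congr 1
        exact integral_congr_ae (ae_of_all _ fun y => by ring)
      · exact ((hK.integrable_mul hk hh x).const_mul (g x)).congr (ae_of_all _ fun y => by ring)
    rw [coag_eq K g h hx, this]
    ring
  rw [e1, integral_const_mul, integral_sub hint3 hint2]
  congr 1
  rw [show (∫ x in Ioi 0, ψ x * kernelOp p h x)
    = ∫ y in Ioi 0, (∫ x in Ioi 0, ψ x * p x y) * h y from hswap, ← integral_sub hint1 hint2]
  refine setIntegral_congr_fun measurableSet_Ioi fun y hy => ?_
  have hy : 0 < y := hy
  have i1 : Integrable (fun u => ψ (u + y) * (K u y * g u)) posMeasure := by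
    refine (hK.memL1k_mul hg y).integrable_mul (c := d * (1 + y) ^ k) (by positivity)
      (hψ.comp (measurable_id.add_const y)) fun u hu => ?_
    refine (hb (u + y) (by positivity)).trans ?_
    rw [mul_assoc]
    gcongr
    exact rpow_add_le_mul hk hu hy
  have i2 : Integrable (fun u => ψ u * (K u y * g u)) posMeasure :=
    (hK.memL1k_mul hg y).integrable_mul hd hψ hb
  have i3 : Integrable (fun u => ψ y * (K y u * g u)) posMeasure :=
    (hK.integrable_mul hk hg y).const_mul _
  have i4 : Integrable (fun x => ψ x * shift (fun u => K u y * g u) x y) posMeasure :=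
    (hgain y hy).integrable_mul hd hψ hb
  have s1 : ∫ x in Ioi 0, ψ x * p x y
      = (∫ u in Ioi 0, ψ (u + y) * (K u y * g u)) - ∫ u in Ioi 0, ψ u * (K u y * g u) := by
    rw [← integral_mul_shift hy.le ψ (fun u => K u y * g u), ← integral_sub i4 i2]
    exact integral_congr_ae (ae_of_all _ fun x => by simp only [hp, gainKernel]; ring)
  have s2 : ∫ u in Ioi 0, (ψ (u + y) - ψ u - ψ y) * (K u y * g u)
      = (∫ u in Ioi 0, ψ (u + y) * (K u y * g u)) - (∫ u in Ioi 0, ψ u * (K u y * g u))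
        - ψ y * ∫ u in Ioi 0, K y u * g u := by
    rw [← integral_const_mul, ← integral_sub i1 i2]
    refine Eq.trans ?_ (integral_sub (i1.sub i2) i3)
    refine integral_congr_ae (ae_of_all _ fun u => ?_)
    simp only
    rw [hK.symm y u]
    ring
  simp only [kernelOp]
  rw [s1, s2]
  ring

end

/-! ### Stationary pairs -/

/-- The integrated form `x² h(x) = ∫_x^∞ y q(y) dy` of the equation `2 h + x h' + q = 0`. -/
def IsStationaryPair (h q : ℝ → ℝ) : Prop :=
  ∀ᵐ x ∂posMeasure, x ^ 2 * h x = ∫ y in Ioi x, y * q y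

theorem IsStationaryPair.congr {h q h' q' : ℝ → ℝ} (H : IsStationaryPair h q)
    (hh : h =ᵐ[posMeasure] h') (hq : q =ᵐ[posMeasure] q') : IsStationaryPair h' q' := by
  filter_upwards [H, hh, ae_pos] with x h1 h2 hx
  rw [← h2, h1]
  refine integral_congr_ae ?_
  filter_upwards [ae_restrict_of_ae_restrict_of_subset (Ioi_subset_Ioi (le_of_lt hx)) hq] with y hy
  rw [hy]

theorem integrableOn_Ioi_of_pos {f : ℝ → ℝ} (hf : Integrable f posMeasure) {x : ℝ} (hx : 0 ≤ x) :
    IntegrableOn f (Ioi x) :=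
  (show IntegrableOn f (Ioi 0) volume from hf).mono_set (Ioi_subset_Ioi hx)

theorem IsStationaryPair.sub {h q h' q' : ℝ → ℝ} (H : IsStationaryPair h q)
    (H' : IsStationaryPair h' q') (hq : MemL1k 1 q) (hq' : MemL1k 1 q') :
    IsStationaryPair (fun x => h x - h' x) (fun x => q x - q' x) := by
  filter_upwards [H, H', ae_pos] with x h1 h2 hx
  rw [mul_sub, h1, h2, ← integral_sub (integrableOn_Ioi_of_pos (hq.integrable_id_mul le_rfl) hx.le)
    (integrableOn_Ioi_of_pos (hq'.integrable_id_mul le_rfl) hx.le)]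
  exact integral_congr_ae (ae_of_all _ fun y => by ring)

/-- Substitution `y = e^s x`, with Jacobian `e^s x`. -/
theorem integral_scaling (q : ℝ → ℝ) {x t : ℝ} (hx : 0 < x) (ht : 0 ≤ t) :
    x ^ 2 * ∫ s in (0 : ℝ)..t, Real.exp (2 * s) * q (Real.exp s * x)
      = ∫ y in Ioc x (Real.exp t * x), y * q y := by
  have himg : (fun s => Real.exp s * x) '' Ioc 0 t = Ioc x (Real.exp t * x) := by
    ext y
    constructor
    · rintro ⟨s, hs, rfl⟩
      have h1 : 1 < Real.exp s := Real.one_lt_exp_iff.2 hs.1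
      have h2 : Real.exp s ≤ Real.exp t := Real.exp_le_exp.2 hs.2
      constructor
      · change x < Real.exp s * x
        nlinarith
      · change Real.exp s * x ≤ Real.exp t * x
        gcongr
    · rintro ⟨h1, h2⟩
      have hy : 0 < y := hx.trans h1
      refine ⟨Real.log (y / x), ⟨Real.log_pos ((one_lt_div hx).2 h1), ?_⟩, ?_⟩
      · rw [Real.log_le_iff_le_exp (by positivity), div_le_iff₀ hx]
        exact h2
      · change Real.exp (Real.log (y / x)) * x = y
        rw [Real.exp_log (by positivity)]
        field_simp
  have hinj : InjOn (fun s => Real.exp s * x) (Ioc 0 t) := fun a _ b _ hab =>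
    Real.exp_injective (mul_right_cancel₀ hx.ne' hab)
  have := integral_image_eq_integral_abs_deriv_smul (measurableSet_Ioc (a := (0 : ℝ)) (b := t))
    (fun s _ => ((Real.hasDerivAt_exp s).mul_const x).hasDerivWithinAt) hinj fun y => y * q y
  rw [himg] at this
  rw [this, intervalIntegral.integral_of_le ht, ← integral_const_mul]
  refine integral_congr_ae (ae_of_all _ fun s => ?_)
  have : 0 < Real.exp s * x := by positivity
  simp only [smul_eq_mul]
  rw [abs_of_pos this, two_mul, Real.exp_add]
  ring

theorem tendsto_setLIntegral_Ioi_zero {f : ℝ → ℝ≥0∞} (hf : ∫⁻ y in Ioi 0, f y ≠ ⊤)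
    (hm : AEMeasurable f posMeasure) :
    Tendsto (fun n : ℕ => ∫⁻ y in Ioi (n : ℝ), f y) atTop (𝓝 0) := by
  have e : ∀ n : ℕ, ∫⁻ y in Ioi (n : ℝ), f y = ∫⁻ y in Ioi 0, (Ioi (n : ℝ)).indicator f y := by
    intro n
    rw [lintegral_indicator measurableSet_Ioi, Measure.restrict_restrict measurableSet_Ioi,
      Ioi_inter_Ioi, sup_eq_left.2 (Nat.cast_nonneg n)]
  simp_rw [e]
  rw [show (0 : ℝ≥0∞) = ∫⁻ y in Ioi (0 : ℝ), 0 by simp]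
  refine tendsto_lintegral_of_dominated_convergence' f (fun n => hm.indicator measurableSet_Ioi)
    (fun n => ae_of_all _ fun y => indicator_le_self _ _ y) hf (ae_of_all _ fun y => ?_)
  refine tendsto_const_nhds.congr' ?_
  obtain ⟨N, hN⟩ := exists_nat_gt y
  filter_upwards [eventually_ge_atTop N] with n hn
  rw [indicator_of_notMem]
  have : (N : ℝ) ≤ n := by exact_mod_cast hn
  rw [mem_Ioi, not_lt]
  linarith

/-- By the mild equation, `D(x) = x² G(x) - ∫_x^∞ y q(y) dy` satisfies `D(x) = D(e^t x)` for every
`t ≥ 0`. Letting `t → ∞` in an average over a compact interval gives `D = 0`, because `y G` and `y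
q` are integrable at infinity. -/
theorem isStationaryPair_of_mild {G q : ℝ → ℝ} (hG : MemL1k 1 G) (hq : MemL1k 1 q)
    (H : ∀ t : ℝ, 0 ≤ t → ∀ᵐ x ∂posMeasure, G x = scalingSemigroup t G x
      + ∫ s in (0 : ℝ)..t, scalingSemigroup (t - s) q x) : IsStationaryPair G q := by
  set r : ℝ → ℝ := fun y => y * q y with hr
  have hri : Integrable r posMeasure := hq.integrable_id_mul le_rfl
  have hGi : Integrable (fun y => y * G y) posMeasure := hG.integrable_id_mul le_rfl
  have key : ∀ t : ℝ, 0 ≤ t → ∀ᵐ x ∂posMeasure, x ^ 2 * G x - ∫ y in Ioi x, r y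
      = (Real.exp t * x) ^ 2 * G (Real.exp t * x) - ∫ y in Ioi (Real.exp t * x), r y := by
    intro t ht
    filter_upwards [H t ht, ae_pos] with x hx h0
    have e1 : ∫ s in (0 : ℝ)..t, scalingSemigroup (t - s) q x
        = ∫ s in (0 : ℝ)..t, Real.exp (2 * s) * q (Real.exp s * x) := by
      have := intervalIntegral.integral_comp_sub_left (a := 0) (b := t)
        (fun s => Real.exp (2 * s) * q (Real.exp s * x)) t
      simpa [scalingSemigroup] using this
    have e2 := integral_scaling q h0 ht
    have hle : x ≤ Real.exp t * x := by nlinarith [Real.one_le_exp ht]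
    have e3 : ∫ y in Ioi x, r y = (∫ y in Ioc x (Real.exp t * x), r y)
        + ∫ y in Ioi (Real.exp t * x), r y := by
      rw [← Ioc_union_Ioi_eq_Ioi hle]
      exact setIntegral_union (Ioc_disjoint_Ioi le_rfl) measurableSet_Ioi
        ((integrableOn_Ioi_of_pos hri h0.le).mono_set Ioc_subset_Ioi_self)
        (integrableOn_Ioi_of_pos hri (by positivity))
    rw [e3, ← e2, hx, e1, scalingSemigroup, two_mul t, Real.exp_add]
    ring
  set f : ℝ → ℝ≥0∞ := fun y => ‖y * G y‖ₑ + ‖r y‖ₑ with hf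
  have hfm : AEMeasurable f posMeasure := hGi.1.enorm.add hri.1.enorm
  have hft : ∫⁻ y in Ioi 0, f y ≠ ⊤ := by
    rw [hf, lintegral_add_left' hGi.1.enorm]
    exact (ENNReal.add_lt_top.2 ⟨hGi.2, hri.2⟩).ne
  have hlim := tendsto_setLIntegral_Ioi_zero hft hfm
  set D : ℝ → ℝ := fun x => x ^ 2 * G x - ∫ y in Ioi x, r y with hD
  have main : ∀ m : ℕ, ∫⁻ x in Ioc ((m + 1 : ℝ)⁻¹) (m + 1), ‖D x‖ₑ = 0 := by
    intro m
    set α : ℝ := (m + 1 : ℝ)⁻¹ with hα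
    set β : ℝ := m + 1 with hβ
    have hα0 : 0 < α := by positivity
    have hβ0 : 0 < β := by positivity
    have bd : ∀ n : ℕ, ∫⁻ x in Ioc α β, ‖D x‖ₑ
        ≤ ENNReal.ofReal (2 * β) * ∫⁻ y in Ioi (n : ℝ), f y := by
      intro n
      -- The dilation `c = e^t` carries `(α, β]` beyond `n`. The factor `c β` from one power of `c
      -- x` is then cancelled by the Jacobian `c⁻¹`, so the bound involves only tails past `n` and
      -- constants independent of `c`.
      set c : ℝ := (n + 1) / α + 1 with hc
      have hc0 : 0 < c := by positivity
      have hc1 : 1 ≤ c := by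
        have : 0 ≤ (n + 1) / α := by positivity
        linarith
      have hcα : (n : ℝ) ≤ c * α := by
        rw [hc, add_mul, div_mul_cancel₀ _ hα0.ne']
        linarith
      have hk := key (Real.log c) (Real.log_nonneg hc1)
      rw [Real.exp_log hc0] at hk
      have hk' : ∀ᵐ x ∂volume.restrict (Ioc α β), ‖D x‖ₑ
          ≤ (fun z => (Ioi (n : ℝ)).indicator (fun z => ENNReal.ofReal (c * β) * ‖z * G z‖ₑ) z)
            (c * x) + ∫⁻ y in Ioi (n : ℝ), ‖r y‖ₑ := by
        filter_upwards [ae_restrict_of_ae_restrict_of_subset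
          (fun x hx => lt_trans hα0 hx.1 : Ioc α β ⊆ Ioi 0) hk,
          ae_restrict_mem measurableSet_Ioc] with x hx hxm
        have hcx : (n : ℝ) < c * x := hcα.trans_lt (by gcongr; exact hxm.1)
        have hx0 : 0 < x := hα0.trans hxm.1
        rw [hD]
        simp only
        rw [hx, indicator_of_mem (show c * x ∈ Ioi (n : ℝ) from hcx)]
        refine (enorm_sub_le).trans (add_le_add ?_ ?_)
        · rw [sq, mul_assoc, enorm_mul, Real.enorm_of_nonneg (by positivity)]
          gcongr
          exact hxm.2
        · refine (enorm_integral_le_lintegral_enorm _).trans ?_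
          exact lintegral_mono_set (Ioi_subset_Ioi hcx.le)
      calc ∫⁻ x in Ioc α β, ‖D x‖ₑ
          ≤ ∫⁻ x in Ioc α β, ((fun z => (Ioi (n : ℝ)).indicator
              (fun z => ENNReal.ofReal (c * β) * ‖z * G z‖ₑ) z) (c * x)
              + ∫⁻ y in Ioi (n : ℝ), ‖r y‖ₑ) := lintegral_mono_ae hk'
        _ = (∫⁻ x in Ioc α β, (fun z => (Ioi (n : ℝ)).indicator
              (fun z => ENNReal.ofReal (c * β) * ‖z * G z‖ₑ) z) (c * x))
              + (∫⁻ y in Ioi (n : ℝ), ‖r y‖ₑ) * ENNReal.ofReal (β - α) := by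
            rw [lintegral_add_right _ measurable_const, setLIntegral_const, Real.volume_Ioc]
        _ ≤ (∫⁻ x in Ioi 0, (fun z => (Ioi (n : ℝ)).indicator
              (fun z => ENNReal.ofReal (c * β) * ‖z * G z‖ₑ) z) (c * x))
              + (∫⁻ y in Ioi (n : ℝ), f y) * ENNReal.ofReal β := by
            refine add_le_add (lintegral_mono_set fun x hx => lt_trans hα0 hx.1) ?_
            refine mul_le_mul' (lintegral_mono fun y => le_add_self) ?_
            exact ENNReal.ofReal_le_ofReal (by linarith)
        _ ≤ ENNReal.ofReal β * (∫⁻ y in Ioi (n : ℝ), f y)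
              + (∫⁻ y in Ioi (n : ℝ), f y) * ENNReal.ofReal β := by
            gcongr
            rw [lintegral_comp_mul_pos hc0 fun z => (Ioi (n : ℝ)).indicator
              (fun z => ENNReal.ofReal (c * β) * ‖z * G z‖ₑ) z, lintegral_indicator
              measurableSet_Ioi, Measure.restrict_restrict measurableSet_Ioi,
              Ioi_inter_Ioi, sup_eq_left.2 (Nat.cast_nonneg n),
              lintegral_const_mul' _ _ ENNReal.ofReal_ne_top, ← mul_assoc,
              ← ENNReal.ofReal_mul (by positivity), inv_mul_cancel_left₀ hc0.ne']
            gcongr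
            exact le_self_add
        _ = _ := by
            rw [mul_comm _ (ENNReal.ofReal β), ← two_mul, ENNReal.ofReal_mul zero_le_two,
              ENNReal.ofReal_ofNat, mul_assoc]
    have h0 : Tendsto (fun n : ℕ => ENNReal.ofReal (2 * β) * ∫⁻ y in Ioi (n : ℝ), f y) atTop
        (𝓝 0) := by
      have := ENNReal.Tendsto.const_mul (a := ENNReal.ofReal (2 * β)) hlim
        (Or.inr ENNReal.ofReal_ne_top)
      rwa [mul_zero] at this
    exact le_antisymm (ge_of_tendsto' h0 bd) zero_le
  have hDm : AEStronglyMeasurable D posMeasure := by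
    refine ((measurable_id.pow_const 2).aestronglyMeasurable.mul hG.aesm).sub ?_
    have : (fun x => ∫ y in Ioi x, r y) =ᵐ[posMeasure]
        fun x => (∫ y in Ioi 0, r y) - ∫ y in (0 : ℝ)..x, r y := by
      filter_upwards [ae_pos] with x hx
      rw [intervalIntegral.integral_of_le hx.le, ← Ioc_union_Ioi_eq_Ioi (le_of_lt hx),
        setIntegral_union (Ioc_disjoint_Ioi le_rfl) measurableSet_Ioi
        ((show IntegrableOn r (Ioi 0) volume from hri).mono_set Ioc_subset_Ioi_self)
        (integrableOn_Ioi_of_pos hri (le_of_lt hx))]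
      ring
    refine AEStronglyMeasurable.congr ?_ this.symm
    refine aestronglyMeasurable_const.sub (ContinuousOn.aestronglyMeasurable ?_ measurableSet_Ioi)
    intro x hx
    have hx : 0 < x := hx
    have hi : IntegrableOn r (Icc 0 (x + 1)) := by
      rw [integrableOn_Icc_iff_integrableOn_Ioc]
      exact (show IntegrableOn r (Ioi 0) volume from hri).mono_set Ioc_subset_Ioi_self
    have hc := intervalIntegral.continuousOn_primitive_interval (a := 0) (b := x + 1) (f := r)
      (μ := volume) (by rwa [uIcc_of_le (by linarith)])
    rw [uIcc_of_le (by linarith : (0 : ℝ) ≤ x + 1)] at hc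
    exact (hc.continuousAt (Icc_mem_nhds hx (by linarith))).continuousWithinAt
  have hall : ∀ᵐ x ∂posMeasure, ∀ m : ℕ, x ∈ Ioc ((m + 1 : ℝ)⁻¹) (m + 1) → D x = 0 := by
    rw [ae_all_iff]
    intro m
    have hsub : Ioc ((m + 1 : ℝ)⁻¹) (m + 1) ⊆ Ioi 0 := fun x hx => lt_trans (by positivity) hx.1
    have h1 := (lintegral_eq_zero_iff' (hDm.mono_measure
      (Measure.restrict_mono hsub le_rfl)).enorm).1 (main m)
    have h2 := (ae_restrict_iff' measurableSet_Ioc).1 h1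
    filter_upwards [ae_restrict_of_ae h2] with x hx hxm
    simpa using hx hxm
  filter_upwards [hall, ae_pos] with x hx h0
  obtain ⟨m, hm⟩ := exists_nat_gt (max x x⁻¹)
  have h1 : x < m := (le_max_left _ _).trans_lt hm
  have h2 : x⁻¹ < m := (le_max_right _ _).trans_lt hm
  have := hx m ⟨inv_lt_of_inv_lt₀ h0 (by linarith), by linarith⟩
  simp only [hD] at this
  linarith

/-! ### Admissible perturbations -/

/-- The restriction of `W` to the open quadrant, extended by zero. -/
def posKernel (W : ℝ → ℝ → ℝ) (x y : ℝ) : ℝ := if 0 < x ∧ 0 < y then W x y else 0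

theorem IsPerturbation.isBoundedKernel {W : ℝ → ℝ → ℝ} (hW : IsPerturbation W) :
    IsBoundedKernel 1 (posKernel W) where
  measurable := by
    classical
    have h : Function.uncurry (posKernel W) = (Ioi (0 : ℝ) ×ˢ Ioi (0 : ℝ)).piecewise
        (fun p : ℝ × ℝ => W p.1 p.2) fun _ => 0 := by
      ext p
      by_cases hp : 0 < p.1 ∧ 0 < p.2 <;> simp [Function.uncurry, posKernel, piecewise, hp]
    rw [h]
    exact hW.continuousOn.measurable_piecewise continuousOn_const
      (measurableSet_Ioi.prod measurableSet_Ioi)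
  symm x y := by
    by_cases h : 0 < x ∧ 0 < y
    · rw [posKernel, posKernel, if_pos h, if_pos h.symm, hW.symm x y h.1 h.2]
    · rw [posKernel, posKernel, if_neg h, if_neg fun h' => h h'.symm]
  bound x y := by
    by_cases h : 0 < x ∧ 0 < y
    · rw [posKernel, if_pos h, abs_of_nonneg (hW.nonneg x y h.1 h.2)]
      exact hW.le_one x y h.1 h.2
    · rw [posKernel, if_neg h, abs_zero]
      exact zero_le_one

theorem IsPerturbation.posKernel_nonneg {W : ℝ → ℝ → ℝ} (hW : IsPerturbation W) (x y : ℝ) :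
    0 ≤ posKernel W x y := by
  by_cases h : 0 < x ∧ 0 < y
  · rw [posKernel, if_pos h]
    exact hW.nonneg x y h.1 h.2
  · rw [posKernel, if_neg h]

theorem IsPerturbation.isBoundedKernel_kernel {W : ℝ → ℝ → ℝ} (hW : IsPerturbation W) {ε : ℝ}
    (hε : 0 ≤ ε) : IsBoundedKernel (2 + ε) (kernel ε (posKernel W)) where
  measurable := measurable_const.add (hW.isBoundedKernel.measurable.const_mul ε)
  symm x y := by rw [kernel, kernel, hW.isBoundedKernel.symm]
  bound x y := by
    have h1 := hW.posKernel_nonneg x y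
    have h2 := hW.isBoundedKernel.bound x y
    rw [abs_of_nonneg h1] at h2
    rw [kernel, abs_of_nonneg (by positivity)]
    nlinarith

/-- Up to null sets the integrals see the kernel only on the open quadrant. Outside it `W` is
arbitrary, so the zero extension supplies global measurability, symmetry and bounds. -/
theorem coag_kernel_posKernel (ε : ℝ) (W : ℝ → ℝ → ℝ) (g h : ℝ → ℝ) {x : ℝ} (hx : 0 < x) :
    coag (kernel ε W) g h x = coag (kernel ε (posKernel W)) g h x := by
  have e : ∀ u y, 0 < u → 0 < y → kernel ε W u y = kernel ε (posKernel W) u y := by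
    intro u y hu hy
    rw [kernel, kernel, posKernel, if_pos ⟨hu, hy⟩]
  have e1 : ∫ y in (0 : ℝ)..x, kernel ε W (x - y) y * g (x - y) * h y
      = ∫ y in (0 : ℝ)..x, kernel ε (posKernel W) (x - y) y * g (x - y) * h y := by
    rw [intervalIntegral.integral_of_le hx.le, intervalIntegral.integral_of_le hx.le,
      integral_Ioc_eq_integral_Ioo, integral_Ioc_eq_integral_Ioo]
    refine setIntegral_congr_fun measurableSet_Ioo fun y hy => ?_
    rw [e _ _ (sub_pos.2 hy.2) hy.1]
  have e2 : ∀ f : ℝ → ℝ, ∫ y in Ioi (0 : ℝ), kernel ε W x y * f y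
      = ∫ y in Ioi (0 : ℝ), kernel ε (posKernel W) x y * f y := by
    intro f
    refine setIntegral_congr_fun measurableSet_Ioi fun y hy => ?_
    rw [e _ _ hx hy]
  rw [coag, coag, e1, e2, e2]

theorem IsProfile.isStationaryPair {ε : ℝ} (hε : 0 ≤ ε) {W : ℝ → ℝ → ℝ} (hW : IsPerturbation W)
    {G : ℝ → ℝ} (hG : IsProfile (kernel ε W) G) :
    IsStationaryPair G (coag (kernel ε (posKernel W)) G G) := by
  refine isStationaryPair_of_mild hG.memL1k
    ((hW.isBoundedKernel_kernel hε).memL1k_coag zero_le_one hG.memL1k hG.memL1k) fun t ht => ?_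
  filter_upwards [hG.stationary t ht, ae_pos] with x hx h0
  rw [hx]
  congr 1
  refine intervalIntegral.integral_congr fun s _ => ?_
  simp only [scalingSemigroup]
  rw [coag_kernel_posKernel _ _ _ _ (by positivity)]

theorem coag_kernel_eq {ε : ℝ} {W : ℝ → ℝ → ℝ} (hW : IsBoundedKernel 1 W) {k : ℝ} (hk : 0 ≤ k)
    {g h : ℝ → ℝ} (hg : MemL1k k g) (hh : MemL1k k h) :
    coag (kernel ε W) g h =ᵐ[posMeasure] fun x => coag kernelZero g h x + ε * coag W g h x := by
  obtain ⟨g', hgm, hgg⟩ := hg.exists_measurable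
  have hg' := (memL1k_congr hgg).1 hg
  have hr := EventuallyEq.refl (ae posMeasure) h
  filter_upwards [coag_congr (kernel ε W) hgg hr, coag_congr kernelZero hgg hr,
    coag_congr W hgg hr, ae_pos,
    ae_integrable_kernel hk (measurable_gainKernel isBoundedKernel_kernelZero.measurable hgm)
      (fun y hy => isBoundedKernel_kernelZero.normL1k_gainKernel_le hk hg' hy) hh,
    ae_integrable_kernel hk (measurable_gainKernel hW.measurable hgm)
      (fun y hy => hW.normL1k_gainKernel_le hk hg' hy) hh] with x e1 e2 e3 hx i1 i2
  have a1 : kernelOp (gainKernel (kernel ε W) g') h x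
      = kernelOp (gainKernel kernelZero g') h x + ε * kernelOp (gainKernel W g') h x := by
    simp only [kernelOp]
    rw [← integral_const_mul, ← integral_add i1 (i2.const_mul ε)]
    refine integral_congr_ae (ae_of_all _ fun y => ?_)
    simp only [gainKernel, shift, kernel, kernelZero]
    split_ifs <;> ring
  have a2 : ∀ f : ℝ → ℝ, MemL1k k f → kernelOp (kernel ε W) f x
      = kernelOp kernelZero f x + ε * kernelOp W f x := by
    intro f hf
    simp only [kernelOp]
    rw [← integral_const_mul, ← integral_add (isBoundedKernel_kernelZero.integrable_mul hk hf x)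
      ((hW.integrable_mul hk hf x).const_mul ε)]
    refine integral_congr_ae (ae_of_all _ fun y => ?_)
    simp only [kernel, kernelZero]
    ring
  rw [e1, e2, e3, coag_eq _ _ _ hx, coag_eq _ _ _ hx, coag_eq _ _ _ hx, a1, a2 h hh, a2 g' hg']
  ring

/-! ### Consequences of stationarity -/

theorem integral_bounded_swap {β : ℝ} {ψ h : ℝ → ℝ} {b : ℝ → ℝ → ℝ}
    (hb : Measurable (Function.uncurry b)) (hβ : ∀ x y, |b x y| ≤ β)
    (hψ : Integrable ψ posMeasure) (hh : Integrable h posMeasure) :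
    ∫ x in Ioi 0, ψ x * ∫ y in Ioi 0, b x y * h y
      = ∫ y in Ioi 0, (∫ x in Ioi 0, ψ x * b x y) * h y := by
  have hint : Integrable (Function.uncurry fun x y => ψ x * (b x y * h y))
      (posMeasure.prod posMeasure) := by
    refine ((hψ.mul_prod hh).bdd_mul (c := β) hb.aestronglyMeasurable
      (ae_of_all _ fun p => hβ p.1 p.2)).congr (ae_of_all _ fun p => ?_)
    simp only [Function.uncurry]
    ring
  have h1 := integral_integral_swap hint
  simp only [integral_const_mul] at h1
  rw [h1]
  refine integral_congr_ae (ae_of_all _ fun y => ?_)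
  simp only
  rw [← integral_mul_const]
  exact integral_congr_ae (ae_of_all _ fun x => by ring)

theorem measurable_lt_indicator :
    Measurable (Function.uncurry fun x y : ℝ => if x < y then (1 : ℝ) else 0) :=
  Measurable.ite (measurableSet_lt measurable_fst measurable_snd) measurable_const measurable_const

theorem integral_ite_lt (r : ℝ → ℝ) {x : ℝ} (hx : 0 ≤ x) :
    ∫ y in Ioi 0, (if x < y then (1 : ℝ) else 0) * r y = ∫ y in Ioi x, r y := by
  have : ∀ y, (if x < y then (1 : ℝ) else 0) * r y = (Ioi x).indicator r y := by
    intro y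
    by_cases h : x < y <;> simp [indicator, h]
  simp only [this]
  rw [integral_indicator measurableSet_Ioi, Measure.restrict_restrict measurableSet_Ioi,
    Ioi_inter_Ioi, sup_eq_left.2 hx]

theorem integral_ite_gt (r : ℝ → ℝ) {y : ℝ} (hy : 0 ≤ y) :
    ∫ x in Ioi 0, r x * (if x < y then (1 : ℝ) else 0) = ∫ x in (0 : ℝ)..y, r x := by
  have : ∀ x, r x * (if x < y then (1 : ℝ) else 0) = (Iio y).indicator r x := by
    intro x
    by_cases h : x < y <;> simp [indicator, h]
  simp only [this]
  rw [integral_indicator measurableSet_Iio, Measure.restrict_restrict measurableSet_Iio,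
    intervalIntegral.integral_of_le hy, integral_Ioc_eq_integral_Ioo, inter_comm, Ioi_inter_Iio]

/-- Testing the integrated equation with `ψ` and applying Fubini moves a primitive of `ψ` onto `y
q(y)`. -/
theorem IsStationaryPair.integral_mul {h q : ℝ → ℝ} (H : IsStationaryPair h q) (hq : MemL1k 1 q)
    {ψ : ℝ → ℝ} (hψ : Integrable ψ posMeasure) :
    ∫ x in Ioi 0, ψ x * (x ^ 2 * h x) = ∫ y in Ioi 0, (∫ x in (0 : ℝ)..y, ψ x) * (y * q y) := by
  have h1 := integral_bounded_swap (β := 1) measurable_lt_indicator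
    (fun x y => by split_ifs <;> simp) hψ (hq.integrable_id_mul le_rfl)
  have e1 : ∫ x in Ioi 0, ψ x * (x ^ 2 * h x)
      = ∫ x in Ioi 0, ψ x * ∫ y in Ioi 0, (if x < y then (1 : ℝ) else 0) * (y * q y) := by
    refine integral_congr_ae ?_
    filter_upwards [H, ae_pos] with x hx h0
    rw [hx, integral_ite_lt (fun y => y * q y) h0.le]
  rw [e1, h1]
  refine setIntegral_congr_fun measurableSet_Ioi fun y hy => ?_
  rw [integral_ite_gt _ (le_of_lt hy)]

theorem integrableOn_Ioi_inv_pow {n : ℕ} (hn : 2 ≤ n) {x : ℝ} (hx : 0 < x) :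
    IntegrableOn (fun z : ℝ => (z ^ n)⁻¹) (Ioi x) := by
  have h := integrableOn_Ioi_rpow_of_lt (a := -(n : ℝ))
    (by have : (2 : ℝ) ≤ n := by exact_mod_cast hn
        linarith) hx
  refine h.congr_fun (fun z hz => ?_) measurableSet_Ioi
  have : 0 < z := hx.trans hz
  simp only
  rw [Real.rpow_neg this.le, Real.rpow_natCast]

theorem integrable_indicator_inv_pow {n : ℕ} (hn : 2 ≤ n) {x : ℝ} (hx : 0 < x) :
    Integrable ((Ioi x).indicator fun z : ℝ => (z ^ n)⁻¹) posMeasure :=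
  ((integrable_indicator_iff measurableSet_Ioi).2 (integrableOn_Ioi_inv_pow hn hx)).restrict

theorem intervalIntegral_indicator_Ioi (r : ℝ → ℝ) {x y : ℝ} (hx : 0 ≤ x) (hxy : x ≤ y) :
    ∫ z in (0 : ℝ)..y, (Ioi x).indicator r z = ∫ z in x..y, r z := by
  rw [intervalIntegral.integral_of_le (hx.trans hxy), intervalIntegral.integral_of_le hxy,
    integral_indicator measurableSet_Ioi, Measure.restrict_restrict measurableSet_Ioi]
  congr 2
  ext z
  simp only [mem_inter_iff, mem_Ioi, mem_Ioc]
  constructor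
  · rintro ⟨h1, _, h3⟩
    exact ⟨h1, h3⟩
  · rintro ⟨h1, h3⟩
    exact ⟨h1, hx.trans_lt h1, h3⟩

theorem intervalIntegral_indicator_Ioi_of_le (r : ℝ → ℝ) {x y : ℝ} (hy : 0 ≤ y) (hxy : y ≤ x) :
    ∫ z in (0 : ℝ)..y, (Ioi x).indicator r z = 0 := by
  rw [intervalIntegral.integral_of_le hy, integral_indicator measurableSet_Ioi,
    Measure.restrict_restrict measurableSet_Ioi]
  have : Ioi x ∩ Ioc 0 y = ∅ := by
    ext z
    simp only [mem_inter_iff, mem_Ioi, mem_Ioc, mem_empty_iff_false, iff_false]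
    rintro ⟨h1, _, h3⟩
    linarith
  rw [this, setIntegral_empty]

theorem integral_inv_sq {x y : ℝ} (hx : 0 < x) (hxy : x ≤ y) :
    ∫ z in x..y, (z ^ 2)⁻¹ = x⁻¹ - y⁻¹ := by
  have h0 : ∀ z ∈ uIcc x y, z ≠ 0 := fun z hz => by
    rw [uIcc_of_le hxy] at hz
    exact (hx.trans_le hz.1).ne'
  rw [intervalIntegral.integral_eq_sub_of_hasDerivAt (f := fun z => -z⁻¹)]
  · ring
  · intro z hz
    have := (hasDerivAt_inv (h0 z hz)).neg
    rw [neg_neg] at this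
    exact this
  · exact (ContinuousOn.inv₀ (by fun_prop) fun z hz => pow_ne_zero _ (h0 z hz)).intervalIntegrable

/-- The test function `z⁻²` on `(x, ∞)` removes the factor `z²`, and its primitive `1/x - 1/y` times
`x y` is `y - x`. -/
theorem IsStationaryPair.tail {h q : ℝ → ℝ} (H : IsStationaryPair h q) (hq : MemL1k 1 q) {x : ℝ}
    (hx : 0 < x) : x * ∫ y in Ioi x, h y = ∫ y in Ioi 0, max (y - x) 0 * q y := by
  have h1 := H.integral_mul hq (integrable_indicator_inv_pow le_rfl hx)
  have e1 : ∫ z in Ioi 0, (Ioi x).indicator (fun z : ℝ => (z ^ 2)⁻¹) z * (z ^ 2 * h z)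
      = ∫ y in Ioi x, h y := by
    rw [← integral_ite_lt h hx.le]
    refine setIntegral_congr_fun measurableSet_Ioi fun z hz => ?_
    have hz : z ≠ 0 := (show (0 : ℝ) < z from hz).ne'
    by_cases hxz : x < z
    · simp only [indicator, mem_Ioi, hxz, if_true]
      field_simp
    · simp [indicator, hxz]
  rw [← e1, h1, ← integral_const_mul]
  refine setIntegral_congr_fun measurableSet_Ioi fun y hy => ?_
  have hy : 0 < y := hy
  rcases le_total x y with hxy | hxy
  · rw [intervalIntegral_indicator_Ioi _ hx.le hxy, integral_inv_sq hx hxy,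
      max_eq_left (sub_nonneg.2 hxy)]
    field_simp
  · rw [intervalIntegral_indicator_Ioi_of_le _ hy.le hxy, max_eq_right (sub_nonpos.2 hxy)]
    ring

/-! ### Orbits of strongly continuous semigroups -/

namespace IsC0Semigroup

variable {X : Type*} [NormedAddCommGroup X] [NormedSpace ℝ X] {S : ℝ → X →L[ℝ] X}

/-- If the norms were unbounded near `0`, times `t n → 0` with `‖S (t n)‖ → ∞` would contradict
Banach–Steinhaus, as orbits converge along them. -/
theorem exists_bound_near [CompleteSpace X] (hS : IsC0Semigroup S) :
    ∃ δ M : ℝ, 0 < δ ∧ 1 ≤ M ∧ ∀ t, 0 ≤ t → t ≤ δ → ‖S t‖ ≤ M := by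
  by_contra! hcon
  have h1 : ∀ n : ℕ, ∃ t : ℝ, 0 ≤ t ∧ t ≤ ((n : ℝ) + 1)⁻¹ ∧ (n : ℝ) + 1 < ‖S t‖ := by
    intro n
    obtain ⟨t, h1, h2, h3⟩ := hcon ((n : ℝ) + 1)⁻¹ (n + 1) (by positivity)
      (by linarith [(Nat.cast_nonneg n : (0 : ℝ) ≤ n)])
    exact ⟨t, h1, h2, h3⟩
  choose t ht0 ht1 ht2 using h1
  have htp : ∀ n, 0 < t n := by
    intro n
    refine (ht0 n).lt_of_ne fun h => ?_
    have h2 := ht2 n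
    rw [← h, hS.zero] at h2
    have := ContinuousLinearMap.norm_id_le (𝕜 := ℝ) (E := X)
    linarith [(Nat.cast_nonneg n : (0 : ℝ) ≤ n)]
  have hlim : Tendsto t atTop (𝓝[>] 0) := by
    refine tendsto_nhdsWithin_iff.2 ⟨?_, Eventually.of_forall htp⟩
    refine squeeze_zero ht0 ht1 ?_
    simpa using tendsto_one_div_add_atTop_nhds_zero_nat (𝕜 := ℝ)
  obtain ⟨C, hC⟩ := banach_steinhaus (g := fun n => S (t n)) fun x => by
    obtain ⟨C, hC⟩ := ((hS.tendsto x).comp hlim).norm.bddAbove_range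
    exact ⟨C, fun n => hC ⟨n, rfl⟩⟩
  obtain ⟨n, hn⟩ := exists_nat_gt C
  have := ht2 n
  have := hC n
  linarith

theorem exists_bound [CompleteSpace X] (hS : IsC0Semigroup S) (T : ℝ) :
    ∃ M : ℝ, 0 ≤ M ∧ ∀ t, 0 ≤ t → t ≤ T → ‖S t‖ ≤ M := by
  obtain ⟨δ, M, hδ, hM, h⟩ := hS.exists_bound_near
  have key : ∀ n : ℕ, ∀ t, 0 ≤ t → t ≤ n * δ → ‖S t‖ ≤ M ^ n := by
    intro n
    induction n with
    | zero =>
      intro t h0 h1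
      have : t = 0 := le_antisymm (by simpa using h1) h0
      rw [this, hS.zero, pow_zero]
      exact ContinuousLinearMap.norm_id_le
    | succ n ih =>
      intro t h0 h1
      push_cast at h1
      rcases le_total t δ with h2 | h2
      · exact (h t h0 h2).trans (le_self_pow₀ hM (Nat.succ_ne_zero n))
      · have e : t = (t - δ) + δ := by ring
        rw [e, hS.add _ _ (sub_nonneg.2 h2) hδ.le, pow_succ]
        refine (ContinuousLinearMap.opNorm_comp_le _ _).trans ?_
        have h3 := ih (t - δ) (sub_nonneg.2 h2) (by linarith)
        have h4 := h δ hδ.le le_rfl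
        exact mul_le_mul h3 h4 (norm_nonneg _) (by positivity)
  obtain ⟨n, hn⟩ := exists_nat_gt (T / δ)
  refine ⟨M ^ n, by positivity, fun t h0 h1 => key n t h0 (h1.trans ?_)⟩
  rw [div_lt_iff₀ hδ] at hn
  exact hn.le

theorem continuousOn [CompleteSpace X] (hS : IsC0Semigroup S) (u : X) :
    ContinuousOn (fun t => S t u) (Ici 0) := by
  have h0 : ∀ η : ℝ, 0 < η → ∃ d, 0 < d ∧ ∀ t, 0 ≤ t → t < d → ‖S t u - u‖ < η := by
    intro η hη
    obtain ⟨d, hd, h⟩ := Metric.nhdsWithin_basis_ball.mem_iff.1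
      (Metric.tendsto_nhds.1 (hS.tendsto u) η hη)
    refine ⟨d, hd, fun t ht0 htd => ?_⟩
    rcases ht0.eq_or_lt with rfl | ht
    · rw [hS.zero]
      simpa using hη
    · rw [← dist_eq_norm]
      exact h ⟨by simpa [abs_of_pos ht] using htd, ht⟩
  rw [Metric.continuousOn_iff]
  intro s hs η hη
  have hs : 0 ≤ s := hs
  obtain ⟨M, hM, hb⟩ := hS.exists_bound (s + 1)
  obtain ⟨d, hd, h⟩ := h0 (η / (M + 1)) (by positivity)
  have key : ∀ a b : ℝ, 0 ≤ a → a ≤ b → a ≤ s + 1 → b - a < d → ‖S b u - S a u‖ < η := by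
    intro a b ha hab has hbd
    have e : S b u - S a u = S a (S (b - a) u - u) := by
      rw [map_sub]
      congr 1
      have : S b = (S a).comp (S (b - a)) := by
        rw [← hS.add a (b - a) ha (sub_nonneg.2 hab)]
        congr 1
        ring
      rw [this]
      rfl
    rw [e]
    have h1 := (S a).le_opNorm (S (b - a) u - u)
    have h2 := hb a ha has
    have h3 := h (b - a) (sub_nonneg.2 hab) hbd
    rw [lt_div_iff₀ (by positivity)] at h3
    have h4 := norm_nonneg (S (b - a) u - u)
    rcases h4.eq_or_lt with h5 | h5
    · rw [← h5, mul_zero] at h1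
      linarith
    · nlinarith
  refine ⟨min d 1, lt_min hd one_pos, fun t ht htd => ?_⟩
  have ht : 0 ≤ t := ht
  rw [Real.dist_eq] at htd
  have h1 := htd.trans_le (min_le_left d 1)
  have h2 := htd.trans_le (min_le_right d 1)
  rw [abs_lt] at h1 h2
  rw [dist_eq_norm]
  rcases le_total s t with hst | hst
  · exact key s t hs hst (by linarith) (by linarith)
  · rw [← norm_neg, neg_sub]
    exact key t s ht hst (by linarith) (by linarith)

/-- The generator is a one-sided limit at `0`, so the semigroup law directly gives a right
derivative, which is all that the mean value inequality below requires. -/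
theorem hasDerivWithinAt (hS : IsC0Semigroup S) {u v : X} (h : IsGeneratorValue S u v) {s : ℝ}
    (hs : 0 ≤ s) : HasDerivWithinAt (fun t => S t u) (S s v) (Ici s) s := by
  rw [← hasDerivWithinAt_Ioi_iff_Ici, hasDerivWithinAt_iff_tendsto_slope' self_notMem_Ioi]
  have h1 := ((S s).continuous.tendsto v).comp h
  have h2 : Tendsto (fun t => t - s) (𝓝[>] s) (𝓝[>] 0) := by
    refine tendsto_nhdsWithin_iff.2 ⟨?_, ?_⟩
    · have : Tendsto (fun t : ℝ => t - s) (𝓝 s) (𝓝 (s - s)) := by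
        exact (continuous_id.sub continuous_const).tendsto s
      rw [sub_self] at this
      exact this.mono_left nhdsWithin_le_nhds
    · filter_upwards [self_mem_nhdsWithin] with t ht
      exact sub_pos.2 (mem_Ioi.1 ht)
  refine (h1.comp h2).congr' ?_
  filter_upwards [self_mem_nhdsWithin] with t ht
  have ht : s < t := ht
  have e : S t = (S s).comp (S (t - s)) := by
    rw [← hS.add s (t - s) hs (sub_nonneg.2 ht.le)]
    congr 1
    ring
  simp only [Function.comp, slope, vsub_eq_sub]
  rw [map_smul, map_sub, e]
  rfl

/-- Formally `u = -∫₀^∞ S_t v dt`, and `∫₀^∞ C e^{-t/2} dt = 2 C`. -/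
theorem norm_le_of_decay [CompleteSpace X] (hS : IsC0Semigroup S) {u v : X}
    (h : IsGeneratorValue S u v) {C : ℝ}
    (hu : ∀ t, 0 ≤ t → ‖S t u‖ ≤ C * Real.exp (-(1 / 2) * t) * ‖u‖)
    (hv : ∀ t, 0 ≤ t → ‖S t v‖ ≤ C * Real.exp (-(1 / 2) * t) * ‖v‖) : ‖u‖ ≤ 2 * C * ‖v‖ := by
  have key : ∀ T : ℝ, 0 ≤ T → ‖u‖ ≤ C * ‖u‖ * Real.exp (-(1 / 2) * T)
      + 2 * C * ‖v‖ * (1 - Real.exp (-(1 / 2) * T)) := by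
    intro T hT
    -- The mean value inequality replaces vector-valued integration: the boundary function is the
    -- primitive of the decay bound for `‖S_t v‖`.
    have h1 := image_norm_le_of_norm_deriv_right_le_deriv_boundary (a := 0) (b := T)
      (f := fun t => S t u - u) (f' := fun t => S t v)
      (B := fun t => 2 * C * ‖v‖ * (1 - Real.exp (-(1 / 2) * t)))
      (B' := fun t => C * Real.exp (-(1 / 2) * t) * ‖v‖)
      (((hS.continuousOn u).mono Icc_subset_Ici_self).sub continuousOn_const)
      (fun t ht => (hS.hasDerivWithinAt h ht.1).sub_const u)
      (by simp [hS.zero])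
      (fun t => by
        have := ((((hasDerivAt_id t).const_mul (-(1 / 2) : ℝ)).exp).const_sub 1).const_mul
          (2 * C * ‖v‖)
        convert! this using 1
        simp only [id]
        ring)
      (fun t ht => hv t ht.1) (right_mem_Icc.2 hT)
    have h2 := hu T hT
    have h3 : ‖u‖ ≤ ‖S T u‖ + ‖S T u - u‖ := by
      have := norm_sub_le (S T u) (S T u - u)
      rwa [sub_sub_cancel] at this
    linarith
  have hlim : Tendsto (fun T : ℝ => Real.exp (-(1 / 2) * T)) atTop (𝓝 0) := by
    refine Real.tendsto_exp_atBot.comp ?_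
    exact tendsto_id.const_mul_atTop_of_neg (by norm_num)
  have h2 := (hlim.const_mul (C * ‖u‖)).add ((hlim.const_sub 1).const_mul (2 * C * ‖v‖))
  rw [mul_zero, zero_add, sub_zero, mul_one] at h2
  refine ge_of_tendsto h2 ?_
  filter_upwards [eventually_ge_atTop 0] with T hT
  exact key T hT

end IsC0Semigroup

/-! ### Stationary pairs and the generator of the dilation semigroup -/

theorem normL1k_mean_scaling_sub_le {k : ℝ} {q : ℝ → ℝ} (hq : Measurable q) {t : ℝ} (ht : 0 < t)
    {c : ℝ≥0∞} (hb : ∀ s, 0 < s → s ≤ t →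
      normL1k k (fun x => Real.exp (2 * s) * q (Real.exp s * x) - q x) ≤ c) :
    normL1k k (fun x => t⁻¹ * (∫ s in (0 : ℝ)..t, Real.exp (2 * s) * q (Real.exp s * x)) - q x)
      ≤ c := by
  have hm : Measurable (Function.uncurry fun x s : ℝ =>
      Real.exp (2 * s) * q (Real.exp s * x) - q x) := by
    unfold Function.uncurry
    fun_prop
  have h1 : ∀ x ∈ Ioi (0 : ℝ),
      ‖t⁻¹ * (∫ s in (0 : ℝ)..t, Real.exp (2 * s) * q (Real.exp s * x)) - q x‖ₑ * weight k x
      ≤ ENNReal.ofReal t⁻¹ *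
        ∫⁻ s in Ioc 0 t, ‖Real.exp (2 * s) * q (Real.exp s * x) - q x‖ₑ * weight k x := by
    intro x hx
    rw [lintegral_mul_const' _ _ (weight_ne_top k x), ← mul_assoc]
    gcongr
    have hmx : Measurable fun s => Real.exp (2 * s) * q (Real.exp s * x) - q x :=
      hm.of_uncurry_left (x := x)
    -- If the time integral on the right is infinite the bound is trivial; otherwise it supplies the
    -- integrability needed to subtract `q x` inside the integral.
    by_cases htop : ∫⁻ s in Ioc 0 t, ‖Real.exp (2 * s) * q (Real.exp s * x) - q x‖ₑ = ⊤
    · rw [htop, ENNReal.mul_top (by simpa using ht)]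
      exact le_top
    · have hi : IntegrableOn (fun s => Real.exp (2 * s) * q (Real.exp s * x) - q x) (Ioc 0 t) :=
        ⟨hmx.aestronglyMeasurable, lt_top_iff_ne_top.2 htop⟩
      have e : t⁻¹ * (∫ s in (0 : ℝ)..t, Real.exp (2 * s) * q (Real.exp s * x)) - q x
          = t⁻¹ * ∫ s in Ioc 0 t, (Real.exp (2 * s) * q (Real.exp s * x) - q x) := by
        have hc : IntegrableOn (fun _ : ℝ => q x) (Ioc 0 t) := by simp
        have h2 := integral_add hi hc
        simp only [sub_add_cancel, setIntegral_const, measureReal_def, Real.volume_Ioc,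
          sub_zero, ENNReal.toReal_ofReal ht.le, smul_eq_mul] at h2
        rw [intervalIntegral.integral_of_le ht.le, h2, mul_add, inv_mul_cancel_left₀ ht.ne',
          add_sub_cancel_right]
      rw [e, enorm_mul, Real.enorm_of_nonneg (by positivity)]
      gcongr
      exact enorm_integral_le_lintegral_enorm _
  calc normL1k k (fun x => t⁻¹ * (∫ s in (0 : ℝ)..t,
        Real.exp (2 * s) * q (Real.exp s * x)) - q x)
      = ∫⁻ x in Ioi 0, ‖t⁻¹ * (∫ s in (0 : ℝ)..t, Real.exp (2 * s) * q (Real.exp s * x))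
          - q x‖ₑ * weight k x := normL1k_eq _ _
    _ ≤ ∫⁻ x in Ioi 0, ENNReal.ofReal t⁻¹ *
        ∫⁻ s in Ioc 0 t, ‖Real.exp (2 * s) * q (Real.exp s * x) - q x‖ₑ * weight k x :=
        setLIntegral_mono' measurableSet_Ioi h1
    _ = ENNReal.ofReal t⁻¹ * ∫⁻ x in Ioi 0,
        ∫⁻ s in Ioc 0 t, ‖Real.exp (2 * s) * q (Real.exp s * x) - q x‖ₑ * weight k x :=
        lintegral_const_mul' _ _ ENNReal.ofReal_ne_top
    _ = ENNReal.ofReal t⁻¹ * ∫⁻ s in Ioc 0 t,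
        ∫⁻ x in Ioi 0, ‖Real.exp (2 * s) * q (Real.exp s * x) - q x‖ₑ * weight k x := by
        rw [lintegral_lintegral_swap]
        exact (hm.enorm.mul ((measurable_weight k).comp measurable_fst)).aemeasurable
    _ ≤ ENNReal.ofReal t⁻¹ * ∫⁻ _ in Ioc 0 t, c := by
        gcongr ENNReal.ofReal t⁻¹ * ?_
        refine setLIntegral_mono' measurableSet_Ioc fun s hs => ?_
        rw [← normL1k_eq]
        exact hb s hs.1 hs.2
    _ = c := by
        rw [setLIntegral_const, Real.volume_Ioc, sub_zero, mul_comm c, ← mul_assoc,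
          ← ENNReal.ofReal_mul (by positivity), inv_mul_cancel₀ ht.ne', ENNReal.ofReal_one, one_mul]

theorem IsStationaryPair.dilate_eq {h q : ℝ → ℝ} (H : IsStationaryPair h q) (hq : MemL1k 1 q)
    {t : ℝ} (ht : 0 ≤ t) : ∀ᵐ x ∂posMeasure, h x - Real.exp (2 * t) * dilate (Real.exp t) h x
      = ∫ s in (0 : ℝ)..t, Real.exp (2 * s) * q (Real.exp s * x) := by
  have H' := (quasiMeasurePreserving_mul (Real.exp_pos t)).ae H
  filter_upwards [H, H', ae_pos] with x h1 h2 hx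
  have h3 := integral_scaling q hx ht
  have hle : x ≤ Real.exp t * x := by nlinarith [Real.one_le_exp ht]
  have hi := hq.integrable_id_mul le_rfl
  have e3 : ∫ y in Ioi x, y * q y = (∫ y in Ioc x (Real.exp t * x), y * q y)
      + ∫ y in Ioi (Real.exp t * x), y * q y := by
    rw [← Ioc_union_Ioi_eq_Ioi hle]
    exact setIntegral_union (Ioc_disjoint_Ioi le_rfl) measurableSet_Ioi
      ((integrableOn_Ioi_of_pos hi hx.le).mono_set Ioc_subset_Ioi_self)
      (integrableOn_Ioi_of_pos hi (by positivity))
  have hx2 : x ^ 2 ≠ 0 := by positivity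
  apply mul_left_cancel₀ hx2
  rw [h3, dilate, two_mul t, Real.exp_add]
  linarith

/-- Formally `2 h + x h' + q = 0`, that is, `x h' = -q - 2 h`. The integrated equation shows that
`t⁻¹ (h - e^{2t} D_t h)` is the mean of `e^{2s} q(e^s ·)` over `[0, t]`, which tends to `q` in
`L¹_k`; the factor `e^{2t}` is then removed. -/
theorem IsStationaryPair.isGeneratorValue {k : ℝ} (hk : 1 ≤ k) {h q : ℝ → ℝ}
    (H : IsStationaryPair h q) (hh : MemL1k k h) (hq : MemL1k k q) :
    IsGeneratorValue (dilationSemigroup (zero_le_one.trans hk)) hh.toL1k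
      (-hq.toL1k - (2 : ℝ) • hh.toL1k) := by
  wlog hqm : Measurable q generalizing q
  · obtain ⟨q', hqm, hqq⟩ := hq.exists_measurable
    have hq' := (memL1k_congr hqq).1 hq
    have h1 := this (H.congr (EventuallyEq.refl _ _) hqq) hq' hqm
    have e : hq.toL1k = hq'.toL1k :=
      L1k.ext_pos ((hq.coeFn_toL1k.trans hqq).trans hq'.coeFn_toL1k.symm)
    rw [e]
    exact h1
  have hk0 : 0 ≤ k := zero_le_one.trans hk
  set u := hh.toL1k with hu
  set w := hq.toL1k with hw
  set D := dilationSemigroup hk0 with hD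
  have hJ : Tendsto (fun t : ℝ => t⁻¹ • (u - Real.exp (2 * t) • D t u)) (𝓝[>] 0) (𝓝 w) := by
    rw [Metric.tendsto_nhds]
    intro η hη
    have h1 : Tendsto (fun t : ℝ => Real.exp (2 * t) • D t w) (𝓝[>] 0) (𝓝 w) := by
      have h2 : Tendsto (fun t : ℝ => Real.exp (2 * t)) (𝓝[>] 0) (𝓝 1) := by
        have h3 : Continuous fun t : ℝ => Real.exp (2 * t) := by fun_prop
        have := h3.tendsto 0
        simp only [mul_zero, Real.exp_zero] at this
        exact tendsto_nhdsWithin_of_tendsto_nhds this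
      have := h2.smul (tendsto_dilationSemigroup hk0 w)
      rwa [one_smul] at this
    obtain ⟨t₁, ht₁, h1'⟩ := mem_nhdsGT_iff_exists_Ioc_subset.1
      (Metric.tendsto_nhds.1 h1 (η / 2) (by positivity))
    filter_upwards [Ioc_mem_nhdsGT ht₁] with t ht
    have hb : ∀ s, 0 < s → s ≤ t →
        normL1k k (fun x => Real.exp (2 * s) * q (Real.exp s * x) - q x)
          ≤ ENNReal.ofReal (η / 2) := by
      intro s hs hst
      have h2 : dist (Real.exp (2 * s) • D s w) w < η / 2 := h1' ⟨hs, hst.trans ht.2⟩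
      rw [dist_eq_norm] at h2
      refine le_trans (le_of_eq ?_) (ENNReal.ofReal_le_ofReal h2.le)
      rw [← L1k.normL1k_eq_ofReal]
      refine normL1k_congr ?_
      filter_upwards [L1k.coeFn_sub' (Real.exp (2 * s) • D s w) w,
        L1k.coeFn_smul' (Real.exp (2 * s)) (D s w), hq.coeFn_toL1k,
        dilationSemigroup_coeFn hk0 hs.le hq.coeFn_toL1k] with x g1 g2 g3 g4
      rw [g1, g2, g3, g4, dilate]
    have h3 := normL1k_mean_scaling_sub_le hqm ht.1 hb
    rw [dist_eq_norm]
    refine lt_of_le_of_lt (L1k.norm_le_of_normL1k_le (by positivity) ?_) (half_lt_self hη)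
    refine le_trans (le_of_eq (normL1k_congr ?_)) h3
    filter_upwards [L1k.coeFn_sub' (t⁻¹ • (u - Real.exp (2 * t) • D t u)) w,
      L1k.coeFn_smul' t⁻¹ (u - Real.exp (2 * t) • D t u),
      L1k.coeFn_sub' u (Real.exp (2 * t) • D t u), L1k.coeFn_smul' (Real.exp (2 * t)) (D t u),
      hq.coeFn_toL1k, hh.coeFn_toL1k, dilationSemigroup_coeFn hk0 ht.1.le hh.coeFn_toL1k,
      H.dilate_eq (hq.mono hk) ht.1.le] with x g1 g2 g3 g4 g5 g6 g7 g8
    rw [g1, g2, g3, g4, g5, g6, g7, g8]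
  have hE : Tendsto (fun t : ℝ => Real.exp (-2 * t)) (𝓝[>] 0) (𝓝 1) := by
    have h3 : Continuous fun t : ℝ => Real.exp (-2 * t) := by fun_prop
    have := h3.tendsto 0
    simp only [mul_zero, Real.exp_zero] at this
    exact tendsto_nhdsWithin_of_tendsto_nhds this
  have hE' : Tendsto (fun t : ℝ => t⁻¹ * (Real.exp (-2 * t) - 1)) (𝓝[>] 0) (𝓝 (-2)) := by
    have h3 : HasDerivAt (fun t : ℝ => Real.exp (-2 * t)) (-2) 0 := by
      have := ((hasDerivAt_id (0 : ℝ)).const_mul (-2)).exp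
      simpa using! this
    have := h3.tendsto_slope_zero_right
    simpa using this
  -- This uses `t⁻¹ (D_t u - u) = t⁻¹ (e^{-2t} - 1) u - e^{-2t} t⁻¹ (u - e^{2t} D_t u)`.
  have := (hE'.smul_const u).sub (hE.smul hJ)
  rw [one_smul] at this
  have e : -w - (2 : ℝ) • u = (-2 : ℝ) • u - w := by module
  rw [e]
  refine this.congr fun t => ?_
  have e2 : Real.exp (-2 * t) * Real.exp (2 * t) = 1 := by
    rw [← Real.exp_add]
    simp
  have e3 : Real.exp (-2 * t) • t⁻¹ • (u - Real.exp (2 * t) • D t u)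
      = t⁻¹ • (Real.exp (-2 * t) • u - (Real.exp (-2 * t) * Real.exp (2 * t)) • D t u) := by
    module
  rw [e3, e2]
  module

/-! ### The inverse of the linearised operator -/

theorem memL1k_profileZero (k : ℝ) : MemL1k k profileZero := by
  have := memL1k_pow_mul_exp k 0 one_pos
  simp only [pow_zero, one_mul] at this
  exact this

theorem integral_id_mul_profileZero : ∫ x in Ioi (0 : ℝ), x * profileZero x = 1 := by
  have h1 := Real.Gamma_eq_integral (s := 2) two_pos
  rw [Real.Gamma_two] at h1
  rw [h1]
  refine setIntegral_congr_fun measurableSet_Ioi fun x hx => ?_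
  simp only [profileZero]
  norm_num
  ring

/-- A test function within `1/2` of `e^{-x}` in `L¹_1` has mass at least `1/2` and can be
normalised. It serves to correct the mass of approximants. -/
theorem exists_testFunction_mass_one :
    ∃ θ : ℝ → ℝ, IsTestFunction θ ∧ ∫ x in Ioi (0 : ℝ), x * θ x = 1 := by
  obtain ⟨φ, hφ, h⟩ := exists_testFunction_approx zero_le_one (memL1k_profileZero 1)
    (half_pos one_pos)
  have hm := (hφ.memL1k zero_le_one (k := 1))
  have hsub := (memL1k_profileZero 1).sub hm
  have h1 : |∫ x in Ioi (0 : ℝ), x * (profileZero x - φ x)| ≤ 1 / 2 := by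
    refine abs_integral_le_integral_abs.trans ((hsub.integral_abs_mul_le zero_le_one
      (ψ := fun x => x) fun x hx => ?_).trans ?_)
    · rw [abs_of_pos hx, Real.rpow_one]; linarith
    · rw [one_mul]
      exact nrm_le_of_le (by norm_num) h
  have h2 : ∫ x in Ioi (0 : ℝ), x * (profileZero x - φ x) = 1 - ∫ x in Ioi (0 : ℝ), x * φ x := by
    rw [← integral_id_mul_profileZero, ← integral_sub
      ((memL1k_profileZero 1).integrable_id_mul le_rfl) (hm.integrable_id_mul le_rfl)]
    exact integral_congr_ae (ae_of_all _ fun x => by ring)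
  rw [h2, abs_le] at h1
  have hpos : (∫ x in Ioi (0 : ℝ), x * φ x) ≠ 0 := by linarith
  refine ⟨fun x => (∫ x in Ioi (0 : ℝ), x * φ x)⁻¹ * φ x, ⟨contDiff_const.mul hφ.smooth,
    hφ.compact.mul_left, ?_⟩, ?_⟩
  · refine (closure_mono fun x hx => ?_).trans hφ.support
    rw [Function.mem_support] at hx ⊢
    exact right_ne_zero_of_mul hx
  · rw [← inv_mul_cancel₀ hpos, ← integral_const_mul]
    exact integral_congr_ae (ae_of_all _ fun x => by ring)

theorem IsBoundedKernel.integral_id_mul_coag {κ : ℝ} {K : ℝ → ℝ → ℝ} (hK : IsBoundedKernel κ K)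
    {g h : ℝ → ℝ} (hg : MemL1k 1 g) (hh : MemL1k 1 h) :
    ∫ x in Ioi 0, x * coag K g h x = 0 := by
  rw [hK.integral_mul_coag zero_le_one hg hh (ψ := fun x => x) measurable_id zero_le_one
    fun x hx => by rw [abs_of_pos hx, Real.rpow_one]; linarith]
  simp

/-- Conservation of mass: `x (2 φ + x φ')` is the derivative of `x² φ`, and coagulation has zero
first moment. -/
theorem IsTestFunction.integral_id_mul_linearised {φ : ℝ → ℝ} (hφ : IsTestFunction φ) :
    ∫ x in Ioi 0, x * linearised kernelZero profileZero φ x = 0 := by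
  have hm := hφ.memL1k zero_le_one (k := 1)
  have hd := hφ.id_mul_deriv.memL1k zero_le_one (k := 1)
  have hc := isBoundedKernel_kernelZero.memL1k_coag zero_le_one (memL1k_profileZero 1) hm
  have hdiff : ∀ x, HasDerivAt (fun x => x ^ 2 * φ x) (2 * x * φ x + x ^ 2 * deriv φ x) x := by
    intro x
    have h1 : HasDerivAt φ (deriv φ x) x :=
      (hφ.smooth.differentiable (by simp)).differentiableAt.hasDerivAt
    have := (hasDerivAt_pow 2 x).mul h1
    simpa using! this
  have h1 : ∫ x in Ioi 0, (x * (2 * φ x) + x * (x * deriv φ x)) = 0 := by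
    have h2 := HasCompactSupport.integral_Ioi_deriv_eq (f := fun x => x ^ 2 * φ x)
      ((show ContDiff ℝ 1 fun x : ℝ => x ^ 2 by fun_prop).mul
      (hφ.smooth.of_le (by exact_mod_cast le_top))) hφ.compact.mul_left 0
    simp only [ne_eq, OfNat.ofNat_ne_zero, not_false_eq_true, zero_pow, zero_mul, neg_zero] at h2
    refine Eq.trans (integral_congr_ae (ae_of_all _ fun x => ?_)) h2
    simp only
    rw [(hdiff x).deriv]
    ring
  have e : ∀ x, x * linearised kernelZero profileZero φ x
      = (x * (2 * φ x) + x * (x * deriv φ x)) + 2 * (x * coag kernelZero profileZero φ x) := by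
    intro x
    rw [linearised]
    ring
  simp only [e]
  have hi : Integrable (fun x => x * (2 * φ x) + x * (x * deriv φ x)) posMeasure :=
    ((hm.const_mul 2).integrable_id_mul le_rfl).add (hd.integrable_id_mul le_rfl)
  rw [integral_add hi
    ((hc.integrable_id_mul le_rfl).const_mul 2), h1, integral_const_mul,
    isBoundedKernel_kernelZero.integral_id_mul_coag (memL1k_profileZero 1) hm]
  ring

theorem L1k.integral_id_mul_congr {k : ℝ} {u : L1k k} {f : ℝ → ℝ} (h : u =ᵐ[posMeasure] f) :
    ∫ x in Ioi 0, x * u x = ∫ x in Ioi 0, x * f x := by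
  refine integral_congr_ae ?_
  filter_upwards [h] with x hx
  rw [hx]

/-- The semigroup provided by the gap hypothesis need not be compared with the closed form: only its
generator on test functions and its decay on zero mass enter. -/
theorem IsGapConstant.norm_testFunction_le {k C : ℝ} (hk : 0 ≤ k) (hC : IsGapConstant k C)
    {φ : ℝ → ℝ} (hφ : IsTestFunction φ) (h0 : ∫ x in Ioi 0, x * φ x = 0) :
    ‖(hφ.memL1k hk).toL1k‖ ≤ 2 * C * ‖(hφ.id_mul_deriv.memL1k hk).toL1k
      + (2 : ℝ) • expCLM hk one_pos (hφ.memL1k hk).toL1k‖ := by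
  obtain ⟨_, S, hS, hdec⟩ := hC
  obtain ⟨u, v, hu, hv, hgen⟩ := hS.generator_eq φ hφ
  have hu' := aeEq_weighted_iff.1 hu
  have hv' := aeEq_weighted_iff.1 hv
  have e1 : u = (hφ.memL1k hk).toL1k := L1k.ext_pos (hu'.trans (hφ.memL1k hk).coeFn_toL1k.symm)
  have e2 : v = (hφ.id_mul_deriv.memL1k hk).toL1k
      + (2 : ℝ) • expCLM hk one_pos (hφ.memL1k hk).toL1k :=
    L1k.ext_pos (hv'.trans (coeFn_add_two_expCLM hk hφ).symm)
  rw [← e2, ← e1]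
  refine hS.semigroup.norm_le_of_decay hgen (hdec u ?_) (hdec v ?_)
  · rw [L1k.integral_id_mul_congr hu', h0]
  · rw [L1k.integral_id_mul_congr hv', hφ.integral_id_mul_linearised]

theorem IsTestFunction.sub_const_mul {φ θ : ℝ → ℝ} (hφ : IsTestFunction φ) (hθ : IsTestFunction θ)
    (m : ℝ) : IsTestFunction fun x => φ x - m * θ x where
  smooth := hφ.smooth.sub (contDiff_const.mul hθ.smooth)
  compact := hφ.compact.sub hθ.compact.mul_left
  support := by
    refine (tsupport_sub φ fun x => m * θ x).trans (union_subset hφ.support ?_)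
    refine (closure_mono fun x hx => ?_).trans hθ.support
    rw [Function.mem_support] at hx ⊢
    exact right_ne_zero_of_mul hx

theorem MemL1k.abs_integral_id_mul_le {k : ℝ} (hk : 1 ≤ k) {f : ℝ → ℝ} (hf : MemL1k k f) :
    |∫ x in Ioi 0, x * f x| ≤ nrm k f := by
  have h1 := (hf.mono hk).integral_abs_mul_le zero_le_one (ψ := fun x => x) fun x hx => by
    rw [abs_of_pos hx, Real.rpow_one]; linarith
  rw [one_mul] at h1
  exact abs_integral_le_integral_abs.trans (h1.trans (nrm_mono hk hf))

/-- The estimate passes from test functions to the domain of the dilation generator, since test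
functions are a core and `2 P` is bounded. -/
theorem IsGapConstant.norm_le_of_isGeneratorValue {k C : ℝ} (hk : 1 ≤ k) (hC : IsGapConstant k C)
    {u v : L1k k} (h : IsGeneratorValue (dilationSemigroup (zero_le_one.trans hk)) u v)
    (h0 : ∫ x in Ioi 0, x * u x = 0) :
    ‖u‖ ≤ 2 * C * ‖v + (2 : ℝ) • expCLM (zero_le_one.trans hk) one_pos u‖ := by
  have hk0 : 0 ≤ k := zero_le_one.trans hk
  obtain ⟨θ, hθ, hθ1⟩ := exists_testFunction_mass_one
  have hC0 : 0 < C := hC.1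
  set P := expCLM hk0 one_pos with hP
  set a := ‖(hθ.memL1k hk0).toL1k‖ with ha
  set b := ‖(hθ.id_mul_deriv.memL1k hk0).toL1k + (2 : ℝ) • P (hθ.memL1k hk0).toL1k‖ with hb
  have key : ∀ δ : ℝ, 0 < δ → ‖u‖ ≤ 2 * C * ‖v + (2 : ℝ) • P u‖
      + δ * (1 + a + 2 * C * (1 + 2 * ‖P‖ + b)) := by
    intro δ hδ
    obtain ⟨ψ, hψ, h1, h2⟩ := dilation_core hk0 h hδ
    set m := ∫ x in Ioi 0, x * ψ x with hm
    have hψm := hψ.memL1k hk0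
    have hmδ : |m| ≤ δ := by
      have e : m = -∫ x in Ioi 0, x * (u x - ψ x) := by
        have : ∫ x in Ioi 0, x * (u x - ψ x) = (∫ x in Ioi 0, x * u x) - m := by
          rw [hm, ← integral_sub (u.memL1k.integrable_id_mul hk) (hψm.integrable_id_mul hk)]
          exact integral_congr_ae (ae_of_all _ fun x => by ring)
        rw [this, h0]
        ring
      rw [e, abs_neg]
      refine ((u.memL1k.sub hψm).abs_integral_id_mul_le hk).trans ?_
      rw [L1k.norm_sub_toL1k] at h1
      exact h1
    -- The approximant has mass `m` with `|m| ≤ δ`; subtracting `m θ` restores zero mass at a cost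
    -- of order `δ`.
    have hφ := hψ.sub_const_mul hθ m
    have hφ0 : ∫ x in Ioi 0, x * (ψ x - m * θ x) = 0 := by
      have : ∫ x in Ioi 0, x * (ψ x - m * θ x) = m - m * ∫ x in Ioi 0, x * θ x := by
        rw [← integral_const_mul, hm, ← integral_sub (hψm.integrable_id_mul hk)
          (((hθ.memL1k hk0).integrable_id_mul hk).const_mul _)]
        exact integral_congr_ae (ae_of_all _ fun x => by ring)
      rw [this, hθ1]
      ring
    have h3 := hC.norm_testFunction_le hk0 hφ hφ0
    have e1 : (hφ.memL1k hk0).toL1k = hψm.toL1k - m • (hθ.memL1k hk0).toL1k := by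
      refine L1k.ext_pos ?_
      filter_upwards [(hφ.memL1k hk0).coeFn_toL1k, hψm.coeFn_toL1k, (hθ.memL1k hk0).coeFn_toL1k,
        L1k.coeFn_sub' hψm.toL1k (m • (hθ.memL1k hk0).toL1k),
        L1k.coeFn_smul' m (hθ.memL1k hk0).toL1k] with x g1 g2 g3 g4 g5
      rw [g1, g4, g5, g2, g3]
    have e2 : (hφ.id_mul_deriv.memL1k hk0).toL1k = (hψ.id_mul_deriv.memL1k hk0).toL1k
        - m • (hθ.id_mul_deriv.memL1k hk0).toL1k := by
      refine L1k.ext_pos ?_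
      filter_upwards [(hφ.id_mul_deriv.memL1k hk0).coeFn_toL1k,
        (hψ.id_mul_deriv.memL1k hk0).coeFn_toL1k, (hθ.id_mul_deriv.memL1k hk0).coeFn_toL1k,
        L1k.coeFn_sub' (hψ.id_mul_deriv.memL1k hk0).toL1k
          (m • (hθ.id_mul_deriv.memL1k hk0).toL1k),
        L1k.coeFn_smul' m (hθ.id_mul_deriv.memL1k hk0).toL1k] with x g1 g2 g3 g4 g5
      have d1 : HasDerivAt ψ (deriv ψ x) x :=
        (hψ.smooth.differentiable (by simp)).differentiableAt.hasDerivAt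
      have d2 : HasDerivAt θ (deriv θ x) x :=
        (hθ.smooth.differentiable (by simp)).differentiableAt.hasDerivAt
      rw [g1, g4, g5, g2, g3, (d1.fun_sub (d2.const_mul m)).deriv]
      ring
    rw [e1, e2] at h3
    set ψL := hψm.toL1k
    set ψD := (hψ.id_mul_deriv.memL1k hk0).toL1k
    set θL := (hθ.memL1k hk0).toL1k
    set θD := (hθ.id_mul_deriv.memL1k hk0).toL1k
    have e3 : ψD - m • θD + (2 : ℝ) • P (ψL - m • θL) = (v + (2 : ℝ) • P u) - (v - ψD)
        - (2 : ℝ) • P (u - ψL) - m • (θD + (2 : ℝ) • P θL) := by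
      simp only [map_sub, map_smul]
      module
    have e4 : u = (u - ψL) + m • θL + (ψL - m • θL) := by module
    have n1 : ‖ψD - m • θD + (2 : ℝ) • P (ψL - m • θL)‖
        ≤ ‖v + (2 : ℝ) • P u‖ + δ + 2 * (‖P‖ * δ) + δ * b := by
      rw [e3]
      refine (norm_sub_le _ _).trans (add_le_add ((norm_sub_le _ _).trans
        (add_le_add ((norm_sub_le _ _).trans (add_le_add le_rfl h2)) ?_)) ?_)
      · rw [norm_smul, Real.norm_of_nonneg zero_le_two]
        gcongr
        exact (P.le_opNorm _).trans (by gcongr)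
      · rw [norm_smul, Real.norm_eq_abs]
        gcongr
    have n2 : ‖u‖ ≤ δ + δ * a + ‖ψL - m • θL‖ := by
      conv_lhs => rw [e4]
      refine (norm_add_le _ _).trans (add_le_add ((norm_add_le _ _).trans
        (add_le_add h1 ?_)) le_rfl)
      rw [norm_smul, Real.norm_eq_abs]
      gcongr
    have n3 := mul_le_mul_of_nonneg_left n1 (by positivity : 0 ≤ 2 * C)
    change ‖ψL - m • θL‖ ≤ 2 * C * ‖ψD - m • θD + (2 : ℝ) • P (ψL - m • θL)‖ at h3
    nlinarith
  refine le_of_forall_pos_le_add fun η hη => ?_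
  have hA : 0 < 1 + a + 2 * C * (1 + 2 * ‖P‖ + b) := by positivity
  have := key (η / (1 + a + 2 * C * (1 + 2 * ‖P‖ + b))) (by positivity)
  rwa [div_mul_cancel₀ _ hA.ne'] at this

/-- The form used for profiles: the equation `2 h + x h' = -q` turns `L₀ h` into `2 C₂(G₀, h) - q`,
so no derivative of `h` appears. -/
theorem IsGapConstant.nrm_le {k C : ℝ} (hk : 1 ≤ k) (hC : IsGapConstant k C) {h q : ℝ → ℝ}
    (H : IsStationaryPair h q) (hh : MemL1k k h) (hq : MemL1k k q)
    (h0 : ∫ x in Ioi 0, x * h x = 0) :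
    nrm k h ≤ 2 * C * nrm k (fun x => 2 * coag kernelZero profileZero h x - q x) := by
  have hk0 : 0 ≤ k := zero_le_one.trans hk
  have h1 := hC.norm_le_of_isGeneratorValue hk (H.isGeneratorValue hk hh hq)
    (by rw [L1k.integral_id_mul_congr hh.coeFn_toL1k, h0])
  have e1 : ‖hh.toL1k‖ = nrm k h := hh.norm_toL1k
  rw [e1, L1k.norm_eq] at h1
  refine h1.trans (le_of_eq ?_)
  congr 1
  refine nrm_congr ?_
  set u := hh.toL1k
  set w := hq.toL1k
  filter_upwards [L1k.coeFn_add' (-w - (2 : ℝ) • u) ((2 : ℝ) • expCLM hk0 one_pos u),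
    L1k.coeFn_sub' (-w) ((2 : ℝ) • u), aeEq_weighted_iff.1 (Lp.coeFn_neg w),
    L1k.coeFn_smul' 2 u, L1k.coeFn_smul' 2 (expCLM hk0 one_pos u),
    (isL1kOperator_expOp hk0 one_pos).coeFn_toCLM_of_ae hh.coeFn_toL1k, hh.coeFn_toL1k,
    hq.coeFn_toL1k, ae_pos] with x g1 g2 g3 g4 g5 g6 g7 g8 hx
  have g6' : expCLM hk0 one_pos u x = expOp 1 h x := g6
  rw [g1, g2, g3, g4, g5, g6', Pi.neg_apply, g7, g8, coag_kernelZero (hh.integrable hk0) hx]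
  ring

/-! ### Exponential profiles for constant kernels -/

theorem integral_const_mul_exp_Ioi (a : ℝ) {b : ℝ} (hb : 0 < b) (c : ℝ) :
    ∫ x in Ioi c, a * Real.exp (-(b * x)) = a / b * Real.exp (-(b * c)) := by
  have := integral_exp_mul_Ioi (a := -b) (by linarith) c
  rw [integral_const_mul]
  simp only [neg_mul] at this
  rw [this]
  field_simp

theorem memL1k_const_mul_exp (k a : ℝ) {b : ℝ} (hb : 0 < b) :
    MemL1k k fun x => a * Real.exp (-(b * x)) := by
  have := (memL1k_pow_mul_exp k 0 hb).const_mul a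
  simpa using this

theorem integral_id_mul_exp {b : ℝ} (hb : 0 < b) :
    ∫ x in Ioi (0 : ℝ), x * (b ^ 2 * Real.exp (-(b * x))) = 1 := by
  have h1 := integral_comp_mul_left_Ioi (fun x => x * profileZero x) 0 hb
  rw [mul_zero, integral_id_mul_profileZero, smul_eq_mul, mul_one] at h1
  have h2 : ∫ x in Ioi (0 : ℝ), x * (b ^ 2 * Real.exp (-(b * x)))
      = b * ∫ x in Ioi (0 : ℝ), (fun x => x * profileZero x) (b * x) := by
    rw [← integral_const_mul]
    refine integral_congr_ae (ae_of_all _ fun x => ?_)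
    simp only [profileZero]
    ring
  rw [h2, h1, mul_inv_cancel₀ hb.ne']

theorem coag_const_exp (κ a : ℝ) {b : ℝ} (hb : 0 < b) (x : ℝ) :
    coag (fun _ _ => κ) (fun x => a * Real.exp (-(b * x))) (fun x => a * Real.exp (-(b * x))) x
      = κ * a ^ 2 * (x / 2 - 1 / b) * Real.exp (-(b * x)) := by
  have e1 : ∫ y in (0 : ℝ)..x, κ * (a * Real.exp (-(b * (x - y)))) * (a * Real.exp (-(b * y)))
      = x * (κ * a ^ 2 * Real.exp (-(b * x))) := by
    have : ∀ y, κ * (a * Real.exp (-(b * (x - y)))) * (a * Real.exp (-(b * y)))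
        = κ * a ^ 2 * Real.exp (-(b * x)) := by
      intro y
      have : Real.exp (-(b * x)) = Real.exp (-(b * (x - y))) * Real.exp (-(b * y)) := by
        rw [← Real.exp_add]
        congr 1
        ring
      rw [this]
      ring
    simp only [this]
    rw [intervalIntegral.integral_const, sub_zero, smul_eq_mul]
  have e2 : ∫ y in Ioi (0 : ℝ), κ * (a * Real.exp (-(b * y))) = κ * (a / b) := by
    rw [integral_const_mul, integral_const_mul_exp_Ioi a hb 0]
    simp
  simp only [coag]
  rw [e1, e2]
  field_simp
  ring

/-- The relation `κ b = 2` makes `2 G + x G' + C_κ(G, G) = 0` pointwise. Then `s ↦ S_{t-s} G` is a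
primitive of `S_{t-s} C_κ(G, G)`, and the mild equation is the fundamental theorem of calculus. -/
theorem isUnitProfile_exp {κ b : ℝ} (hb : 0 < b) (hκ : κ * b = 2) :
    IsUnitProfile (fun _ _ => κ) fun x => b ^ 2 * Real.exp (-(b * x)) where
  memL1k := memL1k_const_mul_exp 1 (b ^ 2) hb
  nonneg := ae_of_all _ fun x => by positivity
  mass := integral_id_mul_exp hb
  stationary t ht := by
    refine ae_of_all _ fun x => ?_
    have hQ : ∀ y, coag (fun _ _ => κ) (fun x => b ^ 2 * Real.exp (-(b * x)))
        (fun x => b ^ 2 * Real.exp (-(b * x))) y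
        = b ^ 2 * (b * y - 2) * Real.exp (-(b * y)) := by
      intro y
      rw [coag_const_exp κ (b ^ 2) hb]
      have h1 : κ = 2 / b := by rw [← hκ]; field_simp
      rw [h1]
      field_simp
    set F : ℝ → ℝ := fun s => Real.exp (2 * (t - s)) *
      (b ^ 2 * Real.exp (-(b * (Real.exp (t - s) * x)))) with hF
    have hd : ∀ s, HasDerivAt F (scalingSemigroup (t - s) (coag (fun _ _ => κ)
        (fun x => b ^ 2 * Real.exp (-(b * x))) (fun x => b ^ 2 * Real.exp (-(b * x)))) x) s := by
      intro s
      have h0 : HasDerivAt (fun s => t - s) (-1) s := by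
        simpa using (hasDerivAt_id s).const_sub t
      have h1 := (h0.const_mul 2).exp
      have h2 := (((h0.exp.mul_const x).const_mul b).neg.exp).const_mul (b ^ 2)
      convert! h1.mul h2 using 1
      rw [scalingSemigroup, hQ]
      simp only [Pi.neg_apply]
      ring
    rw [intervalIntegral.integral_eq_sub_of_hasDerivAt (fun s _ => hd s)]
    · simp [hF, scalingSemigroup]
    · refine Continuous.intervalIntegrable ?_ _ _
      simp only [scalingSemigroup, hQ]
      fun_prop

/-! ### Lower bounds for the constants -/

theorem integral_profileZero : ∫ x in Ioi (0 : ℝ), profileZero x = 1 := by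
  simp only [profileZero]
  exact integral_exp_neg_Ioi_zero

/-- At `t = 0` the gap estimate reads `‖h‖ ≤ C ‖h‖`. The witness `(1 - x/2) e^{-x}` has zero mass
and is nonzero because its integral is `1/2`. -/
theorem IsGapConstant.one_le {k C : ℝ} (hk : 0 ≤ k) (hC : IsGapConstant k C) : 1 ≤ C := by
  obtain ⟨_, S, hS, hdec⟩ := hC
  have h1 := memL1k_profileZero k
  have h2 : MemL1k k fun x => x * profileZero x := by
    simpa [profileZero] using memL1k_pow_mul_exp k 1 one_pos
  have h2' : MemL1k 1 fun x => x * profileZero x := by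
    simpa [profileZero] using memL1k_pow_mul_exp 1 1 one_pos
  have hm := h1.sub (h2.const_mul (1 / 2))
  have e1 : ∫ x in Ioi (0 : ℝ), x * (x * profileZero x) = 2 := by
    have h3 := Real.Gamma_eq_integral (s := 3) (by norm_num)
    have h4 : Real.Gamma 3 = 2 := by
      have := Real.Gamma_nat_eq_factorial 2
      rw [show ((2 : ℕ) : ℝ) + 1 = 3 by norm_num] at this
      rw [this]
      norm_num [Nat.factorial]
    rw [h4] at h3
    rw [h3]
    refine setIntegral_congr_fun measurableSet_Ioi fun x hx => ?_
    have : x ^ ((3 : ℝ) - 1) = x ^ 2 := by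
      rw [← Real.rpow_natCast]
      norm_num
    simp only [profileZero]
    rw [this]
    ring
  have e2 : ∫ x in Ioi (0 : ℝ), x * (profileZero x - 1 / 2 * (x * profileZero x)) = 0 := by
    have : ∀ x, x * (profileZero x - 1 / 2 * (x * profileZero x))
        = x * profileZero x - 1 / 2 * (x * (x * profileZero x)) := fun x => by ring
    simp only [this]
    rw [integral_sub ((memL1k_profileZero 1).integrable_id_mul le_rfl)
      ((h2'.integrable_id_mul le_rfl).const_mul _), integral_const_mul, e1,
      integral_id_mul_profileZero]
    norm_num
  have e3 : ∫ x in Ioi (0 : ℝ), (profileZero x - 1 / 2 * (x * profileZero x)) = 1 / 2 := by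
    rw [integral_sub (h1.integrable hk) ((h2.const_mul (1 / 2)).integrable hk),
      integral_const_mul, integral_id_mul_profileZero, integral_profileZero]
    norm_num
  have h3 := hdec hm.toL1k (by rw [L1k.integral_id_mul_congr hm.coeFn_toL1k, e2]) 0 le_rfl
  rw [hS.semigroup.zero, mul_zero, Real.exp_zero, mul_one] at h3
  have h4 : 0 < ‖hm.toL1k‖ := by
    refine (norm_nonneg _).lt_of_ne fun h => ?_
    have h5 : nrm k (fun x => profileZero x - 1 / 2 * (x * profileZero x)) = 0 := by
      rw [h]; exact hm.norm_toL1k.symm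
    have h6 := abs_integral_le_integral_abs.trans (hm.integral_abs_le hk)
    rw [h5, e3] at h6
    norm_num at h6
  have h5 : ‖hm.toL1k‖ ≤ C * ‖hm.toL1k‖ := h3
  by_contra hlt
  rw [not_le] at hlt
  nlinarith

/-- The step function equal to `-1` on `(z, z + 2]` and `1` on `(z + 2, ∞)`. -/
def stepFunction (z x : ℝ) : ℝ := if x ≤ z then 0 else if x ≤ z + 2 then -1 else 1

theorem measurable_stepFunction (z : ℝ) : Measurable (stepFunction z) :=
  Measurable.ite measurableSet_Iic measurable_const
    (Measurable.ite measurableSet_Iic measurable_const measurable_const)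

theorem abs_stepFunction_le (z x : ℝ) : |stepFunction z x| ≤ (Ioi z).indicator 1 x := by
  by_cases h1 : x ≤ z
  · simp [stepFunction, h1]
  · by_cases h2 : x ≤ z + 2 <;> simp [stepFunction, h1, h2, indicator, not_le.1 h1]

theorem abs_stepFunction_le_one (z x : ℝ) : |stepFunction z x| ≤ 1 :=
  (abs_stepFunction_le z x).trans (indicator_le_self' (fun _ _ => zero_le_one) x)

theorem normL1k_indicator_Ioc_le {k : ℝ} (hk : 0 ≤ k) {z : ℝ} (hz : 0 < z) :
    normL1k k ((Ioc z (z + 2)).indicator (1 : ℝ → ℝ)) ≤ ENNReal.ofReal (2 * (3 + z) ^ k) := by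
  rw [normL1k_eq]
  have h1 : ∀ x ∈ Ioi (0 : ℝ), ‖(Ioc z (z + 2)).indicator (1 : ℝ → ℝ) x‖ₑ * weight k x
      ≤ (Ioc z (z + 2)).indicator (fun _ => weight k (z + 2)) x := by
    intro x hx
    by_cases h : x ∈ Ioc z (z + 2)
    · simp only [h, indicator_of_mem, Pi.one_apply, enorm_one, one_mul]
      exact weight_le_of_le hk hx h.2
    · simp [h]
  refine (setLIntegral_mono' measurableSet_Ioi h1).trans ((setLIntegral_le_lintegral _ _).trans ?_)
  rw [lintegral_indicator measurableSet_Ioc, setLIntegral_const, Real.volume_Ioc, weight,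
    ← ENNReal.ofReal_mul (by positivity)]
  refine ENNReal.ofReal_le_ofReal (le_of_eq ?_)
  rw [show 1 + (z + 2) = 3 + z by ring]
  ring

theorem memL1k_indicator_Ioc {k : ℝ} (hk : 0 ≤ k) {z : ℝ} (hz : 0 < z) :
    MemL1k k ((Ioc z (z + 2)).indicator (1 : ℝ → ℝ)) :=
  memL1k_iff.2 ⟨(measurable_one.indicator measurableSet_Ioc).aestronglyMeasurable,
    (normL1k_indicator_Ioc_le hk hz).trans_lt ENNReal.ofReal_lt_top⟩

theorem integral_exp_Ioc {b : ℝ} (hb : 0 < b) (z : ℝ) :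
    ∫ y in Ioc z (z + 2), Real.exp (-(b * (z + 2 - y))) = (1 - Real.exp (-(2 * b))) / b := by
  rw [← intervalIntegral.integral_of_le (by linarith)]
  have hd : ∀ y, HasDerivAt (fun y => Real.exp (-(b * (z + 2 - y))) / b)
      (Real.exp (-(b * (z + 2 - y)))) y := by
    intro y
    have := (((((hasDerivAt_id y).const_sub (z + 2)).const_mul b).fun_neg).exp).div_const b
    convert! this using 1
    simp only [id]
    field_simp
  rw [intervalIntegral.integral_eq_sub_of_hasDerivAt (fun y _ => hd y)
    (Continuous.intervalIntegrable (by fun_prop) _ _)]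
  simp only [sub_self, mul_zero, neg_zero, Real.exp_zero]
  rw [show b * (z + 2 - z) = 2 * b by ring]
  ring

/-- For `y` in `(z, z + 2]` the defect `ψ(u + y) - ψ(u) - ψ(y)` of the step function equals `2` on
`u > z + 2 - y` and `0` otherwise, minus `ψ(u)`. The first part gives the main term; the second is
bounded by the mass of the exponential beyond `z`. -/
theorem integral_stepFunction_mul_coag {κ a b z : ℝ} (hκ : 0 ≤ κ) (ha : 0 ≤ a) (hb : 0 < b)
    (hz : 0 < z) :
    |2 * (∫ x in Ioi 0, stepFunction z x * coag (fun _ _ => κ)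
      (fun x => a * Real.exp (-(b * x))) ((Ioc z (z + 2)).indicator 1) x)
      - 2 * κ * (a / b) * ((1 - Real.exp (-(2 * b))) / b)|
      ≤ 2 * κ * (a / b * Real.exp (-(b * z))) := by
  set G : ℝ → ℝ := fun x => a * Real.exp (-(b * x)) with hG
  have hGm : MemL1k 0 G := memL1k_const_mul_exp 0 a hb
  have hGi : Integrable G posMeasure := hGm.integrable le_rfl
  have hGn : ∀ x, 0 ≤ G x := fun x => by positivity
  have hK : IsBoundedKernel κ fun _ _ : ℝ => κ := ⟨measurable_const, fun _ _ => rfl,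
    fun _ _ => (abs_of_nonneg hκ).le⟩
  have hh : MemL1k 0 ((Ioc z (z + 2)).indicator (1 : ℝ → ℝ)) := memL1k_indicator_Ioc le_rfl hz
  set s := ∫ u in Ioi 0, stepFunction z u * G u with hs
  have hsG : Integrable (fun u => stepFunction z u * G u) posMeasure :=
    hGm.integrable_mul zero_le_one (measurable_stepFunction z) fun x _ => by
      simpa using abs_stepFunction_le_one z x
  have hsb : |s| ≤ a / b * Real.exp (-(b * z)) := by
    rw [← integral_const_mul_exp_Ioi a hb z, ← integral_ite_lt G hz.le]
    refine abs_integral_le_integral_abs.trans (integral_mono_of_nonneg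
      (ae_of_all _ fun u => abs_nonneg _) ?_ (ae_of_all _ fun u => ?_))
    · refine hGm.integrable_mul zero_le_one (measurable_lt_indicator.of_uncurry_left (x := z))
        fun x _ => ?_
      split_ifs <;> simp
    · simp only
      rw [abs_mul, abs_of_nonneg (hGn u)]
      refine mul_le_mul_of_nonneg_right ((abs_stepFunction_le z u).trans (le_of_eq ?_)) (hGn u)
      by_cases h : z < u <;> simp [indicator, h]
  have hinner : ∀ y ∈ Ioc z (z + 2), ∫ u in Ioi 0,
      (stepFunction z (u + y) - stepFunction z u - stepFunction z y) * (κ * G u)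
      = κ * (2 * (a / b) * Real.exp (-(b * (z + 2 - y))) - s) := by
    intro y hy
    have hy1 : 0 ≤ z + 2 - y := by linarith [hy.2]
    have e : ∀ u ∈ Ioi (0 : ℝ),
        (stepFunction z (u + y) - stepFunction z u - stepFunction z y) * (κ * G u)
        = κ * (2 * ((if z + 2 - y < u then (1 : ℝ) else 0) * G u) - stepFunction z u * G u) := by
      intro u hu
      have hu : 0 < u := hu
      have h1 : stepFunction z y = -1 := by
        simp [stepFunction, not_le.2 hy.1, hy.2]
      have h2 : ¬ u + y ≤ z := by linarith [hy.1]
      rw [h1]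
      by_cases h3 : z + 2 - y < u
      · have h4 : ¬ u + y ≤ z + 2 := by linarith
        rw [stepFunction, if_neg h2, if_neg h4, if_pos h3]
        ring
      · have h4 : u + y ≤ z + 2 := by linarith
        rw [stepFunction, if_neg h2, if_pos h4, if_neg h3]
        ring
    have hi : Integrable (fun u => (if z + 2 - y < u then (1 : ℝ) else 0) * G u) posMeasure := by
      refine hGm.integrable_mul zero_le_one
        (measurable_lt_indicator.of_uncurry_left (x := z + 2 - y)) fun x _ => ?_
      split_ifs <;> simp
    rw [setIntegral_congr_fun measurableSet_Ioi e, integral_const_mul,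
      integral_sub (hi.const_mul 2) hsG, integral_const_mul, integral_ite_lt G hy1,
      integral_const_mul_exp_Ioi a hb]
    ring
  have hmain : 2 * (∫ x in Ioi 0, stepFunction z x * coag (fun _ _ => κ) G
      ((Ioc z (z + 2)).indicator 1) x)
      = 2 * κ * (a / b) * ((1 - Real.exp (-(2 * b))) / b) - 2 * κ * s := by
    rw [hK.integral_mul_coag le_rfl hGm hh (measurable_stepFunction z) zero_le_one fun x _ => by
      simpa using abs_stepFunction_le_one z x]
    have e : ∀ y ∈ Ioi (0 : ℝ), (∫ u in Ioi 0,
        (stepFunction z (u + y) - stepFunction z u - stepFunction z y) * (κ * G u))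
          * (Ioc z (z + 2)).indicator 1 y
        = (Ioc z (z + 2)).indicator
          (fun y => κ * (2 * (a / b) * Real.exp (-(b * (z + 2 - y))) - s)) y := by
      intro y _
      by_cases h : y ∈ Ioc z (z + 2)
      · rw [hinner y h, indicator_of_mem h, indicator_of_mem h, Pi.one_apply, mul_one]
      · rw [indicator_of_notMem h, indicator_of_notMem h, mul_zero]
    have hsub : Ioc z (z + 2) ∩ Ioi 0 = Ioc z (z + 2) :=
      inter_eq_left.2 fun x hx => hz.trans hx.1
    have hci : IntegrableOn (fun y => 2 * (a / b) * Real.exp (-(b * (z + 2 - y))))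
        (Ioc z (z + 2)) :=
      ((Continuous.integrableOn_Icc (by fun_prop)).mono_set Ioc_subset_Icc_self)
    rw [setIntegral_congr_fun measurableSet_Ioi e, integral_indicator measurableSet_Ioc,
      Measure.restrict_restrict measurableSet_Ioc, hsub, integral_const_mul,
      integral_sub hci (by simp), integral_const_mul, integral_exp_Ioc hb, setIntegral_const]
    simp only [measureReal_def, Real.volume_Ioc, add_sub_cancel_left, ENNReal.toReal_ofNat,
      smul_eq_mul, ENNReal.ofReal_ofNat]
    ring
  rw [hmain, sub_sub_cancel_left, abs_neg, abs_mul, abs_of_nonneg (by positivity)]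
  gcongr

theorem IsPerturbation.one : IsPerturbation fun _ _ => 1 where
  continuousOn := continuousOn_const
  symm _ _ _ _ := rfl
  nonneg _ _ _ _ := zero_le_one
  le_one _ _ _ _ := le_rfl
  homogeneous _ _ _ _ _ _ := rfl

/-- Taking fifth powers turns the claim into a bound for `e^{-1}` to the eighth power. -/
theorem exp_neg_eight_fifths_le : Real.exp (-(8 / 5)) ≤ 0.202 := by
  by_contra h
  rw [not_le] at h
  have h1 : (0.202 : ℝ) ^ 5 < Real.exp (-(8 / 5)) ^ 5 := by gcongr
  have h2 : Real.exp (-(8 / 5)) ^ 5 = Real.exp (-1) ^ 8 := by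
    rw [← Real.exp_nat_mul, ← Real.exp_nat_mul]
    congr 1
    norm_num
  have h3 : Real.exp (-1) ^ 8 ≤ (0.3678794412 : ℝ) ^ 8 := by
    gcongr
    exact Real.exp_neg_one_lt_d9.le
  rw [h2] at h1
  have := h1.trans_le h3
  norm_num at this

theorem le_exp_neg_two : 0.1353 ≤ Real.exp (-2) := by
  have h2 : Real.exp (-2) = Real.exp (-1) ^ 2 := by
    rw [← Real.exp_nat_mul]
    congr 1
    norm_num
  have h3 : (0.36787944116 : ℝ) ^ 2 ≤ Real.exp (-1) ^ 2 := by
    gcongr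
    exact Real.exp_neg_one_gt_d9.le
  rw [h2]
  refine le_trans ?_ h3
  norm_num

/-- The estimate (b) is tested by duality, with input the indicator of `(z, z + 2]` and a step
function that picks up opposite signs from unmerged and merged clusters far out. -/
theorem IsPerturbationConstant.half_le_mul {k M : ℝ} (hk : 0 ≤ k) (hM : IsPerturbationConstant k M)
    {z : ℝ} (hz : 0 < z) :
    (1 + z) ^ k * (0.53 - 9 * Real.exp (-(4 / 5 * z))) ≤ M * (3 + z) ^ k := by
  set h : ℝ → ℝ := (Ioc z (z + 2)).indicator 1 with hh
  set G : ℝ → ℝ := fun x => (4 / 5 : ℝ) ^ 2 * Real.exp (-(4 / 5 * x)) with hG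
  have hM0 : 0 < M := hM.1
  -- For `W = 1` and `ε = 1/2` the kernel is constant, and `κ b = 2` gives the profile with rate `b
  -- = 4/5`.
  have hker : kernel (1 / 2) (fun _ _ => 1) = fun _ _ => (5 / 2 : ℝ) := by
    ext x y
    norm_num [kernel]
  have hprof : IsUnitProfile (kernel (1 / 2) fun _ _ => 1) G := by
    rw [hker]
    exact isUnitProfile_exp (by norm_num) (by norm_num)
  have hhm : MemL1k k h := memL1k_indicator_Ioc hk hz
  have hGm : MemL1k k G := memL1k_const_mul_exp k _ (by norm_num)
  have hD := hM.2 _ IsPerturbation.one (1 / 2) (by norm_num) (by norm_num) G hprof h hhm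
  rw [hker] at hD
  have hK : IsBoundedKernel (5 / 2) fun _ _ : ℝ => (5 / 2 : ℝ) := ⟨measurable_const,
    fun _ _ => rfl, fun _ _ => by norm_num⟩
  have c1 := hK.memL1k_coag hk hGm hhm
  have c2 := isBoundedKernel_kernelZero.memL1k_coag hk (memL1k_profileZero k) hhm
  set D : ℝ → ℝ := fun x => 2 * coag (fun _ _ => (5 / 2 : ℝ)) G h x
    - 2 * coag kernelZero profileZero h x with hDdef
  have hDm : MemL1k k D := (c1.const_mul 2).sub (c2.const_mul 2)
  have hDn : nrm k D ≤ M * (3 + z) ^ k := by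
    refine nrm_le_of_le (by positivity) (hD.trans ?_)
    refine (mul_le_mul' le_rfl (normL1k_indicator_Ioc_le hk hz)).trans (le_of_eq ?_)
    rw [← ENNReal.ofReal_mul (by positivity)]
    congr 1
    ring
  have hstep : ∀ x, 0 < x → |stepFunction z x| ≤ ((1 + z) ^ k)⁻¹ * (1 + x) ^ k := by
    intro x hx
    refine (abs_stepFunction_le z x).trans ?_
    by_cases hzx : z < x
    · rw [indicator_of_mem (show x ∈ Ioi z from hzx), Pi.one_apply, le_inv_mul_iff₀ (by positivity),
        mul_one]
      exact Real.rpow_le_rpow (by linarith) (by linarith) hk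
    · rw [indicator_of_notMem (show x ∉ Ioi z from hzx)]
      positivity
  have hup := (abs_integral_le_integral_abs).trans
    (hDm.integral_abs_mul_le (by positivity) hstep)
  have i1 := (c1.integrable_mul (ψ := stepFunction z) (by positivity) (measurable_stepFunction z)
    hstep)
  have i2 := (c2.integrable_mul (ψ := stepFunction z) (by positivity) (measurable_stepFunction z)
    hstep)
  have e1 : ∫ x in Ioi 0, stepFunction z x * D x
      = 2 * (∫ x in Ioi 0, stepFunction z x * coag (fun _ _ => (5 / 2 : ℝ)) G h x)
        - 2 * ∫ x in Ioi 0, stepFunction z x * coag kernelZero profileZero h x := by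
    rw [← integral_const_mul, ← integral_const_mul, ← integral_sub (i1.const_mul 2)
      (i2.const_mul 2)]
    refine integral_congr_ae (ae_of_all _ fun x => ?_)
    simp only [hDdef]
    ring
  have a1 := integral_stepFunction_mul_coag (κ := 5 / 2) (a := (4 / 5) ^ 2) (b := 4 / 5)
    (by norm_num) (by norm_num) (by norm_num) hz
  have a2 := integral_stepFunction_mul_coag (κ := 2) (a := 1) (b := 1)
    (by norm_num) (by norm_num) (by norm_num) hz
  have e2 : (fun x : ℝ => 1 * Real.exp (-(1 * x))) = profileZero := by
    ext x
    simp [profileZero]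
  rw [e2] at a2
  change |2 * (∫ x in Ioi 0, stepFunction z x * coag kernelZero profileZero h x) - _| ≤ _ at a2
  rw [show (2 * (4 / 5) : ℝ) = 8 / 5 by norm_num] at a1
  rw [show (2 * 1 : ℝ) = 2 by norm_num] at a2
  have x1 := exp_neg_eight_fifths_le
  have x2 := le_exp_neg_two
  have x3 : Real.exp (-z) ≤ Real.exp (-(4 / 5 * z)) := Real.exp_le_exp.2 (by linarith)
  rw [e1] at hup
  change |2 * (∫ x in Ioi 0, stepFunction z x * coag (fun _ _ => (5 / 2 : ℝ)) G h x) - _| ≤ _ at a1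
  generalize ∫ x in Ioi 0, stepFunction z x * coag (fun _ _ => (5 / 2 : ℝ)) G h x = I₁ at a1 hup
  generalize ∫ x in Ioi 0, stepFunction z x * coag kernelZero profileZero h x = I₂ at a2 hup
  rw [abs_le] at a1 a2
  -- The main terms `5 (1 - e^{-8/5})` and `4 (1 - e^{-2})` differ by more than `0.53`; the two
  -- errors are at most `4 e^{-4z/5}` each.
  have hlow : 0.53 - 9 * Real.exp (-(4 / 5 * z)) ≤ ((1 + z) ^ k)⁻¹ * nrm k D := by
    refine le_trans ?_ ((le_abs_self _).trans hup)
    norm_num at a1 a2 x1 x2 ⊢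
    linarith [a1.1, a2.2]
  rw [le_inv_mul_iff₀ (by positivity)] at hlow
  exact hlow.trans hDn

/-- As `z → ∞` the weights at `z` and `z + 2` become comparable with ratio `1` and the exponential
error disappears, leaving `M ≥ 0.53`. -/
theorem IsPerturbationConstant.half_le {k M : ℝ} (hk : 0 ≤ k) (hM : IsPerturbationConstant k M) :
    1 / 2 ≤ M := by
  have h1 : Tendsto (fun z : ℝ => (1 + z) / (3 + z)) atTop (𝓝 1) := by
    have h2 : Tendsto (fun z : ℝ => 1 - 2 * (3 + z)⁻¹) atTop (𝓝 (1 - 2 * 0)) :=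
      ((tendsto_inv_atTop_zero.comp (tendsto_atTop_add_const_left _ 3 tendsto_id)).const_mul
        2).const_sub 1
    rw [mul_zero, sub_zero] at h2
    refine h2.congr' ?_
    filter_upwards [eventually_gt_atTop 0] with z hz
    field_simp
    ring
  have h2 := h1.rpow_const (p := k) (Or.inl one_ne_zero)
  rw [Real.one_rpow] at h2
  have h3 : Tendsto (fun z : ℝ => Real.exp (-(4 / 5 * z))) atTop (𝓝 0) := by
    refine Real.tendsto_exp_atBot.comp ?_
    exact tendsto_neg_atTop_atBot.comp (tendsto_id.const_mul_atTop (by norm_num))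
  have h4 := h2.mul ((h3.const_mul 9).const_sub 0.53)
  have h5 : (1 : ℝ) * (0.53 - 9 * 0) ≤ M := by
    refine le_of_tendsto h4 ?_
    filter_upwards [eventually_gt_atTop 0] with z hz
    have := hM.half_le_mul hk hz
    rw [Real.div_rpow (by linarith) (by linarith), div_mul_eq_mul_div,
      div_le_iff₀ (by positivity)]
    exact this
  norm_num at h5 ⊢
  linarith

/-! ### Uniqueness of profiles close to the explicit one -/

theorem nrm_eq_zero_iff {k : ℝ} {f : ℝ → ℝ} (hf : MemL1k k f) :
    nrm k f = 0 ↔ ∀ᵐ x ∂posMeasure, f x = 0 := by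
  rw [nrm, ENNReal.toReal_eq_zero_iff, or_iff_left hf.lt_top.ne, normL1k,
    eLpNorm_eq_zero_iff hf.1 one_ne_zero]
  exact ae_weighted_iff

theorem memL1k_of_normL1k_sub_le {k c : ℝ} {G H : ℝ → ℝ} (hG : AEStronglyMeasurable G posMeasure)
    (hH : MemL1k k H) (h : normL1k k (fun x => G x - H x) ≤ ENNReal.ofReal c) : MemL1k k G := by
  have h1 : MemL1k k fun x => G x - H x :=
    memL1k_iff.2 ⟨hG.sub hH.aesm, h.trans_lt ENNReal.ofReal_lt_top⟩
  have h2 := h1.add hH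
  simpa using h2

theorem IsUnitProfile.integral_sub_eq_zero {K K' : ℝ → ℝ → ℝ} {G G' : ℝ → ℝ}
    (hG : IsUnitProfile K G) (hG' : IsUnitProfile K' G') :
    ∫ x in Ioi 0, x * (G x - G' x) = 0 := by
  simp only [mul_sub]
  rw [integral_sub (hG.memL1k.integrable_id_mul le_rfl) (hG'.memL1k.integrable_id_mul le_rfl),
    hG.mass, hG'.mass, sub_self]

/-- With `h = G₁ - G₂`, polarisation gives `C_K(G₁, G₁) - C_K(G₂, G₂) = 2 C_K(G₁, h) - C_K(h, h)`.
Thus `L₀ h` is `C_K(h, h)` minus the operator difference from (b), and the inverse estimate applies.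
-/
theorem nrm_sub_le_of_isUnitProfile {k C M ε : ℝ} (hk : 1 ≤ k) (hC : IsGapConstant k C)
    (hM : IsPerturbationConstant k M) {W : ℝ → ℝ → ℝ} (hW : IsPerturbation W) (hε : 0 < ε)
    (hε1 : ε < 1) {G₁ G₂ : ℝ → ℝ} (h₁ : IsUnitProfile (kernel ε W) G₁)
    (h₂ : IsUnitProfile (kernel ε W) G₂) (m₁ : MemL1k k G₁) (m₂ : MemL1k k G₂) :
    nrm k (fun x => G₁ x - G₂ x) ≤ 2 * C * (ε * M * nrm k (fun x => G₁ x - G₂ x)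
      + 3 / 2 * (2 + ε) * nrm k (fun x => G₁ x - G₂ x) ^ 2) := by
  have hk0 : 0 ≤ k := zero_le_one.trans hk
  have hC0 : 0 < C := hC.1
  have hM0 : 0 < M := hM.1
  set K := kernel ε (posKernel W) with hKdef
  have hK : IsBoundedKernel (2 + ε) K := hW.isBoundedKernel_kernel hε.le
  set h : ℝ → ℝ := fun x => G₁ x - G₂ x with hh
  have hm : MemL1k k h := m₁.sub m₂
  have q₁ := hK.memL1k_coag hk0 m₁ m₁
  have q₂ := hK.memL1k_coag hk0 m₂ m₂
  have hpair := (h₁.toIsProfile.isStationaryPair hε.le hW).sub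
    (h₂.toIsProfile.isStationaryPair hε.le hW) (q₁.mono hk) (q₂.mono hk)
  have hinv := hC.nrm_le hk hpair hm (q₁.sub q₂) (h₁.integral_sub_eq_zero h₂)
  refine hinv.trans ?_
  gcongr
  have c1 := hK.memL1k_coag hk0 hm hm
  have c2 := hK.memL1k_coag hk0 m₁ hm
  have c3 := isBoundedKernel_kernelZero.memL1k_coag hk0 (memL1k_profileZero k) hm
  set D : ℝ → ℝ := fun x => 2 * coag (kernel ε W) G₁ h x - 2 * coag kernelZero profileZero h x
  have hDeq : D =ᵐ[posMeasure] fun x => 2 * coag K G₁ h x - 2 * coag kernelZero profileZero h x := by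
    filter_upwards [ae_pos] with x hx
    simp only [D]
    rw [coag_kernel_posKernel _ _ _ _ hx]
  have hDm : MemL1k k D := (memL1k_congr hDeq).2 ((c2.const_mul 2).sub (c3.const_mul 2))
  have hDn : nrm k D ≤ ε * M * nrm k h := by
    refine nrm_le_of_le (by have := nrm_nonneg k h; positivity) ?_
    rw [ENNReal.ofReal_mul (by positivity), hm.ofReal_nrm]
    exact hM.2 W hW ε hε hε1 G₁ h₁ h hm
  have e : (fun x => 2 * coag kernelZero profileZero h x - (coag K G₁ G₁ x - coag K G₂ G₂ x))
      =ᵐ[posMeasure] fun x => coag K h h x - D x := by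
    filter_upwards [hDeq, hK.coag_diff hk0 m₁ m₂, hK.coag_add_left hk0 m₁ hm m₂,
      hK.coag_sub_left hk0 m₁ hm m₂] with x e1 e2 e3 e4
    have e2' : coag K G₁ G₁ x - coag K G₂ G₂ x = coag K (fun x => G₁ x + G₂ x) h x := e2
    have e4' : coag K h h x = coag K G₁ h x - coag K G₂ h x := e4
    rw [e1, e2', e3, e4']
    ring
  rw [nrm_congr e]
  have b1 := nrm_sub_le c1 hDm
  have b2 := hK.nrm_coag_le hk0 hm hm
  change nrm k (fun x => coag K h h x - D x) ≤ nrm k (coag K h h) + nrm k D at b1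
  nlinarith

/-- Both profiles lie within the radius `r` of `G₀`, so their distance is at most `2 r`; for this
size the quadratic inequality for the distance leaves only the value zero. -/
theorem uniqueness_of_isUnitProfile {k C M : ℝ} (hk : 1 ≤ k) (hC : IsGapConstant k C)
    (hM : IsPerturbationConstant k M) {W : ℝ → ℝ → ℝ} (hW : IsPerturbation W) {ε : ℝ} (hε : 0 < ε)
    (hε0 : ε < epsilonZero C M) {G₁ G₂ : ℝ → ℝ} (h₁ : IsUnitProfile (kernel ε W) G₁)
    (h₂ : IsUnitProfile (kernel ε W) G₂)
    (b₁ : normL1k k (fun x => G₁ x - profileZero x)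
      ≤ ENNReal.ofReal ((1 - ε / epsilonZero C M) / (12 * C * (1 + ε))))
    (b₂ : normL1k k (fun x => G₂ x - profileZero x)
      ≤ ENNReal.ofReal ((1 - ε / epsilonZero C M) / (12 * C * (1 + ε)))) :
    ∀ᵐ x ∂posMeasure, G₁ x = G₂ x := by
  have hk0 : 0 ≤ k := zero_le_one.trans hk
  have hC1 := hC.one_le hk0
  have hM1 := hM.half_le hk0
  have hC0 : 0 < C := hC.1
  have hM0 : 0 < M := hM.1
  -- Property (b) covers only `ε < 1`; the lower bounds `C ≥ 1` and `M ≥ 1/2` give `ε₀ ≤ 1`.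
  have hε1 : ε < 1 := by
    refine hε0.trans_le ?_
    rw [epsilonZero, div_le_one (by positivity)]
    nlinarith
  have hdiv : ε / epsilonZero C M = 2 * C * M * ε := by
    rw [epsilonZero]
    field_simp
  have hlt : 2 * C * M * ε < 1 := by
    rw [epsilonZero, lt_div_iff₀ (by positivity)] at hε0
    linarith
  rw [hdiv] at b₁ b₂
  set r := (1 - 2 * C * M * ε) / (12 * C * (1 + ε)) with hr
  have hr0 : 0 ≤ r := div_nonneg (by linarith) (by positivity)
  have m₁ := memL1k_of_normL1k_sub_le h₁.memL1k.aesm (memL1k_profileZero k) b₁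
  have m₂ := memL1k_of_normL1k_sub_le h₂.memL1k.aesm (memL1k_profileZero k) b₂
  have key := nrm_sub_le_of_isUnitProfile hk hC hM hW hε hε1 h₁ h₂ m₁ m₂
  have hm := m₁.sub m₂
  have hn2 : nrm k (fun x => G₁ x - G₂ x) ≤ 2 * r := by
    have h3 := nrm_sub_le (m₁.sub (memL1k_profileZero k)) (m₂.sub (memL1k_profileZero k))
    simp only [sub_sub_sub_cancel_right] at h3
    have h4 := nrm_le_of_le hr0 b₁
    have h5 := nrm_le_of_le hr0 b₂
    linarith
  have h0 := nrm_nonneg k fun x => G₁ x - G₂ x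
  have hz : nrm k (fun x => G₁ x - G₂ x) = 0 := by
    set n := nrm k fun x => G₁ x - G₂ x with hn
    have hr' : r * (12 * C * (1 + ε)) = 1 - 2 * C * M * ε := by
      rw [hr]
      field_simp
    rcases h0.eq_or_lt with h | h
    · exact h.symm
    · exfalso
      have h6 : 1 ≤ 2 * C * (ε * M + 3 / 2 * (2 + ε) * (2 * r)) := by
        have h7 : n ≤ 2 * C * (ε * M + 3 / 2 * (2 + ε) * n) * n := by nlinarith
        have h8 : 1 ≤ 2 * C * (ε * M + 3 / 2 * (2 + ε) * n) := by
          by_contra hcon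
          rw [not_le] at hcon
          nlinarith
        refine h8.trans ?_
        gcongr
      -- By the choice of `r`, `6 C (2 + ε) r = 1 - 2 C M ε - 6 C ε r`; the last term makes the
      -- contradiction strict.
      have h9 : 0 < r * C * ε := by
        have : 0 < r := div_pos (by linarith) (by positivity)
        positivity
      nlinarith
  filter_upwards [(nrm_eq_zero_iff hm).1 hz] with x hx
  linarith

/-! ### Bilinear forms on the half-line -/

theorem enorm_rpow_mul (k : ℝ) (f : ℝ → ℝ) {x : ℝ} (hx : 0 < x) :
    ‖(1 + x) ^ k * f x‖ₑ = ‖f x‖ₑ * weight k x := by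
  rw [enorm_mul, Real.enorm_of_nonneg (by positivity), mul_comm]
  rfl

theorem normL1k_eq_lintegral_enorm (k : ℝ) (f : ℝ → ℝ) :
    normL1k k f = ∫⁻ x in Ioi 0, ‖(1 + x) ^ k * f x‖ₑ := by
  rw [normL1k_eq]
  exact setLIntegral_congr_fun measurableSet_Ioi fun x hx => (enorm_rpow_mul k f hx).symm

theorem memL1k_iff_integrable {k : ℝ} {f : ℝ → ℝ} (hf : AEStronglyMeasurable f posMeasure) :
    MemL1k k f ↔ Integrable (fun x => (1 + x) ^ k * f x) posMeasure := by
  have hm : AEStronglyMeasurable (fun x => (1 + x) ^ k * f x) posMeasure :=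
    (Measurable.aestronglyMeasurable (by fun_prop)).mul hf
  rw [memL1k_iff, normL1k_eq_lintegral_enorm]
  exact ⟨fun h => ⟨hm, h.2⟩, fun h => ⟨hf, h.2⟩⟩

theorem nrm_eq_integral {k : ℝ} {f : ℝ → ℝ} (hf : MemL1k k f) :
    nrm k f = ∫ x in Ioi 0, (1 + x) ^ k * |f x| := by
  have h1 := (memL1k_iff_integrable hf.aesm).1 hf
  rw [nrm, normL1k_eq_lintegral_enorm, ← integral_norm_eq_lintegral_enorm h1.1]
  refine setIntegral_congr_fun measurableSet_Ioi fun x hx => ?_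
  have hx : 0 < x := hx
  rw [norm_mul, Real.norm_of_nonneg (by positivity), Real.norm_eq_abs]

section Bilinear

variable {j β : ℝ} {p p' : ℝ → ℝ → ℝ} {g h : ℝ → ℝ}

theorem integrable_bilinear (hp : Measurable (Function.uncurry p))
    (hb : ∀ u y, 0 < u → 0 < y → |p u y| ≤ β * ((1 + u) ^ j * (1 + y) ^ j))
    (hg : MemL1k j g) (hh : MemL1k j h) :
    Integrable (fun z : ℝ × ℝ => p z.1 z.2 * g z.1 * h z.2) (posMeasure.prod posMeasure) := by
  have h1 := ((memL1k_iff_integrable hg.aesm).1 hg).mul_prod ((memL1k_iff_integrable hh.aesm).1 hh)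
  refine ((h1.const_mul β).norm).mono' ?_ ?_
  · exact (hp.aestronglyMeasurable.mul hg.aesm.comp_fst).mul hh.aesm.comp_snd
  · have hpos : ∀ᵐ z ∂posMeasure.prod posMeasure, z ∈ Ioi (0 : ℝ) ×ˢ Ioi (0 : ℝ) := by
      rw [Measure.prod_restrict]
      exact ae_restrict_mem (measurableSet_Ioi.prod measurableSet_Ioi)
    filter_upwards [hpos] with z hz
    have hu : 0 < z.1 := hz.1
    have hy : 0 < z.2 := hz.2
    have h2 := hb z.1 z.2 hu hy
    rw [norm_mul, norm_mul, norm_mul, norm_mul, norm_mul, norm_mul, Real.norm_eq_abs (p _ _),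
      Real.norm_eq_abs β, Real.norm_of_nonneg (by positivity : 0 ≤ (1 + z.1) ^ j),
      Real.norm_of_nonneg (by positivity : 0 ≤ (1 + z.2) ^ j)]
    calc |p z.1 z.2| * ‖g z.1‖ * ‖h z.2‖
        ≤ (|β| * ((1 + z.1) ^ j * (1 + z.2) ^ j)) * ‖g z.1‖ * ‖h z.2‖ := by
          gcongr
          exact h2.trans (by gcongr; exact le_abs_self β)
      _ = _ := by ring

theorem integral_bilinear (hp : Measurable (Function.uncurry p))
    (hb : ∀ u y, 0 < u → 0 < y → |p u y| ≤ β * ((1 + u) ^ j * (1 + y) ^ j))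
    (hg : MemL1k j g) (hh : MemL1k j h) :
    ∫ y in Ioi 0, (∫ u in Ioi 0, p u y * g u) * h y
      = ∫ z, p z.1 z.2 * g z.1 * h z.2 ∂posMeasure.prod posMeasure := by
  rw [integral_prod_symm _ (integrable_bilinear hp hb hg hh)]
  simp only [integral_mul_const]

theorem integral_bilinear_mono {β' : ℝ} (hp : Measurable (Function.uncurry p))
    (hp' : Measurable (Function.uncurry p'))
    (hb : ∀ u y, 0 < u → 0 < y → |p u y| ≤ β * ((1 + u) ^ j * (1 + y) ^ j))
    (hb' : ∀ u y, 0 < u → 0 < y → |p' u y| ≤ β' * ((1 + u) ^ j * (1 + y) ^ j))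
    (hle : ∀ u y, 0 < u → 0 < y → p u y ≤ p' u y) (hg : MemL1k j g) (hh : MemL1k j h)
    (hg0 : ∀ᵐ x ∂posMeasure, 0 ≤ g x) (hh0 : ∀ᵐ x ∂posMeasure, 0 ≤ h x) :
    ∫ y in Ioi 0, (∫ u in Ioi 0, p u y * g u) * h y
      ≤ ∫ y in Ioi 0, (∫ u in Ioi 0, p' u y * g u) * h y := by
  rw [integral_bilinear hp hb hg hh, integral_bilinear hp' hb' hg hh]
  refine integral_mono_ae (integrable_bilinear hp hb hg hh) (integrable_bilinear hp' hb' hg hh) ?_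
  have hpos : ∀ᵐ z ∂posMeasure.prod posMeasure, z ∈ Ioi (0 : ℝ) ×ˢ Ioi (0 : ℝ) := by
    rw [Measure.prod_restrict]
    exact ae_restrict_mem (measurableSet_Ioi.prod measurableSet_Ioi)
  filter_upwards [hpos, Measure.quasiMeasurePreserving_fst.ae hg0,
    Measure.quasiMeasurePreserving_snd.ae hh0] with z hz h1 h2
  gcongr
  exact hle z.1 z.2 hz.1 hz.2

end Bilinear

/-! ### Moments of profiles -/

/-- The properties of unit profiles used in the moment bounds: `G` is a nonnegative solution of
mass one of the integrated equation with a kernel between `2` and `3`. -/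
structure IsRegularProfile (K : ℝ → ℝ → ℝ) (G : ℝ → ℝ) : Prop where
  bounded : IsBoundedKernel 3 K
  two_le : ∀ x y, 2 ≤ K x y
  memL1k : MemL1k 1 G
  nonneg : ∀ᵐ x ∂posMeasure, 0 ≤ G x
  mass : ∫ x in Ioi (0 : ℝ), x * G x = 1
  pair : IsStationaryPair G (coag K G G)

theorem IsBoundedKernel.mono {κ κ' : ℝ} {K : ℝ → ℝ → ℝ} (hK : IsBoundedKernel κ K) (h : κ ≤ κ') :
    IsBoundedKernel κ' K :=
  ⟨hK.measurable, hK.symm, fun x y => (hK.bound x y).trans h⟩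

theorem IsUnitProfile.isRegularProfile {ε : ℝ} (hε : 0 ≤ ε) (hε1 : ε ≤ 1) {W : ℝ → ℝ → ℝ}
    (hW : IsPerturbation W) {G : ℝ → ℝ} (hG : IsUnitProfile (kernel ε W) G) :
    IsRegularProfile (kernel ε (posKernel W)) G where
  bounded := (hW.isBoundedKernel_kernel hε).mono (by linarith)
  two_le x y := by
    have := mul_nonneg hε (hW.posKernel_nonneg x y)
    rw [kernel]
    linarith
  memL1k := hG.memL1k
  nonneg := hG.nonneg
  mass := hG.mass
  pair := hG.toIsProfile.isStationaryPair hε hW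

theorem abs_max_sub_le {y x : ℝ} (hx : 0 ≤ x) (hy : 0 ≤ y) : |max (y - x) 0| ≤ y := by
  rw [abs_of_nonneg (le_max_right _ _)]
  exact max_le (by linarith) hy

theorem max_defect_nonneg {x u y : ℝ} (hx : 0 ≤ x) (hu : 0 ≤ u) (hy : 0 ≤ y) :
    0 ≤ max (u + y - x) 0 - max (u - x) 0 - max (y - x) 0 := by
  rcases le_total x u with h1 | h1 <;> rcases le_total x y with h2 | h2 <;>
  rcases le_total x (u + y) with h3 | h3 <;>
  simp only [max_eq_left, max_eq_right, sub_nonneg, sub_nonpos, h1, h2, h3] <;> linarith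

theorem max_defect_le {x u y : ℝ} (hx : 0 ≤ x) (hu : 0 ≤ u) (hy : 0 ≤ y) :
    max (u + y - x) 0 - max (u - x) 0 - max (y - x) 0 ≤ x := by
  rcases le_total x u with h1 | h1 <;> rcases le_total x y with h2 | h2 <;>
  rcases le_total x (u + y) with h3 | h3 <;>
  simp only [max_eq_left, max_eq_right, sub_nonneg, sub_nonpos, h1, h2, h3] <;> linarith

/-- If both sizes exceed `x`, the defect of `(· - x)₊` is exactly `x`; otherwise it is still
nonnegative. -/
theorem le_max_defect {x u y : ℝ} (hx : 0 ≤ x) (hu : 0 ≤ u) (hy : 0 ≤ y) :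
    x * ((if x < u then 1 else 0) * (if x < y then 1 else 0))
      ≤ max (u + y - x) 0 - max (u - x) 0 - max (y - x) 0 := by
  by_cases h1 : x < u
  · by_cases h2 : x < y
    · rw [if_pos h1, if_pos h2, max_eq_left (by linarith), max_eq_left (by linarith),
        max_eq_left (by linarith)]
      linarith
    · rw [if_neg h2, mul_zero, mul_zero]
      exact max_defect_nonneg hx hu hy
  · rw [if_neg h1, zero_mul, mul_zero]
    exact max_defect_nonneg hx hu hy

namespace IsRegularProfile

variable {K : ℝ → ℝ → ℝ} {G : ℝ → ℝ}

theorem memL1k_coag (H : IsRegularProfile K G) : MemL1k 1 (coag K G G) :=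
  H.bounded.memL1k_coag zero_le_one H.memL1k H.memL1k

theorem integrable (H : IsRegularProfile K G) : Integrable G posMeasure :=
  H.memL1k.integrable zero_le_one

theorem setIntegral_nonneg (H : IsRegularProfile K G) {x : ℝ} (hx : 0 ≤ x) :
    0 ≤ ∫ y in Ioi x, G y :=
  integral_nonneg_of_ae (ae_restrict_of_ae_restrict_of_subset (Ioi_subset_Ioi hx) H.nonneg)

/-- Let `T` be the tail at `x`. The tail identity with the weak form bounds `x T` from below by `x
T²`, because `K ≥ 2` and the defect is at least `x` when both sizes exceed `x`. Hence `T ≤ 1`. -/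
theorem tail_le_one (H : IsRegularProfile K G) {x : ℝ} (hx : 0 < x) : ∫ y in Ioi x, G y ≤ 1 := by
  have h1 := H.pair.tail H.memL1k_coag hx
  have hK := H.bounded
  have hψ : Measurable fun y : ℝ => max (y - x) 0 := by fun_prop
  rw [hK.integral_mul_coag zero_le_one H.memL1k H.memL1k hψ zero_le_one fun y hy => by
    refine (abs_max_sub_le hx.le hy.le).trans ?_
    rw [Real.rpow_one]; linarith] at h1
  set T := ∫ y in Ioi x, G y with hT
  have hT0 : 0 ≤ T := H.setIntegral_nonneg hx.le
  have hG0 : MemL1k 0 G := H.memL1k.mono zero_le_one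
  have hd : Measurable (Function.uncurry fun u y : ℝ =>
      max (u + y - x) 0 - max (u - x) 0 - max (y - x) 0) := by
    unfold Function.uncurry
    fun_prop
  have hi := measurable_lt_indicator.of_uncurry_left (x := x)
  have h2 : ∫ y in Ioi 0, (∫ u in Ioi 0, 2 * x * ((if x < u then (1 : ℝ) else 0)
      * (if x < y then 1 else 0)) * G u) * G y
      ≤ ∫ y in Ioi 0, (∫ u in Ioi 0, (max (u + y - x) 0 - max (u - x) 0 - max (y - x) 0)
        * K u y * G u) * G y := by
    refine integral_bilinear_mono (j := 0) (β := 2 * x) (β' := x * 3) ?_ ?_ ?_ ?_ ?_ hG0 hG0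
      H.nonneg H.nonneg
    · exact ((hi.comp measurable_fst).mul (hi.comp measurable_snd)).const_mul _
    · exact hd.mul hK.measurable
    · intro u y _ _
      split_ifs <;> simp [abs_of_pos hx, hx.le]
    · intro u y hu hy
      rw [abs_mul, abs_of_nonneg (max_defect_nonneg hx.le hu.le hy.le)]
      simp only [Real.rpow_zero, mul_one]
      exact mul_le_mul (max_defect_le hx.le hu.le hy.le) (hK.bound u y) (abs_nonneg _) hx.le
    · intro u y hu hy
      have h3 := le_max_defect hx.le hu.le hy.le
      have h4 := H.two_le u y
      have h5 := max_defect_nonneg hx.le hu.le hy.le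
      nlinarith
  have h3 : ∫ y in Ioi 0, (∫ u in Ioi 0, 2 * x * ((if x < u then (1 : ℝ) else 0)
      * (if x < y then 1 else 0)) * G u) * G y = 2 * x * (T * T) := by
    have e1 : ∀ y, ∫ u in Ioi 0, 2 * x * ((if x < u then (1 : ℝ) else 0)
        * (if x < y then 1 else 0)) * G u = 2 * x * (if x < y then 1 else 0) * T := by
      intro y
      rw [hT, ← integral_ite_lt G hx.le, ← integral_const_mul]
      exact integral_congr_ae (ae_of_all _ fun u => by ring)
    have e2 : ∀ y, 2 * x * (if x < y then (1 : ℝ) else 0) * T * G y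
        = 2 * x * T * ((if x < y then (1 : ℝ) else 0) * G y) := fun y => by ring
    simp only [e1, e2]
    rw [integral_const_mul, integral_ite_lt G hx.le]
    ring
  simp only [mul_assoc] at h1 h2 h3
  rw [h3] at h2
  have h4 : x * (T * T) ≤ x * T := by linarith
  have h5 := le_of_mul_le_mul_left h4 hx
  by_contra hcon
  rw [not_le] at hcon
  nlinarith

theorem integral_le_one (H : IsRegularProfile K G) : ∫ y in Ioi 0, G y ≤ 1 := by
  have hlim : Tendsto (fun n : ℕ => ∫ y in Ioi ((n : ℝ) + 1)⁻¹, G y) atTop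
      (𝓝 (∫ y in Ioi 0, G y)) := by
    have e : (⋃ n : ℕ, Ioi ((n : ℝ) + 1)⁻¹) = Ioi 0 := by
      ext x
      simp only [mem_iUnion, mem_Ioi]
      constructor
      · rintro ⟨n, hn⟩
        exact lt_trans (by positivity) hn
      · intro hx
        obtain ⟨n, hn⟩ := exists_nat_one_div_lt hx
        exact ⟨n, by simpa using hn⟩
    have h1 := tendsto_setIntegral_of_monotone (μ := volume) (f := G)
      (s := fun n : ℕ => Ioi ((n : ℝ) + 1)⁻¹) (fun n => measurableSet_Ioi) (fun n m hnm => by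
        refine Ioi_subset_Ioi ?_
        have : (n : ℝ) ≤ m := by exact_mod_cast hnm
        gcongr) (by rw [e]; exact H.integrable)
    rwa [e] at h1
  exact le_of_tendsto' hlim fun n => H.tail_le_one (by positivity)

end IsRegularProfile

/-! ### Higher moments by truncated power functions. -/

theorem add_pow_sub_pow_le {a b : ℝ} (ha : 0 ≤ a) (hb : 0 ≤ b) (m : ℕ) :
    (a + b) ^ (m + 1) - a ^ (m + 1) ≤ (m + 1) * b * (a + b) ^ m := by
  induction m with
  | zero => simp
  | succ m ih =>
    have h1 : a ^ (m + 1) ≤ (a + b) ^ (m + 1) := by gcongr; linarith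
    have h2 := mul_le_mul_of_nonneg_left ih (add_nonneg ha hb)
    have h3 := mul_le_mul_of_nonneg_left h1 hb
    push_cast
    have e1 : (a + b) ^ (m + 1 + 1) - a ^ (m + 1 + 1)
        = (a + b) * ((a + b) ^ (m + 1) - a ^ (m + 1)) + b * a ^ (m + 1) := by ring
    have e2 : ((m : ℝ) + 1 + 1) * b * (a + b) ^ (m + 1)
        = (a + b) * ((m + 1) * b * (a + b) ^ m) + b * (a + b) ^ (m + 1) := by ring
    rw [e1, e2]
    linarith

/-- The bound must not depend on `R`, so that the truncation can be removed. It contains only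
products of a first and an `(m + 1)`-th power, whose integrals are the mass times a known moment. -/
theorem mul_min_pow_sub_le {u y R : ℝ} (hu : 0 ≤ u) (hy : 0 ≤ y) (hR : 0 ≤ R) (m : ℕ) :
    u * (min (u + y) R ^ (m + 1) - min u R ^ (m + 1))
      ≤ (m + 1) * 2 ^ m * (y * u ^ (m + 1) + u * y ^ (m + 1)) := by
  set a := min u R with ha
  set b := min y R with hb
  have ha0 : 0 ≤ a := le_min hu hR
  have hb0 : 0 ≤ b := le_min hy hR
  have hau : a ≤ u := min_le_left _ _
  have hby : b ≤ y := min_le_left _ _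
  have h1 : min (u + y) R ≤ a + b := by
    rcases le_total u R with h | h
    · rcases le_total y R with h' | h'
      · rw [ha, hb, min_eq_left h, min_eq_left h']
        exact min_le_left _ _
      · rw [hb, min_eq_right h']
        exact (min_le_right _ _).trans (by linarith)
    · rw [ha, min_eq_right h]
      exact (min_le_right _ _).trans (by linarith)
  have h2 : min (u + y) R ^ (m + 1) ≤ (a + b) ^ (m + 1) :=
    pow_le_pow_left₀ (le_min (add_nonneg hu hy) hR) h1 _
  have h3 := add_pow_sub_pow_le ha0 hb0 m
  have h4 : (a + b) ^ m ≤ 2 ^ m * (a ^ m + b ^ m) := by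
    refine (add_pow_le ha0 hb0 m).trans ?_
    gcongr
    · norm_num
    · exact Nat.sub_le m 1
  have h5 : u * (b * (a ^ m + b ^ m)) ≤ y * u ^ (m + 1) + u * y ^ (m + 1) := by
    have h6 : a ^ m ≤ u ^ m := by gcongr
    have h7 : b ^ m ≤ y ^ m := by gcongr
    calc u * (b * (a ^ m + b ^ m)) ≤ u * (y * (u ^ m + y ^ m)) := by gcongr
      _ = _ := by ring
  calc u * (min (u + y) R ^ (m + 1) - a ^ (m + 1))
      ≤ u * ((m + 1) * b * (2 ^ m * (a ^ m + b ^ m))) := by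
        gcongr
        refine (sub_le_sub_right h2 _).trans (h3.trans ?_)
        gcongr
    _ = (m + 1) * 2 ^ m * (u * (b * (a ^ m + b ^ m))) := by ring
    _ ≤ _ := by gcongr

theorem intervalIntegral_pow_truncated (m : ℕ) {y R : ℝ} (hy : 0 ≤ y) (hR : 0 ≤ R) :
    ∫ x in (0 : ℝ)..y, (Ioc 0 R).indicator (fun x => ((m : ℝ) + 1) * x ^ m) x
      = min y R ^ (m + 1) := by
  rw [intervalIntegral.integral_of_le hy, integral_indicator measurableSet_Ioc,
    Measure.restrict_restrict measurableSet_Ioc, Ioc_inter_Ioc, sup_idem, inf_comm,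
    ← intervalIntegral.integral_of_le (le_min hy hR), intervalIntegral.integral_const_mul,
    integral_pow]
  have : (m : ℝ) + 1 ≠ 0 := by positivity
  field_simp
  change min y R ^ (m + 1) - 0 ^ (m + 1) = _
  simp

namespace IsRegularProfile

variable {K : ℝ → ℝ → ℝ} {G : ℝ → ℝ}

theorem integrable_pow_mul {m : ℕ} (hm : MemL1k ((m : ℕ) : ℝ) G) :
    Integrable (fun x => x ^ m * G x) posMeasure := by
  refine hm.integrable_mul zero_le_one (by fun_prop) fun x hx => ?_
  rw [one_mul, Real.rpow_natCast, abs_of_nonneg (by positivity)]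
  gcongr
  linarith

/-- The density `(m + 1) x ^ m` on `(0, R]` is used in the integrated equation. Its primitive makes
`y min(y, R)^{m+1}` the test function for coagulation, and the defect of that function involves only
moments of order `1` and `m + 1`: each moment controls the next one. -/
theorem truncated_moment_le (H : IsRegularProfile K G) (m : ℕ)
    (hm : MemL1k ((m + 1 : ℕ) : ℝ) G) {R : ℝ} (hR : 0 ≤ R) :
    ∫ x in (0 : ℝ)..R, x ^ (m + 2) * G x ≤ 6 * 2 ^ m * ∫ x in Ioi 0, x ^ (m + 1) * G x := by
  have hK := H.bounded
  set N : ℝ := (m : ℝ) + 1 with hN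
  have hN0 : 0 < N := by positivity
  set μ := ∫ x in Ioi 0, x ^ (m + 1) * G x with hμ
  set χ : ℝ → ℝ := fun y => min y R ^ (m + 1) with hχ
  set ψ : ℝ → ℝ := fun y => y * χ y with hψ
  have hχm : Measurable χ := by fun_prop
  have hψm : Measurable ψ := by fun_prop
  have hχ0 : ∀ y, 0 ≤ y → 0 ≤ χ y := fun y hy => pow_nonneg (le_min hy hR) _
  have hχmono : ∀ u y, 0 ≤ u → u ≤ y → χ u ≤ χ y := fun u y hu huy =>
    pow_le_pow_left₀ (le_min hu hR) (min_le_min_right R huy) _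
  have hχR : ∀ y, 0 ≤ y → χ y ≤ R ^ (m + 1) := fun y hy =>
    pow_le_pow_left₀ (le_min hy hR) (min_le_right _ _) _
  have hi : Integrable ((Ioc 0 R).indicator fun x => N * x ^ m) posMeasure :=
    ((integrable_indicator_iff measurableSet_Ioc).2
      ((Continuous.integrableOn_Icc (by fun_prop)).mono_set Ioc_subset_Icc_self)).restrict
  have h1 := H.pair.integral_mul H.memL1k_coag hi
  have e1 : ∫ x in Ioi 0, (Ioc 0 R).indicator (fun x => N * x ^ m) x * (x ^ 2 * G x)
      = N * ∫ x in (0 : ℝ)..R, x ^ (m + 2) * G x := by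
    have : ∀ x, (Ioc 0 R).indicator (fun x => N * x ^ m) x * (x ^ 2 * G x)
        = (Ioc 0 R).indicator (fun x => N * (x ^ (m + 2) * G x)) x := by
      intro x
      by_cases h : x ∈ Ioc 0 R
      · rw [indicator_of_mem h, indicator_of_mem h]
        ring
      · rw [indicator_of_notMem h, indicator_of_notMem h, zero_mul]
    simp only [this]
    rw [integral_indicator measurableSet_Ioc, Measure.restrict_restrict measurableSet_Ioc,
      inter_eq_left.2 Ioc_subset_Ioi_self, integral_const_mul, intervalIntegral.integral_of_le hR]
  have e2 : ∫ y in Ioi 0, (∫ x in (0 : ℝ)..y, (Ioc 0 R).indicator (fun x => N * x ^ m) x)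
      * (y * coag K G G y) = ∫ y in Ioi 0, ψ y * coag K G G y := by
    refine setIntegral_congr_fun measurableSet_Ioi fun y hy => ?_
    simp only [hψ, hχ]
    rw [hN, intervalIntegral_pow_truncated m (le_of_lt hy) hR]
    ring
  rw [e1, e2, hK.integral_mul_coag zero_le_one H.memL1k H.memL1k hψm (d := R ^ (m + 1))
    (by positivity) fun y hy => by
      rw [abs_of_nonneg (mul_nonneg hy.le (hχ0 y hy.le)), Real.rpow_one, mul_comm]
      have := hχR y hy.le
      have h3 := hχ0 y hy.le
      nlinarith] at h1
  -- A factor `2` from the two symmetric halves of the defect and `3` from the bound on `K`.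
  set c : ℝ := 6 * N * 2 ^ m with hc
  have hc0 : 0 < c := by positivity
  have hd0 : ∀ u y, 0 < u → 0 < y → 0 ≤ ψ (u + y) - ψ u - ψ y := by
    intro u y hu hy
    have h2 := hχmono u (u + y) hu.le (by linarith)
    have h3 := hχmono y (u + y) hy.le (by linarith)
    simp only [hψ]
    nlinarith
  have hdle : ∀ u y, 0 < u → 0 < y → (ψ (u + y) - ψ u - ψ y) * K u y
      ≤ c * (y * u ^ (m + 1) + u * y ^ (m + 1)) := by
    intro u y hu hy
    have h2 := mul_min_pow_sub_le hu.le hy.le hR m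
    have h3 := mul_min_pow_sub_le hy.le hu.le hR m
    rw [add_comm y u] at h3
    have h4 : ψ (u + y) - ψ u - ψ y
        ≤ 2 * (N * 2 ^ m * (y * u ^ (m + 1) + u * y ^ (m + 1))) := by
      simp only [hψ, hχ]
      linarith
    have h5 := (abs_le.1 (hK.bound u y)).2
    calc (ψ (u + y) - ψ u - ψ y) * K u y ≤ (ψ (u + y) - ψ u - ψ y) * 3 :=
          mul_le_mul_of_nonneg_left h5 (hd0 u y hu hy)
      _ ≤ 2 * (N * 2 ^ m * (y * u ^ (m + 1) + u * y ^ (m + 1))) * 3 := by gcongr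
      _ = _ := by rw [hc]; ring
  have hb' : ∀ u y : ℝ, 0 < u → 0 < y → c * (y * u ^ (m + 1) + u * y ^ (m + 1))
      ≤ c * 2 * ((1 + u) ^ ((m + 1 : ℕ) : ℝ) * (1 + y) ^ ((m + 1 : ℕ) : ℝ)) := by
    intro u y hu hy
    rw [Real.rpow_natCast, Real.rpow_natCast]
    have a1 : u ≤ (1 + u) ^ (m + 1) :=
      (by linarith : u ≤ 1 + u).trans (le_self_pow₀ (by linarith) (Nat.succ_ne_zero m))
    have a2 : y ≤ (1 + y) ^ (m + 1) :=
      (by linarith : y ≤ 1 + y).trans (le_self_pow₀ (by linarith) (Nat.succ_ne_zero m))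
    have a3 : u ^ (m + 1) ≤ (1 + u) ^ (m + 1) := by gcongr; linarith
    have a4 : y ^ (m + 1) ≤ (1 + y) ^ (m + 1) := by gcongr; linarith
    have a5 : y * u ^ (m + 1) ≤ (1 + y) ^ (m + 1) * (1 + u) ^ (m + 1) := by gcongr
    have a6 : u * y ^ (m + 1) ≤ (1 + u) ^ (m + 1) * (1 + y) ^ (m + 1) := by gcongr
    rw [mul_assoc c]
    gcongr
    linarith
  have h2 : ∫ y in Ioi 0, (∫ u in Ioi 0, (ψ (u + y) - ψ u - ψ y) * K u y * G u) * G y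
      ≤ ∫ y in Ioi 0, (∫ u in Ioi 0, c * (y * u ^ (m + 1) + u * y ^ (m + 1)) * G u) * G y := by
    refine integral_bilinear_mono (j := ((m + 1 : ℕ) : ℝ)) (β := c * 2) (β' := c * 2) ?_ ?_ ?_ ?_
      hdle hm hm H.nonneg H.nonneg
    · refine Measurable.mul ?_ hK.measurable
      exact ((hψm.comp (measurable_fst.add measurable_snd)).sub (hψm.comp measurable_fst)).sub
        (hψm.comp measurable_snd)
    · unfold Function.uncurry
      fun_prop
    · intro u y hu hy
      rw [abs_of_nonneg (mul_nonneg (hd0 u y hu hy) (by linarith [H.two_le u y]))]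
      exact (hdle u y hu hy).trans (hb' u y hu hy)
    · intro u y hu hy
      rw [abs_of_nonneg (by positivity)]
      exact hb' u y hu hy
  have hiμ := integrable_pow_mul hm
  have hi1 := H.memL1k.integrable_id_mul le_rfl
  have h3 : ∫ y in Ioi 0, (∫ u in Ioi 0, c * (y * u ^ (m + 1) + u * y ^ (m + 1)) * G u) * G y
      = c * (2 * μ) := by
    have e3 : ∀ y, ∫ u in Ioi 0, c * (y * u ^ (m + 1) + u * y ^ (m + 1)) * G u
        = c * (y * μ + y ^ (m + 1)) := by
      intro y
      have : ∀ u, c * (y * u ^ (m + 1) + u * y ^ (m + 1)) * G u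
          = c * y * (u ^ (m + 1) * G u) + c * y ^ (m + 1) * (u * G u) := fun u => by ring
      simp only [this]
      rw [integral_add (hiμ.const_mul _) (hi1.const_mul _), integral_const_mul,
        integral_const_mul, H.mass]
      ring
    have e4 : ∀ y, c * (y * μ + y ^ (m + 1)) * G y
        = c * μ * (y * G y) + c * (y ^ (m + 1) * G y) := fun y => by ring
    simp only [e3, e4]
    rw [integral_add (hi1.const_mul _) (hiμ.const_mul _), integral_const_mul,
      integral_const_mul, H.mass]
    ring
  rw [h3] at h2
  simp only [mul_assoc] at h1 h2
  have h4 : N * ∫ x in (0 : ℝ)..R, x ^ (m + 2) * G x ≤ N * (6 * 2 ^ m * μ) := by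
    have : c * (2 * μ) = 2 * (N * (6 * 2 ^ m * μ)) := by rw [hc]; ring
    linarith
  exact le_of_mul_le_mul_left h4 hN0

/-- The truncated bound is uniform in `R`; nonnegativity of `G` turns it into integrability on the
whole half-line. -/
theorem moment_step (H : IsRegularProfile K G) (m : ℕ) (hm : MemL1k ((m + 1 : ℕ) : ℝ) G) :
    MemL1k ((m + 2 : ℕ) : ℝ) G ∧
      ∫ x in Ioi 0, x ^ (m + 2) * G x ≤ 6 * 2 ^ m * ∫ x in Ioi 0, x ^ (m + 1) * G x := by
  set f : ℝ → ℝ := fun x => x ^ (m + 2) * G x with hf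
  have hfm : AEStronglyMeasurable f posMeasure :=
    (Measurable.aestronglyMeasurable (by fun_prop)).mul H.memL1k.aesm
  have hG0 : ∀ᵐ x ∂posMeasure, 0 ≤ f x := by
    filter_upwards [H.nonneg, ae_pos] with x h1 h2
    positivity
  have hloc : ∀ R : ℝ, IntegrableOn f (Ioc 0 R) := by
    intro R
    have h1 : IntegrableOn G (Ioc 0 R) := IntegrableOn.mono_set (t := Ioi 0) H.integrable
      Ioc_subset_Ioi_self
    refine (h1.norm.const_mul (R ^ (m + 2))).mono' (hfm.mono_measure
      (Measure.restrict_mono Ioc_subset_Ioi_self le_rfl)) ?_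
    filter_upwards [ae_restrict_mem measurableSet_Ioc] with x hx
    rw [hf, norm_mul, norm_pow, Real.norm_of_nonneg hx.1.le]
    have := hx.1.le
    gcongr
    exact hx.2
  have htr := fun R : ℝ => H.truncated_moment_le m hm (R := R)
  have hint : IntegrableOn f (Ioi 0) := by
    refine integrableOn_Ioi_of_intervalIntegral_norm_bounded (b := fun R : ℝ => R) (l := atTop)
      (6 * 2 ^ m * ∫ x in Ioi 0, x ^ (m + 1) * G x) 0 hloc tendsto_id ?_
    filter_upwards [eventually_ge_atTop 0] with R hR
    refine le_trans (le_of_eq ?_) (htr R hR)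
    rw [intervalIntegral.integral_of_le hR, intervalIntegral.integral_of_le hR]
    refine integral_congr_ae ?_
    filter_upwards [ae_restrict_of_ae_restrict_of_subset Ioc_subset_Ioi_self hG0] with x hx
    exact Real.norm_of_nonneg hx
  refine ⟨?_, ?_⟩
  · rw [memL1k_iff_integrable H.memL1k.aesm]
    have hb : Integrable (fun x => 2 ^ (m + 2 - 1) * (|G x| + |f x|)) posMeasure :=
      (H.integrable.abs.add (show Integrable f posMeasure from hint).abs).const_mul _
    refine hb.mono' ((Measurable.aestronglyMeasurable (by fun_prop)).mul H.memL1k.aesm) ?_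
    filter_upwards [ae_pos] with x hx
    rw [Real.rpow_natCast, norm_mul, Real.norm_of_nonneg (by positivity), Real.norm_eq_abs]
    have h1 := add_pow_le zero_le_one hx.le (m + 2)
    rw [one_pow] at h1
    calc (1 + x) ^ (m + 2) * |G x| ≤ 2 ^ (m + 2 - 1) * (1 + x ^ (m + 2)) * |G x| := by gcongr
      _ = 2 ^ (m + 2 - 1) * (|G x| + |f x|) := by
        rw [hf, abs_mul, abs_of_nonneg (by positivity : 0 ≤ x ^ (m + 2))]
        ring
  · have hlim := intervalIntegral_tendsto_integral_Ioi 0 hint tendsto_id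
    refine le_of_tendsto hlim ?_
    filter_upwards [eventually_ge_atTop 0] with R hR
    exact htr R hR

/-- The bound for the moments of profiles. -/
def _root_.momentBound : ℕ → ℝ
  | 0 => 1
  | m + 1 => 6 * 2 ^ m * momentBound m

theorem moment_le (H : IsRegularProfile K G) (m : ℕ) :
    MemL1k ((m + 1 : ℕ) : ℝ) G ∧ ∫ x in Ioi 0, x ^ (m + 1) * G x ≤ momentBound m := by
  induction m with
  | zero =>
    refine ⟨by simpa using H.memL1k, ?_⟩
    have := H.mass
    simp only [zero_add, pow_one, momentBound]
    exact this.le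
  | succ m ih =>
    obtain ⟨h1, h2⟩ := H.moment_step m ih.1
    refine ⟨h1, h2.trans ?_⟩
    rw [momentBound]
    gcongr
    exact ih.2

end IsRegularProfile

/-- The moment bounds use only `2 ≤ K ≤ 3`, mass one and the equation, so `B` is the same for all
kernels and profiles. -/
theorem exists_nrm_profile_le (k : ℝ) : ∃ B : ℝ, 1 ≤ B ∧ ∀ (K : ℝ → ℝ → ℝ) (G : ℝ → ℝ),
    IsRegularProfile K G → MemL1k k G ∧ nrm k G ≤ B := by
  obtain ⟨m, hm⟩ := exists_nat_ge k
  have hk : k ≤ ((m + 1 : ℕ) : ℝ) := by push_cast; linarith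
  refine ⟨max 1 (2 ^ (m + 1 - 1) * (1 + momentBound m)), le_max_left _ _, fun K G H => ?_⟩
  obtain ⟨h1, h2⟩ := H.moment_le m
  refine ⟨h1.mono hk, ((nrm_mono hk h1).trans ?_).trans (le_max_right _ _)⟩
  have hi := IsRegularProfile.integrable_pow_mul h1
  calc nrm ((m + 1 : ℕ) : ℝ) G = ∫ x in Ioi 0, (1 + x) ^ ((m + 1 : ℕ) : ℝ) * |G x| :=
        nrm_eq_integral h1
    _ ≤ ∫ x in Ioi 0, 2 ^ (m + 1 - 1) * (G x + x ^ (m + 1) * G x) := by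
        refine integral_mono_ae ?_ ((H.integrable.add hi).const_mul _) ?_
        · refine ((memL1k_iff_integrable h1.aesm).1 h1).norm.congr ?_
          filter_upwards [ae_pos] with x hx
          rw [norm_mul, Real.norm_of_nonneg (by positivity), Real.norm_eq_abs]
        · filter_upwards [ae_pos, H.nonneg] with x hx h0
          have h3 := add_pow_le zero_le_one hx.le (m + 1)
          rw [one_pow] at h3
          rw [Real.rpow_natCast, abs_of_nonneg h0]
          calc (1 + x) ^ (m + 1) * G x ≤ 2 ^ (m + 1 - 1) * (1 + x ^ (m + 1)) * G x := by gcongr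
            _ = _ := by ring
    _ = 2 ^ (m + 1 - 1) * ((∫ x in Ioi 0, G x) + ∫ x in Ioi 0, x ^ (m + 1) * G x) := by
        rw [integral_const_mul, integral_add H.integrable hi]
    _ ≤ _ := by
        gcongr
        exact H.integral_le_one

/-! ### Tails -/

/-- The kernel of `g ↦ ∫_x^∞ g`. -/
def ltKernel (x y : ℝ) : ℝ := if x < y then 1 else 0

/-- The kernel of `g ↦ ∫_x^∞ (y - x) g(y) dy`. -/
def maxKernel (x y : ℝ) : ℝ := max (y - x) 0

theorem measurable_maxKernel : Measurable (Function.uncurry maxKernel) := by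
  unfold Function.uncurry maxKernel
  fun_prop

theorem measurable_ltKernel : Measurable (Function.uncurry ltKernel) := measurable_lt_indicator

theorem kernelOp_ltKernel (g : ℝ → ℝ) {x : ℝ} (hx : 0 ≤ x) :
    kernelOp ltKernel g x = ∫ y in Ioi x, g y := integral_ite_lt g hx

theorem kernelOp_congr (p : ℝ → ℝ → ℝ) {g g' : ℝ → ℝ} (h : g =ᵐ[posMeasure] g') :
    kernelOp p g = kernelOp p g' := by
  ext x
  refine integral_congr_ae ?_
  filter_upwards [h] with y hy
  rw [hy]

theorem measurable_kernelOp {p : ℝ → ℝ → ℝ} (hp : Measurable (Function.uncurry p)) {g : ℝ → ℝ}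
    (hg : AEStronglyMeasurable g posMeasure) : Measurable (kernelOp p g) := by
  rw [kernelOp_congr p hg.ae_eq_mk]
  exact (StronglyMeasurable.integral_prod_right (ν := posMeasure)
    (hp.mul (hg.stronglyMeasurable_mk.measurable.comp measurable_snd)).stronglyMeasurable).measurable

theorem nrm_kernelOp_le {j c : ℝ} (hc : 0 ≤ c) {p : ℝ → ℝ → ℝ}
    (hp : Measurable (Function.uncurry p)) {h : ℝ → ℝ}
    (hN : ∀ y, 0 < y → normL1k 0 (fun x => p x y) ≤ ENNReal.ofReal c * weight j y)
    (hh : MemL1k j h) : MemL1k 0 (kernelOp p h) ∧ nrm 0 (kernelOp p h) ≤ c * nrm j h := by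
  have h1 := (normL1k_kernel_le (k := 0) hp hh.aesm).trans (lintegral_kernel_le hN)
  rw [← hh.ofReal_nrm, ← ENNReal.ofReal_mul hc] at h1
  exact ⟨memL1k_iff.2 ⟨aesm_kernel hp hh.aesm, h1.trans_lt ENNReal.ofReal_lt_top⟩,
    nrm_le_of_le (mul_nonneg hc (nrm_nonneg _ _)) h1⟩

theorem normL1k_zero_le_of_bound {φ : ℝ → ℝ} {c y : ℝ} (hy : 0 < y)
    (h1 : ∀ x, 0 < x → x < y → |φ x| ≤ c) (h2 : ∀ x, y ≤ x → φ x = 0) :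
    normL1k 0 φ ≤ ENNReal.ofReal (c * y) := by
  have hc : 0 ≤ c := (abs_nonneg _).trans (h1 (y / 2) (by linarith) (by linarith))
  rw [normL1k_eq]
  have h3 : ∀ x ∈ Ioi (0 : ℝ), ‖φ x‖ₑ * weight 0 x
      ≤ (Ioc 0 y).indicator (fun _ => ENNReal.ofReal c) x := by
    intro x hx
    have hx : 0 < x := hx
    rcases lt_or_ge x y with h | h
    · rw [indicator_of_mem (show x ∈ Ioc 0 y from ⟨hx, h.le⟩), weight, Real.rpow_zero,
        ENNReal.ofReal_one, mul_one, Real.enorm_eq_ofReal_abs]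
      exact ENNReal.ofReal_le_ofReal (h1 x hx h)
    · rw [h2 x h]
      simp
  refine (setLIntegral_mono' measurableSet_Ioi h3).trans ((setLIntegral_le_lintegral _ _).trans ?_)
  rw [lintegral_indicator measurableSet_Ioc, setLIntegral_const, Real.volume_Ioc, sub_zero,
    ENNReal.ofReal_mul hc]

theorem normL1k_ltKernel_le {y : ℝ} (hy : 0 < y) :
    normL1k 0 (fun x => ltKernel x y) ≤ ENNReal.ofReal 1 * weight 1 y := by
  refine (normL1k_zero_le_of_bound (c := 1) hy (fun x _ h => ?_) fun x h => ?_).trans ?_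
  · simp [ltKernel, h]
  · simp [ltKernel, not_lt.2 h]
  · rw [ENNReal.ofReal_one, one_mul, one_mul, weight, Real.rpow_one]
    exact ENNReal.ofReal_le_ofReal (by linarith)

theorem normL1k_maxKernel_le {y : ℝ} (hy : 0 < y) :
    normL1k 0 (fun x => maxKernel x y) ≤ ENNReal.ofReal 1 * weight 2 y := by
  refine (normL1k_zero_le_of_bound (c := y) hy (fun x h _ => ?_) fun x h => ?_).trans ?_
  · exact abs_max_sub_le h.le hy.le
  · rw [maxKernel, max_eq_right (by linarith)]
  · rw [ENNReal.ofReal_one, one_mul, weight]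
    refine ENNReal.ofReal_le_ofReal ?_
    rw [show (2 : ℝ) = ((2 : ℕ) : ℝ) by norm_num, Real.rpow_natCast]
    nlinarith

theorem nrm_tail_le {g : ℝ → ℝ} (hg : MemL1k 1 g) :
    MemL1k 0 (kernelOp ltKernel g) ∧ nrm 0 (kernelOp ltKernel g) ≤ nrm 1 g := by
  have := nrm_kernelOp_le zero_le_one measurable_lt_indicator
    (fun y hy => normL1k_ltKernel_le hy) hg
  rwa [one_mul] at this

theorem nrm_secondTail_le {g : ℝ → ℝ} (hg : MemL1k 2 g) :
    MemL1k 0 (kernelOp maxKernel g) ∧ nrm 0 (kernelOp maxKernel g) ≤ nrm 2 g := by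
  have := nrm_kernelOp_le zero_le_one measurable_maxKernel (fun y hy => normL1k_maxKernel_le hy) hg
  rwa [one_mul] at this

theorem nrm_kernelOp_shift_le {φ Γ : ℝ → ℝ} (hφm : Measurable φ) (hφ : MemL1k 0 φ)
    (hΓ : MemL1k 0 Γ) : MemL1k 0 (kernelOp (shift φ) Γ) ∧
      nrm 0 (kernelOp (shift φ) Γ) ≤ nrm 0 φ * nrm 0 Γ :=
  nrm_kernelOp_le (nrm_nonneg 0 φ) (measurable_shift hφm) (fun y hy => by
    rw [hφ.ofReal_nrm]
    exact normL1k_shift_le le_rfl φ hy) hΓ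

theorem abs_tail_le {g : ℝ → ℝ} (hg : MemL1k 0 g) (x : ℝ) : |kernelOp ltKernel g x| ≤ nrm 0 g := by
  refine abs_integral_le_integral_abs.trans ((hg.integral_abs_mul_le zero_le_one
    fun y _ => ?_).trans (one_mul _).le)
  rw [ltKernel]
  split_ifs <;> simp

theorem abs_secondTail_le {g : ℝ → ℝ} (hg : MemL1k 1 g) {x : ℝ} (hx : 0 ≤ x) :
    |kernelOp maxKernel g x| ≤ nrm 1 g := by
  refine abs_integral_le_integral_abs.trans ((hg.integral_abs_mul_le zero_le_one
    fun y hy => ?_).trans (one_mul _).le)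
  refine (abs_max_sub_le hx hy.le).trans ?_
  rw [Real.rpow_one]
  linarith

theorem integrable_shift_mul {φ Γ : ℝ → ℝ} {c : ℝ} (hφm : Measurable φ)
    (hφ : ∀ s, 0 ≤ s → |φ s| ≤ c) (hΓ : MemL1k 0 Γ) (x : ℝ) :
    Integrable (fun y => shift φ x y * Γ y) posMeasure := by
  have hc : 0 ≤ c := (abs_nonneg _).trans (hφ 0 le_rfl)
  refine hΓ.integrable_mul hc ((measurable_shift hφm).of_uncurry_left (x := x)) fun y _ => ?_
  rw [Real.rpow_zero, mul_one]
  by_cases h : y < x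
  · simp only [shift, if_pos h]
    exact hφ _ (by linarith)
  · simpa [shift, h] using hc

theorem integrable_ltKernel_mul {g : ℝ → ℝ} (hg : MemL1k 0 g) (x : ℝ) :
    Integrable (fun y => ltKernel x y * g y) posMeasure := by
  refine hg.integrable_mul zero_le_one (measurable_lt_indicator.of_uncurry_left (x := x))
    fun y _ => ?_
  rw [ltKernel]
  split_ifs <;> simp

theorem integrable_maxKernel_mul {g : ℝ → ℝ} (hg : MemL1k 1 g) {x : ℝ} (hx : 0 ≤ x) :
    Integrable (fun y => maxKernel x y * g y) posMeasure := by
  refine hg.integrable_mul zero_le_one (measurable_maxKernel.of_uncurry_left (x := x))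
    fun y hy => (abs_max_sub_le hx hy.le).trans ?_
  rw [Real.rpow_one]
  linarith

/-! ### Tails of the coagulation operator and recovery of the second tail. -/

section Weak

variable {g Γ : ℝ → ℝ}

/-- For `y < x` the defect shifts the threshold `x` to `x - y`, which produces a convolution. For `y
≥ x` it equals `u - (u - x)₊`, and zero mass of `g` kills the first part, so the convolution may be
extended by zero. -/
theorem integral_maxKernel_mul_coag (hg : MemL1k 1 g) (hΓ : MemL1k 1 Γ)
    (h0 : ∫ x in Ioi 0, x * g x = 0) {x : ℝ} (hx : 0 < x) :
    kernelOp maxKernel (coag kernelZero Γ g) x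
      = kernelOp (shift (kernelOp maxKernel g)) Γ x
        - (∫ y in Ioi 0, Γ y) * kernelOp maxKernel g x := by
  set F := kernelOp maxKernel g with hF
  have hFm : Measurable F := measurable_kernelOp measurable_maxKernel hg.aesm
  have hΓ0 := hΓ.mono zero_le_one
  have e1 : kernelOp maxKernel (coag kernelZero Γ g) x
      = ∫ y in Ioi 0, maxKernel x y * coag kernelZero g Γ y := by
    refine integral_congr_ae (ae_of_all _ fun y => ?_)
    simp only
    rw [coag_comm isBoundedKernel_kernelZero]
  rw [e1, isBoundedKernel_kernelZero.integral_mul_coag zero_le_one hg hΓ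
    (measurable_maxKernel.of_uncurry_left (x := x)) zero_le_one fun y hy => by
      refine (abs_max_sub_le hx.le hy.le).trans ?_
      rw [Real.rpow_one]; linarith]
  have e2 : ∀ y ∈ Ioi (0 : ℝ), (∫ u in Ioi 0, (maxKernel x (u + y) - maxKernel x u - maxKernel x y)
      * (kernelZero u y * g u)) * Γ y = 2 * (shift F x y * Γ y - F x * Γ y) := by
    intro y hy
    have hy : 0 < y := hy
    have hi := integrable_maxKernel_mul hg hx.le
    have : ∫ u in Ioi 0, (maxKernel x (u + y) - maxKernel x u - maxKernel x y)
        * (kernelZero u y * g u) = 2 * (shift F x y - F x) := by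
      rcases lt_or_ge y x with h | h
      · have e : ∀ u, (maxKernel x (u + y) - maxKernel x u - maxKernel x y)
            * (kernelZero u y * g u)
            = 2 * (maxKernel (x - y) u * g u - maxKernel x u * g u) := by
          intro u
          simp only [maxKernel, kernelZero]
          rw [max_eq_right (by linarith : y - x ≤ 0), show u + y - x = u - (x - y) by ring]
          ring
        simp only [e]
        rw [integral_const_mul, integral_sub (integrable_maxKernel_mul hg (by linarith)) hi,
          shift, if_pos h]
        rfl
      · have e : ∀ u ∈ Ioi (0 : ℝ), (maxKernel x (u + y) - maxKernel x u - maxKernel x y)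
            * (kernelZero u y * g u) = 2 * (u * g u - maxKernel x u * g u) := by
          intro u hu
          have hu : 0 < u := hu
          simp only [maxKernel, kernelZero]
          rw [max_eq_left (by linarith : 0 ≤ y - x), max_eq_left (by linarith : 0 ≤ u + y - x)]
          ring
        rw [setIntegral_congr_fun measurableSet_Ioi e, integral_const_mul,
          integral_sub (hg.integrable_id_mul le_rfl) hi, h0, shift, if_neg (not_lt.2 h)]
        rfl
    rw [this]
    ring
  rw [setIntegral_congr_fun measurableSet_Ioi e2, integral_const_mul,
    integral_sub (integrable_shift_mul hFm (fun s hs => abs_secondTail_le hg hs) hΓ0 x)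
      ((hΓ0.integrable le_rfl).const_mul _), integral_const_mul]
  simp only [kernelOp]
  ring

theorem integral_ltKernel_mul_coag (hg : MemL1k 1 g) (hΓ : MemL1k 1 Γ) (x : ℝ) :
    kernelOp ltKernel (coag kernelZero Γ g) x
      = kernelOp (shift (kernelOp ltKernel g)) Γ x
        - (∫ y in Ioi 0, Γ y) * kernelOp ltKernel g x := by
  set F := kernelOp ltKernel g with hF
  have hFm : Measurable F := measurable_kernelOp measurable_lt_indicator hg.aesm
  have hg0 := hg.mono zero_le_one
  have hΓ0 := hΓ.mono zero_le_one
  have e1 : kernelOp ltKernel (coag kernelZero Γ g) x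
      = ∫ y in Ioi 0, (if x < y then (1 : ℝ) else 0) * coag kernelZero g Γ y := by
    refine integral_congr_ae (ae_of_all _ fun y => ?_)
    simp only [ltKernel]
    rw [coag_comm isBoundedKernel_kernelZero]
  rw [e1, isBoundedKernel_kernelZero.integral_mul_coag le_rfl hg0 hΓ0
    (measurable_lt_indicator.of_uncurry_left (x := x)) zero_le_one fun y hy => by
      split_ifs <;> simp]
  -- At `y = x` the strict and non-strict conventions of the indicators clash; a single point is
  -- null.
  have hne : ∀ᵐ y ∂posMeasure, y ≠ x := ae_restrict_of_ae (Measure.ae_ne volume x)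
  have e2 : ∀ᵐ y ∂posMeasure, (∫ u in Ioi 0, ((if x < u + y then (1 : ℝ) else 0)
      - (if x < u then 1 else 0) - (if x < y then 1 else 0)) * (kernelZero u y * g u)) * Γ y
      = 2 * (shift F x y * Γ y - F x * Γ y) := by
    filter_upwards [hne, ae_pos] with y hyx hy
    have hi := integrable_ltKernel_mul hg0 x
    have : ∫ u in Ioi 0, ((if x < u + y then (1 : ℝ) else 0)
        - (if x < u then 1 else 0) - (if x < y then 1 else 0)) * (kernelZero u y * g u)
        = 2 * (shift F x y - F x) := by
      rcases lt_or_gt_of_ne hyx with h | h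
      · have e : ∀ u, ((if x < u + y then (1 : ℝ) else 0)
            - (if x < u then 1 else 0) - (if x < y then 1 else 0)) * (kernelZero u y * g u)
            = 2 * (ltKernel (x - y) u * g u - ltKernel x u * g u) := by
          intro u
          simp only [ltKernel, kernelZero, sub_lt_iff_lt_add, if_neg h.not_gt]
          ring
        simp only [e]
        rw [integral_const_mul, integral_sub (integrable_ltKernel_mul hg0 _) hi,
          shift, if_pos h]
        rfl
      · have e : ∀ u ∈ Ioi (0 : ℝ), ((if x < u + y then (1 : ℝ) else 0)
            - (if x < u then 1 else 0) - (if x < y then 1 else 0)) * (kernelZero u y * g u)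
            = -2 * (ltKernel x u * g u) := by
          intro u hu
          have hu : 0 < u := hu
          simp only [ltKernel, kernelZero]
          rw [if_pos h, if_pos (by linarith : x < u + y)]
          ring
        rw [setIntegral_congr_fun measurableSet_Ioi e, integral_const_mul, shift,
          if_neg (not_lt.2 h.le)]
        change -2 * F x = _
        ring
    rw [this]
    ring
  rw [integral_congr_ae e2, integral_const_mul,
    integral_sub (integrable_shift_mul hFm (fun s _ => abs_tail_le hg0 s) hΓ0 x)
      ((hΓ0.integrable le_rfl).const_mul _), integral_const_mul]
  simp only [kernelOp]
  ring

/-- The kernel of `B ↦ x² ∫_x^∞ y⁻³ B(y) dy`. -/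
def cubicKernel (x y : ℝ) : ℝ := if 0 < x ∧ x < y then x ^ 2 * (y ^ 3)⁻¹ else 0

theorem measurable_cubicKernel : Measurable (Function.uncurry cubicKernel) := by
  refine Measurable.ite ((measurableSet_lt measurable_const measurable_fst).inter
    (measurableSet_lt measurable_fst measurable_snd)) ?_ measurable_const
  exact (measurable_fst.pow_const 2).mul (measurable_snd.pow_const 3).inv

theorem normL1k_cubicKernel_le {y : ℝ} (hy : 0 < y) :
    normL1k 0 (fun x => cubicKernel x y) ≤ ENNReal.ofReal (1 / 3) * weight 0 y := by
  have hw : ∀ z, weight 0 z = 1 := fun z => by simp [weight]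
  rw [normL1k_eq, hw, mul_one]
  have h1 : ∀ x ∈ Ioi (0 : ℝ), ‖cubicKernel x y‖ₑ * weight 0 x
      ≤ (Ioc 0 y).indicator (fun x => ENNReal.ofReal (x ^ 2 * (y ^ 3)⁻¹)) x := by
    intro x hx
    have hx : 0 < x := hx
    rw [hw, mul_one]
    by_cases h : x < y
    · rw [indicator_of_mem (show x ∈ Ioc 0 y from ⟨hx, h.le⟩), cubicKernel, if_pos ⟨hx, h⟩,
        Real.enorm_of_nonneg (by positivity)]
    · rw [cubicKernel, if_neg fun h' => h h'.2]
      simp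
  refine (setLIntegral_mono' measurableSet_Ioi h1).trans ((setLIntegral_le_lintegral _ _).trans ?_)
  have hc : Continuous fun x : ℝ => x ^ 2 * (y ^ 3)⁻¹ := by fun_prop
  rw [lintegral_indicator measurableSet_Ioc, ← ofReal_integral_eq_lintegral_ofReal
    (hc.integrableOn_Icc.mono_set Ioc_subset_Icc_self) (ae_of_all _ fun x => by positivity),
    ← intervalIntegral.integral_of_le hy.le, intervalIntegral.integral_mul_const, integral_pow]
  refine ENNReal.ofReal_le_ofReal (le_of_eq ?_)
  norm_num
  field_simp

theorem integral_inv_cube_mul {x w : ℝ} (hx : 0 < x) (hxw : x ≤ w) :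
    ∫ y in x..w, (y ^ 3)⁻¹ * (2 - y / w) = (x ^ 2)⁻¹ - (x * w)⁻¹ := by
  have hw : 0 < w := hx.trans_le hxw
  have h0 : ∀ z ∈ uIcc x w, 0 < z := fun z hz => by
    rw [uIcc_of_le hxw] at hz
    exact hx.trans_le hz.1
  rw [intervalIntegral.integral_eq_sub_of_hasDerivAt
    (f := fun z => -(z ^ 2)⁻¹ + z⁻¹ * w⁻¹)]
  · field_simp
    ring
  · intro z hz
    have hz0 := (h0 z hz).ne'
    have h1 := ((hasDerivAt_pow 2 z).fun_inv (pow_ne_zero 2 hz0)).fun_neg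
    have h2 := (hasDerivAt_inv hz0).mul_const w⁻¹
    convert! h1.add h2 using 1
    field_simp
    ring
  · refine ContinuousOn.intervalIntegrable (ContinuousOn.mul (ContinuousOn.inv₀ (by fun_prop)
      fun z hz => pow_ne_zero _ (h0 z hz).ne') (by fun_prop))

/-- With `F` the second tail and `T = -F'` the tail, `-(y⁻² F)' = y⁻³ (y T + 2 F)`; integrating from
`x` to infinity gives the formula. It is proved by Fubini, so no differentiability is used. -/
theorem secondTail_eq_cubic (hg : MemL1k 1 g) {x : ℝ} (hx : 0 < x) :
    kernelOp maxKernel g x = kernelOp cubicKernel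
      (fun y => y * kernelOp ltKernel g y + 2 * kernelOp maxKernel g y) x := by
  set b : ℝ → ℝ → ℝ := fun y w => if 0 < y ∧ y < w then 2 - y / w else 0 with hb
  have hbm : Measurable (Function.uncurry b) := by
    refine Measurable.ite ((measurableSet_lt measurable_const measurable_fst).inter
      (measurableSet_lt measurable_fst measurable_snd)) ?_ measurable_const
    exact measurable_const.sub (measurable_fst.div measurable_snd)
  have hb2 : ∀ y w, |b y w| ≤ 2 := by
    intro y w
    simp only [hb]
    split_ifs with h
    · have hw : 0 < w := h.1.trans h.2
      have h1 : y / w ≤ 1 := (div_le_one hw).2 h.2.le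
      have h2 : 0 ≤ y / w := div_nonneg h.1.le hw.le
      rw [abs_of_nonneg (by linarith)]
      linarith
    · simp
  have hswap := integral_bounded_swap hbm hb2 (integrable_indicator_inv_pow (n := 3) (by norm_num)
    hx) (hg.integrable_id_mul le_rfl)
  have hin : ∀ y, 0 < y → ∫ w in Ioi 0, b y w * (w * g w)
      = y * kernelOp ltKernel g y + 2 * kernelOp maxKernel g y := by
    intro y hy
    have e : ∀ w ∈ Ioi (0 : ℝ), b y w * (w * g w)
        = y * (ltKernel y w * g w) + 2 * (maxKernel y w * g w) := by
      intro w hw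
      have hw : 0 < w := hw
      simp only [hb, ltKernel, maxKernel]
      by_cases h : y < w
      · rw [if_pos ⟨hy, h⟩, if_pos h, max_eq_left (by linarith)]
        field_simp
        ring
      · rw [if_neg fun h' => h h'.2, if_neg h, max_eq_right (by linarith)]
        ring
    rw [setIntegral_congr_fun measurableSet_Ioi e, integral_add
      ((integrable_ltKernel_mul (hg.mono zero_le_one) y).const_mul _)
      ((integrable_maxKernel_mul hg hy.le).const_mul _), integral_const_mul, integral_const_mul]
    rfl
  have hx2 : x ^ 2 ≠ 0 := by positivity
  have e1 : kernelOp cubicKernel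
      (fun y => y * kernelOp ltKernel g y + 2 * kernelOp maxKernel g y) x
      = x ^ 2 * ∫ y in Ioi 0, (Ioi x).indicator (fun z : ℝ => (z ^ 3)⁻¹) y
        * ∫ w in Ioi 0, b y w * (w * g w) := by
    rw [kernelOp, ← integral_const_mul]
    refine setIntegral_congr_fun measurableSet_Ioi fun y hy => ?_
    rw [hin y hy, cubicKernel]
    by_cases h : x < y
    · rw [if_pos ⟨hx, h⟩, indicator_of_mem (show y ∈ Ioi x from h)]
      ring
    · rw [if_neg fun h' => h h'.2, indicator_of_notMem (show y ∉ Ioi x from h)]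
      ring
  rw [e1, hswap, kernelOp, ← integral_const_mul]
  refine setIntegral_congr_fun measurableSet_Ioi fun w hw => ?_
  have hw : 0 < w := hw
  have e2 : ∀ y, (Ioi x).indicator (fun z : ℝ => (z ^ 3)⁻¹) y * b y w
      = (Ioo x w).indicator (fun y => (y ^ 3)⁻¹ * (2 - y / w)) y := by
    intro y
    simp only [hb]
    by_cases h1 : x < y
    · by_cases h2 : y < w
      · rw [indicator_of_mem (show y ∈ Ioi x from h1), if_pos ⟨hx.trans h1, h2⟩,
          indicator_of_mem (show y ∈ Ioo x w from ⟨h1, h2⟩)]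
      · rw [if_neg fun h' => h2 h'.2, indicator_of_notMem fun h' : y ∈ Ioo x w => h2 h'.2, mul_zero]
    · rw [indicator_of_notMem (show y ∉ Ioi x from h1),
        indicator_of_notMem fun h' : y ∈ Ioo x w => h1 h'.1, zero_mul]
  simp only [e2]
  have hsub : Ioo x w ∩ Ioi 0 = Ioo x w := inter_eq_left.2 fun y hy => hx.trans hy.1
  rw [integral_indicator measurableSet_Ioo, Measure.restrict_restrict measurableSet_Ioo,
    hsub, ← integral_Ioc_eq_integral_Ioo]
  rcases le_total x w with h | h
  · rw [← intervalIntegral.integral_of_le h, integral_inv_cube_mul hx h, maxKernel,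
      max_eq_left (by linarith)]
    field_simp
  · rw [Ioc_eq_empty (not_lt.2 h), setIntegral_empty, maxKernel, max_eq_right (by linarith)]
    ring

end Weak

/-! ### Weak estimates for stationary pairs -/

theorem nrm_le_of_abs_le {k : ℝ} {f g : ℝ → ℝ} (hg : MemL1k k g)
    (h : ∀ᵐ x ∂posMeasure, |f x| ≤ |g x|) : nrm k f ≤ nrm k g :=
  ENNReal.toReal_mono hg.lt_top.ne (normL1k_le_of_le h)

theorem nrm_zero_eq_integral {f : ℝ → ℝ} (hf : MemL1k 0 f) :
    nrm 0 f = ∫ x in Ioi 0, |f x| := by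
  simpa using nrm_eq_integral hf

/-- The integrated equation `2 g + x g' + C₂(Γ, g) + A = 0` for a function `g` of zero mass, with
the constant kernel `2`. -/
structure IsForcedPair (Γ g A : ℝ → ℝ) : Prop where
  memL1k : MemL1k 2 g
  memL1k_left : MemL1k 2 Γ
  memL1k_right : MemL1k 2 A
  pair : IsStationaryPair g fun x => coag kernelZero Γ g x + A x
  mass : ∫ x in Ioi 0, x * g x = 0
  nrm_left : nrm 0 Γ = ∫ x in Ioi 0, Γ x
  le_two : ∫ x in Ioi 0, Γ x ≤ 2

namespace IsForcedPair

variable {Γ g A : ℝ → ℝ}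

theorem nonneg (H : IsForcedPair Γ g A) : 0 ≤ ∫ x in Ioi 0, Γ x :=
  H.nrm_left ▸ nrm_nonneg 0 Γ

theorem memL1k_sum (H : IsForcedPair Γ g A) : MemL1k 2 fun x => coag kernelZero Γ g x + A x :=
  (isBoundedKernel_kernelZero.memL1k_coag zero_le_two H.memL1k_left H.memL1k).add H.memL1k_right

theorem id_mul_tail (H : IsForcedPair Γ g A) {x : ℝ} (hx : 0 < x) :
    x * kernelOp ltKernel g x = kernelOp (shift (kernelOp maxKernel g)) Γ x
      - (∫ y in Ioi 0, Γ y) * kernelOp maxKernel g x + kernelOp maxKernel A x := by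
  have hg := H.memL1k.mono one_le_two
  have hΓ := H.memL1k_left.mono one_le_two
  have h1 := H.pair.tail (H.memL1k_sum.mono one_le_two) hx
  rw [kernelOp_ltKernel g hx.le, h1, ← integral_maxKernel_mul_coag hg hΓ H.mass hx]
  have h2 := integral_add (integrable_maxKernel_mul
    (isBoundedKernel_kernelZero.memL1k_coag zero_le_one hΓ hg) hx.le)
    (integrable_maxKernel_mul (H.memL1k_right.mono one_le_two) hx.le)
  refine Eq.trans ?_ h2
  exact integral_congr_ae (ae_of_all _ fun y => mul_add _ _ _)

/-- Writing `y = (y - x) + x` in `x² g(x) = ∫_x^∞ y q(y) dy` and recognising the first part as `x`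
times the tail of `g`, one may divide by `x`. -/
theorem id_mul_eq (H : IsForcedPair Γ g A) :
    ∀ᵐ x ∂posMeasure, x * g x = kernelOp ltKernel g x
      + (kernelOp (shift (kernelOp ltKernel g)) Γ x
        - (∫ y in Ioi 0, Γ y) * kernelOp ltKernel g x + kernelOp ltKernel A x) := by
  have hg := H.memL1k.mono one_le_two
  have hΓ := H.memL1k_left.mono one_le_two
  have hA := H.memL1k_right.mono one_le_two
  have hq := H.memL1k_sum.mono one_le_two
  have hc := isBoundedKernel_kernelZero.memL1k_coag zero_le_one hΓ hg
  filter_upwards [H.pair, ae_pos] with x h1 hx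
  have h2 := H.pair.tail hq hx
  rw [← integral_ltKernel_mul_coag hg hΓ x]
  set q : ℝ → ℝ := fun x => coag kernelZero Γ g x + A x with hqdef
  have h3 : kernelOp ltKernel q x = kernelOp ltKernel (coag kernelZero Γ g) x
      + kernelOp ltKernel A x := by
    refine Eq.trans ?_ (integral_add (integrable_ltKernel_mul (hc.mono zero_le_one) x)
      (integrable_ltKernel_mul (hA.mono zero_le_one) x))
    exact integral_congr_ae (ae_of_all _ fun y => mul_add _ _ _)
  rw [← h3, kernelOp_ltKernel g hx.le]
  have h4 : ∫ y in Ioi x, y * q y = (∫ y in Ioi 0, max (y - x) 0 * q y)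
      + x * kernelOp ltKernel q x := by
    rw [← integral_ite_lt (fun y => y * q y) hx.le, kernelOp, ← integral_const_mul]
    refine Eq.trans ?_ (integral_add (integrable_maxKernel_mul hq hx.le)
      ((integrable_ltKernel_mul (hq.mono zero_le_one) x).const_mul x))
    refine integral_congr_ae (ae_of_all _ fun y => ?_)
    simp only [ltKernel]
    by_cases h : x < y
    · rw [if_pos h, max_eq_left (by linarith)]
      ring
    · rw [if_neg h, max_eq_right (by linarith)]
      ring
  rw [h4, ← h2] at h1
  exact mul_left_cancel₀ hx.ne' (by linear_combination h1)

/-- The norm of a convolution with `Γ`, minus a multiple, plus an error. -/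
theorem nrm_convolution_le (H : IsForcedPair Γ g A) {φ ψ : ℝ → ℝ} (hm : Measurable φ)
    (hφ : MemL1k 0 φ) (hψ : MemL1k 0 ψ) (c : ℝ) :
    MemL1k 0 (fun x => kernelOp (shift φ) Γ x + c * φ x + ψ x) ∧
      nrm 0 (fun x => kernelOp (shift φ) Γ x + c * φ x + ψ x)
        ≤ ((∫ x in Ioi 0, Γ x) + |c|) * nrm 0 φ + nrm 0 ψ := by
  obtain ⟨h1, h2⟩ := nrm_kernelOp_shift_le hm hφ (H.memL1k_left.mono zero_le_two)
  have h3 := h1.add (hφ.const_mul c)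
  have h4 := nrm_add_le h1 (hφ.const_mul c)
  have h5 := nrm_add_le h3 hψ
  rw [H.nrm_left] at h2
  rw [nrm_const_mul] at h4
  refine ⟨h3.add hψ, ?_⟩
  linarith

/-- Let `F` be the second tail and `m = ∫ Γ ≤ 2`. Then `x T + 2 F` is `Γ * F + (2 - m) F` plus the
second tail of `A`, of norm at most `2 ‖F‖ + ‖A‖`. Recovering `F` through the cubic kernel costs a
factor `1/3`, so `3 ‖F‖ ≤ 2 ‖F‖ + ‖A‖`. -/
theorem nrm_secondTail_le (H : IsForcedPair Γ g A) :
    nrm 0 (kernelOp maxKernel g) ≤ nrm 2 A := by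
  have hg := H.memL1k.mono one_le_two
  obtain ⟨hF, -⟩ := _root_.nrm_secondTail_le H.memL1k
  obtain ⟨hA, hA'⟩ := _root_.nrm_secondTail_le H.memL1k_right
  set F := kernelOp maxKernel g with hFdef
  set m := ∫ x in Ioi 0, Γ x with hm
  obtain ⟨h1, h2⟩ := H.nrm_convolution_le (measurable_kernelOp measurable_maxKernel hg.aesm) hF hA
    (2 - m)
  have h3 : (fun y => y * kernelOp ltKernel g y + 2 * F y) =ᵐ[posMeasure]
      fun x => kernelOp (shift F) Γ x + (2 - m) * F x + kernelOp maxKernel A x := by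
    filter_upwards [ae_pos] with x hx
    rw [H.id_mul_tail hx]
    ring
  have h4 : F =ᵐ[posMeasure] kernelOp cubicKernel
      fun x => kernelOp (shift F) Γ x + (2 - m) * F x + kernelOp maxKernel A x := by
    filter_upwards [ae_pos] with x hx
    rw [← kernelOp_congr _ h3, hFdef, secondTail_eq_cubic hg hx]
  have h5 := (nrm_kernelOp_le (by norm_num) measurable_cubicKernel
    (fun y hy => normL1k_cubicKernel_le hy) h1).2
  rw [← nrm_congr h4] at h5
  have h6 : |2 - m| = 2 - m := abs_of_nonneg (sub_nonneg.2 H.le_two)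
  rw [h6, add_sub_cancel] at h2
  linarith

theorem nrm_id_mul_tail_le (H : IsForcedPair Γ g A) :
    MemL1k 0 (fun x => x * kernelOp ltKernel g x) ∧
      nrm 0 (fun x => x * kernelOp ltKernel g x) ≤ 5 * nrm 2 A := by
  have hg := H.memL1k.mono one_le_two
  obtain ⟨hF, -⟩ := _root_.nrm_secondTail_le H.memL1k
  obtain ⟨hA, hA'⟩ := _root_.nrm_secondTail_le H.memL1k_right
  obtain ⟨h1, h2⟩ := H.nrm_convolution_le (measurable_kernelOp measurable_maxKernel hg.aesm) hF hA
    (-∫ x in Ioi 0, Γ x)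
  have h3 : (fun y => y * kernelOp ltKernel g y) =ᵐ[posMeasure]
      fun x => kernelOp (shift (kernelOp maxKernel g)) Γ x
        + (-∫ x in Ioi 0, Γ x) * kernelOp maxKernel g x + kernelOp maxKernel A x := by
    filter_upwards [ae_pos] with x hx
    rw [H.id_mul_tail hx]
    ring
  rw [memL1k_congr h3, nrm_congr h3]
  refine ⟨h1, h2.trans ?_⟩
  rw [abs_neg, abs_of_nonneg H.nonneg]
  have h4 := H.nrm_secondTail_le
  have h5 := H.le_two
  have h6 := H.nonneg
  have h7 := nrm_nonneg 0 (kernelOp maxKernel g)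
  nlinarith

/-- Below `δ` the tail is bounded by `1`; above `δ` it is at most `δ⁻¹` times `x` times the tail. -/
theorem nrm_tail_le (H : IsForcedPair Γ g A) (hT : ∀ x, 0 < x → |kernelOp ltKernel g x| ≤ 1)
    {δ : ℝ} (hδ : 0 < δ) : nrm 0 (kernelOp ltKernel g) ≤ δ + δ⁻¹ * (5 * nrm 2 A) := by
  obtain ⟨h1, h2⟩ := H.nrm_id_mul_tail_le
  have h3 : normL1k 0 (fun x => ltKernel x δ) ≤ ENNReal.ofReal δ := by
    have := normL1k_zero_le_of_bound (φ := fun x => ltKernel x δ) (c := 1) hδ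
      (fun x _ h => by simp [ltKernel, h]) fun x h => by simp [ltKernel, not_lt.2 h]
    rwa [one_mul] at this
  have h4 : MemL1k 0 fun x => ltKernel x δ :=
    memL1k_iff.2 ⟨(measurable_lt_indicator.of_uncurry_right (y := δ)).aestronglyMeasurable,
      h3.trans_lt ENNReal.ofReal_lt_top⟩
  have h5 : MemL1k 0 fun x => |x * kernelOp ltKernel g x| := h1.norm
  have h6 : nrm 0 (fun x => |x * kernelOp ltKernel g x|) ≤ 5 * nrm 2 A :=
    (nrm_le_of_abs_le h1 (ae_of_all _ fun x => (abs_abs _).le)).trans h2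
  have h7 := nrm_add_le h4 (h5.const_mul δ⁻¹)
  rw [nrm_const_mul, abs_of_pos (inv_pos.2 hδ)] at h7
  have h8 : nrm 0 (kernelOp ltKernel g)
      ≤ nrm 0 (fun x => ltKernel x δ + δ⁻¹ * |x * kernelOp ltKernel g x|) := by
    refine nrm_le_of_abs_le (h4.add (h5.const_mul δ⁻¹)) ?_
    filter_upwards [ae_pos] with x hx
    have e0 : 0 ≤ δ⁻¹ * |x * kernelOp ltKernel g x| := by positivity
    refine le_trans ?_ (le_abs_self _)
    by_cases h : x < δ
    · have e1 : ltKernel x δ = 1 := if_pos h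
      have := hT x hx
      rw [e1]
      linarith
    · have e1 : ltKernel x δ = 0 := if_neg h
      rw [e1, zero_add, abs_mul, abs_of_pos hx, ← mul_assoc]
      refine le_mul_of_one_le_left (abs_nonneg _) ?_
      rw [inv_mul_eq_div, one_le_div hδ]
      exact not_lt.1 h
  have h9 : nrm 0 (fun x => ltKernel x δ) ≤ δ := nrm_le_of_le hδ.le h3
  have h10 : δ⁻¹ * nrm 0 (fun x => |x * kernelOp ltKernel g x|) ≤ δ⁻¹ * (5 * nrm 2 A) := by gcongr
  linarith

theorem nrm_id_mul_le (H : IsForcedPair Γ g A) :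
    MemL1k 0 (fun x => x * g x) ∧
      nrm 0 (fun x => x * g x) ≤ 5 * nrm 0 (kernelOp ltKernel g) + nrm 2 A := by
  have hg := H.memL1k.mono one_le_two
  obtain ⟨hF, -⟩ := _root_.nrm_tail_le hg
  obtain ⟨hA, hA'⟩ := _root_.nrm_tail_le (H.memL1k_right.mono one_le_two)
  obtain ⟨h1, h2⟩ := H.nrm_convolution_le (measurable_kernelOp measurable_ltKernel hg.aesm) hF
    hA (1 - ∫ x in Ioi 0, Γ x)
  have h3 : (fun y => y * g y) =ᵐ[posMeasure]
      fun x => kernelOp (shift (kernelOp ltKernel g)) Γ x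
        + (1 - ∫ x in Ioi 0, Γ x) * kernelOp ltKernel g x + kernelOp ltKernel A x := by
    filter_upwards [H.id_mul_eq] with x hx
    rw [hx]
    ring
  rw [memL1k_congr h3, nrm_congr h3]
  refine ⟨h1, h2.trans ?_⟩
  have h4 := nrm_mono one_le_two H.memL1k_right
  have h5 := H.le_two
  have h6 := H.nonneg
  have h7 := nrm_nonneg 0 (kernelOp ltKernel g)
  have h8 : |1 - ∫ x in Ioi 0, Γ x| ≤ 1 := abs_le.2 ⟨by linarith, by linarith⟩
  nlinarith

/-- Control of `x g` says nothing near `0`. There the lower bound on `g` gives `∫₀ˢ |g| ≤ ∫₀ˢ g + 2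
s`, and since `∫ g ≤ 0` the last integral is at most minus the tail at `s`. -/
theorem nrm_zero_le (H : IsForcedPair Γ g A) (hint : ∫ x in Ioi 0, g x ≤ 0)
    (hneg : ∀ᵐ x ∂posMeasure, |g x| ≤ g x + 2) {δ : ℝ} (hδ : 0 < δ) :
    nrm 0 g ≤ 4 * δ + δ⁻¹ * (nrm 0 (kernelOp ltKernel g) + nrm 0 (fun x => x * g x)) := by
  have hg0 := H.memL1k.mono zero_le_two
  have hgi := hg0.integrable le_rfl
  have hgI : IntegrableOn g (Ioi 0) := hgi
  obtain ⟨hxg, -⟩ := H.nrm_id_mul_le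
  obtain ⟨hT, -⟩ := _root_.nrm_tail_le (H.memL1k.mono one_le_two)
  have hTi : IntegrableOn (kernelOp ltKernel g) (Ioi 0) := hT.integrable le_rfl
  have hsplit : ∀ {f : ℝ → ℝ}, IntegrableOn f (Ioi 0) → ∀ {s : ℝ}, 0 ≤ s →
      ∫ x in Ioi 0, f x = (∫ x in Ioc 0 s, f x) + ∫ x in Ioi s, f x := by
    intro f hf s hs
    rw [← Ioc_union_Ioi_eq_Ioi hs]
    exact setIntegral_union (Ioc_disjoint_Ioi le_rfl) measurableSet_Ioi
      (hf.mono_set Ioc_subset_Ioi_self) (hf.mono_set (Ioi_subset_Ioi hs))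
  have h1 : ∀ s, 0 < s → ∫ x in Ioc 0 s, |g x| ≤ |kernelOp ltKernel g s| + 2 * s := by
    intro s hs
    have hgs := hgI.mono_set (Ioc_subset_Ioi_self : Ioc 0 s ⊆ Ioi 0)
    have e1 : ∫ x in Ioc 0 s, |g x| ≤ ∫ x in Ioc 0 s, (g x + 2) := by
      refine integral_mono_ae hgs.abs (hgs.add (integrable_const 2)) ?_
      exact ae_restrict_of_ae_restrict_of_subset Ioc_subset_Ioi_self hneg
    have e2 : ∫ x in Ioc 0 s, (2 : ℝ) = 2 * s := by
      rw [setIntegral_const, measureReal_def, Real.volume_Ioc, sub_zero,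
        ENNReal.toReal_ofReal hs.le, smul_eq_mul, mul_comm]
    rw [integral_add hgs (integrable_const 2), e2] at e1
    have e3 := hsplit hgI hs.le
    rw [← kernelOp_ltKernel g hs.le] at e3
    have e4 := neg_le_abs (kernelOp ltKernel g s)
    linarith
  -- The tail is small only in `L¹`, so the bound at `s` is averaged over `s` in `(δ, 2δ]`.
  have h2 : (∫ x in Ioc 0 δ, |g x|) * δ ≤ nrm 0 (kernelOp ltKernel g) + 4 * δ * δ := by
    have hsub : Ioc δ (2 * δ) ⊆ Ioi 0 := fun x hx => hδ.trans hx.1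
    have hTs := (hTi.mono_set hsub).abs
    have e0 : ∀ c : ℝ, ∫ x in Ioc δ (2 * δ), c = c * δ := by
      intro c
      rw [setIntegral_const, measureReal_def, Real.volume_Ioc, show 2 * δ - δ = δ by ring,
        ENNReal.toReal_ofReal hδ.le, smul_eq_mul, mul_comm]
    have e1 : ∫ s in Ioc δ (2 * δ), (∫ x in Ioc 0 δ, |g x|)
        ≤ ∫ s in Ioc δ (2 * δ), (|kernelOp ltKernel g s| + 4 * δ) := by
      refine setIntegral_mono_on (integrable_const _) (hTs.add (integrable_const _))
        measurableSet_Ioc fun s hs => ?_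
      have a1 := h1 s (hδ.trans hs.1)
      have a2 : ∫ x in Ioc 0 δ, |g x| ≤ ∫ x in Ioc 0 s, |g x| :=
        setIntegral_mono_set (hgI.mono_set Ioc_subset_Ioi_self).abs
          (ae_of_all _ fun x => abs_nonneg _) (Ioc_subset_Ioc_right hs.1.le).eventuallyLE
      have a3 := hs.2
      linarith
    rw [integral_add hTs (integrable_const _), e0, e0] at e1
    have e2 : ∫ s in Ioc δ (2 * δ), |kernelOp ltKernel g s| ≤ nrm 0 (kernelOp ltKernel g) := by
      rw [nrm_zero_eq_integral hT]
      exact setIntegral_mono_set hTi.abs (ae_of_all _ fun x => abs_nonneg _) hsub.eventuallyLE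
    linarith
  have h3 : ∫ x in Ioi δ, |g x| ≤ δ⁻¹ * nrm 0 (fun x => x * g x) := by
    have hxi : IntegrableOn (fun x => x * g x) (Ioi 0) := hxg.integrable le_rfl
    have hsub : Ioi δ ⊆ Ioi 0 := Ioi_subset_Ioi hδ.le
    rw [nrm_zero_eq_integral hxg, ← integral_const_mul]
    refine le_trans ?_ (setIntegral_mono_set (hxi.abs.const_mul _)
      (ae_of_all _ fun x => by positivity) hsub.eventuallyLE)
    refine setIntegral_mono_on (hgI.mono_set hsub).abs ((hxi.mono_set hsub).abs.const_mul _)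
      measurableSet_Ioi fun x hx => ?_
    have hx : δ < x := hx
    rw [abs_mul, abs_of_pos (hδ.trans hx), ← mul_assoc]
    refine le_mul_of_one_le_left (abs_nonneg _) ?_
    rw [inv_mul_eq_div, one_le_div hδ]
    exact hx.le
  rw [nrm_zero_eq_integral hg0, hsplit hgI.abs hδ.le]
  have h4 : ∫ x in Ioc 0 δ, |g x| ≤ 4 * δ + δ⁻¹ * nrm 0 (kernelOp ltKernel g) := by
    rw [← mul_le_mul_iff_left₀ hδ]
    refine h2.trans (le_of_eq ?_)
    field_simp
    ring
  linarith

theorem nrm_zero_le_of_nrm_le (H : IsForcedPair Γ g A) (hint : ∫ x in Ioi 0, g x ≤ 0)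
    (hneg : ∀ᵐ x ∂posMeasure, |g x| ≤ g x + 2)
    (hT : ∀ x, 0 < x → |kernelOp ltKernel g x| ≤ 1) {δ : ℝ} (hδ : 0 < δ) (hδ1 : δ ≤ 1)
    (hA : nrm 2 A ≤ δ ^ 4) : nrm 0 g ≤ 41 * δ := by
  -- Splitting at `δ²` gives at most `6 δ²` for the tail, hence at most `31 δ²` for `x g`; dividing
  -- the sum by `δ` gives `37 δ`.
  have h1 := H.nrm_tail_le hT (pow_pos hδ 2)
  have h2 := H.nrm_id_mul_le.2
  have h3 := H.nrm_zero_le hint hneg hδ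
  have e1 : (δ ^ 2)⁻¹ * (5 * nrm 2 A) ≤ 5 * δ ^ 2 := by
    rw [inv_mul_le_iff₀ (by positivity)]
    nlinarith
  have e2 : δ ^ 4 ≤ δ ^ 2 := pow_le_pow_of_le_one hδ.le hδ1 (by norm_num)
  have e3 : δ⁻¹ * (nrm 0 (kernelOp ltKernel g) + nrm 0 (fun x => x * g x)) ≤ 37 * δ := by
    rw [inv_mul_le_iff₀ hδ]
    nlinarith
  linarith

end IsForcedPair

/-- Split at `1 + x = R`: below it the weight is at most `R ^ k`, above it one extra power of `1 +
x` pays for `R⁻¹`. -/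
theorem nrm_interpolation {k R : ℝ} (hk : 0 ≤ k) (hR : 0 < R) {g : ℝ → ℝ} (hg : MemL1k (k + 1) g) :
    nrm k g ≤ R ^ k * nrm 0 g + R⁻¹ * nrm (k + 1) g := by
  have hgk := hg.mono (by linarith : k ≤ k + 1)
  have hg0 := hgk.mono hk
  have i0 := (memL1k_iff_integrable hg0.aesm).1 hg0
  have ik := (memL1k_iff_integrable hgk.aesm).1 hgk
  have i1 := (memL1k_iff_integrable hg.aesm).1 hg
  have key : ∀ {j : ℝ}, Integrable (fun x => (1 + x) ^ j * g x) posMeasure →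
      Integrable (fun x => (1 + x) ^ j * |g x|) posMeasure := by
    intro j hj
    refine hj.abs.congr ?_
    filter_upwards [ae_pos] with x hx
    rw [abs_mul, abs_of_pos (by positivity)]
  rw [nrm_eq_integral hg, nrm_eq_integral hgk, nrm_eq_integral hg0, ← integral_const_mul,
    ← integral_const_mul, ← integral_add ((key i0).const_mul _) ((key i1).const_mul _)]
  refine integral_mono_ae (key ik) (((key i0).const_mul _).add ((key i1).const_mul _)) ?_
  filter_upwards [ae_pos] with x hx
  have h1 : (1 + x) ^ k ≤ R ^ k * (1 + x) ^ (0 : ℝ) + R⁻¹ * (1 + x) ^ (k + 1) := by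
    rw [Real.rpow_zero, mul_one, Real.rpow_add_one (by positivity)]
    rcases le_total (1 + x) R with h | h
    · have a1 := Real.rpow_le_rpow (by positivity) h hk
      have a2 : 0 ≤ R⁻¹ * ((1 + x) ^ k * (1 + x)) := by positivity
      linarith
    · have a1 : 0 ≤ R ^ k := by positivity
      have a2 : (1 + x) ^ k ≤ R⁻¹ * ((1 + x) ^ k * (1 + x)) := by
        rw [le_inv_mul_iff₀ hR, mul_comm]
        gcongr
      linarith
  calc (1 + x) ^ k * |g x| ≤ (R ^ k * (1 + x) ^ (0 : ℝ) + R⁻¹ * (1 + x) ^ (k + 1)) * |g x| := by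
        gcongr
    _ = _ := by ring

/-! ### Distance of profiles to the explicit one -/

theorem isRegularProfile_profileZero : IsRegularProfile kernelZero profileZero := by
  have h1 : IsUnitProfile kernelZero profileZero := by
    have h := isUnitProfile_exp (κ := 2) zero_lt_one (mul_one 2)
    have e : (fun x : ℝ => 1 ^ 2 * Real.exp (-(1 * x))) = profileZero := by
      ext x
      simp [profileZero]
    rwa [e] at h
  exact
    { bounded := isBoundedKernel_kernelZero.mono (by norm_num)
      two_le := fun _ _ => le_rfl
      memL1k := h1.memL1k
      nonneg := h1.nonneg
      mass := h1.mass
      pair := isStationaryPair_of_mild h1.memL1k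
        (isBoundedKernel_kernelZero.memL1k_coag zero_le_one h1.memL1k h1.memL1k) h1.stationary }

theorem nrm_mul_coag_le {ε B k : ℝ} (hε : 0 ≤ ε) (hk : 0 ≤ k) {V : ℝ → ℝ → ℝ}
    (hV : IsBoundedKernel 1 V) {G : ℝ → ℝ} (hG : MemL1k k G) (hB : nrm k G ≤ B) :
    nrm k (fun x => ε * coag V G G x) ≤ ε * (3 / 2 * B ^ 2) := by
  rw [nrm_const_mul, abs_of_nonneg hε]
  have h1 := hV.nrm_coag_le hk hG hG
  have h2 := nrm_nonneg k G
  have h3 : nrm k G * nrm k G ≤ B ^ 2 := by nlinarith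
  gcongr
  linarith

namespace IsRegularProfile

variable {ε : ℝ} {V : ℝ → ℝ → ℝ} {G : ℝ → ℝ}

/-- Subtracting the equations of `G` and `G₀`, the quadratic terms with kernel `2` polarise to `C₂(G
+ G₀, G - G₀)`, and the rest of the kernel becomes the forcing. -/
theorem isForcedPair (H : IsRegularProfile (kernel ε V) G) (hV : IsBoundedKernel 1 V)
    (hG : MemL1k 2 G) : IsForcedPair (fun x => G x + profileZero x) (fun x => G x - profileZero x)
      (fun x => ε * coag V G G x) where
  memL1k := hG.sub (memL1k_profileZero 2)
  memL1k_left := hG.add (memL1k_profileZero 2)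
  memL1k_right := (hV.memL1k_coag zero_le_two hG hG).const_mul ε
  pair := by
    have h0 := isRegularProfile_profileZero
    refine (H.pair.sub h0.pair H.memL1k_coag h0.memL1k_coag).congr (EventuallyEq.refl _ _) ?_
    filter_upwards [coag_kernel_eq (ε := ε) hV zero_le_one H.memL1k H.memL1k,
      isBoundedKernel_kernelZero.coag_diff zero_le_one H.memL1k h0.memL1k] with x h1 h2
    rw [h1, ← h2]
    ring
  mass := by
    have h0 := isRegularProfile_profileZero
    simp only [mul_sub]
    rw [integral_sub (H.memL1k.integrable_id_mul le_rfl) (h0.memL1k.integrable_id_mul le_rfl),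
      H.mass, h0.mass, sub_self]
  nrm_left := by
    rw [nrm_zero_eq_integral ((hG.add (memL1k_profileZero 2)).mono zero_le_two)]
    refine integral_congr_ae ?_
    filter_upwards [H.nonneg] with x hx
    exact abs_of_nonneg (add_nonneg hx (Real.exp_pos _).le)
  le_two := by
    rw [integral_add H.integrable isRegularProfile_profileZero.integrable, integral_profileZero]
    linarith [H.integral_le_one]

theorem nrm_zero_sub_le (H : IsRegularProfile (kernel ε V) G) (hV : IsBoundedKernel 1 V)
    (hG : MemL1k 2 G) {δ : ℝ} (hδ : 0 < δ) (hδ1 : δ ≤ 1)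
    (hA : nrm 2 (fun x => ε * coag V G G x) ≤ δ ^ 4) :
    nrm 0 (fun x => G x - profileZero x) ≤ 41 * δ := by
  have h0 := isRegularProfile_profileZero
  refine (H.isForcedPair hV hG).nrm_zero_le_of_nrm_le ?_ ?_ ?_ hδ hδ1 hA
  · rw [integral_sub H.integrable h0.integrable, integral_profileZero]
    linarith [H.integral_le_one]
  · filter_upwards [H.nonneg, ae_pos] with x h1 h2
    have h3 : profileZero x ≤ 1 := Real.exp_le_one_iff.2 (by linarith)
    exact abs_le.2 ⟨by linarith, by linarith⟩
  · intro x hx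
    rw [kernelOp_ltKernel _ hx.le, integral_sub (integrableOn_Ioi_of_pos H.integrable hx.le)
      (integrableOn_Ioi_of_pos h0.integrable hx.le)]
    have h1 := H.tail_le_one hx
    have h2 := h0.tail_le_one hx
    have h3 := H.setIntegral_nonneg hx.le
    have h4 := h0.setIntegral_nonneg hx.le
    exact abs_le.2 ⟨by linarith, by linarith⟩

end IsRegularProfile

/-- Profiles of nearly constant kernels are close to the explicit profile. -/
theorem exists_nrm_sub_profileZero_le {k η : ℝ} (hk : 2 ≤ k) (hη : 0 < η) :
    ∃ ε₁ : ℝ, 0 < ε₁ ∧ ∀ ε : ℝ, 0 ≤ ε → ε ≤ ε₁ → ∀ (V : ℝ → ℝ → ℝ) (G : ℝ → ℝ),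
      IsBoundedKernel 1 V → IsRegularProfile (kernel ε V) G →
        nrm k (fun x => G x - profileZero x) ≤ η := by
  have hk0 : 0 ≤ k := by linarith
  obtain ⟨B, hB1, hB⟩ := exists_nrm_profile_le (k + 1)
  set D := B + nrm (k + 1) profileZero with hD
  have hD0 : 0 < D := by
    have := nrm_nonneg (k + 1) profileZero
    linarith
  -- `R` makes the high-moment part at most `η / 2`, and `δ` then makes `41 δ R ^ k` at most `η /
  -- 2`.
  set R := 2 * D / η with hR
  have hR0 : 0 < R := by positivity
  set δ := min 1 (η / (82 * R ^ k)) with hδ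
  have hδ0 : 0 < δ := lt_min zero_lt_one (by positivity)
  have hδ1 : δ ≤ 1 := min_le_left _ _
  -- Up to this threshold the forcing `ε C_V(G, G)` has norm at most `δ⁴`.
  refine ⟨δ ^ 4 / (3 / 2 * B ^ 2), by positivity, fun ε hε hε1 V G hV H => ?_⟩
  obtain ⟨hG, hGB⟩ := hB _ _ H
  have hG2 := hG.mono (by linarith : (2 : ℝ) ≤ k + 1)
  have hA : nrm 2 (fun x => ε * coag V G G x) ≤ δ ^ 4 := by
    refine (nrm_mul_coag_le hε zero_le_two hV hG2
      ((nrm_mono (by linarith : (2 : ℝ) ≤ k + 1) hG).trans hGB)).trans ?_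
    rwa [← le_div_iff₀ (by positivity)]
  have h1 := H.nrm_zero_sub_le hV hG2 hδ0 hδ1 hA
  have hg : MemL1k (k + 1) fun x => G x - profileZero x := hG.sub (memL1k_profileZero _)
  have h2 := nrm_interpolation hk0 hR0 hg
  have h3 : nrm (k + 1) (fun x => G x - profileZero x) ≤ D :=
    (nrm_sub_le hG (memL1k_profileZero _)).trans (by rw [hD]; gcongr)
  have h4 : R⁻¹ * nrm (k + 1) (fun x => G x - profileZero x) ≤ η / 2 := by
    refine (mul_le_mul_of_nonneg_left h3 (by positivity)).trans (le_of_eq ?_)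
    rw [hR]
    field_simp
  have h5 : R ^ k * nrm 0 (fun x => G x - profileZero x) ≤ η / 2 := by
    have hRk : 0 < R ^ k := by positivity
    have h6 : δ ≤ η / (82 * R ^ k) := min_le_right _ _
    calc R ^ k * nrm 0 (fun x => G x - profileZero x) ≤ R ^ k * (41 * (η / (82 * R ^ k))) := by
          gcongr
          linarith
      _ = η / 2 := by
          field_simp
          norm_num
  linarith

/-- From closeness to a linear rate: with `n = ‖G - G₀‖` the inverse estimate gives `n ≤ 2 C (3 n² +
(3/2) B² ε)`, and the quadratic term is absorbed once `n` is known to be small. -/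
theorem exists_nrm_sub_profileZero_le_mul {k : ℝ} (hk : 2 ≤ k) :
    ∃ D : ℝ, 0 < D ∧ ∀ ε : ℝ, 0 < ε → ∀ (V : ℝ → ℝ → ℝ) (G : ℝ → ℝ), IsBoundedKernel 1 V →
      IsRegularProfile (kernel ε V) G → nrm k (fun x => G x - profileZero x) ≤ ε * D := by
  have hk0 : 0 ≤ k := by linarith
  obtain ⟨C, hC⟩ := exists_isGapConstant hk
  have hC0 := hC.1
  obtain ⟨B, hB1, hB⟩ := exists_nrm_profile_le k
  -- The radius `(12 C)⁻¹` makes `6 C n² ≤ n / 2`, whence `n ≤ 6 C B² ε`.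
  obtain ⟨ε₁, hε₁, hclose⟩ := exists_nrm_sub_profileZero_le (η := (12 * C)⁻¹) hk (by positivity)
  have hP := nrm_nonneg k profileZero
  -- The second entry covers `ε ≥ ε₁`, where the uniform bound on profiles suffices.
  refine ⟨max (6 * C * B ^ 2) ((B + nrm k profileZero) / ε₁), lt_max_of_lt_left (by positivity),
    fun ε hε V G hV H => ?_⟩
  obtain ⟨hG, hGB⟩ := hB _ _ H
  have hg : MemL1k k fun x => G x - profileZero x := hG.sub (memL1k_profileZero _)
  rcases le_total ε ε₁ with hle | hle
  · refine le_trans ?_ (mul_le_mul_of_nonneg_left (le_max_left _ _) hε.le)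
    have hsmall := hclose ε hε.le hle V G hV H
    have hF := H.isForcedPair hV (hG.mono hk)
    have hA := (hV.memL1k_coag hk0 hG hG).const_mul ε
    have hAn := nrm_mul_coag_le hε.le hk0 hV hG hGB
    have h2 := isBoundedKernel_kernelZero
    have hgg := h2.memL1k_coag hk0 hg hg
    have hinv := hC.nrm_le (by linarith) hF.pair hg
      ((h2.memL1k_coag hk0 (hG.add (memL1k_profileZero k)) hg).add hA) hF.mass
    have e : (fun x => 2 * coag kernelZero profileZero (fun x => G x - profileZero x) x
        - (coag kernelZero (fun x => G x + profileZero x) (fun x => G x - profileZero x) x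
          + ε * coag V G G x)) =ᵐ[posMeasure]
        fun x => -1 * (coag kernelZero (fun x => G x - profileZero x)
          (fun x => G x - profileZero x) x + ε * coag V G G x) := by
      filter_upwards [h2.coag_add_left hk0 hG hg (memL1k_profileZero k),
        h2.coag_sub_left hk0 hG hg (memL1k_profileZero k)] with x e1 e2
      rw [e1, e2]
      ring
    rw [nrm_congr e, nrm_const_mul, abs_neg, abs_one, one_mul] at hinv
    have h3 := nrm_add_le hgg hA
    have h4 := h2.nrm_coag_le hk0 hg hg
    set n := nrm k (fun x => G x - profileZero x) with hn
    have hn0 : 0 ≤ n := nrm_nonneg _ _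
    have h5 : n ≤ 2 * C * (3 * (n * n) + ε * (3 / 2 * B ^ 2)) := by
      refine hinv.trans ?_
      gcongr
      linarith
    have h6 : 12 * C * n ≤ 1 := by
      have := mul_le_mul_of_nonneg_left hsmall (by positivity : 0 ≤ 12 * C)
      rwa [mul_inv_cancel₀ (by positivity)] at this
    nlinarith
  · refine le_trans ?_ (mul_le_mul_of_nonneg_left (le_max_right _ _) hε.le)
    have h1 := nrm_sub_le hG (memL1k_profileZero k)
    have h2 : B + nrm k profileZero ≤ ε * ((B + nrm k profileZero) / ε₁) := by
      rw [mul_div_assoc', le_div_iff₀ hε₁, mul_comm]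
      gcongr
    linarith

theorem exists_isPerturbationConstant {k : ℝ} (hk : 2 < k) :
    ∃ M : ℝ, IsPerturbationConstant k M := by
  have hk0 : 0 ≤ k := by linarith
  obtain ⟨D, hD0, hD⟩ := exists_nrm_sub_profileZero_le_mul hk.le
  obtain ⟨B, hB1, hB⟩ := exists_nrm_profile_le k
  -- The difference is `2 C₂(G - G₀, h) + 2 ε C_W(G, h)`; the bilinear bound `3/2 κ` gives `6 D ε`
  -- with `κ = 2` and `3 B ε` with `κ = 1`.
  refine ⟨6 * D + 3 * B, by positivity, fun W hW ε hε hε1 G hG h hh => ?_⟩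
  have hV := hW.isBoundedKernel
  have H := hG.isRegularProfile hε.le hε1.le hW
  have h2 := isBoundedKernel_kernelZero
  obtain ⟨hGm, hGB⟩ := hB _ _ H
  have hg : MemL1k k fun x => G x - profileZero x := hGm.sub (memL1k_profileZero _)
  have hgD := hD ε hε _ G hV H
  have e : (fun x => 2 * coag (kernel ε W) G h x - 2 * coag kernelZero profileZero h x)
      =ᵐ[posMeasure] fun x => 2 * coag kernelZero (fun x => G x - profileZero x) h x
        + 2 * ε * coag (posKernel W) G h x := by
    filter_upwards [h2.coag_sub_left hk0 hGm hh (memL1k_profileZero k),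
      coag_kernel_eq (ε := ε) hV hk0 hGm hh, ae_pos] with x e1 e2 hx
    rw [coag_kernel_posKernel ε W G h hx, e1, e2]
    ring
  have m1 := (h2.memL1k_coag hk0 hg hh).const_mul 2
  have m2 := (hV.memL1k_coag hk0 hGm hh).const_mul (2 * ε)
  rw [normL1k_congr e, ← (m1.add m2).ofReal_nrm, ← hh.ofReal_nrm,
    ← ENNReal.ofReal_mul (by positivity)]
  refine ENNReal.ofReal_le_ofReal ((nrm_add_le m1 m2).trans ?_)
  rw [nrm_const_mul, nrm_const_mul, abs_of_pos zero_lt_two, abs_of_pos (by positivity : 0 < 2 * ε)]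
  have b1 := h2.nrm_coag_le hk0 hg hh
  have b2 := hV.nrm_coag_le hk0 hGm hh
  have hn := nrm_nonneg k h
  have b3 : nrm k (fun x => G x - profileZero x) * nrm k h ≤ ε * D * nrm k h := by gcongr
  have b4 : nrm k G * nrm k h ≤ B * nrm k h := by gcongr
  have b5 : 2 * ε * nrm k (coag (posKernel W) G h) ≤ 2 * ε * (3 / 2 * (B * nrm k h)) := by
    gcongr
    linarith
  linarith

end

/-! ### The main theorem. -/

theorem theorem7p7 (k : ℝ) (hk : 2 < k) :
    (∃ C : ℝ, IsGapConstant k C) ∧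
    (∃ M₂ : ℝ, IsPerturbationConstant k M₂) ∧
    ∀ C M₂ : ℝ, IsGapConstant k C → IsPerturbationConstant k M₂ →
      ∀ W : ℝ → ℝ → ℝ, IsPerturbation W →
        ∀ ε : ℝ, 0 < ε → ε < epsilonZero C M₂ →
          ∀ G₁ G₂ : ℝ → ℝ,
            IsUnitProfile (kernel ε W) G₁ →
            IsUnitProfile (kernel ε W) G₂ →
            normL1k k (fun x => G₁ x - profileZero x)
              ≤ ENNReal.ofReal ((1 - ε / epsilonZero C M₂) / (12 * C * (1 + ε))) →
            normL1k k (fun x => G₂ x - profileZero x)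
              ≤ ENNReal.ofReal ((1 - ε / epsilonZero C M₂) / (12 * C * (1 + ε))) →
            ∀ᵐ x ∂(volume.restrict (Ioi (0 : ℝ))), G₁ x = G₂ x := by
  have hk1 : 1 ≤ k := by linarith
  refine ⟨exists_isGapConstant hk.le, exists_isPerturbationConstant hk, ?_⟩
  intro C M hC hM W hW ε hε hε0 G₁ G₂ h₁ h₂ b₁ b₂
  exact uniqueness_of_isUnitProfile hk1 hC hM hW hε hε0 h₁ h₂ b₁ b₂
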